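/- Let $X_1,X_2,\dots$ be random variables with values in $\{0,1,2,\dots\}$ which are 1-dependent: for all $1\le s<t$ with $t-s>1$, the $\sigma$-algebras generated by $X_1,\dots,X_s$ and by $X_t,X_{t+1},\dots$ are independent. Put $X_k\equiv0$ for $k\le 0$, let $\nu_j(k)=\mathbb E\,X_k(X_k-1)\cdots(X_k-j+1)$, and let $F_n$ be the distribution of $S_n=X_1+\dots+X_n$. For random variables $Y_1,\dots,Y_k$ define recursively $$\widehat{\mathbb E}(Y_1,\dots,Y_k)=\mathbb E\,Y_1\cdots Y_k-\sum_{j=1}^{k-1}\widehat{\mathbb E}(Y_1,\dots,Y_j)\,\mathbb E\,Y_{j+1}\cdots Y_k ,$$ $$\widehat{\mathbb E}^+(Y_1,\dots,Y_k)=\mathbb E\,Y_1\cdots Y_k+\sum_{j=1}^{k-1}\widehat{\mathbb E}^+(Y_1,\dots,Y_j)\,\mathbb E\,Y_{j+1}\cdots Y_k ,$$ and, writing $X^{(2)}=X(X-1)$ and $X^{(3)}=X(X-1)(X-2)$, $$\widehat{\mathbb E}^+_2(X_{k-1},X_k)=\widehat{\mathbb E}^+(X_{k-1}^{(2)},X_k)+\widehat{\mathbb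 E}^+(X_{k-1},X_k^{(2)}),$$ $$\widehat{\mathbb E}^+_2(X_{k-2},X_{k-1},X_k)=\widehat{\mathbb E}^+(X_{k-2}^{(2)},X_{k-1},X_k)+\widehat{\mathbb E}^+(X_{k-2},X_{k-1}^{(2)},X_k)+\widehat{\mathbb E}^+(X_{k-2},X_{k-1},X_k^{(2)}),$$ $$\widehat{\mathbb E}^+_3(X_{k-1},X_k)=\widehat{\mathbb E}^+(X_{k-1}^{(3)},X_k)+\widehat{\mathbb E}^+(X_{k-1}^{(2)},X_k^{(2)})+\widehat{\mathbb E}^+(X_{k-1},X_k^{(3)}).$$ Let $$\Gamma_1=\sum_{k=1}^n\nu_1(k),\qquad \Gamma_2=\frac12\sum_{k=1}^n\big(\nu_2(k)-\nu_1^2(k)\big)+\sum_{k=2}^n\widehat{\mathbb E}(X_{k-1},X_k),$$ $$\Gamma_3=\frac16\sum_{k=1}^n\big(\nu_3(k)-3\nu_1(k)\nu_2(k)+2\nu_1^3(k)\big)-\sum_{k=2}^n\big(\nu_1(k-1)+\nu_1(k)\big)\widehat{\mathbb E}(X_{k-1},X_k)+\frac12\sum_{k=2}^n\big(\widehat{\mathbb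 E}(X_{k-1}^{(2)},X_k)+\widehat{\mathbb E}(X_{k-1},X_k^{(2)})\big)+\sum_{k=3}^n\widehat{\mathbb E}(X_{k-2},X_{k-1},X_k),$$ $$\lambda=\sum_{k=1}^n\nu_1(k)-1.52\sum_{k=1}^n\nu_2(k)-12\sum_{k=2}^n\mathbb E\,X_{k-1}X_k,$$ $$R_1=\sum_{k=1}^n\Big\{\nu_1^3(k)+\nu_1(k)\nu_2(k)+\nu_3(k)+[\nu_1(k-2)+\nu_1(k-1)+\nu_1(k)]\,\mathbb E\,X_{k-1}X_k+\widehat{\mathbb E}^+_2(X_{k-1},X_k)+\widehat{\mathbb E}^+(X_{k-2},X_{k-1},X_k)\Big\},$$ $$\begin{aligned}R_2=\sum_{k=1}^n\Big\{&\nu_1^4(k)+\nu_2^2(k)+\nu_4(k)+[\nu_1(k-2)+\nu_1(k-1)+\nu_1(k)]\,[\nu_3(k)+\widehat{\mathbb E}^+_2(X_{k-1},X_k)]+(\mathbb E\,X_{k-1}X_k)^2\\&+\sum_{l=0}^3\nu_1(k-l)\,\widehat{\mathbb E}^+(X_{k-2},X_{k-1},X_k)+\widehat{\mathbb E}^+_2(X_{k-2},X_{k-1},X_k)+\widehat{\mathbb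 E}^+_3(X_{k-1},X_k)+\widehat{\mathbb E}^+(X_{k-3},X_{k-2},X_{k-1},X_k)\Big\}.\end{aligned}$$ Let $\delta_a$ be the unit mass at $a$, $\delta=\delta_0$ and $U=\delta_1-\delta$. Products and powers of measures are convolutions, $M^0=\delta$, $\exp\{M\}=\sum_{m\ge0}M^m/m!$, and $$G=\exp\{\Gamma_1U+\Gamma_2U^2\}.$$ For a signed measure $M$ concentrated on $\mathbb Z$ let $\|M\|=\sum_{k\in\mathbb Z}|M\{k\}|$ and $\|M\|_\infty=\sup_{k\in\mathbb Z}|M\{k\}|$. **Theorem.** There are positive absolute constants $C_5,C_6,C_7,C_8$ such that, for every such sequence and every $n$ with $$\nu_1(k)\le\tfrac1{100},\qquad \nu_2(k)\le\nu_1(k),\qquad \nu_4(k)<\infty\qquad(1\le k\le n),\qquad\text{and}\qquad \lambda>0,$$ the following four estimates hold: $$\|F_n-G\|\le C_5R_1\{1+\Gamma_1\min(1,\lambda^{-1})\}\min(1,\lambda^{-3/2}),$$ $$\|F_n-G(\delta+\Gamma_3U^3)\|\le C_6\{1+\Gamma_1\min(1,\lambda^{-1})\}\big(R_1^2\min(1,\lambda^{-3})+R_2\min(1,\lambda^{-2})\big),$$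 $$\|F_n-G\|_\infty\le C_7R_1\min(1,\lambda^{-2}),$$ $$\|F_n-G(\delta+\Gamma_3U^3)\|_\infty\le C_8\big\{R_1^2\min(1,\lambda^{-7/2})+R_2\min(1,\lambda^{-5/2})\big\}.$$ -/

import Mathlib

open MeasureTheory ProbabilityTheory
open scoped ENNReal

namespace OneDependent

/-! ### Finite signed measures on the integers

A measure of finite variation concentrated on `ℤ` is represented by its masses `k ↦ M {k}`. -/

/-- The unit mass at `a`. -/
def dirac (a : ℤ) : ℤ → ℝ := Pi.single a 1

/-- Convolution of measures concentrated on `ℤ`. -/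
noncomputable def conv (M N : ℤ → ℝ) : ℤ → ℝ :=
  DiscreteConvolution.addConvolution (LinearMap.mul ℝ ℝ) M N

theorem conv_apply (M N : ℤ → ℝ) (k : ℤ) : conv M N k = ∑' j : ℤ, M j * N (k - j) := by
  let e : ℤ ≃ DiscreteConvolution.addFiber k :=
    { toFun := fun j => ⟨(j, k - j), by simp [DiscreteConvolution.mem_addFiber]⟩
      invFun := fun p => p.1.1
      left_inv := fun j => rfl
      right_inv := fun p => by
        have h := DiscreteConvolution.mem_addFiber.1 p.2
        ext
        · rfl
        · change k - p.1.1 = p.1.2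
          omega }
  exact (e.tsum_eq (fun ab : DiscreteConvolution.addFiber k => M ab.1.1 * N ab.1.2)).symm

/-- Convolution powers, with `M ^ 0` the unit mass at the origin. -/
noncomputable def convPow (M : ℤ → ℝ) : ℕ → ℤ → ℝ
  | 0 => dirac 0
  | m + 1 => conv (convPow M m) M

/-- The exponential measure `exp M = ∑ M ^ m / m!`, powers being convolution powers. -/
noncomputable def expMeasure (M : ℤ → ℝ) : ℤ → ℝ :=
  fun k => ∑' m : ℕ, (m.factorial : ℝ)⁻¹ * convPow M m k

/-- `U = δ₁ - δ₀`. -/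
def U : ℤ → ℝ := dirac 1 - dirac 0

/-- The total variation norm `∑ |M {k}|`, with values in `[0, ∞]`. -/
noncomputable def tvNorm (M : ℤ → ℝ) : ℝ≥0∞ := ∑' k : ℤ, ENNReal.ofReal |M k|

/-- The local norm `sup |M {k}|`, with values in `[0, ∞]`. -/
noncomputable def localNorm (M : ℤ → ℝ) : ℝ≥0∞ := ⨆ k : ℤ, ENNReal.ofReal |M k|

/-! ### Sequences of random variables -/

section

variable {Ω : Type*}

/-- The sequence `X₁, X₂, …` is `m`-dependent: for `1 ≤ s < t` with `t - s > m`, the σ-algebras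
generated by `X₁, …, X_s` and by `X_t, X_{t+1}, …` are independent. -/
def MDependent [MeasurableSpace Ω] (m : ℕ) (X : ℕ → Ω → ℕ) (P : Measure Ω) : Prop :=
  ∀ s t : ℕ, 1 ≤ s → s + m < t →
    Indep (⨆ i ∈ Set.Icc 1 s, MeasurableSpace.comap (X i) ⊤)
      (⨆ i ∈ Set.Ici t, MeasurableSpace.comap (X i) ⊤) P

/-- The sequence `X₁, X₂, …` extended by `X_k = 0` for `k ≤ 0`. -/
def ext (X : ℕ → Ω → ℕ) (k : ℤ) : Ω → ℕ := if 1 ≤ k then X k.toNat else fun _ => 0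

/-- The falling factorial `X_k (X_k - 1) ⋯ (X_k - j + 1)`. -/
def fall (X : ℕ → Ω → ℕ) (j : ℕ) (k : ℤ) : Ω → ℝ := fun ω => ((ext X k ω).descFactorial j : ℝ)

/-- `X_k` as a real random variable. -/
def rv (X : ℕ → Ω → ℕ) (k : ℤ) : Ω → ℝ := fun ω => (ext X k ω : ℝ)

variable [MeasurableSpace Ω]

/-- The distribution of `S_n = X₁ + ⋯ + X_n`. -/
noncomputable def sumLaw (P : Measure Ω) (X : ℕ → Ω → ℕ) (n : ℕ) : ℤ → ℝ :=
  fun k => P.real {ω | ((∑ i ∈ Finset.Icc 1 n, X i ω : ℕ) : ℤ) = k}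

/-- The `j`-th factorial moment `ν_j(k)` of `X_k`. -/
noncomputable def nu (P : Measure Ω) (X : ℕ → Ω → ℕ) (j : ℕ) (k : ℤ) : ℝ := ∫ ω, fall X j k ω ∂P

/-- `Ê(Y₁, …, Y_k) = E Y₁⋯Y_k - ∑_{j=1}^{k-1} Ê(Y₁, …, Y_j) E Y_{j+1}⋯Y_k`. -/
noncomputable def hatE (P : Measure Ω) (Y : List (Ω → ℝ)) : ℝ :=
  (∫ ω, Y.prod ω ∂P) -
    ∑ j : Finset.Ico 1 Y.length, hatE P (Y.take j) * ∫ ω, (Y.drop j).prod ω ∂P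
termination_by Y.length
decreasing_by
  have := Finset.mem_Ico.1 j.2
  simp only [List.length_take]
  omega

/-- `Ê⁺(Y₁, …, Y_k) = E Y₁⋯Y_k + ∑_{j=1}^{k-1} Ê⁺(Y₁, …, Y_j) E Y_{j+1}⋯Y_k`. -/
noncomputable def hatEplus (P : Measure Ω) (Y : List (Ω → ℝ)) : ℝ :=
  (∫ ω, Y.prod ω ∂P) +
    ∑ j : Finset.Ico 1 Y.length, hatEplus P (Y.take j) * ∫ ω, (Y.drop j).prod ω ∂P
termination_by Y.length
decreasing_by
  have := Finset.mem_Ico.1 j.2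
  simp only [List.length_take]
  omega

/-- `E X_{k-1} X_k`. -/
noncomputable def pairMoment (P : Measure Ω) (X : ℕ → Ω → ℕ) (k : ℤ) : ℝ :=
  ∫ ω, rv X (k - 1) ω * rv X k ω ∂P

/-- `Ê⁺₂(X_{k-1}, X_k)`. -/
noncomputable def pairPlus₂ (P : Measure Ω) (X : ℕ → Ω → ℕ) (k : ℤ) : ℝ :=
  hatEplus P [fall X 2 (k - 1), rv X k] + hatEplus P [rv X (k - 1), fall X 2 k]

/-- `Ê⁺₃(X_{k-1}, X_k)`. -/
noncomputable def pairPlus₃ (P : Measure Ω) (X : ℕ → Ω → ℕ) (k : ℤ) : ℝ :=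
  hatEplus P [fall X 3 (k - 1), rv X k] + hatEplus P [fall X 2 (k - 1), fall X 2 k]
    + hatEplus P [rv X (k - 1), fall X 3 k]

/-- `Ê⁺(X_{k-2}, X_{k-1}, X_k)`. -/
noncomputable def triplePlus (P : Measure Ω) (X : ℕ → Ω → ℕ) (k : ℤ) : ℝ :=
  hatEplus P [rv X (k - 2), rv X (k - 1), rv X k]

/-- `Ê⁺₂(X_{k-2}, X_{k-1}, X_k)`. -/
noncomputable def triplePlus₂ (P : Measure Ω) (X : ℕ → Ω → ℕ) (k : ℤ) : ℝ :=
  hatEplus P [fall X 2 (k - 2), rv X (k - 1), rv X k]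
    + hatEplus P [rv X (k - 2), fall X 2 (k - 1), rv X k]
    + hatEplus P [rv X (k - 2), rv X (k - 1), fall X 2 k]

/-- `Ê⁺(X_{k-3}, X_{k-2}, X_{k-1}, X_k)`. -/
noncomputable def quadPlus (P : Measure Ω) (X : ℕ → Ω → ℕ) (k : ℤ) : ℝ :=
  hatEplus P [rv X (k - 3), rv X (k - 2), rv X (k - 1), rv X k]

noncomputable def Γ₁ (P : Measure Ω) (X : ℕ → Ω → ℕ) (n : ℕ) : ℝ :=
  ∑ k ∈ Finset.Icc (1 : ℤ) n, nu P X 1 k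

noncomputable def Γ₂ (P : Measure Ω) (X : ℕ → Ω → ℕ) (n : ℕ) : ℝ :=
  (1 / 2) * ∑ k ∈ Finset.Icc (1 : ℤ) n, (nu P X 2 k - nu P X 1 k ^ 2)
    + ∑ k ∈ Finset.Icc (2 : ℤ) n, hatE P [rv X (k - 1), rv X k]

noncomputable def Γ₃ (P : Measure Ω) (X : ℕ → Ω → ℕ) (n : ℕ) : ℝ :=
  (1 / 6) * ∑ k ∈ Finset.Icc (1 : ℤ) n,
      (nu P X 3 k - 3 * nu P X 1 k * nu P X 2 k + 2 * nu P X 1 k ^ 3)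
    - ∑ k ∈ Finset.Icc (2 : ℤ) n, (nu P X 1 (k - 1) + nu P X 1 k) * hatE P [rv X (k - 1), rv X k]
    + (1 / 2) * ∑ k ∈ Finset.Icc (2 : ℤ) n,
      (hatE P [fall X 2 (k - 1), rv X k] + hatE P [rv X (k - 1), fall X 2 k])
    + ∑ k ∈ Finset.Icc (3 : ℤ) n, hatE P [rv X (k - 2), rv X (k - 1), rv X k]

/-- `λ = ∑ ν₁(k) - 1.52 ∑ ν₂(k) - 12 ∑_{k ≥ 2} E X_{k-1} X_k`. -/
noncomputable def lam (P : Measure Ω) (X : ℕ → Ω → ℕ) (n : ℕ) : ℝ :=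
  ∑ k ∈ Finset.Icc (1 : ℤ) n, nu P X 1 k - 1.52 * ∑ k ∈ Finset.Icc (1 : ℤ) n, nu P X 2 k
    - 12 * ∑ k ∈ Finset.Icc (2 : ℤ) n, pairMoment P X k

noncomputable def R₁ (P : Measure Ω) (X : ℕ → Ω → ℕ) (n : ℕ) : ℝ :=
  ∑ k ∈ Finset.Icc (1 : ℤ) n,
    (nu P X 1 k ^ 3 + nu P X 1 k * nu P X 2 k + nu P X 3 k
      + (nu P X 1 (k - 2) + nu P X 1 (k - 1) + nu P X 1 k) * pairMoment P X k
      + pairPlus₂ P X k + triplePlus P X k)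

noncomputable def R₂ (P : Measure Ω) (X : ℕ → Ω → ℕ) (n : ℕ) : ℝ :=
  ∑ k ∈ Finset.Icc (1 : ℤ) n,
    (nu P X 1 k ^ 4 + nu P X 2 k ^ 2 + nu P X 4 k
      + (nu P X 1 (k - 2) + nu P X 1 (k - 1) + nu P X 1 k) * (nu P X 3 k + pairPlus₂ P X k)
      + pairMoment P X k ^ 2
      + (∑ l ∈ Finset.range 4, nu P X 1 (k - l)) * triplePlus P X k
      + triplePlus₂ P X k + pairPlus₃ P X k + quadPlus P X k)

/-- The signed compound Poisson measure `G = exp (Γ₁ U + Γ₂ U²)`. -/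
noncomputable def G (P : Measure Ω) (X : ℕ → Ω → ℕ) (n : ℕ) : ℤ → ℝ :=
  expMeasure (Γ₁ P X n • U + Γ₂ P X n • convPow U 2)

/-- The second-order approximation `G (δ₀ + Γ₃ U³)`. -/
noncomputable def Gexp (P : Measure Ω) (X : ℕ → Ω → ℕ) (n : ℕ) : ℤ → ℝ :=
  conv (G P X n) (dirac 0 + Γ₃ P X n • convPow U 3)

end

end OneDependent

/-! Put `E = exp (it)`, `z = E - 1`, `w = ‖z‖`. The four estimates rest on one expansion of the
characteristic function, `𝔼 E ^ S_n = exp (Γ₁ z + Γ₂ z ^ 2 + y)` with `y = O(R₁ w ^ 3)` and `y - Γ₃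
z ^ 3 = O(R₂ w ^ 4)`, together with its analogue for the derivative in `t`, which is one power of
`w` weaker (`OneDepSeq.exists_log_expansion`).

Let `Y_m = E ^ X_m - 1` and let `F_k` be the characteristic function of the `k`-th partial sum.
Splitting the entries `1 + Y_m` of the product one by one, each omitted entry leaves a gap over
which 1-dependence factors the expectation. This gives a linear recurrence for `F_k`
(`OneDepSeq.jet_recurrence`), which `heinrich_expansion` resums into `F_{k+1} - F_k = ∑ F_j
Ê(Y_{j+1}, …, Y_{k+1})`. Now `|Y_m| ≤ 2` and `𝔼 |Y_m| ≤ 1/50`; bounding one entry of a chain by 2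
makes its two sides independent, so `Ê`, dominated by `Ê⁺`, decays geometrically in the length
(`plusChain_split`, `IsFree.plusChain_le`). The recurrence can therefore be divided by `F_k`: `F_n =
∏ (1 + u_k)` with `‖u_k‖ ≤ 1/10`, where `u_k` is a sum over the chains ending at `k`, weighted by
inverses of earlier factors (`exists_factors`).

In `log (1 + u_k)` the chains of lengths one, two and three produce the summands of `Γ₁`, `Γ₂`,
`Γ₃`. Longer chains are compared with a window of three or four indices: inside it `|E ^ m - 1| ≤ w
m` yields `w ^ q Ê⁺` of the variables themselves, outside it the geometric decay remains
(`IsWindowed.plusChain_le`, `sum_tail_le`).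

The derivative is carried along by computing in the dual numbers `Jet`, with the derivative
multiplied by `w / 10000`. The factor `w` restores the power of `w` that differentiation loses, so a
single norm estimate serves value and derivative; the factor `1/10000` keeps the norms of the chain
sums small.

For the decay, the leading part of each factor has modulus at most `1 - (w ^ 2 / 2) (0.99 ν₁ - ν₂)`,
and the longer chains cost multiples of `w ^ 2` times the mixed moments and the products of
neighbouring means. Both characteristic functions are thus at most `exp (-(9/20) w ^ 2 λ)`
(`OneDepSeq.norm_fst_le_exp`, `OneDepSeq.norm_exp_le`). Along the segment joining the two exponents
the exponential stays below the same bound (`norm_exp_add_smul_le`), so the differences are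
polynomials in `w` times a Gaussian weight.

With `b = max 1 √λ`, a term `w ^ j` integrates to order `b ^ (-j-1)`. Fourier inversion gives the
local norm. For total variation, Cauchy–Schwarz with the weight `1 + ((k - Γ₁) / b) ^ 2` and
Parseval's identity use the transforms of `M` and of `(k - Γ₁) M` (`exists_norm_bounds`). After
centring, the drift `E (Γ₁ + 2 Γ₂ z) - Γ₁ = O(Γ₁ w)` remains; it is the source of the factor `1 + Γ₁
min (1, 1/λ)`. -/

namespace OneDependent

/-! ### Chains

A chain is a block of `L` consecutive indices starting at `j`; `c j L` is its moment. -/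

section Chains

variable {R : Type*} [CommRing R]

/-- The signed chain sums `Ê` of the chain moments `c`, with the value `-1` on the empty chain. -/
def hatChain (c : ℤ → ℕ → R) (j : ℤ) : ℕ → R
  | 0 => -1
  | L + 1 => -∑ i : Fin (L + 1), hatChain c j i * c (j + (i : ℕ)) (L + 1 - i)
decreasing_by exact i.2

/-- The positive chain sums `Ê⁺` of the chain moments `c`, with the value `1` on the empty chain. -/
def plusChain (c : ℤ → ℕ → R) (j : ℤ) : ℕ → R
  | 0 => 1
  | L + 1 => ∑ i : Fin (L + 1), plusChain c j i * c (j + (i : ℕ)) (L + 1 - i)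
decreasing_by exact i.2

@[simp] theorem hatChain_zero (c : ℤ → ℕ → R) (j : ℤ) : hatChain c j 0 = -1 := by
  rw [hatChain]

@[simp] theorem plusChain_zero (c : ℤ → ℕ → R) (j : ℤ) : plusChain c j 0 = 1 := by
  rw [plusChain]

theorem hatChain_of_pos (c : ℤ → ℕ → R) (j : ℤ) {L : ℕ} (hL : 0 < L) :
    hatChain c j L = -∑ i ∈ Finset.range L, hatChain c j i * c (j + i) (L - i) := by
  obtain ⟨L, rfl⟩ : ∃ M, L = M + 1 := ⟨L - 1, by omega⟩
  rw [hatChain, ← Fin.sum_univ_eq_sum_range (fun i => hatChain c j i * c (j + i) (L + 1 - i))]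

theorem plusChain_of_pos (c : ℤ → ℕ → R) (j : ℤ) {L : ℕ} (hL : 0 < L) :
    plusChain c j L = ∑ i ∈ Finset.range L, plusChain c j i * c (j + i) (L - i) := by
  obtain ⟨L, rfl⟩ : ∃ M, L = M + 1 := ⟨L - 1, by omega⟩
  rw [plusChain, ← Fin.sum_univ_eq_sum_range (fun i => plusChain c j i * c (j + i) (L + 1 - i))]

theorem hatChain_one (c : ℤ → ℕ → R) (j : ℤ) : hatChain c j 1 = c j 1 := by
  rw [hatChain_of_pos c j (by norm_num : 0 < 1)]; simp

theorem hatChain_two (c : ℤ → ℕ → R) (j : ℤ) :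
    hatChain c j 2 = c j 2 - c j 1 * c (j + 1) 1 := by
  rw [hatChain_of_pos c j (by norm_num : 0 < 2)]; simp [Finset.sum_range_succ, hatChain_one]; ring

theorem hatChain_three (c : ℤ → ℕ → R) (j : ℤ) :
    hatChain c j 3 = c j 3 - c j 1 * c (j + 1) 2
      - (c j 2 - c j 1 * c (j + 1) 1) * c (j + 2) 1 := by
  rw [hatChain_of_pos c j (by norm_num : 0 < 3)]
  simp [Finset.sum_range_succ, hatChain_one, hatChain_two]; ring

theorem plusChain_one (c : ℤ → ℕ → R) (j : ℤ) : plusChain c j 1 = c j 1 := by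
  rw [plusChain_of_pos c j (by norm_num : 0 < 1)]; simp

theorem plusChain_two (c : ℤ → ℕ → R) (j : ℤ) :
    plusChain c j 2 = c j 2 + c j 1 * c (j + 1) 1 := by
  rw [plusChain_of_pos c j (by norm_num : 0 < 2)]; simp [Finset.sum_range_succ, plusChain_one]

theorem plusChain_three (c : ℤ → ℕ → R) (j : ℤ) :
    plusChain c j 3 = c j 3 + c j 1 * c (j + 1) 2
      + (c j 2 + c j 1 * c (j + 1) 1) * c (j + 2) 1 := by
  rw [plusChain_of_pos c j (by norm_num : 0 < 3)]
  simp [Finset.sum_range_succ, plusChain_one, plusChain_two]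

theorem plusChain_four (c : ℤ → ℕ → R) (j : ℤ) :
    plusChain c j 4 = c j 4 + c j 1 * c (j + 1) 3 + (c j 2 + c j 1 * c (j + 1) 1) * c (j + 2) 2
      + (c j 3 + c j 1 * c (j + 1) 2 + (c j 2 + c j 1 * c (j + 1) 1) * c (j + 2) 1)
        * c (j + 3) 1 := by
  rw [plusChain_of_pos c j (by norm_num : 0 < 4)]
  simp [Finset.sum_range_succ, plusChain_one, plusChain_two, plusChain_three]

theorem hatChain_eq_zero {c : ℤ → ℕ → R} {j : ℤ} (hc : ∀ L, 0 < L → c j L = 0) {L : ℕ}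
    (hL : 0 < L) : hatChain c j L = 0 := by
  induction L using Nat.strong_induction_on with
  | _ L ih =>
    rw [hatChain_of_pos c j hL, neg_eq_zero]
    refine Finset.sum_eq_zero fun i hi => ?_
    rcases Nat.eq_zero_or_pos i with rfl | h
    · simp [hc L hL]
    · simp [ih i (Finset.mem_range.1 hi) h]

theorem plusChain_eq_zero {c : ℤ → ℕ → R} {j : ℤ} (hc : ∀ L, 0 < L → c j L = 0) {L : ℕ}
    (hL : 0 < L) : plusChain c j L = 0 := by
  induction L using Nat.strong_induction_on with
  | _ L ih =>
    rw [plusChain_of_pos c j hL]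
    refine Finset.sum_eq_zero fun i hi => ?_
    rcases Nat.eq_zero_or_pos i with rfl | h
    · simp [hc L hL]
    · simp [ih i (Finset.mem_range.1 hi) h]

theorem plusChain_congr {c c' : ℤ → ℕ → R} {j : ℤ} {L : ℕ}
    (h : ∀ i M, 0 < M → i + M ≤ L → c (j + i) M = c' (j + i) M) :
    plusChain c j L = plusChain c' j L := by
  induction L using Nat.strong_induction_on with
  | _ L ih =>
    rcases Nat.eq_zero_or_pos L with rfl | hL
    · simp
    rw [plusChain_of_pos c j hL, plusChain_of_pos c' j hL]
    refine Finset.sum_congr rfl fun i hi => ?_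
    have hi := Finset.mem_range.1 hi
    rw [ih i hi fun a M hM haM => h a M hM (by omega), h i (L - i) (by omega) (by omega)]

/-- **Heinrich's expansion.** -/
theorem heinrich_expansion {c : ℤ → ℕ → R} {F : ℕ → R}
    (hF : ∀ k, F (k + 1) - F k = ∑ j ∈ Finset.range (k + 1), F (j - 1) * c (j + 1) (k + 1 - j))
    (k : ℕ) :
    F (k + 1) - F k = ∑ j ∈ Finset.range (k + 1), F j * hatChain c (j + 1) (k + 1 - j) := by
  induction k using Nat.strong_induction_on with
  | _ k ih =>
    -- The value `-1` on the empty chain makes the term `j = m` equal to `-F m`, so the induction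
    -- hypothesis `F m - F (m - 1)` collapses to `-F (m - 1)`. At `m = 0` truncated subtraction
    -- reads `F (0 - 1) = F 0`, in agreement with `hF`.
    have inner : ∀ m ∈ Finset.range (k + 1),
        ∑ j ∈ Finset.range (m + 1), F j * hatChain c (j + 1) (m - j) = -F (m - 1) := by
      intro m hm
      rw [Finset.sum_range_succ]
      rcases Nat.eq_zero_or_pos m with rfl | hm0
      · simp
      · obtain ⟨m, rfl⟩ : ∃ M, m = M + 1 := ⟨m - 1, by omega⟩
        rw [← ih m (by have := Finset.mem_range.1 hm; omega)]
        simp; ring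
    -- The recursion for `hatChain` is inserted and the summations are exchanged, so that the last
    -- cut `m` becomes the outer index.
    have key : ∑ j ∈ Finset.range (k + 1), F j * hatChain c (j + 1) (k + 1 - j)
        = -∑ m ∈ Finset.range (k + 1), (∑ j ∈ Finset.range (m + 1),
            F j * hatChain c (j + 1) (m - j)) * c (m + 1) (k + 1 - m) := by
      rw [← Finset.sum_neg_distrib]
      have h1 : ∀ j ∈ Finset.range (k + 1), F j * hatChain c (j + 1) (k + 1 - j)
          = ∑ m ∈ Finset.Ico j (k + 1),
            -(F j * hatChain c (j + 1) (m - j) * c (m + 1) (k + 1 - m)) := by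
        intro j hj
        have hj := Finset.mem_range.1 hj
        rw [hatChain_of_pos c _ (by omega : 0 < k + 1 - j), Finset.sum_Ico_eq_sum_range,
          mul_neg, Finset.mul_sum, ← Finset.sum_neg_distrib]
        refine Finset.sum_congr rfl fun i hi => ?_
        have e1 : j + i - j = i := by omega
        have e2 : k + 1 - j - i = k + 1 - (j + i) := by omega
        rw [e1, e2]; push_cast
        rw [add_right_comm (j : ℤ) 1 (i : ℤ)]; ring
      rw [Finset.sum_congr rfl h1]
      simp only [Finset.sum_mul, ← Finset.sum_neg_distrib]
      refine Finset.sum_comm' fun j m => ?_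
      simp only [Finset.mem_range, Finset.mem_Ico]; omega
    rw [key, hF, ← Finset.sum_neg_distrib]
    refine Finset.sum_congr rfl fun m hm => ?_
    rw [inner m hm]; ring

end Chains

/-! ### Positive chain sums of real moments. -/

section RealChains

theorem plusChain_nonneg {c : ℤ → ℕ → ℝ} (hc : ∀ j L, 0 ≤ c j L) (j : ℤ) (L : ℕ) :
    0 ≤ plusChain c j L := by
  induction L using Nat.strong_induction_on with
  | _ L ih =>
    rcases Nat.eq_zero_or_pos L with rfl | hL
    · simp
    rw [plusChain_of_pos c j hL]
    exact Finset.sum_nonneg fun i hi => mul_nonneg (ih i (Finset.mem_range.1 hi)) (hc _ _)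

theorem plusChain_mono {c c' : ℤ → ℕ → ℝ} (hc : ∀ j L, 0 ≤ c j L) {j : ℤ} {L : ℕ}
    (h : ∀ i M, 0 < M → i + M ≤ L → c (j + i) M ≤ c' (j + i) M) :
    plusChain c j L ≤ plusChain c' j L := by
  induction L using Nat.strong_induction_on with
  | _ L ih =>
    rcases Nat.eq_zero_or_pos L with rfl | hL
    · simp
    rw [plusChain_of_pos c j hL, plusChain_of_pos c' j hL]
    refine Finset.sum_le_sum fun i hi => ?_
    have hi := Finset.mem_range.1 hi
    have h1 := ih i hi fun a M hM haM => h a M hM (by omega)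
    exact mul_le_mul h1 (h i (L - i) (by omega) (by omega)) (hc _ _)
      ((plusChain_nonneg hc j i).trans h1)

/-- A chain moment that factors, up to `κ`, at an interior index makes `Ê⁺` factor there. -/
theorem plusChain_split {c : ℤ → ℕ → ℝ} {κ : ℝ} (hκ : 0 ≤ κ) (hc : ∀ j L, 0 ≤ c j L)
    (hc0 : ∀ j, c j 0 = 1) {j : ℤ} {a : ℕ}
    (hs : ∀ i ≤ a, ∀ b, c (j + i) (a - i + 1 + b)
      ≤ κ * c (j + i) (a - i) * c (j + a + 1) b) (b : ℕ) :
    plusChain c j (a + 1 + b) ≤ 4 * κ * plusChain c j a * plusChain c (j + a + 1) b := by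
  have pn := plusChain_nonneg hc
  -- These are the last cuts at or before the split index. The terms `i < a` rebuild `plusChain c j
  -- a` and the term `i = a` contributes it once more, whence the factor 2.
  have sum_le : ∀ b, ∑ i ∈ Finset.range (a + 1), plusChain c j i * c (j + i) (a + 1 + b - i)
      ≤ 2 * κ * plusChain c j a * c (j + a + 1) b := by
    intro b
    have h1 : ∀ i ∈ Finset.range (a + 1), plusChain c j i * c (j + i) (a + 1 + b - i)
        ≤ κ * c (j + a + 1) b * (plusChain c j i * c (j + i) (a - i)) := by
      intro i hi
      have hi := Finset.mem_range.1 hi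
      have h := hs i (by omega) b
      rw [show a - i + 1 + b = a + 1 + b - i by omega] at h
      calc _ ≤ plusChain c j i * (κ * c (j + i) (a - i) * c (j + a + 1) b) :=
            mul_le_mul_of_nonneg_left h (pn _ _)
        _ = _ := by ring
    refine (Finset.sum_le_sum h1).trans ?_
    rw [← Finset.mul_sum, Finset.sum_range_succ]
    have h2 : ∑ i ∈ Finset.range a, plusChain c j i * c (j + i) (a - i) ≤ plusChain c j a := by
      rcases Nat.eq_zero_or_pos a with rfl | ha
      · simp
      · rw [← plusChain_of_pos c j ha]
    rw [Nat.sub_self, hc0]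
    have := mul_le_mul_of_nonneg_left h2 (mul_nonneg hκ (hc (j + a + 1) b))
    nlinarith
  have first : plusChain c j (a + 1) ≤ 2 * κ * plusChain c j a := by
    rw [plusChain_of_pos c j (by omega)]
    simpa [hc0] using sum_le 0
  induction b using Nat.strong_induction_on with
  | _ b ih =>
    rcases Nat.eq_zero_or_pos b with rfl | hb
    · have := mul_nonneg hκ (pn j a)
      simp only [add_zero, plusChain_zero, mul_one]; linarith
    rw [plusChain_of_pos c j (by omega : 0 < a + 1 + b), Finset.sum_range_add,
      plusChain_of_pos c (j + a + 1) hb, Finset.mul_sum]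
    obtain ⟨b, rfl⟩ : ∃ M, b = M + 1 := ⟨b - 1, by omega⟩
    rw [Finset.sum_range_succ' _ b, Finset.sum_range_succ' _ b]
    have h3 : ∀ i ∈ Finset.range b, plusChain c j (a + 1 + (i + 1))
          * c (j + ((a + 1 + (i + 1) : ℕ) : ℤ)) (a + 1 + (b + 1) - (a + 1 + (i + 1)))
        ≤ 4 * κ * plusChain c j a * (plusChain c (j + a + 1) (i + 1)
          * c (j + a + 1 + ((i + 1 : ℕ) : ℤ)) (b + 1 - (i + 1))) := by
      intro i hi
      have hi := Finset.mem_range.1 hi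
      rw [show a + 1 + (b + 1) - (a + 1 + (i + 1)) = b + 1 - (i + 1) by omega,
        show j + ((a + 1 + (i + 1) : ℕ) : ℤ) = j + a + 1 + ((i + 1 : ℕ) : ℤ) by push_cast; ring,
        ← mul_assoc]
      exact mul_le_mul_of_nonneg_right (ih (i + 1) (by omega)) (hc _ _)
    have h4 := Finset.sum_le_sum h3
    have h5 := sum_le (b + 1)
    -- The cut immediately after the split index. It and the earlier cuts cost `2 * κ` each, and
    -- together they match the empty-chain term on the right; the later cuts are matched term by
    -- term by induction.
    have h6 : plusChain c j (a + 1 + 0) * c (j + ((a + 1 + 0 : ℕ) : ℤ))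
        (a + 1 + (b + 1) - (a + 1 + 0)) ≤ 2 * κ * plusChain c j a * c (j + a + 1) (b + 1) := by
      rw [add_zero, show a + 1 + (b + 1) - (a + 1) = b + 1 by omega,
        show j + ((a + 1 : ℕ) : ℤ) = j + a + 1 by push_cast; ring]
      exact mul_le_mul_of_nonneg_right first (hc _ _)
    simp only [plusChain_zero, Nat.cast_zero, add_zero, one_mul, Nat.sub_zero] at *
    linarith

end RealChains

end OneDependent

/-! ### Geometric decay of positive chain sums. -/

namespace OneDependent

/-- A majorant of `Ê⁺` for chains of small bounded variables. -/
noncomputable def freeBound : ℕ → ℝ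
  | 0 => 1
  | 1 => 1 / 50
  | 2 => 101 / 2500
  | n + 3 => 4 / 25 * freeBound (n + 1)

theorem freeBound_nonneg : ∀ n, 0 ≤ freeBound n
  | 0 => by norm_num [freeBound]
  | 1 => by norm_num [freeBound]
  | 2 => by norm_num [freeBound]
  | n + 3 => by
    have := freeBound_nonneg (n + 1)
    rw [freeBound]; positivity

theorem freeBound_le_pow : ∀ n, freeBound n ≤ (2 / 5 : ℝ) ^ n
  | 0 => by norm_num [freeBound]
  | 1 => by norm_num [freeBound]
  | 2 => by norm_num [freeBound]
  | n + 3 => by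
    have := freeBound_le_pow (n + 1)
    rw [freeBound, show n + 3 = n + 1 + 2 by ring, pow_add]; linarith

/-- The weight `10 / 9` is the bound for inverse factors used in `exists_factors`. The recursion for
`freeBound` expresses the sum as its first two terms plus `(10/9) ^ 2 * (4/25) = 16/81` times a
shorter one, and `81 / 1000` survives this map. -/
theorem sum_freeBound_le (N : ℕ) :
    ∑ L ∈ Finset.range N, (10 / 9 : ℝ) ^ L * freeBound (L + 1) ≤ 81 / 1000 := by
  induction N using Nat.strong_induction_on with
  | _ N ih =>
    match N with
    | 0 => norm_num
    | 1 => norm_num [freeBound]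
    | N + 2 =>
      rw [Finset.sum_range_succ', Finset.sum_range_succ']
      have h : ∑ L ∈ Finset.range N, (10 / 9 : ℝ) ^ (L + 1 + 1) * freeBound (L + 1 + 1 + 1)
          = 100 / 81 * (4 / 25) * ∑ L ∈ Finset.range N, (10 / 9 : ℝ) ^ L * freeBound (L + 1) := by
        rw [Finset.mul_sum]
        refine Finset.sum_congr rfl fun L _ => ?_
        rw [freeBound]; ring
      rw [h]
      have := ih N (by omega)
      norm_num [freeBound]; linarith

/-- Chain moments of small variables bounded by `2`. -/
structure IsFree (c : ℤ → ℕ → ℝ) : Prop where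
  nonneg : ∀ j L, 0 ≤ c j L
  zero : ∀ j, c j 0 = 1
  split : ∀ j a b, c j (a + 1 + b) ≤ 2 * c j a * c (j + a + 1) b
  one : ∀ j, c j 1 ≤ 1 / 50

theorem IsFree.two {c : ℤ → ℕ → ℝ} (hc : IsFree c) (j : ℤ) : c j 2 ≤ 1 / 25 := by
  have h := hc.split j 0 1
  have h1 := hc.one (j + 1)
  rw [hc.zero] at h
  simp only [Nat.cast_zero, add_zero] at h
  norm_num at h; linarith

theorem IsFree.plusChain_split {c : ℤ → ℕ → ℝ} (hc : IsFree c) (j : ℤ) (a b : ℕ) :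
    plusChain c j (a + 1 + b) ≤ 8 * plusChain c j a * plusChain c (j + a + 1) b := by
  have := OneDependent.plusChain_split (c := c) (κ := 2) (j := j) (a := a) (by norm_num)
    hc.nonneg hc.zero (fun i hi b => by
      have h := hc.split (j + i) (a - i) b
      rwa [show j + i + ((a - i : ℕ) : ℤ) = j + a by push_cast [hi]; ring] at h) b
  linarith

/-- Splitting at the last index but one costs 8 and isolates the last variable, which contributes `1
/ 50`; so two indices cost `4/25 = (2/5) ^ 2`. The value at length two is `1/25 + (1/50) ^ 2`. -/
theorem IsFree.plusChain_le {c : ℤ → ℕ → ℝ} (hc : IsFree c) (j : ℤ) (L : ℕ) :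
    plusChain c j L ≤ freeBound L := by
  induction L using Nat.strong_induction_on generalizing j with
  | _ L ih =>
    match L with
    | 0 => simp [freeBound]
    | 1 => simpa [plusChain_one, freeBound] using hc.one j
    | 2 =>
      rw [plusChain_two, freeBound]
      nlinarith [hc.two j, hc.one j, hc.one (j + 1), hc.nonneg j 1, hc.nonneg (j + 1) 1]
    | L + 3 =>
      have h := hc.plusChain_split j (L + 1) 1
      rw [plusChain_one] at h
      have h1 := hc.one (j + ((L + 1 : ℕ) : ℤ) + 1)
      have h2 := ih (L + 1) (by omega) j
      have h3 := plusChain_nonneg hc.nonneg j (L + 1)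
      rw [freeBound]
      rw [show L + 1 + 1 + 1 = L + 3 by ring] at h
      nlinarith [hc.nonneg (j + ((L + 1 : ℕ) : ℤ) + 1) 1]

theorem IsFree.plusChain_le_pow {c : ℤ → ℕ → ℝ} (hc : IsFree c) (j : ℤ) (L : ℕ) :
    plusChain c j L ≤ (2 / 5 : ℝ) ^ L :=
  (hc.plusChain_le j L).trans (freeBound_le_pow L)

/-- Chain moments which are those of `d` away from the window `[a, a + q)`. -/
structure IsWindowed (c d : ℤ → ℕ → ℝ) (a : ℤ) (q : ℕ) : Prop where
  free : IsFree d
  nonneg : ∀ j L, 0 ≤ c j L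
  zero : ∀ j, c j 0 = 1
  split : ∀ j m b, (j + (m : ℕ) < a ∨ a + q ≤ j + (m : ℕ)) →
    c j (m + 1 + b) ≤ 2 * c j m * c (j + m + 1) b
  eq_free : ∀ j L, (j + (L : ℕ) ≤ a ∨ a + q ≤ j) → c j L = d j L

theorem IsWindowed.plusChain_split {c d : ℤ → ℕ → ℝ} {a : ℤ} {q : ℕ} (h : IsWindowed c d a q)
    (j : ℤ) (m b : ℕ) (hj : j + (m : ℕ) < a ∨ a + q ≤ j + (m : ℕ)) :
    plusChain c j (m + 1 + b) ≤ 8 * plusChain c j m * plusChain c (j + m + 1) b := by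
  have := OneDependent.plusChain_split (c := c) (κ := 2) (j := j) (a := m) (by norm_num)
    h.nonneg h.zero (fun i hi b => by
      have e : j + i + ((m - i : ℕ) : ℤ) = j + m := by push_cast [hi]; ring
      have h := h.split (j + i) (m - i) b (by rw [e]; exact hj)
      rwa [e] at h) b
  linarith

theorem IsWindowed.plusChain_free_le {c d : ℤ → ℕ → ℝ} {a : ℤ} {q : ℕ} (h : IsWindowed c d a q)
    (j : ℤ) (L : ℕ) (hj : j + (L : ℕ) ≤ a ∨ a + q ≤ j) : plusChain c j L ≤ (2 / 5 : ℝ) ^ L := by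
  rw [plusChain_congr (c' := d) fun i M hM hi => h.eq_free _ _ (by omega)]
  exact h.free.plusChain_le_pow j L

/-- On each side the index adjacent to the window is bounded crudely, at the cost 8, which detaches
an outer chain of the free moments. That chain has lost one index, so each side costs `8 * (5/2) =
20`, and `400 = 20 ^ 2`. -/
theorem IsWindowed.plusChain_le {c d : ℤ → ℕ → ℝ} {a : ℤ} {q : ℕ} (h : IsWindowed c d a q)
    (l₁ l₂ : ℕ) : plusChain c (a - l₁) (l₁ + q + l₂)
      ≤ 400 * (2 / 5 : ℝ) ^ (l₁ + l₂) * plusChain c a q := by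
  have pn := plusChain_nonneg h.nonneg
  have right : plusChain c a (q + l₂) ≤ 20 * (2 / 5 : ℝ) ^ l₂ * plusChain c a q := by
    rcases Nat.eq_zero_or_pos l₂ with rfl | hl
    · simp only [add_zero, pow_zero]; linarith [pn a q]
    obtain ⟨b, rfl⟩ : ∃ M, l₂ = M + 1 := ⟨l₂ - 1, by omega⟩
    have h1 := h.plusChain_split a q b (Or.inr le_rfl)
    have h2 := h.plusChain_free_le (a + q + 1) b (Or.inr (by omega))
    have h3 := mul_le_mul_of_nonneg_left h2 (mul_nonneg (by norm_num : (0 : ℝ) ≤ 8) (pn a q))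
    rw [show q + (b + 1) = q + 1 + b by ring, pow_succ]
    linarith
  rcases Nat.eq_zero_or_pos l₁ with rfl | hl
  · simp only [Nat.cast_zero, sub_zero, zero_add]
    have := mul_nonneg (by positivity : (0 : ℝ) ≤ (2 / 5) ^ l₂) (pn a q)
    nlinarith
  obtain ⟨m, rfl⟩ : ∃ M, l₁ = M + 1 := ⟨l₁ - 1, by omega⟩
  have h1 := h.plusChain_split (a - ((m + 1 : ℕ) : ℤ)) m (q + l₂) (Or.inl (by push_cast; omega))
  have h2 := h.plusChain_free_le (a - ((m + 1 : ℕ) : ℤ)) m (Or.inl (by push_cast; omega))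
  rw [show a - ((m + 1 : ℕ) : ℤ) + m + 1 = a by push_cast; ring] at h1
  rw [show m + 1 + q + l₂ = m + 1 + (q + l₂) by ring]
  calc _ ≤ 8 * plusChain c (a - ((m + 1 : ℕ) : ℤ)) m * plusChain c a (q + l₂) := h1
    _ ≤ 8 * (2 / 5 : ℝ) ^ m * (20 * (2 / 5 : ℝ) ^ l₂ * plusChain c a q) := by
        refine mul_le_mul ?_ right (pn _ _) (by positivity)
        linarith
    _ = _ := by ring

/-! ### Sums over the last index of a chain -/

theorem sum_shift_le {f : ℤ → ℝ} (hf : ∀ k, 0 ≤ f k) (hf0 : ∀ k ≤ 0, f k = 0) (n : ℤ) (d : ℕ) :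
    ∑ k ∈ Finset.Icc 1 n, f (k - d) ≤ ∑ k ∈ Finset.Icc 1 n, f k := by
  have h1 : ∑ k ∈ Finset.Icc 1 n, f (k - d) = ∑ k ∈ Finset.Icc (1 - (d : ℤ)) (n - d), f k := by
    rw [← Finset.sum_image (g := fun k : ℤ => k - d) (by intro a _ b _ h; simpa using h)]
    congr 1; ext k
    simp only [Finset.mem_image, Finset.mem_Icc]
    exact ⟨fun ⟨a, ha, h⟩ => by omega, fun h => ⟨k + d, by omega, by omega⟩⟩
  rw [h1, ← Finset.sum_subset (Finset.filter_subset (fun k => 1 ≤ k) _)]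
  · refine Finset.sum_le_sum_of_subset_of_nonneg ?_ fun k _ _ => hf k
    intro k; simp only [Finset.mem_filter, Finset.mem_Icc]; omega
  · intro k _ hk'
    refine hf0 k ?_
    by_contra h
    exact hk' (Finset.mem_filter.2 ⟨‹_›, by omega⟩)

theorem sq_le_pow (L : ℕ) : (L : ℝ) ^ 2 ≤ 4 * (3 / 2 : ℝ) ^ L := by
  induction L with
  | zero => norm_num
  | succ L ih =>
    rcases lt_or_ge L 5 with h | h
    · interval_cases L <;> norm_num
    · have : (5 : ℝ) ≤ L := by exact_mod_cast h
      rw [pow_succ (3 / 2 : ℝ)]; push_cast; nlinarith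

/-- A chain of length `L` contains `L + 1 - q` windows of length `q`, and each shifted sum of window
moments is at most the one ending at `k`, because `M` vanishes at nonpositive indices. This leaves
the sum of `L ^ 2 * (10/9 * 2/5) ^ L`; with `L ^ 2 ≤ 4 * (3/2) ^ L` the ratio becomes `2/3`. The
restriction `q ≤ 4` enters through `(5/2) ^ q ≤ 40`. -/
theorem sum_tail_le {H : ℤ → ℕ → ℝ} {M : ℤ → ℝ} {q : ℕ} (hq1 : 1 ≤ q) (hq : q ≤ 4) {K : ℝ}
    (hK : 0 ≤ K) (hM : ∀ a, 0 ≤ M a) (hM0 : ∀ a ≤ 0, M a = 0)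
    (hH : ∀ j L, q ≤ L → H j L ≤ K * L * (2 / 5 : ℝ) ^ (L - q)
      * ∑ d ∈ Finset.range (L + 1 - q), M (j + d)) (n : ℤ) (N : ℕ) :
    ∑ k ∈ Finset.Icc 1 n, ∑ L ∈ Finset.Ico q N, (10 / 9 : ℝ) ^ (L - 1) * H (k + 1 - L) L
      ≤ 500 * K * ∑ k ∈ Finset.Icc 1 n, M (k + 1 - q) := by
  set S := ∑ k ∈ Finset.Icc 1 n, M (k + 1 - q)
  have hS : 0 ≤ S := Finset.sum_nonneg fun k _ => hM _
  have each : ∀ L ∈ Finset.Ico q N,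
      ∑ k ∈ Finset.Icc 1 n, (10 / 9 : ℝ) ^ (L - 1) * H (k + 1 - L) L
        ≤ K * S * (160 * (2 / 3 : ℝ) ^ L) := by
    intro L hL
    have hL := Finset.mem_Ico.1 hL
    have h1 : ∑ k ∈ Finset.Icc 1 n, ∑ d ∈ Finset.range (L + 1 - q), M (k + 1 - L + d)
        ≤ (L : ℝ) * S := by
      rw [Finset.sum_comm]
      have h2 : ∀ d ∈ Finset.range (L + 1 - q), ∑ k ∈ Finset.Icc 1 n, M (k + 1 - L + d) ≤ S := by
        intro d hd
        have hd := Finset.mem_range.1 hd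
        have h3 := sum_shift_le (f := fun k => M (k + 1 - q)) (fun k => hM _)
          (fun k hk => hM0 _ (by omega)) n (L - q - d)
        refine le_trans (le_of_eq ?_) h3
        refine Finset.sum_congr rfl fun k _ => ?_
        congr 1; omega
      refine (Finset.sum_le_sum h2).trans ?_
      rw [Finset.sum_const, Finset.card_range, nsmul_eq_mul]
      have : ((L + 1 - q : ℕ) : ℝ) ≤ L := by exact_mod_cast (by omega : L + 1 - q ≤ L)
      exact mul_le_mul_of_nonneg_right this hS
    rw [← Finset.mul_sum]
    have h4 : ∑ k ∈ Finset.Icc 1 n, H (k + 1 - L) L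
        ≤ K * L * (2 / 5 : ℝ) ^ (L - q) * ((L : ℝ) * S) := by
      refine (Finset.sum_le_sum fun k _ => hH (k + 1 - L) L hL.1).trans ?_
      rw [← Finset.mul_sum]
      exact mul_le_mul_of_nonneg_left h1 (by positivity)
    have h5 : (2 / 5 : ℝ) ^ (L - q) ≤ 40 * (2 / 5 : ℝ) ^ L := by
      obtain ⟨m, rfl⟩ : ∃ m, L = m + q := ⟨L - q, by omega⟩
      rw [Nat.add_sub_cancel, pow_add]
      have : (1 / 40 : ℝ) ≤ (2 / 5 : ℝ) ^ q := by interval_cases q <;> norm_num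
      have := mul_le_mul_of_nonneg_left this (by positivity : (0 : ℝ) ≤ (2 / 5) ^ m)
      linarith
    have h6 : (10 / 9 : ℝ) ^ (L - 1) ≤ (10 / 9 : ℝ) ^ L :=
      pow_le_pow_right₀ (by norm_num) (by omega)
    calc _ ≤ (10 / 9 : ℝ) ^ (L - 1) * (K * L * (2 / 5 : ℝ) ^ (L - q) * ((L : ℝ) * S)) :=
          mul_le_mul_of_nonneg_left h4 (by positivity)
      _ ≤ (10 / 9 : ℝ) ^ L * (K * L * (40 * (2 / 5 : ℝ) ^ L) * ((L : ℝ) * S)) := by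
          gcongr
      _ = K * S * (40 * ((L : ℝ) ^ 2 * ((10 / 9 : ℝ) ^ L * (2 / 5 : ℝ) ^ L))) := by ring
      _ ≤ K * S * (40 * (4 * (3 / 2 : ℝ) ^ L * ((10 / 9 : ℝ) ^ L * (2 / 5 : ℝ) ^ L))) := by
          gcongr; exact sq_le_pow L
      _ = _ := by
          rw [← mul_pow, mul_assoc 4, ← mul_pow]; norm_num; left; ring
  rw [Finset.sum_comm]
  refine (Finset.sum_le_sum each).trans ?_
  rw [← Finset.mul_sum, ← Finset.mul_sum]
  have geo : ∑ L ∈ Finset.Ico q N, (2 / 3 : ℝ) ^ L ≤ 3 := by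
    refine (Finset.sum_le_sum_of_subset_of_nonneg (t := Finset.range N) ?_ ?_).trans ?_
    · intro L; simp only [Finset.mem_Ico, Finset.mem_range]; omega
    · intros; positivity
    · rw [geom_sum_eq (by norm_num)]
      have : (0 : ℝ) ≤ (2 / 3) ^ N := by positivity
      rw [div_le_iff_of_neg (by norm_num)]; linarith
  have := mul_nonneg hK hS
  nlinarith

end OneDependent

/-! ### Factorisation of the solution of a recurrence in a Banach algebra. -/

namespace OneDependent

section Factors

variable {A : Type*} [NormedCommRing A] [NormOneClass A]

theorem norm_le_of_mul_one_add_eq_one {u v : A} (h : v * (1 + u) = 1) (hu : ‖u‖ ≤ 1 / 10) :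
    ‖v‖ ≤ 10 / 9 := by
  have h1 : v = 1 - v * u := by linear_combination h
  have h2 : ‖v‖ ≤ 1 + ‖v‖ * ‖u‖ := by
    calc ‖v‖ = ‖1 - v * u‖ := by rw [← h1]
      _ ≤ ‖(1 : A)‖ + ‖v * u‖ := norm_sub_le _ _
      _ ≤ 1 + ‖v‖ * ‖u‖ := by rw [norm_one]; gcongr; exact norm_mul_le _ _
  nlinarith [norm_nonneg v]

theorem norm_prod_le_pow {ι : Type*} (s : Finset ι) (f : ι → A) {B : ℝ}
    (h : ∀ i ∈ s, ‖f i‖ ≤ B) : ‖∏ i ∈ s, f i‖ ≤ B ^ s.card := by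
  refine (s.norm_prod_le f).trans ((Finset.prod_le_prod (fun i _ => norm_nonneg _) h).trans ?_)
  simp

/-- The factors of a solution of a recurrence with small coefficients. -/
theorem exists_factors [CompleteSpace A] {H : ℤ → ℕ → A} {F : ℕ → A} (hF0 : F 0 = 1)
    (hF : ∀ k, F (k + 1) - F k = ∑ j ∈ Finset.range (k + 1), F j * H (j + 1) (k + 1 - j))
    (hH : ∀ j ≤ 0, ∀ L, 0 < L → H j L = 0)
    (hb : ∀ (k : ℤ) (N : ℕ),
      ∑ L ∈ Finset.Ico 1 N, (10 / 9 : ℝ) ^ (L - 1) * ‖H (k + 1 - L) L‖ ≤ 1 / 10) :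
    ∃ u v : ℤ → A, (∀ k, v k * (1 + u k) = 1) ∧ (∀ k, ‖u k‖ ≤ 1 / 10) ∧ (∀ k, ‖v k‖ ≤ 10 / 9) ∧
      (∀ k ≤ 0, u k = 0) ∧ (∀ k : ℕ, F k = ∏ i ∈ Finset.range k, (1 + u (i + 1))) ∧
      ∀ (k : ℤ) (N : ℕ), k < N → u k = ∑ L ∈ Finset.Ico 1 N,
        (∏ i ∈ Finset.range (L - 1), v (k - 1 - i)) * H (k + 1 - L) L := by
  -- `ψ k` stands for `F k / F (k + 1)`. Products of these are the quotients `F j / F k`, which turn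
  -- the recurrence into `F (k + 1) = F k * (1 + υ k)`. `Ring.inverse` has the junk value 0 at
  -- non-units, so invertibility must be part of the induction.
  set ψ : ℕ → A := fun k => F k * Ring.inverse (F (k + 1)) with hψ
  set υ : ℕ → A := fun k => ∑ L ∈ Finset.Ico 1 (k + 2),
    (∏ i ∈ Finset.range (L - 1), ψ (k - 1 - i)) * H (k + 2 - L) L with hυ
  have main : ∀ k, IsUnit (F k) ∧ (∀ i < k, ‖ψ i‖ ≤ 10 / 9) ∧
      (∀ i < k, F (i + 1) = F i * (1 + υ i)) ∧ (∀ i < k, ‖υ i‖ ≤ 1 / 10) := by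
    intro k
    induction k with
    | zero => exact ⟨by rw [hF0]; exact isUnit_one, by simp, by simp, by simp⟩
    | succ k ih =>
      obtain ⟨hu, hψ1, hrec, hυ1⟩ := ih
      have hprod : ∀ m ≤ k, IsUnit (F (k - m)) →
          F (k - m) = F k * ∏ i ∈ Finset.range m, ψ (k - 1 - i) := by
        intro m hm _
        induction m with
        | zero => simp
        | succ m ihm =>
          have hkm : k - m = k - (m + 1) + 1 := by omega
          have hunit : IsUnit (F (k - m)) := by
            rcases Nat.eq_zero_or_pos m with rfl | h0
            · simpa using hu
            · have h1 : IsUnit (1 + υ (k - (m + 1))) := by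
                have := hυ1 (k - (m + 1)) (by omega)
                have h2 : ‖-υ (k - (m + 1))‖ < 1 := by rw [norm_neg]; linarith
                simpa using isUnit_one_sub_of_norm_lt_one h2
              rw [hkm, hrec _ (by omega)]
              exact IsUnit.mul ‹_› h1
          rw [Finset.prod_range_succ, ← mul_assoc, ← ihm (by omega) hunit, hψ]
          have e : k - 1 - m = k - (m + 1) := by omega
          simp only [e]
          rw [← hkm, mul_left_comm, Ring.mul_inverse_cancel _ hunit, mul_one]
      have hunits : ∀ m ≤ k, IsUnit (F m) := by
        intro m hm
        induction m with
        | zero => rw [hF0]; exact isUnit_one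
        | succ m ihm =>
          have h1 : IsUnit (1 + υ m) := by
            have := hυ1 m (by omega)
            have h2 : ‖-υ m‖ < 1 := by rw [norm_neg]; linarith
            simpa using isUnit_one_sub_of_norm_lt_one h2
          rw [hrec m (by omega)]
          exact (ihm (by omega)).mul h1
      have hk : F (k + 1) = F k * (1 + υ k) := by
        have h1 : ∑ j ∈ Finset.range (k + 1), F j * H (j + 1) (k + 1 - j) = F k * υ k := by
          have key := Finset.sum_Ico_reflect (fun j : ℕ => F j * H (j + 1) (k + 1 - j)) 1
            (m := k + 2) (n := k + 1) le_rfl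
          rw [show k + 1 + 1 - (k + 2) = 0 by omega, show k + 1 + 1 - 1 = k + 1 by omega] at key
          rw [hυ, Finset.mul_sum, Finset.range_eq_Ico, ← key]
          refine Finset.sum_congr rfl fun L hL => ?_
          have hL := Finset.mem_Ico.1 hL
          rw [← mul_assoc, ← hprod (L - 1) (by omega) (hunits _ (by omega)),
            show k + 1 - L = k - (L - 1) by omega, show k + 1 - (k - (L - 1)) = L by omega]
          congr 2
          push_cast [hL.1, (by omega : L - 1 ≤ k)]; ring
        linear_combination hF k + h1
      -- A chain of length `L` is multiplied by `L - 1` inverses of norm at most `10 / 9`; this is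
      -- exactly the weight in `hb`, which closes the induction.
      have hυk : ‖υ k‖ ≤ 1 / 10 := by
        refine le_trans ?_ (hb (k + 1) (k + 2))
        refine (norm_sum_le _ _).trans (Finset.sum_le_sum fun L hL => ?_)
        have hL := Finset.mem_Ico.1 hL
        rw [show (k : ℤ) + 1 + 1 - L = k + 2 - L by ring]
        refine (norm_mul_le _ _).trans (mul_le_mul_of_nonneg_right ?_ (norm_nonneg _))
        refine (norm_prod_le_pow _ _ (B := 10 / 9) fun i hi => ?_).trans (by simp)
        have hi := Finset.mem_range.1 hi
        exact hψ1 _ (by omega)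
      have hunit1 : IsUnit (1 + υ k) := by
        have h2 : ‖-υ k‖ < 1 := by rw [norm_neg]; linarith
        simpa using isUnit_one_sub_of_norm_lt_one h2
      have hFk : IsUnit (F (k + 1)) := by rw [hk]; exact hu.mul hunit1
      have hψk : ‖ψ k‖ ≤ 10 / 9 := by
        refine norm_le_of_mul_one_add_eq_one (u := υ k) ?_ hυk
        have := Ring.mul_inverse_cancel _ hFk
        simp only [hψ]
        linear_combination this - Ring.inverse (F (k + 1)) * hk
      refine ⟨hFk, ?_, ?_, ?_⟩ <;> intro i hi <;>
        rcases Nat.lt_succ_iff_lt_or_eq.1 hi with h | rfl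
      exacts [hψ1 i h, hψk, hrec i h, hk, hυ1 i h, hυk]
  have hrec : ∀ i, F (i + 1) = F i * (1 + υ i) := fun i => (main (i + 1)).2.2.1 i (by omega)
  have hψυ : ∀ i, ψ i * (1 + υ i) = 1 := fun i => by
    have := Ring.mul_inverse_cancel _ (main (i + 1)).1
    simp only [hψ]
    linear_combination this - Ring.inverse (F (i + 1)) * hrec i
  -- The factors are extended by the trivial one to nonpositive indices. Chains starting there
  -- vanish by `hH`, so the length may run up to any `N > k`.
  refine ⟨fun k => if 1 ≤ k then υ (k - 1).toNat else 0,
    fun k => if 1 ≤ k then ψ (k - 1).toNat else 1, fun k => ?_, fun k => ?_, fun k => ?_,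
    fun k hk => ?_, fun k => ?_, fun k N hkN => ?_⟩ <;> dsimp only
  · split_ifs
    · exact hψυ _
    · simp
  · split_ifs
    · exact (main (_ + 1)).2.2.2 _ (Nat.lt_succ_self _)
    · norm_num
  · split_ifs
    · exact (main (_ + 1)).2.1 _ (Nat.lt_succ_self _)
    · norm_num
  · rw [if_neg (by omega)]
  · induction k with
    | zero => simpa using hF0
    | succ k ih =>
      rw [Finset.prod_range_succ, ← ih, hrec, if_pos (by omega)]
      simp
  · by_cases hk : 1 ≤ k
    · rw [if_pos hk]
      obtain ⟨m, rfl⟩ : ∃ m : ℕ, k = m + 1 := ⟨(k - 1).toNat, by omega⟩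
      rw [show ((m : ℤ) + 1 - 1).toNat = m by omega, hυ]
      refine Finset.sum_subset_zero_on_sdiff (fun L hL => ?_) (fun L hL => ?_) fun L hL => ?_
      · simp only [Finset.mem_Ico] at *; omega
      · simp only [Finset.mem_sdiff, Finset.mem_Ico] at hL
        rw [hH _ (by omega) _ (by omega), mul_zero]
      · have hL := Finset.mem_Ico.1 hL
        rw [show (m : ℤ) + 1 + 1 - L = m + 2 - L by ring]
        congr 1
        refine Finset.prod_congr rfl fun i hi => ?_
        have hi := Finset.mem_range.1 hi
        rw [if_pos (by omega)]
        congr 1; omega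
    · rw [if_neg hk, eq_comm]
      refine Finset.sum_eq_zero fun L hL => ?_
      have hL := Finset.mem_Ico.1 hL
      rw [hH _ (by omega) _ (by omega), mul_zero]

end Factors

/-! ### Logarithms in the ring of jets -/

/-- Values and (scaled) first derivatives of functions at a point. -/
abbrev Jet := TrivSqZeroExt ℂ ℂ

theorem Jet.norm_fst_le (u : Jet) : ‖u.fst‖ ≤ ‖u‖ := by
  rw [TrivSqZeroExt.norm_def]; linarith [norm_nonneg u.snd]

theorem Jet.norm_snd_le (u : Jet) : ‖u.snd‖ ≤ ‖u‖ := by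
  rw [TrivSqZeroExt.norm_def]; linarith [norm_nonneg u.fst]

/-- `log (1 + u)` in the ring of jets. -/
noncomputable def logJet (u : Jet) : Jet :=
  TrivSqZeroExt.inl (Complex.log (1 + u.fst)) + TrivSqZeroExt.inr (u.snd / (1 + u.fst))

theorem norm_one_add_inv_le {a : ℂ} (ha : ‖a‖ ≤ 1 / 10) : 1 + a ≠ 0 ∧ ‖(1 + a)⁻¹‖ ≤ 10 / 9 := by
  have h : 9 / 10 ≤ ‖1 + a‖ := by
    have := norm_sub_norm_le (1 : ℂ) (-a)
    rw [norm_one, norm_neg, sub_neg_eq_add] at this; linarith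
  refine ⟨fun h0 => by rw [h0, norm_zero] at h; norm_num at h, ?_⟩
  rw [norm_inv, inv_le_comm₀ (by linarith) (by norm_num)]; linarith

/-- The value component is the Taylor remainder of the complex logarithm. The derivative component
is exact, since `log (1 + a) - a + a ^ 2 / 2` has the derivative `a ^ 2 / (1 + a)`. The norm of a
jet is the sum of the two moduli, whose cube contains both bounds. -/
theorem norm_logJet_sub_le₂ {u : Jet} (hu : ‖u‖ ≤ 1 / 10) :
    ‖logJet u - (u - (1 / 2 : ℂ) • u ^ 2)‖ ≤ 2 * ‖u‖ ^ 3 := by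
  have ha : ‖u.fst‖ ≤ 1 / 10 := (Jet.norm_fst_le u).trans hu
  obtain ⟨hne, hinv⟩ := norm_one_add_inv_le ha
  rw [TrivSqZeroExt.norm_def, TrivSqZeroExt.norm_def u]
  have h1 : ‖(logJet u - (u - (1 / 2 : ℂ) • u ^ 2)).fst‖ ≤ ‖u.fst‖ ^ 3 := by
    have h := Complex.norm_log_sub_logTaylor_le 2 (z := u.fst) (by linarith)
    have e : Complex.logTaylor (2 + 1) u.fst = u.fst - (1 / 2 : ℂ) * u.fst ^ 2 := by
      simp [Complex.logTaylor, Finset.sum_range_succ]; ring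
    rw [e] at h
    simp only [logJet, TrivSqZeroExt.fst_sub, TrivSqZeroExt.fst_add, TrivSqZeroExt.fst_inl,
      TrivSqZeroExt.fst_inr, add_zero, TrivSqZeroExt.fst_smul, TrivSqZeroExt.fst_pow, smul_eq_mul]
    refine h.trans ?_
    have : (1 - ‖u.fst‖)⁻¹ ≤ 3 := by rw [inv_le_comm₀ (by linarith) (by norm_num)]; linarith
    have h3 : (0 : ℝ) ≤ ‖u.fst‖ ^ 3 := by positivity
    norm_num; nlinarith
  have h2 : ‖(logJet u - (u - (1 / 2 : ℂ) • u ^ 2)).snd‖ ≤ 10 / 9 * (‖u.snd‖ * ‖u.fst‖ ^ 2) := by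
    have e : (logJet u - (u - (1 / 2 : ℂ) • u ^ 2)).snd
        = (1 + u.fst)⁻¹ * (u.snd * u.fst ^ 2) := by
      simp only [logJet, TrivSqZeroExt.snd_sub, TrivSqZeroExt.snd_add, TrivSqZeroExt.snd_inl,
        TrivSqZeroExt.snd_inr, zero_add, TrivSqZeroExt.snd_smul, pow_two, TrivSqZeroExt.snd_mul,
        smul_eq_mul, MulOpposite.smul_eq_mul_unop, MulOpposite.unop_op]
      field_simp; ring
    rw [e, norm_mul, norm_mul, norm_pow]
    gcongr
  have := norm_nonneg u.fst
  have := norm_nonneg u.snd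
  have : 0 ≤ ‖u.fst‖ * ‖u.snd‖ ^ 2 := by positivity
  have : 0 ≤ ‖u.snd‖ * ‖u.fst‖ ^ 2 := by positivity
  have : 0 ≤ ‖u.snd‖ ^ 3 := by positivity
  have : 0 ≤ ‖u.fst‖ ^ 3 := by positivity
  nlinarith

theorem norm_logJet_sub_le₃ {u : Jet} (hu : ‖u‖ ≤ 1 / 10) :
    ‖logJet u - (u - (1 / 2 : ℂ) • u ^ 2 + (1 / 3 : ℂ) • u ^ 3)‖ ≤ 2 * ‖u‖ ^ 4 := by
  have ha : ‖u.fst‖ ≤ 1 / 10 := (Jet.norm_fst_le u).trans hu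
  obtain ⟨hne, hinv⟩ := norm_one_add_inv_le ha
  rw [TrivSqZeroExt.norm_def, TrivSqZeroExt.norm_def u]
  have h1 : ‖(logJet u - (u - (1 / 2 : ℂ) • u ^ 2 + (1 / 3 : ℂ) • u ^ 3)).fst‖
      ≤ ‖u.fst‖ ^ 4 := by
    have h := Complex.norm_log_sub_logTaylor_le 3 (z := u.fst) (by linarith)
    have e : Complex.logTaylor (3 + 1) u.fst
        = u.fst - (1 / 2 : ℂ) * u.fst ^ 2 + (1 / 3 : ℂ) * u.fst ^ 3 := by
      simp [Complex.logTaylor, Finset.sum_range_succ]; ring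
    rw [e] at h
    simp only [logJet, TrivSqZeroExt.fst_sub, TrivSqZeroExt.fst_add, TrivSqZeroExt.fst_inl,
      TrivSqZeroExt.fst_inr, add_zero, TrivSqZeroExt.fst_smul, TrivSqZeroExt.fst_pow, smul_eq_mul]
    refine h.trans ?_
    have : (1 - ‖u.fst‖)⁻¹ ≤ 3 := by rw [inv_le_comm₀ (by linarith) (by norm_num)]; linarith
    have h3 : (0 : ℝ) ≤ ‖u.fst‖ ^ 4 := by positivity
    norm_num; nlinarith
  have h2 : ‖(logJet u - (u - (1 / 2 : ℂ) • u ^ 2 + (1 / 3 : ℂ) • u ^ 3)).snd‖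
      ≤ 10 / 9 * (‖u.snd‖ * ‖u.fst‖ ^ 3) := by
    have e : (logJet u - (u - (1 / 2 : ℂ) • u ^ 2 + (1 / 3 : ℂ) • u ^ 3)).snd
        = -((1 + u.fst)⁻¹ * (u.snd * u.fst ^ 3)) := by
      simp only [logJet, TrivSqZeroExt.snd_sub, TrivSqZeroExt.snd_add, TrivSqZeroExt.snd_inl,
        TrivSqZeroExt.snd_inr, zero_add, TrivSqZeroExt.snd_smul, pow_succ, pow_zero, one_mul,
        TrivSqZeroExt.snd_mul, TrivSqZeroExt.fst_mul,
        smul_eq_mul, MulOpposite.smul_eq_mul_unop, MulOpposite.unop_op]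
      field_simp; ring
    rw [e, norm_neg, norm_mul, norm_mul, norm_pow]
    gcongr
  have := norm_nonneg u.fst
  have := norm_nonneg u.snd
  have : 0 ≤ ‖u.fst‖ * ‖u.snd‖ ^ 3 := by positivity
  have : 0 ≤ ‖u.fst‖ ^ 2 * ‖u.snd‖ ^ 2 := by positivity
  have : 0 ≤ ‖u.snd‖ * ‖u.fst‖ ^ 3 := by positivity
  have : 0 ≤ ‖u.snd‖ ^ 4 := by positivity
  have : 0 ≤ ‖u.fst‖ ^ 4 := by positivity
  nlinarith

end OneDependent

/-! ### Expansion of the logarithm of a single factor. -/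

namespace OneDependent

section RealEstimates

theorem add_sq_le_four (a b c d : ℝ) :
    (a + b + c + d) ^ 2 ≤ 4 * (a ^ 2 + b ^ 2 + c ^ 2 + d ^ 2) := by
  nlinarith [sq_nonneg (a - b), sq_nonneg (a - c), sq_nonneg (a - d), sq_nonneg (b - c),
    sq_nonneg (b - d), sq_nonneg (c - d)]

/-- Here `e`, `P`, `T` are the sizes of the chains of length one, of length two and longer that end
at an index; the subscript 1 refers to the preceding index. On the left stand the remainder of the
logarithm, the error of the linear term and the error of the square. -/
theorem second_order_real {e e₁ P P₁ T T₁ : ℝ} (he : 0 ≤ e) (he₁ : 0 ≤ e₁) (hP : 0 ≤ P)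
    (hP₁ : 0 ≤ P₁) (hT : 0 ≤ T) (hT₁ : 0 ≤ T₁) (ke : e ≤ 1) (kP : P ≤ 1) (kT : T ≤ 1) :
    2 * (e + 2 * P + T) ^ 3 + (2 * P * (e₁ + 2 * P₁ + T₁) + T)
      + (2 * P + T) * (2 * e + 2 * P + T)
      ≤ 200 * (e ^ 3 + P * (e + e₁ + P + P₁) + T + T₁) := by
  have h1 : (e + 2 * P + T) ^ 3 ≤ 9 * (e ^ 3 + (2 * P) ^ 3 + T ^ 3) := by
    have key : ∀ a b c : ℝ, 0 ≤ a → 0 ≤ b → 0 ≤ c →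
        (a + b + c) ^ 3 ≤ 9 * (a ^ 3 + b ^ 3 + c ^ 3) := by
      intro a b c ha hb hc
      nlinarith [mul_nonneg (add_nonneg ha hb) (sq_nonneg (a - b)),
        mul_nonneg (add_nonneg hb hc) (sq_nonneg (b - c)),
        mul_nonneg (add_nonneg ha hc) (sq_nonneg (a - c)), pow_nonneg ha 3, pow_nonneg hb 3,
        pow_nonneg hc 3, mul_nonneg ha (sq_nonneg (b - c)), mul_nonneg hb (sq_nonneg (a - c)),
        mul_nonneg hc (sq_nonneg (a - b))]
    exact key e (2 * P) T he (by linarith) hT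
  have h2 : P ^ 3 ≤ P * P := by nlinarith [mul_nonneg hP hP]
  have h3 : T ^ 3 ≤ T := by nlinarith [mul_nonneg hT hT, pow_le_one₀ hT kT (n := 2)]
  have h4 : P * T₁ ≤ T₁ := by nlinarith
  have h5 : P * T ≤ T := by nlinarith
  have h6 : T * e ≤ T := by nlinarith
  have h7 : T * T ≤ T := by nlinarith
  have := mul_nonneg hP he
  have := mul_nonneg hP he₁
  have := mul_nonneg hP hP
  have := mul_nonneg hP hP₁
  have := pow_nonneg he 3
  nlinarith

/-- The size of the error of the third order expansion of `log (1 + u)`. -/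
def thirdError (e e₁ e₂ P P₁ P₂ Q Q₁ Q₂ T T₁ T₂ : ℝ) : ℝ :=
  e ^ 4 + e₁ ^ 4 + P ^ 2 + P₁ ^ 2 + Q ^ 2 + Q₁ ^ 2 + Q₂ ^ 2
    + Q * (e + e₁ + e₂ + P + P₁ + P₂) + P * Q₁ + T + T₁ + T₂

variable {e e₁ e₂ P P₁ P₂ Q Q₁ Q₂ T T₁ T₂ : ℝ}

/-- The error of the linear term, with `Q` for chains of length three; the two lemmas after it treat
the square, and the cube with the remainder of the logarithm. Mixed products are separated as in `P
* e₁ ^ 2 ≤ P ^ 2 + e₁ ^ 4`, and whatever contains a tail is absorbed by that tail. -/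
theorem third_order_real₁ (he : 0 ≤ e) (he₁ : 0 ≤ e₁) (he₂ : 0 ≤ e₂) (hP : 0 ≤ P) (hP₁ : 0 ≤ P₁)
    (hP₂ : 0 ≤ P₂) (hQ : 0 ≤ Q) (hQ₁ : 0 ≤ Q₁) (hT : 0 ≤ T) (hT₁ : 0 ≤ T₁)
    (hT₂ : 0 ≤ T₂) (kP : P ≤ 1) (kQ : Q ≤ 1) (kT₁ : T₁ ≤ 1) :
    P * (2 * P₁ + 2 * Q₁ + T₁) + 2 * (P * (e₁ + 2 * P₁ + 2 * Q₁ + T₁) ^ 2)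
      + Q * (2 * (e₁ + 2 * P₁ + 2 * Q₁ + T₁) + 2 * (e₂ + 2 * P₂ + 2 * Q₂ + T₂)) + T
      ≤ 100 * thirdError e e₁ e₂ P P₁ P₂ Q Q₁ Q₂ T T₁ T₂ := by
  have h1 : (e₁ + 2 * P₁ + 2 * Q₁ + T₁) ^ 2
      ≤ 4 * (e₁ ^ 2 + 4 * P₁ ^ 2 + 4 * Q₁ ^ 2 + T₁ ^ 2) := by
    have := add_sq_le_four e₁ (2 * P₁) (2 * Q₁) T₁
    linarith
  have h2 := mul_le_mul_of_nonneg_left h1 hP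
  have h3 : P * e₁ ^ 2 ≤ P ^ 2 + e₁ ^ 4 := by
    nlinarith [sq_nonneg (P - e₁ ^ 2), sq_nonneg P, sq_nonneg (e₁ ^ 2)]
  have h4 : P * P₁ ^ 2 ≤ P₁ ^ 2 := mul_le_of_le_one_left (sq_nonneg _) kP
  have h5 : P * Q₁ ^ 2 ≤ Q₁ ^ 2 := mul_le_of_le_one_left (sq_nonneg _) kP
  have h6 : P * T₁ ≤ T₁ := mul_le_of_le_one_left hT₁ kP
  have h7 : P * T₁ ^ 2 ≤ T₁ := by nlinarith
  have h8 : P * P₁ ≤ P ^ 2 + P₁ ^ 2 := by nlinarith [sq_nonneg (P - P₁), sq_nonneg (P + P₁)]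
  have h9 : Q * Q₁ ≤ Q ^ 2 + Q₁ ^ 2 := by nlinarith [sq_nonneg (Q - Q₁), sq_nonneg (Q + Q₁)]
  have h10 : Q * Q₂ ≤ Q ^ 2 + Q₂ ^ 2 := by nlinarith [sq_nonneg (Q - Q₂), sq_nonneg (Q + Q₂)]
  have h11 : Q * T₁ ≤ T₁ := mul_le_of_le_one_left hT₁ kQ
  have h12 : Q * T₂ ≤ T₂ := mul_le_of_le_one_left hT₂ kQ
  have := mul_nonneg hQ he
  have := mul_nonneg hQ he₁
  have := mul_nonneg hQ he₂
  have := mul_nonneg hQ hP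
  have := mul_nonneg hQ hP₁
  have := mul_nonneg hQ hP₂
  have := mul_nonneg hP hQ₁
  have := pow_nonneg he 4
  have := pow_nonneg he₁ 4
  have := sq_nonneg P
  have := sq_nonneg P₁
  have := sq_nonneg Q
  have := sq_nonneg Q₁
  have := sq_nonneg Q₂
  unfold thirdError
  linarith

theorem third_order_real₂ (he : 0 ≤ e) (he₁ : 0 ≤ e₁) (he₂ : 0 ≤ e₂) (hP : 0 ≤ P) (hP₁ : 0 ≤ P₁)
    (hP₂ : 0 ≤ P₂) (hQ : 0 ≤ Q) (hQ₁ : 0 ≤ Q₁) (hT : 0 ≤ T) (hT₁ : 0 ≤ T₁)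
    (hT₂ : 0 ≤ T₂) (ke : e ≤ 1) (ke₁ : e₁ ≤ 1) (kP : P ≤ 1) (kP₁ : P₁ ≤ 1)
    (kQ₁ : Q₁ ≤ 1) (kT : T ≤ 1) (kT₁ : T₁ ≤ 1) :
    P ^ 2 + (2 * (e + P) + (2 * P * (e₁ + 2 * P₁ + 2 * Q₁ + T₁) + 2 * Q + T))
      * (2 * P * (e₁ + 2 * P₁ + 2 * Q₁ + T₁) + 2 * Q + T)
      ≤ 1000 * thirdError e e₁ e₂ P P₁ P₂ Q Q₁ Q₂ T T₁ T₂ := by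
  set U := e₁ + 2 * P₁ + 2 * Q₁ + T₁ with hU
  have hU0 : 0 ≤ U := by positivity
  have hU6 : U ≤ 6 := by linarith
  have a1 : P * U ≤ 6 * P := by nlinarith
  have a2 : (2 * P * U + 2 * Q + T) ^ 2 ≤ 3 * (144 * P ^ 2 + 4 * Q ^ 2 + T) := by
    have b1 : (2 * P * U) ^ 2 ≤ 144 * P ^ 2 := by
      have := pow_le_pow_left₀ (mul_nonneg hP hU0) a1 2
      linarith [mul_pow 6 P 2]
    have b2 : T ^ 2 ≤ T := by nlinarith
    nlinarith [sq_nonneg (2 * P * U - 2 * Q), sq_nonneg (2 * P * U - T), sq_nonneg (2 * Q - T)]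
  have a3 : e * (P * U) ≤ 2 * P ^ 2 + e ^ 4 + e₁ ^ 4 + 2 * (P ^ 2 + P₁ ^ 2) + 2 * (P * Q₁) + T₁ := by
    have c1 : e * P * e₁ ≤ P ^ 2 + e ^ 4 + e₁ ^ 4 := by
      nlinarith [sq_nonneg (P - e * e₁), sq_nonneg (e ^ 2 - e₁ ^ 2), sq_nonneg (e ^ 2 + e₁ ^ 2),
        sq_nonneg P]
    have c2 : e * (P * P₁) ≤ P ^ 2 + P₁ ^ 2 := by
      nlinarith [mul_le_of_le_one_left (mul_nonneg hP hP₁) ke, sq_nonneg (P - P₁),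
        sq_nonneg (P + P₁)]
    have c3 : e * (P * Q₁) ≤ P * Q₁ := mul_le_of_le_one_left (mul_nonneg hP hQ₁) ke
    have c4 : e * (P * T₁) ≤ T₁ := by
      have := mul_le_of_le_one_left hT₁ kP
      nlinarith [mul_nonneg hP hT₁]
    have c5 : e * (P * U) = e * P * e₁ + 2 * (e * (P * P₁)) + 2 * (e * (P * Q₁)) + e * (P * T₁) := by
      rw [hU]; ring
    have := sq_nonneg P
    linarith
  have a4 : P * (P * U) ≤ 6 * P ^ 2 := by
    have := mul_le_mul_of_nonneg_left a1 hP
    linarith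
  have a5 : e * T ≤ T := mul_le_of_le_one_left hT ke
  have a6 : P * T ≤ T := mul_le_of_le_one_left hT kP
  have := mul_nonneg hQ he
  have := mul_nonneg hQ he₁
  have := mul_nonneg hQ he₂
  have := mul_nonneg hQ hP
  have := mul_nonneg hQ hP₁
  have := mul_nonneg hQ hP₂
  have := mul_nonneg hP hQ₁
  have := pow_nonneg he 4
  have := pow_nonneg he₁ 4
  have := sq_nonneg P
  have := sq_nonneg P₁
  have := sq_nonneg Q
  have := sq_nonneg Q₁
  have := sq_nonneg Q₂
  have key : P ^ 2 + (2 * (e + P) + (2 * P * U + 2 * Q + T)) * (2 * P * U + 2 * Q + T)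
      = P ^ 2 + 2 * (2 * (e * (P * U)) + 2 * (Q * e) + e * T)
        + 2 * (2 * (P * (P * U)) + 2 * (Q * P) + P * T) + (2 * P * U + 2 * Q + T) ^ 2 := by ring
  rw [key]
  unfold thirdError
  linarith

theorem third_order_real₃ (he : 0 ≤ e) (he₁ : 0 ≤ e₁) (he₂ : 0 ≤ e₂) (hP : 0 ≤ P) (hP₁ : 0 ≤ P₁)
    (hP₂ : 0 ≤ P₂) (hQ : 0 ≤ Q) (hQ₁ : 0 ≤ Q₁) (hT : 0 ≤ T) (hT₁ : 0 ≤ T₁)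
    (hT₂ : 0 ≤ T₂) (ke : e ≤ 1) (kP : P ≤ 1) (kQ : Q ≤ 1) (kT : T ≤ 1) :
    (2 * P + 2 * Q + T) * (3 * (e + 2 * P + 2 * Q + T) ^ 2) + 2 * (e + 2 * P + 2 * Q + T) ^ 4
      ≤ 10000 * thirdError e e₁ e₂ P P₁ P₂ Q Q₁ Q₂ T T₁ T₂ := by
  set U := e + 2 * P + 2 * Q + T with hU
  have hU0 : 0 ≤ U := by positivity
  have hU6 : U ≤ 6 := by linarith
  have b2 : T ^ 2 ≤ T := by nlinarith
  have h1 : U ^ 2 ≤ 4 * (e ^ 2 + 4 * P ^ 2 + 4 * Q ^ 2 + T) := by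
    have := add_sq_le_four e (2 * P) (2 * Q) T
    rw [hU]; linarith
  have h2 : P * U ^ 2 ≤ 4 * (P ^ 2 + e ^ 4 + 4 * P ^ 2 + 4 * Q ^ 2 + T) := by
    have c1 : P * e ^ 2 ≤ P ^ 2 + e ^ 4 := by
      nlinarith [sq_nonneg (P - e ^ 2), sq_nonneg P, sq_nonneg (e ^ 2)]
    have c2 : P * P ^ 2 ≤ P ^ 2 := mul_le_of_le_one_left (sq_nonneg _) kP
    have c3 : P * Q ^ 2 ≤ Q ^ 2 := mul_le_of_le_one_left (sq_nonneg _) kP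
    have c4 : P * T ≤ T := mul_le_of_le_one_left hT kP
    have := mul_le_mul_of_nonneg_left h1 hP
    linarith
  have h3 : Q * U ^ 2 ≤ 6 * (Q * e + 2 * (Q * P) + 2 * Q ^ 2 + T) := by
    have c1 : Q * U ^ 2 ≤ 6 * (Q * U) := by nlinarith [mul_nonneg hQ hU0]
    have c4 : Q * T ≤ T := mul_le_of_le_one_left hT kQ
    have c5 : Q * U = Q * e + 2 * (Q * P) + 2 * Q ^ 2 + Q * T := by rw [hU]; ring
    linarith
  have h4 : T * U ^ 2 ≤ 36 * T := by
    have := pow_le_pow_left₀ hU0 hU6 2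
    nlinarith
  have h5 : U ^ 4 ≤ 64 * (e ^ 4 + 16 * P ^ 2 + 16 * Q ^ 2 + T) := by
    have d1 : U ^ 4 ≤ (4 * (e ^ 2 + 4 * P ^ 2 + 4 * Q ^ 2 + T)) ^ 2 := by
      rw [show U ^ 4 = (U ^ 2) ^ 2 by ring]
      exact pow_le_pow_left₀ (by positivity) h1 2
    have d2 : (e ^ 2 + 4 * P ^ 2 + 4 * Q ^ 2 + T) ^ 2
        ≤ 4 * (e ^ 4 + 16 * P ^ 4 + 16 * Q ^ 4 + T ^ 2) := by
      refine (add_sq_le_four _ _ _ _).trans (le_of_eq ?_)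
      ring
    have d3 : P ^ 4 ≤ P ^ 2 := pow_le_pow_of_le_one hP kP (by norm_num)
    have d4 : Q ^ 4 ≤ Q ^ 2 := pow_le_pow_of_le_one hQ kQ (by norm_num)
    linarith
  have := mul_nonneg hQ he
  have := mul_nonneg hQ he₁
  have := mul_nonneg hQ he₂
  have := mul_nonneg hQ hP
  have := mul_nonneg hQ hP₁
  have := mul_nonneg hQ hP₂
  have := mul_nonneg hP hQ₁
  have := pow_nonneg he 4
  have := pow_nonneg he₁ 4
  have := sq_nonneg P
  have := sq_nonneg P₁
  have := sq_nonneg Q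
  have := sq_nonneg Q₁
  have := sq_nonneg Q₂
  have key : (2 * P + 2 * Q + T) * (3 * U ^ 2) + 2 * U ^ 4
      = 6 * (P * U ^ 2) + 6 * (Q * U ^ 2) + 3 * (T * U ^ 2) + 2 * U ^ 4 := by ring
  rw [key]
  unfold thirdError
  linarith

end RealEstimates

section Expansions

theorem norm_add_add_le_of_le {A : Type*} [SeminormedAddCommGroup A] {x y z : A} {a b c : ℝ}
    (hx : ‖x‖ ≤ a) (hy : ‖y‖ ≤ b) (hz : ‖z‖ ≤ c) : ‖x + y + z‖ ≤ a + b + c :=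
  norm_add_le_of_le (norm_add_le_of_le hx hy) hz

theorem norm_mul_le_two {A : Type*} [NormedCommRing A] {x v : A} (hv : ‖v‖ ≤ 10 / 9) :
    ‖x * v‖ ≤ 2 * ‖x‖ :=
  (norm_mul_le _ _).trans (by nlinarith [norm_nonneg x])

theorem norm_mul_mul_le_two {A : Type*} [NormedCommRing A] {x v w : A} (hv : ‖v‖ ≤ 10 / 9)
    (hw : ‖w‖ ≤ 10 / 9) : ‖x * v * w‖ ≤ 2 * ‖x‖ := by
  have h1 := norm_mul_le (x * v) w
  have h2 := norm_mul_le x v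
  have h3 : ‖x‖ * ‖v‖ ≤ ‖x‖ * (10 / 9) := mul_le_mul_of_nonneg_left hv (norm_nonneg _)
  have h4 : ‖x * v‖ * ‖w‖ ≤ (‖x‖ * (10 / 9)) * (10 / 9) :=
    mul_le_mul (h2.trans h3) hw (norm_nonneg _) (by positivity)
  linarith [norm_nonneg x]

/-- Since `v₁ = 1 - u₁ * v₁`, dropping the inverse factor after `P` costs `P * u₁ * v₁`, a product
with the chains ending one index earlier. In the square only `e ^ 2` is kept, the cross term with
`P` being of the order of the error. -/
theorem logJet_second_order {u u₁ v₁ v₂ e e₁ P P₁ T T₁ : Jet} (hv₁ : ‖v₁‖ ≤ 10 / 9)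
    (hv₂ : ‖v₂‖ ≤ 10 / 9) (h₁ : v₁ * (1 + u₁) = 1) (hu : u = e + P * v₁ + T)
    (hu₁ : u₁ = e₁ + P₁ * v₂ + T₁) (hun : ‖u‖ ≤ 1 / 10) (ke : ‖e‖ ≤ 1) (kP : ‖P‖ ≤ 1)
    (kT : ‖T‖ ≤ 1) :
    ‖logJet u - (e + P - (1 / 2 : ℂ) • e ^ 2)‖
      ≤ 200 * (‖e‖ ^ 3 + ‖P‖ * (‖e‖ + ‖e₁‖ + ‖P‖ + ‖P₁‖) + ‖T‖ + ‖T₁‖) := by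
  have hU : ‖u‖ ≤ ‖e‖ + 2 * ‖P‖ + ‖T‖ := by
    rw [hu]; exact norm_add_add_le_of_le le_rfl (norm_mul_le_two hv₁) le_rfl
  have hU₁ : ‖u₁‖ ≤ ‖e₁‖ + 2 * ‖P₁‖ + ‖T₁‖ := by
    rw [hu₁]; exact norm_add_add_le_of_le le_rfl (norm_mul_le_two hv₂) le_rfl
  have h1 : ‖logJet u - (u - (1 / 2 : ℂ) • u ^ 2)‖ ≤ 2 * (‖e‖ + 2 * ‖P‖ + ‖T‖) ^ 3 := by
    refine (norm_logJet_sub_le₂ hun).trans ?_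
    gcongr
  have h2 : ‖u - (e + P)‖ ≤ 2 * ‖P‖ * (‖e₁‖ + 2 * ‖P₁‖ + ‖T₁‖) + ‖T‖ := by
    have e1 : u - (e + P) = -(P * u₁ * v₁) + T := by rw [hu]; linear_combination P * h₁
    rw [e1]
    refine norm_add_le_of_le ?_ le_rfl
    rw [norm_neg]
    refine (norm_mul_le_two hv₁).trans ?_
    have := norm_mul_le P u₁
    have := mul_le_mul_of_nonneg_left hU₁ (norm_nonneg P)
    linarith
  have h3 : ‖u ^ 2 - e ^ 2‖ ≤ (2 * ‖P‖ + ‖T‖) * (2 * ‖e‖ + 2 * ‖P‖ + ‖T‖) := by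
    have e1 : u ^ 2 - e ^ 2 = (P * v₁ + T) * (2 * e + P * v₁ + T) := by rw [hu]; ring
    rw [e1]
    refine (norm_mul_le _ _).trans (mul_le_mul ?_ ?_ (norm_nonneg _) (by positivity))
    · exact norm_add_le_of_le (norm_mul_le_two hv₁) le_rfl
    · refine norm_add_add_le_of_le ?_ (norm_mul_le_two hv₁) le_rfl
      rw [two_mul, two_mul]; exact norm_add_le _ _
  have h4 : ‖(1 / 2 : ℂ) • (u ^ 2 - e ^ 2)‖ ≤ ‖u ^ 2 - e ^ 2‖ := by
    rw [norm_smul]; norm_num; linarith [norm_nonneg (u ^ 2 - e ^ 2)]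
  have e2 : logJet u - (e + P - (1 / 2 : ℂ) • e ^ 2)
      = (logJet u - (u - (1 / 2 : ℂ) • u ^ 2)) + (u - (e + P))
        + -((1 / 2 : ℂ) • (u ^ 2 - e ^ 2)) := by
    rw [smul_sub]; abel
  rw [e2]
  refine le_trans (norm_add_add_le_of_le h1 h2 ((norm_neg _).le.trans (h4.trans h3))) ?_
  exact second_order_real (norm_nonneg _) (norm_nonneg _) (norm_nonneg _) (norm_nonneg _)
    (norm_nonneg _) (norm_nonneg _) ke kP kT

/-- One step further, `v₁ = 1 - u₁ + u₁ ^ 2 * v₁`, so that `P * v₁` contributes the correction `-P *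
e₁`, while `-e * P` is the cross term of `-u ^ 2 / 2`. Both inverse factors after `Q` may be
replaced by 1 at this order. -/
theorem logJet_third_order {u u₁ u₂ v₁ v₂ v₃ v₄ e e₁ e₂ P P₁ P₂ Q Q₁ Q₂ T T₁ T₂ : Jet}
    (hv₁ : ‖v₁‖ ≤ 10 / 9) (hv₂ : ‖v₂‖ ≤ 10 / 9) (hv₃ : ‖v₃‖ ≤ 10 / 9) (hv₄ : ‖v₄‖ ≤ 10 / 9)
    (h₁ : v₁ * (1 + u₁) = 1) (h₂ : v₂ * (1 + u₂) = 1) (hu : u = e + P * v₁ + Q * v₁ * v₂ + T)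
    (hu₁ : u₁ = e₁ + P₁ * v₂ + Q₁ * v₂ * v₃ + T₁) (hu₂ : u₂ = e₂ + P₂ * v₃ + Q₂ * v₃ * v₄ + T₂)
    (hun : ‖u‖ ≤ 1 / 10) (ke : ‖e‖ ≤ 1) (ke₁ : ‖e₁‖ ≤ 1) (kP : ‖P‖ ≤ 1) (kP₁ : ‖P₁‖ ≤ 1)
    (kQ : ‖Q‖ ≤ 1) (kQ₁ : ‖Q₁‖ ≤ 1) (kT : ‖T‖ ≤ 1) (kT₁ : ‖T₁‖ ≤ 1) :
    ‖logJet u - (e + P - P * e₁ + Q - (1 / 2 : ℂ) • e ^ 2 - e * P + (1 / 3 : ℂ) • e ^ 3)‖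
      ≤ 20000 * thirdError ‖e‖ ‖e₁‖ ‖e₂‖ ‖P‖ ‖P₁‖ ‖P₂‖ ‖Q‖ ‖Q₁‖ ‖Q₂‖ ‖T‖ ‖T₁‖ ‖T₂‖ := by
  have hU : ‖u‖ ≤ ‖e‖ + 2 * ‖P‖ + 2 * ‖Q‖ + ‖T‖ := by
    rw [hu]
    exact norm_add_le_of_le (norm_add_add_le_of_le le_rfl (norm_mul_le_two hv₁)
      (norm_mul_mul_le_two hv₁ hv₂)) le_rfl
  have hU₁ : ‖u₁‖ ≤ ‖e₁‖ + 2 * ‖P₁‖ + 2 * ‖Q₁‖ + ‖T₁‖ := by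
    rw [hu₁]
    exact norm_add_le_of_le (norm_add_add_le_of_le le_rfl (norm_mul_le_two hv₂)
      (norm_mul_mul_le_two hv₂ hv₃)) le_rfl
  have hU₂ : ‖u₂‖ ≤ ‖e₂‖ + 2 * ‖P₂‖ + 2 * ‖Q₂‖ + ‖T₂‖ := by
    rw [hu₂]
    exact norm_add_le_of_le (norm_add_add_le_of_le le_rfl (norm_mul_le_two hv₃)
      (norm_mul_mul_le_two hv₃ hv₄)) le_rfl
  have mul_le : ∀ {x y : Jet} {a b : ℝ}, ‖x‖ ≤ a → ‖y‖ ≤ b → ‖x * y‖ ≤ a * b :=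
    fun hx hy => (norm_mul_le _ _).trans
      (mul_le_mul hx hy (norm_nonneg _) ((norm_nonneg _).trans hx))
  set U := ‖e‖ + 2 * ‖P‖ + 2 * ‖Q‖ + ‖T‖ with hUdef
  set U₁ := ‖e₁‖ + 2 * ‖P₁‖ + 2 * ‖Q₁‖ + ‖T₁‖ with hU₁def
  set U₂ := ‖e₂‖ + 2 * ‖P₂‖ + 2 * ‖Q₂‖ + ‖T₂‖ with hU₂def
  have a1 : ‖logJet u - (u - (1 / 2 : ℂ) • u ^ 2 + (1 / 3 : ℂ) • u ^ 3)‖ ≤ 2 * U ^ 4 := by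
    refine (norm_logJet_sub_le₃ hun).trans ?_
    gcongr
  have a2 : ‖u - (e + P - P * e₁ + Q)‖ ≤ ‖P‖ * (2 * ‖P₁‖ + 2 * ‖Q₁‖ + ‖T₁‖)
      + 2 * (‖P‖ * U₁ ^ 2) + ‖Q‖ * (2 * U₁ + 2 * U₂) + ‖T‖ := by
    have e1 : u - (e + P - P * e₁ + Q) = -(P * (P₁ * v₂ + Q₁ * v₂ * v₃ + T₁))
        + P * (u₁ * u₁) * v₁ + -(Q * (u₁ * v₁ * v₂ + u₂ * v₂)) + T := by
      rw [hu]
      linear_combination (P - P * u₁ + Q * v₂) * h₁ + Q * h₂ - P * hu₁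
    rw [e1]
    refine norm_add_le_of_le (norm_add_add_le_of_le ?_ ?_ ?_) le_rfl
    · rw [norm_neg]
      exact mul_le le_rfl (norm_add_add_le_of_le (norm_mul_le_two hv₂)
        (norm_mul_mul_le_two hv₂ hv₃) le_rfl)
    · refine (norm_mul_le_two hv₁).trans ?_
      have := mul_le (le_refl ‖P‖) (mul_le hU₁ hU₁)
      rw [pow_two]; linarith
    · rw [norm_neg]
      refine mul_le le_rfl (norm_add_le_of_le ?_ ?_)
      · exact (norm_mul_mul_le_two hv₁ hv₂).trans (by linarith)
      · exact (norm_mul_le_two hv₂).trans (by linarith)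
  -- `D` bounds `u - e - P`, hence the part of `u ^ 2` not accounted for by `(e + P) ^ 2`.
  set D := 2 * ‖P‖ * U₁ + 2 * ‖Q‖ + ‖T‖ with hD
  have hδ : ‖u - e - P‖ ≤ D := by
    have e1 : u - e - P = -(P * u₁ * v₁) + Q * v₁ * v₂ + T := by
      rw [hu]; linear_combination P * h₁
    rw [e1]
    refine norm_add_add_le_of_le ?_ (norm_mul_mul_le_two hv₁ hv₂) le_rfl
    rw [norm_neg]
    refine (norm_mul_le_two hv₁).trans ?_
    have := mul_le (le_refl ‖P‖) hU₁
    linarith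
  have a3 : ‖u ^ 2 - (e ^ 2 + 2 * (e * P))‖ ≤ ‖P‖ ^ 2 + (2 * (‖e‖ + ‖P‖) + D) * D := by
    have e1 : u ^ 2 - (e ^ 2 + 2 * (e * P))
        = P * P + ((e + P) + (e + P) + (u - e - P)) * (u - e - P) := by ring
    rw [e1, pow_two ‖P‖]
    refine norm_add_le_of_le (norm_mul_le _ _) (mul_le ?_ hδ)
    rw [two_mul]
    exact norm_add_add_le_of_le (norm_add_le _ _) (norm_add_le _ _) hδ
  have heU : ‖e‖ ≤ U := by
    rw [hUdef]; linarith [norm_nonneg P, norm_nonneg Q, norm_nonneg T]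
  have a4 : ‖u ^ 3 - e ^ 3‖ ≤ (2 * ‖P‖ + 2 * ‖Q‖ + ‖T‖) * (3 * U ^ 2) := by
    have e1 : u ^ 3 - e ^ 3 = (u - e) * (u * u + u * e + e * e) := by ring
    rw [e1]
    refine mul_le ?_ ?_
    · rw [show u - e = P * v₁ + Q * v₁ * v₂ + T by rw [hu]; ring]
      exact norm_add_add_le_of_le (norm_mul_le_two hv₁) (norm_mul_mul_le_two hv₁ hv₂) le_rfl
    · have := norm_add_add_le_of_le (mul_le hU hU) (mul_le hU heU) (mul_le heU heU)
      linarith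
  have e2 : logJet u - (e + P - P * e₁ + Q - (1 / 2 : ℂ) • e ^ 2 - e * P + (1 / 3 : ℂ) • e ^ 3)
      = ((logJet u - (u - (1 / 2 : ℂ) • u ^ 2 + (1 / 3 : ℂ) • u ^ 3)) + (u - (e + P - P * e₁ + Q))
        + -((1 / 2 : ℂ) • (u ^ 2 - (e ^ 2 + 2 * (e * P))))) + (1 / 3 : ℂ) • (u ^ 3 - e ^ 3) := by
    have e3 : (1 / 2 : ℂ) • (2 * (e * P)) = e * P := by
      rw [two_mul, ← two_smul ℂ (e * P), smul_smul]; norm_num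
    rw [smul_sub, smul_sub, smul_add, e3]; abel
  rw [e2]
  have a5 : ‖(1 / 2 : ℂ) • (u ^ 2 - (e ^ 2 + 2 * (e * P)))‖
      ≤ ‖P‖ ^ 2 + (2 * (‖e‖ + ‖P‖) + D) * D := by
    rw [norm_smul]; norm_num; linarith [norm_nonneg (u ^ 2 - (e ^ 2 + 2 * (e * P)))]
  have a6 : ‖(1 / 3 : ℂ) • (u ^ 3 - e ^ 3)‖ ≤ (2 * ‖P‖ + 2 * ‖Q‖ + ‖T‖) * (3 * U ^ 2) := by
    rw [norm_smul]; norm_num; linarith [norm_nonneg (u ^ 3 - e ^ 3)]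
  refine le_trans (norm_add_le_of_le (norm_add_add_le_of_le a1 a2 ((norm_neg _).le.trans a5)) a6) ?_
  have r1 := third_order_real₁ (Q₂ := ‖Q₂‖) (norm_nonneg e) (norm_nonneg e₁) (norm_nonneg e₂) (norm_nonneg P)
    (norm_nonneg P₁) (norm_nonneg P₂) (norm_nonneg Q) (norm_nonneg Q₁)
    (norm_nonneg T) (norm_nonneg T₁) (norm_nonneg T₂) kP kQ kT₁
  have r2 := third_order_real₂ (Q₂ := ‖Q₂‖) (norm_nonneg e) (norm_nonneg e₁) (norm_nonneg e₂)
    (norm_nonneg P) (norm_nonneg P₁) (norm_nonneg P₂) (norm_nonneg Q) (norm_nonneg Q₁)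
    (norm_nonneg T) (norm_nonneg T₁) (norm_nonneg T₂) ke ke₁ kP kP₁ kQ₁ kT kT₁
  have r3 := third_order_real₃ (Q₂ := ‖Q₂‖) (norm_nonneg e) (norm_nonneg e₁) (norm_nonneg e₂)
    (norm_nonneg P) (norm_nonneg P₁) (norm_nonneg P₂) (norm_nonneg Q) (norm_nonneg Q₁)
    (norm_nonneg T) (norm_nonneg T₁) (norm_nonneg T₂) ke kP kQ kT
  have r4 : 0 ≤ thirdError ‖e‖ ‖e₁‖ ‖e₂‖ ‖P‖ ‖P₁‖ ‖P₂‖ ‖Q‖ ‖Q₁‖ ‖Q₂‖ ‖T‖ ‖T₁‖ ‖T₂‖ := by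
    unfold thirdError; positivity
  linarith

end Expansions

end OneDependent

/-! ### Moments of chains of 1-dependent variables. -/

namespace OneDependent

section Blocks

variable {Ω : Type*}

/-- The product of `φ i (x i)` over a chain. -/
def block {A : Type*} [CommMonoid A] (x : ℤ → Ω → ℕ) (φ : ℤ → ℕ → A) (j : ℤ) (L : ℕ) : Ω → A :=
  fun ω => ∏ i ∈ Finset.range L, φ (j + i) (x (j + i) ω)

section Algebra

variable {A : Type*} [CommMonoid A] (x : ℤ → Ω → ℕ) (φ ψ : ℤ → ℕ → A)

@[simp] theorem block_zero (j : ℤ) (ω : Ω) : block x φ j 0 ω = 1 := by simp [block]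

@[simp] theorem block_one (j : ℤ) (ω : Ω) : block x φ j 1 ω = φ j (x j ω) := by simp [block]

theorem block_add (j : ℤ) (a b : ℕ) (ω : Ω) :
    block x φ j (a + b) ω = block x φ j a ω * block x φ (j + a) b ω := by
  simp only [block, Finset.prod_range_add, Nat.cast_add, add_assoc]

theorem block_congr {j : ℤ} {L : ℕ} (h : ∀ i < L, φ (j + i) = ψ (j + i)) :
    block x φ j L = block x ψ j L := by
  funext ω
  exact Finset.prod_congr rfl fun i hi => by rw [h i (Finset.mem_range.1 hi)]

end Algebra

variable [mΩ : MeasurableSpace Ω]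

/-- A sequence of `1`-dependent variables with small means and finite fourth moments, vanishing
up to the index `0`. -/
structure OneDepSeq (P : Measure Ω) (x : ℤ → Ω → ℕ) : Prop where
  meas : ∀ i, Measurable (x i)
  indep : ∀ s t : ℤ, s + 1 < t → Indep (⨆ i ∈ Set.Iic s, MeasurableSpace.comap (x i) ⊤)
    (⨆ i ∈ Set.Ici t, MeasurableSpace.comap (x i) ⊤) P
  zero : ∀ i ≤ 0, ∀ ω, x i ω = 0
  fourth : ∀ i, Integrable (fun ω => (x i ω : ℝ) ^ 4) P
  mean : ∀ i, ∫ ω, (x i ω : ℝ) ∂P ≤ 1 / 100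

section Measurability

variable {A : Type*} [NormedCommRing A] {x : ℤ → Ω → ℕ}

omit mΩ in
theorem stronglyMeasurable_block (φ : ℤ → ℕ → A) {S : Set ℤ} {j : ℤ} {L : ℕ}
    (h : ∀ i < L, j + (i : ℕ) ∈ S) :
    StronglyMeasurable[⨆ i ∈ S, MeasurableSpace.comap (x i) ⊤] (block x φ j L) := by
  refine Finset.stronglyMeasurable_fun_prod _ fun i hi => ?_
  have h1 : StronglyMeasurable (φ (j + i)) := StronglyMeasurable.of_discrete
  refine h1.comp_measurable ?_
  refine Measurable.mono (comap_measurable (x (j + i))) ?_ le_rfl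
  exact le_iSup₂_of_le (j + i) (h i (Finset.mem_range.1 hi)) le_rfl

variable {P : Measure Ω} (hx : OneDepSeq P x)
include hx

theorem OneDepSeq.iSup_comap_le (S : Set ℤ) :
    ⨆ i ∈ S, MeasurableSpace.comap (x i) ⊤ ≤ mΩ :=
  iSup₂_le fun i _ => (hx.meas i).comap_le

theorem OneDepSeq.stronglyMeasurable_block (φ : ℤ → ℕ → A) (j : ℤ) (L : ℕ) :
    StronglyMeasurable (block x φ j L) :=
  (OneDependent.stronglyMeasurable_block (S := Set.univ) φ fun _ _ => trivial).mono
    (hx.iSup_comap_le _)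

/-- The chains are separated by at least the index `j + a`, and a gap of one index is what
1-dependence needs. -/
theorem OneDepSeq.integral_mul [NormedAlgebra ℝ A] [CompleteSpace A] {φ ψ : ℤ → ℕ → A} {j l : ℤ}
    {a b : ℕ} (hjl : j + a + 1 ≤ l) (hφ : Integrable (block x φ j a) P)
    (hψ : Integrable (block x ψ l b) P) :
    ∫ ω, block x φ j a ω * block x ψ l b ω ∂P
      = (∫ ω, block x φ j a ω ∂P) * ∫ ω, block x ψ l b ω ∂P := by
  borelize A
  have hind := hx.indep (j + a - 1) l (by omega)
  have h1 := OneDependent.stronglyMeasurable_block (x := x) φ (S := Set.Iic (j + a - 1)) (j := j)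
    (L := a) fun i hi => by simp only [Set.mem_Iic]; omega
  have h2 := OneDependent.stronglyMeasurable_block (x := x) ψ (S := Set.Ici l) (j := l)
    (L := b) fun i hi => by simp only [Set.mem_Ici]; omega
  have h3 : IndepFun (block x φ j a) (block x ψ l b) P := by
    rw [IndepFun_iff_Indep]
    exact indep_of_indep_of_le_right (indep_of_indep_of_le_left hind h1.measurable.comap_le)
      h2.measurable.comap_le
  exact h3.integral_bilin hφ hψ (ContinuousLinearMap.mul ℝ A)

end Measurability

section Integrability

variable {P : Measure Ω} {x : ℤ → Ω → ℕ}

/-- Fourth moments suffice for up to four unbounded entries, whatever their dependence: the product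
is at most the fourth power of its largest factor. -/
theorem prod_one_add_le (W : Finset ℤ) (hW : W.card ≤ 4) (f : ℤ → ℕ) :
    ∏ i ∈ W, (1 + (f i : ℝ)) ≤ 1 + ∑ i ∈ W, (1 + (f i : ℝ)) ^ 4 := by
  rcases W.eq_empty_or_nonempty with rfl | hne
  · simp
  obtain ⟨m, hm, hmax⟩ := W.exists_max_image f hne
  have h1 : ∏ i ∈ W, (1 + (f i : ℝ)) ≤ (1 + (f m : ℝ)) ^ W.card := by
    refine (Finset.prod_le_prod (fun i _ => by positivity) (g := fun _ => 1 + (f m : ℝ))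
      fun i hi => ?_).trans (by simp)
    have : (f i : ℝ) ≤ f m := by exact_mod_cast hmax i hi
    linarith
  have h2 : (1 + (f m : ℝ)) ^ W.card ≤ (1 + (f m : ℝ)) ^ 4 :=
    pow_le_pow_right₀ (by linarith [(Nat.cast_nonneg (f m) : (0 : ℝ) ≤ f m)]) hW
  have h3 : (1 + (f m : ℝ)) ^ 4 ≤ ∑ i ∈ W, (1 + (f i : ℝ)) ^ 4 :=
    Finset.single_le_sum (f := fun i => (1 + (f i : ℝ)) ^ 4) (fun i _ => by positivity) hm
  linarith

omit mΩ in
-- Only the entries with index in `W` may be unbounded. Indices of `W` outside the chain can be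
-- added freely, because their factors are at least 1; this makes the bound uniform in the chain.
theorem abs_block_le {g : ℤ → ℕ → ℝ} {W : Finset ℤ} {B : ℝ} (hB : 1 ≤ B)
    (h1 : ∀ i ∉ W, ∀ m, |g i m| ≤ B) (h2 : ∀ i ∈ W, ∀ m : ℕ, |g i m| ≤ B * (1 + m)) (j : ℤ) (L : ℕ)
    (ω : Ω) : |block x g j L ω| ≤ B ^ L * ∏ i ∈ W, (1 + (x i ω : ℝ)) := by
  have one_le : ∀ i : ℤ, (1 : ℝ) ≤ if i ∈ W then 1 + (x i ω : ℝ) else 1 := fun i => by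
    split_ifs
    · linarith [(Nat.cast_nonneg (x i ω) : (0 : ℝ) ≤ x i ω)]
    · exact le_rfl
  rw [block, Finset.abs_prod]
  calc ∏ i ∈ Finset.range L, |g (j + i) (x (j + i) ω)|
      ≤ ∏ i ∈ Finset.range L, (B * if j + (i : ℤ) ∈ W then 1 + (x (j + i) ω : ℝ) else 1) := by
        refine Finset.prod_le_prod (fun i _ => abs_nonneg _) fun i _ => ?_
        split_ifs with h
        · exact h2 _ h _
        · rw [mul_one]; exact h1 _ h _
    _ = B ^ L * ∏ i ∈ (Finset.range L).image (fun i : ℕ => j + (i : ℤ)),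
          (if i ∈ W then 1 + (x i ω : ℝ) else 1) := by
        rw [Finset.prod_mul_distrib, Finset.prod_image (by intro a _ b _ h; simpa using h)]
        simp
    _ ≤ B ^ L * ∏ i ∈ (Finset.range L).image (fun i : ℕ => j + (i : ℤ)) ∪ W,
          (if i ∈ W then 1 + (x i ω : ℝ) else 1) := by
        refine mul_le_mul_of_nonneg_left ?_ (by positivity)
        rw [← Finset.prod_sdiff (Finset.subset_union_left (s₂ := W))]
        refine le_mul_of_one_le_left (Finset.prod_nonneg fun i _ => zero_le_one.trans (one_le i)) ?_
        exact (Finset.prod_const_one (ι := ℤ)).symm.le.trans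
          (Finset.prod_le_prod (fun _ _ => zero_le_one) fun i _ => one_le i)
    _ = B ^ L * ∏ i ∈ W, (1 + (x i ω : ℝ)) := by
        congr 1
        rw [← Finset.prod_subset Finset.subset_union_right (fun i _ hi => if_neg hi)]
        exact Finset.prod_congr rfl fun i hi => if_pos hi

variable [IsProbabilityMeasure P] (hx : OneDepSeq P x)
include hx

theorem OneDepSeq.integrable_one_add_pow (i : ℤ) :
    Integrable (fun ω => (1 + (x i ω : ℝ)) ^ 4) P := by
  have h : Integrable (fun ω => 8 + 8 * (x i ω : ℝ) ^ 4) P :=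
    (integrable_const _).add ((hx.fourth i).const_mul 8)
  refine h.mono' ?_ (Filter.Eventually.of_forall fun ω => ?_)
  · exact ((measurable_from_top (f := fun m : ℕ => (1 + (m : ℝ)) ^ 4)).comp
      (hx.meas i)).aestronglyMeasurable
  · have : (0 : ℝ) ≤ x i ω := Nat.cast_nonneg _
    rw [Real.norm_of_nonneg (by positivity)]
    nlinarith [sq_nonneg ((x i ω : ℝ) ^ 2 - 1), sq_nonneg ((x i ω : ℝ) - 1), mul_nonneg this
      (sq_nonneg ((x i ω : ℝ) - 1)), sq_nonneg ((x i ω : ℝ) * (x i ω - 1))]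

theorem OneDepSeq.integrable_prod_one_add (W : Finset ℤ) (hW : W.card ≤ 4) :
    Integrable (fun ω => ∏ i ∈ W, (1 + (x i ω : ℝ))) P := by
  have h : Integrable (fun ω => 1 + ∑ i ∈ W, (1 + (x i ω : ℝ)) ^ 4) P :=
    (integrable_const _).add (integrable_finsetSum _ fun i _ => hx.integrable_one_add_pow i)
  refine h.mono' ?_ (Filter.Eventually.of_forall fun ω => ?_)
  · refine Measurable.aestronglyMeasurable ?_
    exact Finset.measurable_fun_prod _ fun i _ =>
      (measurable_from_top (f := fun m : ℕ => 1 + (m : ℝ))).comp (hx.meas i)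
  · rw [Real.norm_of_nonneg (Finset.prod_nonneg fun i _ => by positivity)]
    exact prod_one_add_le W hW fun i => x i ω

theorem OneDepSeq.integrable_block {g : ℤ → ℕ → ℝ} {W : Finset ℤ} (hW : W.card ≤ 4) {B : ℝ}
    (hB : 1 ≤ B) (h1 : ∀ i ∉ W, ∀ m, |g i m| ≤ B)
    (h2 : ∀ i ∈ W, ∀ m : ℕ, |g i m| ≤ B * (1 + m)) (j : ℤ) (L : ℕ) :
    Integrable (block x g j L) P :=
  ((hx.integrable_prod_one_add W hW).const_mul (B ^ L)).mono'
    (hx.stronglyMeasurable_block g j L).aestronglyMeasurable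
    (Filter.Eventually.of_forall fun ω => abs_block_le hB h1 h2 j L ω)

end Integrability

section Jets

/-- Replaces the entry of index `p` of a family. -/
def mark {α : Type*} (g h : ℤ → α) (p : ℤ) : ℤ → α := fun i => if i = p then h i else g i

omit mΩ in
theorem fst_block (x : ℤ → Ω → ℕ) (φ : ℤ → ℕ → Jet) (j : ℤ) (L : ℕ) (ω : Ω) :
    (block x φ j L ω).fst = block x (fun i m => (φ i m).fst) j L ω := by
  induction L with
  | zero => simp
  | succ L ih => rw [block_add, TrivSqZeroExt.fst_mul, ih, block_one, ← block_one x
      (fun i m => (φ i m).fst), ← block_add]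

omit mΩ in
theorem block_mark_eq {A : Type*} [CommMonoid A] (x : ℤ → Ω → ℕ) (g h : ℤ → ℕ → A) {p j : ℤ}
    {L : ℕ} (hp : p < j ∨ j + (L : ℕ) ≤ p) : block x (mark g h p) j L = block x g j L := by
  refine block_congr _ _ _ fun i hi => ?_
  rw [mark, if_neg (by omega)]

omit mΩ in
theorem norm_fst_block (x : ℤ → Ω → ℕ) (φ : ℤ → ℕ → Jet) (j : ℤ) (L : ℕ) (ω : Ω) :
    ‖(block x φ j L ω).fst‖ = block x (fun i m => ‖(φ i m).fst‖) j L ω := by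
  rw [fst_block]; simp [block]

omit mΩ in
-- The product rule: the derivative falls on exactly one entry, the marked one, and all others keep
-- their values.
theorem norm_snd_block_le (x : ℤ → Ω → ℕ) (φ : ℤ → ℕ → Jet) (j : ℤ) (L : ℕ) (ω : Ω) :
    ‖(block x φ j L ω).snd‖ ≤ ∑ p ∈ Finset.range L, block x
      (mark (fun i m => ‖(φ i m).fst‖) (fun i m => ‖(φ i m).snd‖) (j + p)) j L ω := by
  induction L with
  | zero => simp [block]
  | succ L ih =>
    rw [block_add, block_one, TrivSqZeroExt.snd_mul, Finset.sum_range_succ, add_comm]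
    simp only [smul_eq_mul, MulOpposite.smul_eq_mul_unop, MulOpposite.unop_op]
    refine norm_add_le_of_le ?_ ?_ <;> rw [norm_mul]
    · refine (mul_le_mul_of_nonneg_right ih (norm_nonneg _)).trans (le_of_eq ?_)
      rw [Finset.sum_mul]
      refine Finset.sum_congr rfl fun p hp => ?_
      have hp := Finset.mem_range.1 hp
      rw [block_add _ _ j L 1, block_one, mark, if_neg (by omega)]
    · rw [block_add _ _ j L 1, block_mark_eq _ _ _ (Or.inr le_rfl), block_one, mark, if_pos rfl,
        norm_fst_block]

variable {P : Measure Ω} {x : ℤ → Ω → ℕ} [IsProbabilityMeasure P] (hx : OneDepSeq P x)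
include hx

theorem OneDepSeq.integrable_block_jet {φ : ℤ → ℕ → Jet} {B : ℝ} (hB : 1 ≤ B)
    (h1 : ∀ i m, ‖(φ i m).fst‖ ≤ B) (h2 : ∀ i (m : ℕ), ‖(φ i m).snd‖ ≤ B * (1 + m)) (j : ℤ)
    (L : ℕ) : Integrable (block x φ j L) P := by
  have hB' : ∀ m : ℕ, B ≤ B * (1 + m) := fun m => by
    have : (0 : ℝ) ≤ m := Nat.cast_nonneg _
    nlinarith
  have h3 : Integrable (fun ω => block x (fun i m => ‖(φ i m).fst‖) j L ω
      + ∑ p ∈ Finset.range L, block x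
        (mark (fun i m => ‖(φ i m).fst‖) (fun i m => ‖(φ i m).snd‖) (j + p)) j L ω) P := by
    refine (hx.integrable_block (W := ∅) (by simp) hB (fun i _ m => ?_) (by simp) j L).add
      (integrable_finsetSum _ fun p _ => hx.integrable_block (W := {j + (p : ℤ)}) (by simp) hB
        (fun i hi m => ?_) (fun i hi m => ?_) j L)
    · rw [abs_norm]; exact h1 i m
    · rw [mark, if_neg (by simpa using hi), abs_norm]; exact h1 i m
    · rw [mark, if_pos (by simpa using hi), abs_norm]; exact h2 i m
  refine h3.mono' (hx.stronglyMeasurable_block φ j L).aestronglyMeasurable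
    (Filter.Eventually.of_forall fun ω => ?_)
  rw [TrivSqZeroExt.norm_def]
  exact add_le_add (norm_fst_block x φ j L ω).le (norm_snd_block_le x φ j L ω)

/-- The recurrence for the jets of the characteristic functions of the partial sums. -/
theorem OneDepSeq.jet_recurrence {φ : ℤ → ℕ → Jet} {B : ℝ} (hB : 1 ≤ B)
    (h1 : ∀ i m, ‖(φ i m).fst‖ ≤ B) (h2 : ∀ i (m : ℕ), ‖(φ i m).snd‖ ≤ B * (1 + m)) (k : ℕ) :
    (∫ ω, block x (fun i m => 1 + φ i m) 1 (k + 1) ω ∂P)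
        - ∫ ω, block x (fun i m => 1 + φ i m) 1 k ω ∂P
      = ∑ j ∈ Finset.range (k + 1), (∫ ω, block x (fun i m => 1 + φ i m) 1 (j - 1) ω ∂P)
          * ∫ ω, block x φ (j + 1) (k + 1 - j) ω ∂P := by
  have hφ := hx.integrable_block_jet hB h1 h2
  have hB2 : ∀ i (m : ℕ), ‖(1 + φ i m).fst‖ ≤ 1 + B := fun i m => by
    rw [TrivSqZeroExt.fst_add, TrivSqZeroExt.fst_one]
    exact norm_add_le_of_le (by simp) (h1 i m)
  have hB3 : ∀ i (m : ℕ), ‖(1 + φ i m).snd‖ ≤ (1 + B) * (1 + m) := fun i m => by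
    rw [TrivSqZeroExt.snd_add, TrivSqZeroExt.snd_one, zero_add]
    have : (0 : ℝ) ≤ m := Nat.cast_nonneg _
    linarith [h2 i m]
  have hψ := hx.integrable_block_jet (by linarith) hB2 hB3
  set ψ : ℤ → ℕ → Jet := fun i m => 1 + φ i m with hψdef
  -- The product of the two blocks is a single block of a family that switches from `ψ` to `φ` after
  -- the index `a`.
  have mixed : ∀ a b : ℕ, Integrable (fun ω => block x ψ 1 a ω * block x φ (1 + a) b ω) P := by
    intro a b
    have h := hx.integrable_block_jet (φ := fun i m => if i ≤ a then ψ i m else φ i m)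
      (B := 1 + B) (by linarith) (fun i m => by
        split_ifs
        · exact hB2 i m
        · linarith [h1 i m]) (fun i m => by
        have : (0 : ℝ) ≤ m := Nat.cast_nonneg _
        split_ifs
        · exact hB3 i m
        · linarith [h2 i m]) 1 (a + b)
    refine h.congr (Filter.Eventually.of_forall fun ω => ?_)
    dsimp only
    rw [block_add]
    rw [block_congr x _ ψ (j := 1) (L := a) fun i hi => ?_,
      block_congr x _ φ (j := 1 + a) (L := b) fun i hi => ?_]
    · funext m; rw [if_neg (by omega)]
    · funext m; rw [if_pos (by omega)]
  -- The entry `1 + φ` at the index `m + 1` is split into its two summands. The summand `φ`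
  -- lengthens the chain on the right; the summand 1 leaves a gap at `m + 1`, over which the
  -- expectation factors. For `j = 0` truncated subtraction gives the empty product.
  have step : ∀ m ≤ k, ∫ ω, block x ψ 1 m ω * block x φ (1 + m) (k + 1 - m) ω ∂P
      = ∑ j ∈ Finset.range (m + 1), (∫ ω, block x ψ 1 (j - 1) ω ∂P)
          * ∫ ω, block x φ (j + 1) (k + 1 - j) ω ∂P := by
    intro m hm
    induction m with
    | zero => simp
    | succ m ih =>
      rw [Finset.sum_range_succ, ← ih (by omega)]
      have e : ∀ ω, block x ψ 1 (m + 1) ω * block x φ (1 + (m + 1 : ℕ)) (k + 1 - (m + 1)) ω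
          = block x ψ 1 m ω * block x φ (1 + m) (k + 1 - m) ω
            + block x ψ 1 m ω * block x φ ((m + 1 : ℕ) + 1) (k + 1 - (m + 1)) ω := by
        intro ω
        rw [show k + 1 - m = 1 + (k + 1 - (m + 1)) by omega, block_add x φ, block_add x ψ,
          block_one, block_one, hψdef, show ((m + 1 : ℕ) : ℤ) + 1 = 1 + m + (1 : ℕ) by
            push_cast; ring, show (1 : ℤ) + ((m + 1 : ℕ) : ℤ) = 1 + m + (1 : ℕ) by push_cast; ring]
        ring
      have hi2 : Integrable (fun ω => block x ψ 1 m ω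
          * block x φ ((m + 1 : ℕ) + 1) (k + 1 - (m + 1)) ω) P := by
        have h := (mixed (m + 1) (k + 1 - (m + 1))).sub (mixed m (k + 1 - m))
        refine h.congr (Filter.Eventually.of_forall fun ω => ?_)
        simp only [Pi.sub_apply, e ω]; ring
      rw [integral_congr_ae (Filter.Eventually.of_forall e), integral_add (mixed m _) hi2,
        Nat.add_sub_cancel]
      congr 1
      exact hx.integral_mul (by push_cast; omega) (hψ _ _) (hφ _ _)
  rw [← step k le_rfl, ← integral_sub (hψ _ _) (hψ _ _)]
  refine integral_congr_ae (Filter.Eventually.of_forall fun ω => ?_)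
  simp only [Nat.add_sub_cancel_left, block_one, block_add x ψ 1 k 1]
  rw [hψdef]; ring

end Jets

end Blocks

end OneDependent

/-! ### Chain sums of jets and their majorants. -/

namespace OneDependent

section JetChains

/-- The triangle inequality turns the signed recursion into the positive one. -/
theorem norm_fst_hatChain_le {c : ℤ → ℕ → Jet} {d : ℤ → ℕ → ℝ}
    (h : ∀ j L, ‖(c j L).fst‖ ≤ d j L) (j : ℤ) (L : ℕ) :
    ‖(hatChain c j L).fst‖ ≤ plusChain d j L := by
  induction L using Nat.strong_induction_on with
  | _ L ih =>
    rcases Nat.eq_zero_or_pos L with rfl | hL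
    · simp
    rw [hatChain_of_pos c j hL, plusChain_of_pos d j hL, TrivSqZeroExt.fst_neg, norm_neg,
      TrivSqZeroExt.fst_sum]
    refine (norm_sum_le _ _).trans (Finset.sum_le_sum fun i hi => ?_)
    have h1 := ih i (Finset.mem_range.1 hi)
    rw [TrivSqZeroExt.fst_mul, norm_mul]
    exact mul_le_mul h1 (h _ _) (norm_nonneg _) ((norm_nonneg _).trans h1)

/-- The product rule for chain sums. The derivative hits either the earlier chain sum or the last
moment. A mark outside the indices of a moment leaves that moment unchanged, by `h₃`, so both
contributions belong to the one positive chain sum marked at `p`. -/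
theorem norm_snd_hatChain_le {c : ℤ → ℕ → Jet} {d : ℤ → ℕ → ℝ} {e : ℤ → ℤ → ℕ → ℝ} {κ : ℝ}
    (hκ : 0 ≤ κ) (he : ∀ p j L, 0 ≤ e p j L) (h₁ : ∀ j L, ‖(c j L).fst‖ ≤ d j L)
    (h₂ : ∀ j L, ‖(c j L).snd‖ ≤ κ * ∑ p ∈ Finset.range L, e (j + p) j L)
    (h₃ : ∀ (p j : ℤ) (L : ℕ), p < j ∨ j + L ≤ p → e p j L = d j L) (j : ℤ) (L : ℕ) :
    ‖(hatChain c j L).snd‖ ≤ κ * ∑ p ∈ Finset.range L, plusChain (e (j + p)) j L := by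
  have hd : ∀ j L, 0 ≤ d j L := fun j L => (norm_nonneg _).trans (h₁ j L)
  induction L using Nat.strong_induction_on with
  | _ L ih =>
    rcases Nat.eq_zero_or_pos L with rfl | hL
    · simp
    have e1 : ∑ p ∈ Finset.range L, plusChain (e (j + p)) j L
        = ∑ i ∈ Finset.range L, ∑ p ∈ Finset.range L,
          plusChain (e (j + p)) j i * e (j + p) (j + i) (L - i) := by
      rw [Finset.sum_comm]
      exact Finset.sum_congr rfl fun p _ => plusChain_of_pos _ _ hL
    rw [e1, hatChain_of_pos c j hL, TrivSqZeroExt.snd_neg, norm_neg, TrivSqZeroExt.snd_sum,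
      Finset.mul_sum]
    refine (norm_sum_le _ _).trans (Finset.sum_le_sum fun i hi => ?_)
    have hi := Finset.mem_range.1 hi
    obtain ⟨b, hb⟩ : ∃ b, L = i + b := ⟨L - i, by omega⟩
    have e2 : ∑ p ∈ Finset.range L, plusChain (e (j + p)) j i * e (j + p) (j + i) (L - i)
        = (∑ p ∈ Finset.range i, plusChain (e (j + p)) j i) * d (j + i) (L - i)
          + plusChain d j i * ∑ p ∈ Finset.range (L - i), e (j + i + p) (j + i) (L - i) := by
      rw [hb, Nat.add_sub_cancel_left, Finset.sum_range_add, Finset.sum_mul, Finset.mul_sum]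
      congr 1
      · refine Finset.sum_congr rfl fun p hp => ?_
        have hp := Finset.mem_range.1 hp
        rw [h₃ (j + p) (j + i) b (Or.inl (by omega))]
      · refine Finset.sum_congr rfl fun p hp => ?_
        rw [plusChain_congr (c' := d) fun a M _ haM => h₃ _ _ _ (Or.inr (by push_cast; omega))]
        push_cast; rw [add_assoc]
    rw [e2, TrivSqZeroExt.snd_mul, add_comm, mul_add]
    simp only [smul_eq_mul, MulOpposite.smul_eq_mul_unop, MulOpposite.unop_op]
    refine norm_add_le_of_le ?_ ?_ <;> rw [norm_mul]
    · rw [← mul_assoc]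
      refine mul_le_mul (ih i hi) (h₁ _ _) (norm_nonneg _) (mul_nonneg hκ ?_)
      exact Finset.sum_nonneg fun p _ => plusChain_nonneg (he _) _ _
    · rw [mul_left_comm]
      exact mul_le_mul (norm_fst_hatChain_le h₁ j i) (h₂ _ _) (norm_nonneg _)
        (plusChain_nonneg hd _ _)

end JetChains

section Moments

variable {Ω : Type*} [mΩ : MeasurableSpace Ω]

/-- The moment of a chain. -/
noncomputable def chainMoment {A : Type*} [NormedCommRing A] [NormedSpace ℝ A] (P : Measure Ω)
    (x : ℤ → Ω → ℕ) (φ : ℤ → ℕ → A) (j : ℤ) (L : ℕ) : A := ∫ ω, block x φ j L ω ∂P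

/-- Equals `h` on the window `[a, a + q)` and `y` elsewhere. -/
def window (y h : ℕ → ℝ) (a : ℤ) (q : ℕ) : ℤ → ℕ → ℝ :=
  fun i => if a ≤ i ∧ i < a + q then h else y

/-- A bounded function of size at most `w m` and at most `2`. -/
structure IsDamped (w : ℝ) (y : ℕ → ℝ) : Prop where
  nonneg : ∀ m, 0 ≤ y m
  le_two : ∀ m, y m ≤ 2
  le_mul : ∀ m : ℕ, y m ≤ w * m
  pos : 0 ≤ w
  w_le : w ≤ 2

omit mΩ in
theorem block_nonneg {x : ℤ → Ω → ℕ} {g : ℤ → ℕ → ℝ} (hg : ∀ i m, 0 ≤ g i m) (j : ℤ) (L : ℕ)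
    (ω : Ω) : 0 ≤ block x g j L ω := Finset.prod_nonneg fun _ _ => hg _ _

omit mΩ in
theorem block_le_block {x : ℤ → Ω → ℕ} {g g' : ℤ → ℕ → ℝ} {j : ℤ} {L : ℕ}
    (hg : ∀ i m, 0 ≤ g i m) (h : ∀ i < L, ∀ m, g (j + i) m ≤ g' (j + i) m) (ω : Ω) :
    block x g j L ω ≤ block x g' j L ω :=
  Finset.prod_le_prod (fun _ _ => hg _ _) fun i hi => h i (Finset.mem_range.1 hi) _

variable {P : Measure Ω} {x : ℤ → Ω → ℕ}

theorem chainMoment_nonneg {g : ℤ → ℕ → ℝ} (hg : ∀ i m, 0 ≤ g i m) (j : ℤ) (L : ℕ) :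
    0 ≤ chainMoment P x g j L := integral_nonneg fun _ => block_nonneg hg _ _ _

theorem chainMoment_congr {A : Type*} [NormedCommRing A] [NormedSpace ℝ A] {g g' : ℤ → ℕ → A}
    {j : ℤ} {L : ℕ} (h : ∀ i < L, g (j + i) = g' (j + i)) :
    chainMoment P x g j L = chainMoment P x g' j L := by
  rw [chainMoment, block_congr x g g' h, ← chainMoment]

variable [IsProbabilityMeasure P]

theorem chainMoment_zero {A : Type*} [NormedCommRing A] [NormedSpace ℝ A] [CompleteSpace A]
    (φ : ℤ → ℕ → A) (j : ℤ) : chainMoment P x φ j 0 = 1 := by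
  simp [chainMoment]

omit [IsProbabilityMeasure P] in
theorem chainMoment_mono {g g' : ℤ → ℕ → ℝ} {j : ℤ} {L : ℕ} (hg : ∀ i m, 0 ≤ g i m)
    (h : ∀ i < L, ∀ m, g (j + i) m ≤ g' (j + i) m) (hi : Integrable (block x g' j L) P) :
    chainMoment P x g j L ≤ chainMoment P x g' j L :=
  integral_mono_of_nonneg (Filter.Eventually.of_forall fun ω => block_nonneg hg j L ω) hi
    (Filter.Eventually.of_forall fun ω => block_le_block hg h ω)

variable (hx : OneDepSeq P x)
include hx

/-- The entry at `j + a` is replaced by its bound 2; the gap it leaves makes the two remaining parts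
independent. -/
theorem OneDepSeq.chainMoment_split {g : ℤ → ℕ → ℝ} {W : Finset ℤ} (hW : W.card ≤ 4) {B : ℝ}
    (hB : 1 ≤ B) (h0 : ∀ i m, 0 ≤ g i m) (h1 : ∀ i ∉ W, ∀ m, g i m ≤ B)
    (h2 : ∀ i ∈ W, ∀ m : ℕ, g i m ≤ B * (1 + m)) {j : ℤ} {a : ℕ} (hs : ∀ m, g (j + a) m ≤ 2)
    (b : ℕ) : chainMoment P x g j (a + 1 + b)
      ≤ 2 * chainMoment P x g j a * chainMoment P x g (j + a + 1) b := by
  have hint := hx.integrable_block (g := g) hW hB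
    (fun i hi m => by rw [abs_of_nonneg (h0 i m)]; exact h1 i hi m)
    (fun i hi m => by rw [abs_of_nonneg (h0 i m)]; exact h2 i hi m)
  set g' : ℤ → ℕ → ℝ := fun i m => if i = j + a then 1 else g i m with hg'
  have hint' := hx.integrable_block (g := g') hW hB
    (fun i hi m => by
      simp only [hg']; split_ifs
      · simpa using hB
      · rw [abs_of_nonneg (h0 i m)]; exact h1 i hi m)
    (fun i hi m => by
      have : (0 : ℝ) ≤ m := Nat.cast_nonneg _
      simp only [hg']; split_ifs
      · rw [abs_one]; nlinarith
      · rw [abs_of_nonneg (h0 i m)]; exact h2 i hi m) j (a + 1 + b)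
  have e1 : ∀ ω, block x g' j (a + 1 + b) ω = block x g j a ω * block x g (j + a + 1) b ω := by
    intro ω
    rw [block_add, block_add, block_one, block_congr x g' g (j := j) (L := a) fun i hi => ?_,
      show j + ((a + 1 : ℕ) : ℤ) = j + a + 1 by push_cast; ring,
      block_congr x g' g (j := j + a + 1) (L := b) fun i hi => ?_]
    · simp [hg']
    · funext m; simp only [hg']; rw [if_neg (by omega)]
    · funext m; simp only [hg']; rw [if_neg (by omega)]
  have e2 : chainMoment P x g' j (a + 1 + b)
      = chainMoment P x g j a * chainMoment P x g (j + a + 1) b := by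
    rw [chainMoment, integral_congr_ae (Filter.Eventually.of_forall e1)]
    exact hx.integral_mul le_rfl (hint _ _) (hint _ _)
  rw [mul_assoc, ← e2, chainMoment, chainMoment, ← integral_const_mul]
  refine integral_mono (hint _ _) (hint'.const_mul 2) fun ω => ?_
  change block x g j (a + 1 + b) ω ≤ 2 * block x g' j (a + 1 + b) ω
  rw [e1, block_add, block_add, block_one, show j + ((a + 1 : ℕ) : ℤ) = j + a + 1 by push_cast; ring]
  have n1 := block_nonneg (x := x) h0 j a ω
  have n2 := block_nonneg (x := x) h0 (j + a + 1) b ω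
  have := mul_le_mul_of_nonneg_left (hs (x (j + a) ω)) (mul_nonneg n1 n2)
  linarith

theorem OneDepSeq.integrable_id (i : ℤ) : Integrable (fun ω => (x i ω : ℝ)) P := by
  have h := hx.integrable_block (g := fun _ m => (m : ℝ)) (W := {i}) (B := 1) (by simp) le_rfl
    (j := i) (L := 1)
  refine (hx.integrable_prod_one_add {i} (by simp)).mono'
    ((measurable_from_top (f := fun m : ℕ => (m : ℝ))).comp (hx.meas i)).aestronglyMeasurable
    (Filter.Eventually.of_forall fun ω => ?_)
  rw [Real.norm_of_nonneg (Nat.cast_nonneg _)]; simp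

section Damped

variable {w : ℝ} {y : ℕ → ℝ} (hy : IsDamped w y)
include hy

theorem OneDepSeq.integrable_window (a : ℤ) {q : ℕ} (hq : q ≤ 4) (j : ℤ) (L : ℕ) :
    Integrable (block x (window y (fun m => w * m) a q) j L) P := by
  have hw := hy.pos
  refine hx.integrable_block (W := Finset.Ico a (a + q)) (by simpa using hq) one_le_two
    (fun i hi m => ?_) (fun i hi m => ?_) j L
  · rw [window, if_neg (by simpa using hi), abs_of_nonneg (hy.nonneg m)]; exact hy.le_two m
  · have : (0 : ℝ) ≤ m := Nat.cast_nonneg _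
    rw [window, if_pos (by simpa using hi), abs_of_nonneg (by positivity)]
    nlinarith [hy.w_le]

theorem OneDepSeq.isFree : IsFree (chainMoment P x fun _ => y) where
  nonneg := chainMoment_nonneg fun _ => hy.nonneg
  zero := chainMoment_zero _
  split j a b := hx.chainMoment_split (W := ∅) (by simp) one_le_two (fun _ => hy.nonneg)
    (fun _ _ => hy.le_two) (by simp) hy.le_two b
  one j := by
    have h1 : chainMoment P x (fun _ => y) j 1 ≤ ∫ ω, w * (x j ω : ℝ) ∂P := by
      refine integral_mono_of_nonneg (Filter.Eventually.of_forall fun ω =>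
        block_nonneg (fun _ => hy.nonneg) j 1 ω) ((hx.integrable_id j).const_mul w)
        (Filter.Eventually.of_forall fun ω => ?_)
      simp only [block_one]; exact hy.le_mul _
    rw [integral_const_mul] at h1
    have h2 := hx.mean j
    have h3 : 0 ≤ ∫ ω, (x j ω : ℝ) ∂P := integral_nonneg fun _ => Nat.cast_nonneg _
    nlinarith [hy.w_le, hy.pos]

omit mΩ [IsProbabilityMeasure P] hx in
theorem window_nonneg {a : ℤ} {q : ℕ} (i : ℤ) (m : ℕ) : 0 ≤ window y (fun m => w * m) a q i m := by
  have := hy.pos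
  rw [window]; split_ifs
  · positivity
  · exact hy.nonneg m

theorem OneDepSeq.isWindowed (a : ℤ) {q : ℕ} (hq : q ≤ 4) :
    IsWindowed (chainMoment P x (window y (fun m => w * m) a q)) (chainMoment P x fun _ => y)
      a q where
  free := hx.isFree hy
  nonneg := chainMoment_nonneg fun _ _ => window_nonneg hy _ _
  zero := chainMoment_zero _
  split j m b h := by
    refine hx.chainMoment_split (W := Finset.Ico a (a + q)) (by simpa using hq) one_le_two
      (fun _ _ => window_nonneg hy _ _)
      (fun i hi m => ?_) (fun i hi m => ?_) (fun m => ?_) b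
    · rw [window, if_neg (by simpa using hi)]; exact hy.le_two m
    · have : (0 : ℝ) ≤ m := Nat.cast_nonneg _
      rw [window, if_pos (by simpa using hi)]
      nlinarith [hy.w_le]
    · rw [window, if_neg (by omega)]; exact hy.le_two m
  eq_free j L h := chainMoment_congr fun i hi => by rw [window, if_neg (by omega)]

/-- The positive chain sums of the sequence itself. -/
noncomputable def plusMoment (P : Measure Ω) (x : ℤ → Ω → ℕ) (a : ℤ) (q : ℕ) : ℝ :=
  plusChain (chainMoment P x fun _ m => (m : ℝ)) a q

omit hx hy [IsProbabilityMeasure P] in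
theorem plusMoment_nonneg (a : ℤ) (q : ℕ) : 0 ≤ plusMoment P x a q :=
  plusChain_nonneg (chainMoment_nonneg fun _ _ => Nat.cast_nonneg _) _ _

omit [IsProbabilityMeasure P] hy in
theorem OneDepSeq.plusMoment_eq_zero {a : ℤ} (ha : a ≤ 0) {q : ℕ} (hq : 0 < q) :
    plusMoment P x a q = 0 := by
  refine plusChain_eq_zero (fun L hL => ?_) hq
  rw [chainMoment, integral_eq_zero_of_ae (Filter.Eventually.of_forall fun ω => ?_)]
  refine Finset.prod_eq_zero (Finset.mem_range.2 hL) ?_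
  simp [hx.zero a ha ω]

omit [IsProbabilityMeasure P] hx hy in
theorem chainMoment_const_mul (w : ℝ) (a : ℤ) (q : ℕ) :
    chainMoment P x (fun _ m => w * (m : ℝ)) a q
      = w ^ q * chainMoment P x (fun _ m => (m : ℝ)) a q := by
  rw [chainMoment, chainMoment, ← integral_const_mul]
  simp [block, Finset.prod_mul_distrib]

omit [IsProbabilityMeasure P] hx hy in
theorem plusChain_const_mul (w : ℝ) (a : ℤ) (q : ℕ) :
    plusChain (chainMoment P x (fun _ m => w * (m : ℝ))) a q = w ^ q * plusMoment P x a q := by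
  rw [plusMoment]
  induction q using Nat.strong_induction_on with
  | _ q ih =>
    rcases Nat.eq_zero_or_pos q with rfl | hq
    · simp
    rw [plusChain_of_pos _ _ hq, plusChain_of_pos _ _ hq, Finset.mul_sum]
    refine Finset.sum_congr rfl fun i hi => ?_
    have hi := Finset.mem_range.1 hi
    rw [ih i hi, chainMoment_const_mul]
    obtain ⟨b, rfl⟩ : ∃ b, q = i + b := ⟨q - i, by omega⟩
    rw [Nat.add_sub_cancel_left, pow_add]; ring

/-- Inside the window the entries are `w * m`, and homogeneity extracts `w ^ q`. This is how long
chains come to be estimated by a fixed power of `w`. -/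
theorem OneDepSeq.plusChain_window_le (a : ℤ) {q : ℕ} (hq : q ≤ 4) (l₁ l₂ : ℕ) :
    plusChain (chainMoment P x (window y (fun m => w * m) a q)) (a - l₁) (l₁ + q + l₂)
      ≤ 400 * (2 / 5 : ℝ) ^ (l₁ + l₂) * (w ^ q * plusMoment P x a q) := by
  refine ((hx.isWindowed hy a hq).plusChain_le l₁ l₂).trans (le_of_eq ?_)
  rw [← plusChain_const_mul, plusChain_congr fun i M hM hi => chainMoment_congr fun i' hi' => ?_]
  rw [window, if_pos (by omega)]

/-- A chain with one unbounded entry, in terms of a window containing it. -/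
theorem OneDepSeq.plusChain_mark_le (j : ℤ) {L p q : ℕ} (hp : p < L) (hq1 : 1 ≤ q) (hq : q ≤ 4)
    (hqL : q ≤ L) :
    plusChain (chainMoment P x (mark (fun _ => y) (fun _ m => w * m) (j + p))) j L
      ≤ 400 * (2 / 5 : ℝ) ^ (L - q) * (w ^ q * plusMoment P x (j + (min p (L - q) : ℕ)) q) := by
  -- The window begins at the marked entry if it fits into the chain, and otherwise ends with the
  -- chain. Since `p < L`, it contains the mark in both cases.
  set d := min p (L - q) with hd
  have hw := hy.pos
  have hmark : ∀ i m, 0 ≤ mark (fun _ => y) (fun _ m => w * m) (j + p) i m := fun i m => by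
    rw [mark]; split_ifs
    · positivity
    · exact hy.nonneg m
  have h1 : plusChain (chainMoment P x (mark (fun _ => y) (fun _ m => w * m) (j + p))) j L
      ≤ plusChain (chainMoment P x (window y (fun m => w * m) (j + d) q)) j L := by
    refine plusChain_mono (chainMoment_nonneg hmark) fun i M _ _ => chainMoment_mono hmark
      (fun i' _ m => ?_) (hx.integrable_window hy _ hq _ _)
    rw [mark, window]
    by_cases h : j + (i : ℤ) + i' = j + p
    · rw [if_pos h, if_pos (by omega)]
    · rw [if_neg h]
      split_ifs
      · exact hy.le_mul m
      · exact le_rfl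
  refine h1.trans ?_
  have h2 := hx.plusChain_window_le hy (j + d) hq d (L - q - d)
  rwa [show j + (d : ℤ) - d = j by ring, show d + q + (L - q - d) = L by omega,
    show d + (L - q - d) = L - q by omega] at h2

theorem OneDepSeq.plusChain_damped_le (j : ℤ) {L q : ℕ} (hq : q ≤ 4) (hqL : q ≤ L) :
    plusChain (chainMoment P x fun _ => y) j L
      ≤ 400 * (2 / 5 : ℝ) ^ (L - q) * (w ^ q * plusMoment P x j q) := by
  have h1 : plusChain (chainMoment P x fun _ => y) j L
      ≤ plusChain (chainMoment P x (window y (fun m => w * m) j q)) j L := by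
    refine plusChain_mono (chainMoment_nonneg fun _ => hy.nonneg) fun i M _ _ =>
      chainMoment_mono (fun _ => hy.nonneg) (fun i' _ m => ?_) (hx.integrable_window hy _ hq _ _)
    rw [window]
    split_ifs
    · exact hy.le_mul m
    · exact le_rfl
  refine h1.trans ?_
  have h2 := hx.plusChain_window_le hy j hq 0 (L - q)
  rwa [Nat.cast_zero, sub_zero, zero_add, zero_add, Nat.add_sub_cancel' hqL] at h2

end Damped

end Moments

end OneDependent

/-! ### Jets of powers of a number of modulus one. -/

namespace OneDependent

section JetVariables

/-- The scale at which derivatives enter the norm of a jet. -/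
noncomputable def jetScale (E : ℂ) : ℝ := 1 / 10000 * ‖E - 1‖

/-- The jet of `t ↦ exp (i t) - 1` at a point where `exp (i t) = E`. -/
noncomputable def jetZ (E : ℂ) : Jet :=
  TrivSqZeroExt.inl (E - 1) + TrivSqZeroExt.inr (jetScale E * (Complex.I * E))

/-- The jet of `t ↦ exp (i t m) - 1` at a point where `exp (i t) = E`. -/
noncomputable def jetY (E : ℂ) (m : ℕ) : Jet := (1 + jetZ E) ^ m - 1

variable {E : ℂ}

theorem jetScale_nonneg (E : ℂ) : 0 ≤ jetScale E := by unfold jetScale; positivity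

theorem jetZ_fst (E : ℂ) : (jetZ E).fst = E - 1 := by simp [jetZ]

theorem jetZ_snd (E : ℂ) : (jetZ E).snd = jetScale E * (Complex.I * E) := by simp [jetZ]

theorem one_add_jetZ_pow_fst (E : ℂ) (m : ℕ) : ((1 + jetZ E) ^ m).fst = E ^ m := by
  simp [TrivSqZeroExt.fst_pow, jetZ_fst]

theorem one_add_jetZ_pow_snd (E : ℂ) (m : ℕ) :
    ((1 + jetZ E) ^ m).snd = jetScale E * Complex.I * (m * E ^ m) := by
  rw [TrivSqZeroExt.snd_pow, TrivSqZeroExt.fst_add, TrivSqZeroExt.snd_add, jetZ_fst, jetZ_snd]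
  rcases Nat.eq_zero_or_pos m with rfl | hm
  · simp
  · obtain ⟨k, rfl⟩ : ∃ k, m = k + 1 := ⟨m - 1, by omega⟩
    simp [pow_succ]; ring

theorem jetY_fst (E : ℂ) (m : ℕ) : (jetY E m).fst = E ^ m - 1 := by
  rw [jetY, TrivSqZeroExt.fst_sub, one_add_jetZ_pow_fst, TrivSqZeroExt.fst_one]

theorem jetY_snd (E : ℂ) (m : ℕ) : (jetY E m).snd = jetScale E * Complex.I * (m * E ^ m) := by
  rw [jetY, TrivSqZeroExt.snd_sub, one_add_jetZ_pow_snd, TrivSqZeroExt.snd_one, sub_zero]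

variable (hE : ‖E‖ = 1)
include hE

theorem norm_sub_one_le_two : ‖E - 1‖ ≤ 2 := by
  have := norm_sub_le E 1
  rw [hE, norm_one] at this; linarith

theorem norm_jetZ : ‖jetZ E‖ ≤ 2 * ‖E - 1‖ := by
  rw [TrivSqZeroExt.norm_def, jetZ_fst, jetZ_snd, norm_mul, norm_mul, Complex.norm_I, hE,
    Complex.norm_real, Real.norm_of_nonneg (jetScale_nonneg E), jetScale]
  linarith [norm_nonneg (E - 1)]

theorem norm_jetY_snd (m : ℕ) : ‖(jetY E m).snd‖ = jetScale E * m := by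
  rw [jetY_snd]; simp [hE, abs_of_nonneg (jetScale_nonneg E)]

/-- Taylor remainders of powers of a number of modulus one. -/
theorem norm_pow_sub_sum_choose_le (j m : ℕ) :
    ‖E ^ m - ∑ i ∈ Finset.range j, (m.choose i : ℂ) * (E - 1) ^ i‖
      ≤ m.choose j * ‖E - 1‖ ^ j := by
  induction m generalizing j with
  | zero =>
    cases j with
    | zero => simp
    | succ j => simp [Finset.sum_range_succ']
  | succ m ih =>
    cases j with
    | zero => simp [hE]
    | succ j =>
      have e : E ^ (m + 1) - ∑ i ∈ Finset.range (j + 1), ((m + 1).choose i : ℂ) * (E - 1) ^ i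
          = (E ^ m - ∑ i ∈ Finset.range (j + 1), (m.choose i : ℂ) * (E - 1) ^ i)
            + (E - 1) * (E ^ m - ∑ i ∈ Finset.range j, (m.choose i : ℂ) * (E - 1) ^ i) := by
        rw [Finset.sum_range_succ', Finset.sum_range_succ' (fun i => (m.choose i : ℂ) * _)]
        simp only [Nat.choose_succ_succ, Nat.cast_add, add_mul, Finset.sum_add_distrib, mul_sub,
          Finset.mul_sum, Nat.choose_zero_right]
        have e2 : ∀ i, (E - 1) * ((m.choose i : ℂ) * (E - 1) ^ i)
            = (m.choose i : ℂ) * (E - 1) ^ (i + 1) := fun i => by ring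
        simp only [e2]; ring
      rw [e]
      refine (norm_add_le_of_le (ih (j + 1)) ((norm_mul _ _).le.trans
        (mul_le_mul_of_nonneg_left (ih j) (norm_nonneg _)))).trans (le_of_eq ?_)
      rw [Nat.choose_succ_succ]; push_cast; ring

/-- Taylor remainders of jets. -/
noncomputable def jetRem (E : ℂ) (j m : ℕ) : Jet :=
  (1 + jetZ E) ^ m - ∑ i ∈ Finset.range j, (m.choose i : ℂ) • jetZ E ^ i

omit hE in
theorem jetRem_succ_succ (j m : ℕ) :
    jetRem E (j + 1) (m + 1) = jetRem E (j + 1) m + jetZ E * jetRem E j m := by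
  unfold jetRem
  rw [Finset.sum_range_succ', Finset.sum_range_succ' (fun i => (m.choose i : ℂ) • _)]
  simp only [Nat.choose_succ_succ, Nat.cast_add, add_smul, Finset.sum_add_distrib, mul_sub,
    Finset.mul_sum, Nat.choose_zero_right]
  have e2 : ∀ i, jetZ E * ((m.choose i : ℂ) • jetZ E ^ i)
      = (m.choose i : ℂ) • jetZ E ^ (i + 1) := fun i => by rw [mul_smul_comm, pow_succ']
  simp only [e2]; ring

omit hE in
theorem jetRem_fst (j m : ℕ) : (jetRem E j m).fst
    = E ^ m - ∑ i ∈ Finset.range j, (m.choose i : ℂ) * (E - 1) ^ i := by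
  simp [jetRem, TrivSqZeroExt.fst_sum, TrivSqZeroExt.fst_pow, jetZ_fst]

/-- Induction on `m` by Pascal's rule for remainders, `jetRem_succ_succ`, and the product rule. The
factor `j + 1` arises from `j + 1` copies of the earlier bound together with one copy from the
derivative of `jetZ E`. -/
theorem norm_jetRem_snd_le (j m : ℕ) : ‖(jetRem E (j + 1) m).snd‖
    ≤ jetScale E * ((j + 1) * m.choose (j + 1) * ‖E - 1‖ ^ j) := by
  have hs := jetScale_nonneg E
  induction m generalizing j with
  | zero => simp [jetRem, Finset.sum_range_succ']
  | succ m ih =>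
    cases j with
    | zero =>
      have e : jetRem E (0 + 1) (m + 1) = jetY E (m + 1) := by simp [jetRem, jetY]
      rw [e, norm_jetY_snd hE]
      simp
    | succ j =>
      rw [jetRem_succ_succ, TrivSqZeroExt.snd_add, TrivSqZeroExt.snd_mul]
      simp only [smul_eq_mul, MulOpposite.smul_eq_mul_unop, MulOpposite.unop_op]
      have h1 : ‖(jetZ E).snd * (jetRem E (j + 1) m).fst‖
          ≤ jetScale E * (m.choose (j + 1) * ‖E - 1‖ ^ (j + 1)) := by
        rw [norm_mul, jetRem_fst, jetZ_snd]
        refine mul_le_mul ?_ (norm_pow_sub_sum_choose_le hE (j + 1) m) (norm_nonneg _) hs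
        simp [hE, abs_of_nonneg hs]
      have h2 : ‖(jetZ E).fst * (jetRem E (j + 1) m).snd‖
          ≤ ‖E - 1‖ * (jetScale E * ((j + 1) * m.choose (j + 1) * ‖E - 1‖ ^ j)) := by
        rw [norm_mul, jetZ_fst]
        exact mul_le_mul_of_nonneg_left (ih j) (norm_nonneg _)
      refine (norm_add_le_of_le (ih (j + 1)) (norm_add_le_of_le h2 h1)).trans (le_of_eq ?_)
      rw [Nat.choose_succ_succ m (j + 1)]; push_cast; ring

/-- The derivative of the remainder has one power of `‖E - 1‖` less; `jetScale` supplies it, and its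
constant absorbs `j + 1`. Value and derivative thus have the same order. -/
theorem norm_jetRem_le {j : ℕ} (hj : j < 4) (m : ℕ) :
    ‖jetRem E (j + 1) m‖ ≤ 2 * ‖E - 1‖ ^ (j + 1) * m.descFactorial (j + 1) := by
  have h1 := norm_jetRem_snd_le hE j m
  have h2 := norm_pow_sub_sum_choose_le hE (j + 1) m
  rw [← jetRem_fst] at h2
  have h3 : (m.choose (j + 1) : ℝ) ≤ m.descFactorial (j + 1) := by
    rw [Nat.descFactorial_eq_factorial_mul_choose]
    exact_mod_cast Nat.le_mul_of_pos_left _ (Nat.factorial_pos _)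
  have h4 : jetScale E * ((j + 1) * m.choose (j + 1) * ‖E - 1‖ ^ j)
      ≤ m.choose (j + 1) * ‖E - 1‖ ^ (j + 1) := by
    rw [jetScale]
    have hj' : (j : ℝ) ≤ 4 := by exact_mod_cast hj.le
    have h5 : 0 ≤ m.choose (j + 1) * ‖E - 1‖ ^ (j + 1) := by positivity
    calc _ = (1 / 10000 * (j + 1)) * (m.choose (j + 1) * ‖E - 1‖ ^ (j + 1)) := by ring
      _ ≤ 1 * (m.choose (j + 1) * ‖E - 1‖ ^ (j + 1)) := by gcongr; linarith
      _ = _ := one_mul _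
  rw [TrivSqZeroExt.norm_def]
  have h6 := mul_le_mul_of_nonneg_right h3 (by positivity : 0 ≤ ‖E - 1‖ ^ (j + 1))
  linarith

theorem isDamped_pow_sub_one : IsDamped ‖E - 1‖ fun m => ‖E ^ m - 1‖ where
  nonneg _ := norm_nonneg _
  le_two m := by
    have := norm_sub_le (E ^ m) 1
    rw [norm_pow, hE, one_pow, norm_one] at this; linarith
  le_mul m := by
    have := norm_pow_sub_sum_choose_le hE 1 m
    simpa [mul_comm] using this
  pos := norm_nonneg _
  w_le := norm_sub_one_le_two hE

end JetVariables

section JetChainBounds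

theorem succ_le_pow (l : ℕ) : ((l + 1 : ℕ) : ℝ) ≤ 2 * (3 / 2 : ℝ) ^ l := by
  induction l with
  | zero => norm_num
  | succ l ih =>
    push_cast at *
    rw [pow_succ]
    have : (1 : ℝ) ≤ (3 / 2) ^ l := one_le_pow₀ (by norm_num)
    linarith

variable {Ω : Type*} [mΩ : MeasurableSpace Ω] {P : Measure Ω} [IsProbabilityMeasure P]
  {x : ℤ → Ω → ℕ} (hx : OneDepSeq P x) {E : ℂ} (hE : ‖E‖ = 1)

omit [IsProbabilityMeasure P] in
theorem fst_integral {f : Ω → Jet} (hf : Integrable f P) :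
    (∫ ω, f ω ∂P).fst = ∫ ω, (f ω).fst ∂P :=
  ((TrivSqZeroExt.fstCLM ℂ ℂ).integral_comp_comm hf).symm

omit [IsProbabilityMeasure P] in
theorem snd_integral {f : Ω → Jet} (hf : Integrable f P) :
    (∫ ω, f ω ∂P).snd = ∫ ω, (f ω).snd ∂P :=
  ((TrivSqZeroExt.sndCLM ℂ ℂ).integral_comp_comm hf).symm

/-- The signed chain sums of the jets. -/
noncomputable def jetHat (P : Measure Ω) (x : ℤ → Ω → ℕ) (E : ℂ) : ℤ → ℕ → Jet :=
  hatChain (chainMoment P x fun _ => jetY E)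

include hx hE

theorem OneDepSeq.integrable_jetY (j : ℤ) (L : ℕ) : Integrable (block x (fun _ => jetY E) j L) P :=
  hx.integrable_block_jet one_le_two
    (fun _ m => by rw [jetY_fst]; exact (isDamped_pow_sub_one hE).le_two m)
    (fun _ m => by
      have : (0 : ℝ) ≤ m := Nat.cast_nonneg _
      rw [norm_jetY_snd hE, jetScale]
      nlinarith [norm_sub_one_le_two hE]) j L

theorem OneDepSeq.norm_chainMoment_jet_fst_le (j : ℤ) (L : ℕ) :
    ‖(chainMoment P x (fun _ => jetY E) j L).fst‖
      ≤ chainMoment P x (fun _ m => ‖E ^ m - 1‖) j L := by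
  rw [chainMoment, fst_integral (hx.integrable_jetY hE j L)]
  refine (norm_integral_le_integral_norm _).trans (le_of_eq ?_)
  refine integral_congr_ae (Filter.Eventually.of_forall fun ω => ?_)
  simp only [norm_fst_block, jetY_fst]

theorem OneDepSeq.integrable_mark (p j : ℤ) (L : ℕ) : Integrable (block x
    (mark (fun _ m => ‖E ^ m - 1‖) (fun _ m => ‖E - 1‖ * (m : ℝ)) p) j L) P := by
  have h := hx.integrable_window (isDamped_pow_sub_one hE) p (q := 1) (by norm_num) j L
  convert h using 2
  funext i m
  rw [mark, window]
  by_cases hi : i = p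
  · rw [if_pos hi, if_pos (by omega)]
  · rw [if_neg hi, if_neg (by omega)]

theorem OneDepSeq.norm_chainMoment_jet_snd_le (j : ℤ) (L : ℕ) :
    ‖(chainMoment P x (fun _ => jetY E) j L).snd‖
      ≤ 1 / 10000 * ∑ p ∈ Finset.range L, chainMoment P x
        (mark (fun _ m => ‖E ^ m - 1‖) (fun _ m => ‖E - 1‖ * (m : ℝ)) (j + p)) j L := by
  rw [chainMoment, snd_integral (hx.integrable_jetY hE j L)]
  simp only [chainMoment]
  rw [← integral_finsetSum _ fun p _ => hx.integrable_mark hE _ j L, ← integral_const_mul]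
  refine norm_integral_le_of_norm_le ((integrable_finsetSum _
    fun p _ => hx.integrable_mark hE _ j L).const_mul _) (Filter.Eventually.of_forall fun ω => ?_)
  refine (norm_snd_block_le _ _ _ _ _).trans (le_of_eq ?_)
  rw [Finset.mul_sum]
  refine Finset.sum_congr rfl fun p hp => ?_
  simp only [jetY_fst, norm_jetY_snd hE, block, jetScale]
  rw [← Finset.mul_prod_erase _ _ hp, ← Finset.mul_prod_erase _ _ hp, mark, mark, if_pos rfl,
    if_pos rfl, ← mul_assoc, ← mul_assoc]
  congr 1
  refine Finset.prod_congr rfl fun i hi => ?_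
  have hi := Finset.ne_of_mem_erase hi
  rw [mark, mark, if_neg (by omega), if_neg (by omega)]

theorem OneDepSeq.norm_jetHat_le (j : ℤ) (L : ℕ) :
    ‖jetHat P x E j L‖ ≤ plusChain (chainMoment P x fun _ m => ‖E ^ m - 1‖) j L
      + 1 / 10000 * ∑ p ∈ Finset.range L, plusChain (chainMoment P x
        (mark (fun _ m => ‖E ^ m - 1‖) (fun _ m => ‖E - 1‖ * (m : ℝ)) (j + p))) j L := by
  rw [TrivSqZeroExt.norm_def]
  refine add_le_add (norm_fst_hatChain_le (hx.norm_chainMoment_jet_fst_le hE) j L)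
    (norm_snd_hatChain_le (e := fun p => chainMoment P x
      (mark (fun _ m => ‖E ^ m - 1‖) (fun _ m => ‖E - 1‖ * (m : ℝ)) p)) (by norm_num)
      (fun p => chainMoment_nonneg fun i m => ?_)
      (hx.norm_chainMoment_jet_fst_le hE) (hx.norm_chainMoment_jet_snd_le hE)
      (fun p j L h => ?_) j L)
  · rw [mark]; split_ifs <;> positivity
  · simp only [chainMoment]; rw [block_mark_eq _ _ _ h]

/-- Long chains are controlled by short windows. -/
theorem OneDepSeq.norm_jetHat_le_window (j : ℤ) {L q : ℕ} (hq1 : 1 ≤ q) (hq : q ≤ 4)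
    (hqL : q ≤ L) :
    ‖jetHat P x E j L‖ ≤ 800 * ‖E - 1‖ ^ q * L * (2 / 5 : ℝ) ^ (L - q)
      * ∑ d ∈ Finset.range (L + 1 - q), plusMoment P x (j + d) q := by
  have hy := isDamped_pow_sub_one hE
  set S := ∑ d ∈ Finset.range (L + 1 - q), plusMoment P x (j + d) q
  have single : ∀ d < L + 1 - q, plusMoment P x (j + d) q ≤ S := fun d hd =>
    Finset.single_le_sum (f := fun d : ℕ => plusMoment P x (j + d) q)
      (fun _ _ => plusMoment_nonneg _ _) (Finset.mem_range.2 hd)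
  have hS : 0 ≤ S := Finset.sum_nonneg fun _ _ => plusMoment_nonneg _ _
  set B := 400 * (2 / 5 : ℝ) ^ (L - q) * (‖E - 1‖ ^ q * S) with hB
  have hB0 : 0 ≤ B := by positivity
  have h1 : plusChain (chainMoment P x fun _ m => ‖E ^ m - 1‖) j L ≤ B := by
    refine (hx.plusChain_damped_le hy j hq hqL).trans ?_
    have := single 0 (by omega)
    rw [Nat.cast_zero, add_zero] at this
    rw [hB]; gcongr
  have h2 : ∑ p ∈ Finset.range L, plusChain (chainMoment P x
      (mark (fun _ m => ‖E ^ m - 1‖) (fun _ m => ‖E - 1‖ * (m : ℝ)) (j + p))) j L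
      ≤ L * B := by
    refine (Finset.sum_le_card_nsmul _ _ B fun p hp => ?_).trans (by simp)
    refine (hx.plusChain_mark_le hy j (Finset.mem_range.1 hp) hq1 hq hqL).trans ?_
    have := single (min p (L - q)) (by omega)
    rw [hB]; gcongr
  have h3 := hx.norm_jetHat_le hE j L
  have hL : (1 : ℝ) ≤ L := by exact_mod_cast hq1.trans hqL
  calc ‖jetHat P x E j L‖ ≤ B + 1 / 10000 * (L * B) := by linarith
    _ ≤ 2 * L * B := by nlinarith [mul_nonneg (by linarith : (0 : ℝ) ≤ L - 1) hB0]
    _ = _ := by rw [hB]; ring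

theorem OneDepSeq.sum_norm_jetHat_le (k : ℤ) (N : ℕ) :
    ∑ L ∈ Finset.Ico 1 N, (10 / 9 : ℝ) ^ (L - 1) * ‖jetHat P x E (k + 1 - L) L‖ ≤ 1 / 10 := by
  have hy := isDamped_pow_sub_one hE
  have mean_le : ∀ a, ‖E - 1‖ ^ 1 * plusMoment P x a 1 ≤ 1 / 50 := fun a => by
    have h1 := hx.mean a
    have h2 : plusMoment P x a 1 = ∫ ω, (x a ω : ℝ) ∂P := by
      simp [plusMoment, plusChain_one, chainMoment]
    have h3 : 0 ≤ ∫ ω, (x a ω : ℝ) ∂P := integral_nonneg fun _ => Nat.cast_nonneg _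
    rw [h2, pow_one]; nlinarith [hy.w_le, hy.pos]
  -- The values give `freeBound`. For the derivative there are `l + 1` marks, each costing at most
  -- `400 * (2/5) ^ l / 50`; with `l + 1 ≤ 2 * (3/2) ^ l` and the scale `1/10000` this becomes
  -- `(3/5) ^ l / 625`. The total is at most `81/1000 + 3/625 < 1/10`.
  have each : ∀ L ∈ Finset.Ico 1 N, (10 / 9 : ℝ) ^ (L - 1) * ‖jetHat P x E (k + 1 - L) L‖
      ≤ (10 / 9 : ℝ) ^ (L - 1) * freeBound (L - 1 + 1) + 1 / 625 * (2 / 3 : ℝ) ^ (L - 1) := by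
    intro L hL
    have hL := (Finset.mem_Ico.1 hL).1
    obtain ⟨l, rfl⟩ : ∃ l, L = l + 1 := ⟨L - 1, by omega⟩
    simp only [Nat.add_sub_cancel]
    have h1 := hx.norm_jetHat_le hE (k + 1 - ((l + 1 : ℕ) : ℤ)) (l + 1)
    have h2 := (hx.isFree hy).plusChain_le (k + 1 - ((l + 1 : ℕ) : ℤ)) (l + 1)
    have h3 : ∑ p ∈ Finset.range (l + 1), plusChain (chainMoment P x
        (mark (fun _ m => ‖E ^ m - 1‖) (fun _ m => ‖E - 1‖ * (m : ℝ))
          (k + 1 - ((l + 1 : ℕ) : ℤ) + p))) (k + 1 - ((l + 1 : ℕ) : ℤ)) (l + 1)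
        ≤ (l + 1 : ℕ) * (8 * (2 / 5 : ℝ) ^ l) := by
      refine (Finset.sum_le_card_nsmul _ _ (8 * (2 / 5 : ℝ) ^ l) fun p hp => ?_).trans (by simp)
      refine (hx.plusChain_mark_le hy _ (Finset.mem_range.1 hp) le_rfl (by norm_num)
        (by omega)).trans ?_
      rw [Nat.add_sub_cancel]
      have := mul_le_mul_of_nonneg_left (mean_le (k + 1 - ((l + 1 : ℕ) : ℤ) + (min p l : ℕ)))
        (by positivity : (0 : ℝ) ≤ 400 * (2 / 5) ^ l)
      linarith
    have h4 := succ_le_pow l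
    have h5 : ((l + 1 : ℕ) : ℝ) * (8 * (2 / 5 : ℝ) ^ l) ≤ 16 * (3 / 5 : ℝ) ^ l := by
      calc _ ≤ 2 * (3 / 2 : ℝ) ^ l * (8 * (2 / 5 : ℝ) ^ l) := by gcongr
        _ = 16 * ((3 / 2 : ℝ) * (2 / 5)) ^ l := by rw [mul_pow]; ring
        _ = _ := by norm_num
    have h6 : ‖jetHat P x E (k + 1 - ((l + 1 : ℕ) : ℤ)) (l + 1)‖
        ≤ freeBound (l + 1) + 1 / 625 * (3 / 5 : ℝ) ^ l := by linarith
    refine (mul_le_mul_of_nonneg_left h6 (by positivity)).trans (le_of_eq ?_)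
    rw [mul_add, mul_left_comm, ← mul_pow]; norm_num
  refine (Finset.sum_le_sum each).trans ?_
  rw [Finset.sum_add_distrib, ← Finset.mul_sum]
  have h1 : ∑ L ∈ Finset.Ico 1 N, (10 / 9 : ℝ) ^ (L - 1) * freeBound (L - 1 + 1) ≤ 81 / 1000 := by
    rw [Finset.sum_Ico_eq_sum_range]
    refine le_trans (le_of_eq ?_) (sum_freeBound_le (N - 1))
    exact Finset.sum_congr rfl fun i _ => by rw [Nat.add_sub_cancel_left]
  have h2 : ∑ L ∈ Finset.Ico 1 N, (2 / 3 : ℝ) ^ (L - 1) ≤ 3 := by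
    rw [Finset.sum_Ico_eq_sum_range]
    simp only [Nat.add_sub_cancel_left]
    rw [geom_sum_eq (by norm_num)]
    have : (0 : ℝ) ≤ (2 / 3) ^ (N - 1) := by positivity
    rw [div_le_iff_of_neg (by norm_num)]; linarith
  linarith

end JetChainBounds

end OneDependent

/-! ### Decay of the characteristic function. -/

namespace OneDependent

section Damping

theorem Jet.fst_prod {ι : Type*} (s : Finset ι) (f : ι → Jet) :
    (∏ i ∈ s, f i).fst = ∏ i ∈ s, (f i).fst :=
  map_prod (TrivSqZeroExt.fstHom ℂ ℂ ℂ) f s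

variable {Ω : Type*} [mΩ : MeasurableSpace Ω]

/-- The factorial moments of a sequence. -/
noncomputable def factMoment (P : Measure Ω) (x : ℤ → Ω → ℕ) (j : ℕ) (k : ℤ) : ℝ :=
  ∫ ω, ((x k ω).descFactorial j : ℝ) ∂P

/-- The mixed moments of neighbours. -/
noncomputable def mixedMoment (P : Measure Ω) (x : ℤ → Ω → ℕ) (k : ℤ) : ℝ :=
  ∫ ω, (x (k - 1) ω : ℝ) * (x k ω : ℝ) ∂P

variable {P : Measure Ω} {x : ℤ → Ω → ℕ} {E : ℂ}

theorem factMoment_nonneg (j : ℕ) (k : ℤ) : 0 ≤ factMoment P x j k :=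
  integral_nonneg fun _ => Nat.cast_nonneg _

theorem mixedMoment_nonneg (k : ℤ) : 0 ≤ mixedMoment P x k :=
  integral_nonneg fun _ => by positivity

theorem factMoment_one (k : ℤ) : factMoment P x 1 k = ∫ ω, (x k ω : ℝ) ∂P := by
  simp [factMoment]

theorem plusMoment_one (a : ℤ) : plusMoment P x a 1 = factMoment P x 1 a := by
  simp [plusMoment, plusChain_one, chainMoment, factMoment]

theorem chainMoment_nat_two (a : ℤ) :
    chainMoment P x (fun _ m => (m : ℝ)) a 2 = mixedMoment P x (a + 1) := by
  simp [chainMoment, mixedMoment, block, Finset.prod_range_succ]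

theorem plusMoment_two (a : ℤ) : plusMoment P x a 2
    = mixedMoment P x (a + 1) + factMoment P x 1 a * factMoment P x 1 (a + 1) := by
  rw [plusMoment, plusChain_two, chainMoment_nat_two]
  simp [chainMoment, factMoment]

/-- On the unit circle `‖1 + a (E - 1)‖ ^ 2 = 1 - ‖E - 1‖ ^ 2 a (1 - a)` exactly, and `√(1 - 2 s) ≤
1 - s`. -/
theorem norm_one_add_mul_sub_one_le (hE : ‖E‖ = 1) (a : ℝ) :
    ‖1 + a * (E - 1)‖ ≤ 1 - ‖E - 1‖ ^ 2 / 2 * (a * (1 - a)) := by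
  have e1 : E.re ^ 2 + E.im ^ 2 = 1 := by
    have := Complex.sq_norm E
    rw [hE, Complex.normSq_apply] at this; linarith
  have e2 : ‖E - 1‖ ^ 2 = 2 - 2 * E.re := by
    rw [Complex.sq_norm, Complex.normSq_apply]; simp; linarith
  have e3 : ‖1 + a * (E - 1)‖ ^ 2 = 1 - ‖E - 1‖ ^ 2 * (a * (1 - a)) := by
    rw [e2, Complex.sq_norm, Complex.normSq_apply]; simp
    linear_combination a ^ 2 * e1
  have h2 : 0 ≤ 1 - ‖E - 1‖ ^ 2 / 2 * (a * (1 - a)) := by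
    have h3 : ‖E - 1‖ ^ 2 ≤ 4 := by
      have := norm_sub_one_le_two hE
      nlinarith [norm_nonneg (E - 1)]
    nlinarith [sq_nonneg (a - 1 / 2), sq_nonneg ‖E - 1‖]
  refine le_of_sq_le_sq ?_ h2
  rw [e3]
  nlinarith [sq_nonneg (‖E - 1‖ ^ 2 / 2 * (a * (1 - a)))]

variable [IsProbabilityMeasure P] (hx : OneDepSeq P x)
include hx

theorem OneDepSeq.integrable_descFactorial {j : ℕ} (hj : j ≤ 4) (k : ℤ) :
    Integrable (fun ω => ((x k ω).descFactorial j : ℝ)) P := by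
  refine (hx.integrable_one_add_pow k).mono'
    ((measurable_from_top (f := fun m : ℕ => (m.descFactorial j : ℝ))).comp
      (hx.meas k)).aestronglyMeasurable (Filter.Eventually.of_forall fun ω => ?_)
  have h1 : ((x k ω).descFactorial j : ℝ) ≤ (x k ω : ℝ) ^ j := by
    exact_mod_cast Nat.descFactorial_le_pow (x k ω) j
  have h0 : (0 : ℝ) ≤ x k ω := Nat.cast_nonneg _
  rw [Real.norm_of_nonneg (Nat.cast_nonneg _)]
  calc ((x k ω).descFactorial j : ℝ) ≤ (x k ω : ℝ) ^ j := h1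
    _ ≤ (1 + (x k ω : ℝ)) ^ j := by gcongr; linarith
    _ ≤ _ := pow_le_pow_right₀ (by linarith) hj

omit [IsProbabilityMeasure P] in
theorem OneDepSeq.factMoment_one_le (k : ℤ) : factMoment P x 1 k ≤ 1 / 100 := by
  rw [factMoment_one]; exact hx.mean k

omit [IsProbabilityMeasure P] in
theorem OneDepSeq.factMoment_eq_zero {j : ℕ} (hj : 0 < j) {k : ℤ} (hk : k ≤ 0) :
    factMoment P x j k = 0 := by
  rw [factMoment, integral_eq_zero_of_ae (Filter.Eventually.of_forall fun ω => ?_)]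
  obtain ⟨i, rfl⟩ : ∃ i, j = i + 1 := ⟨j - 1, by omega⟩
  simp [hx.zero k hk ω]

omit [IsProbabilityMeasure P] in
theorem OneDepSeq.mixedMoment_eq_zero {k : ℤ} (hk : k ≤ 1) : mixedMoment P x k = 0 := by
  rw [mixedMoment, integral_eq_zero_of_ae (Filter.Eventually.of_forall fun ω => ?_)]
  simp [hx.zero (k - 1) (by omega) ω]

/-- The factors of the jet of the characteristic function. -/
theorem OneDepSeq.exists_jet_factors (hE : ‖E‖ = 1) :
    ∃ u v : ℤ → Jet, (∀ k, v k * (1 + u k) = 1) ∧ (∀ k, ‖u k‖ ≤ 1 / 10) ∧ (∀ k, ‖v k‖ ≤ 10 / 9) ∧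
      (∀ k ≤ 0, u k = 0) ∧
      (∀ k : ℕ, chainMoment P x (fun _ m => (1 + jetZ E) ^ m) 1 k
        = ∏ i ∈ Finset.range k, (1 + u (i + 1))) ∧
      ∀ (k : ℤ) (N : ℕ), k < N → u k = ∑ L ∈ Finset.Ico 1 N,
        (∏ i ∈ Finset.range (L - 1), v (k - 1 - i)) * jetHat P x E (k + 1 - L) L := by
  have e : (fun (_ : ℤ) (m : ℕ) => 1 + jetY E m) = fun _ m => (1 + jetZ E) ^ m := by
    funext _ m; rw [jetY]; ring
  have hrec := hx.jet_recurrence (φ := fun _ => jetY E) one_le_two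
    (fun _ m => by rw [jetY_fst]; exact (isDamped_pow_sub_one hE).le_two m)
    (fun _ m => by
      have : (0 : ℝ) ≤ m := Nat.cast_nonneg _
      rw [norm_jetY_snd hE, jetScale]
      nlinarith [norm_sub_one_le_two hE])
  simp only [e] at hrec
  refine exists_factors (H := jetHat P x E)
    (F := fun k => chainMoment P x (fun _ m => (1 + jetZ E) ^ m) 1 k) (chainMoment_zero _ _)
    (fun k => heinrich_expansion hrec k) (fun j hj L hL => ?_)
    (hx.sum_norm_jetHat_le hE)
  refine hatChain_eq_zero (fun M hM => ?_) hL
  rw [chainMoment, integral_eq_zero_of_ae (Filter.Eventually.of_forall fun ω => ?_)]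
  refine Finset.prod_eq_zero (Finset.mem_range.2 hM) ?_
  simp [hx.zero j hj ω, jetY]

section Fst

variable (hE : ‖E‖ = 1)
include hE

/-- The characteristic function of one variable is `1 + ν₁ z` up to `ν₂ ‖z‖ ^ 2 / 2`, and `1 - ν₁ ≥
99/100`. -/
theorem OneDepSeq.norm_one_add_mean_le (k : ℤ) :
    ‖1 + (jetHat P x E k 1).fst‖ ≤ 1 - ‖E - 1‖ ^ 2 / 2
      * (99 / 100 * factMoment P x 1 k - factMoment P x 2 k) := by
  set z := E - 1 with hz
  have hi : Integrable (fun ω => (x k ω : ℂ)) P := (hx.integrable_id k).ofReal.congr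
    (Filter.Eventually.of_forall fun ω => by simp)
  have e1 : (jetHat P x E k 1).fst = ∫ ω, (E ^ x k ω - 1) ∂P := by
    rw [jetHat, hatChain_one, chainMoment, fst_integral (hx.integrable_jetY hE k 1)]
    refine integral_congr_ae (Filter.Eventually.of_forall fun ω => ?_)
    simp [jetY_fst]
  have hi2 : Integrable (fun ω => E ^ x k ω - 1) P := by
    have := (hx.integrable_jetY hE k 1)
    refine ((TrivSqZeroExt.fstCLM ℂ ℂ).integrable_comp this).congr
      (Filter.Eventually.of_forall fun ω => ?_)
    simp [jetY_fst]
  have e2 : (jetHat P x E k 1).fst = factMoment P x 1 k * z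
      + ∫ ω, (E ^ x k ω - (1 + x k ω * z)) ∂P := by
    have h1 : (factMoment P x 1 k : ℂ) * z = ∫ ω, (x k ω : ℂ) * z ∂P := by
      rw [integral_mul_const, factMoment_one, ← integral_complex_ofReal]; simp
    rw [e1, h1, ← integral_add (hi.mul_const z)]
    · refine integral_congr_ae (Filter.Eventually.of_forall fun ω => ?_)
      ring
    · refine (hi2.sub (hi.mul_const z)).congr (Filter.Eventually.of_forall fun ω => ?_)
      simp only [Pi.sub_apply]; ring
  have h2 : ‖∫ ω, (E ^ x k ω - (1 + x k ω * z)) ∂P‖ ≤ ‖z‖ ^ 2 / 2 * factMoment P x 2 k := by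
    rw [factMoment, ← integral_const_mul]
    refine norm_integral_le_of_norm_le ((hx.integrable_descFactorial (by norm_num) k).const_mul _)
      (Filter.Eventually.of_forall fun ω => ?_)
    have h := norm_pow_sub_sum_choose_le hE 2 (x k ω)
    have e3 : ((x k ω).descFactorial 2 : ℝ) = 2 * (x k ω).choose 2 := by
      rw [Nat.descFactorial_eq_factorial_mul_choose]; push_cast; norm_num
    rw [e3]
    simp only [Finset.sum_range_succ, Finset.sum_range_zero, Nat.choose_zero_right,
      Nat.choose_one_right, pow_zero, pow_one, Nat.cast_one, zero_add, one_mul] at h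
    linarith
  have h3 := norm_one_add_mul_sub_one_le hE (factMoment P x 1 k)
  have h4 : factMoment P x 1 k * (99 / 100) ≤ factMoment P x 1 k * (1 - factMoment P x 1 k) :=
    mul_le_mul_of_nonneg_left (by linarith [hx.factMoment_one_le k]) (factMoment_nonneg 1 k)
  have h5 := mul_le_mul_of_nonneg_left h4 (by positivity : 0 ≤ ‖z‖ ^ 2 / 2)
  rw [e2, ← add_assoc]
  have h6 := norm_add_le_of_le h3 h2
  rw [← hz] at h6
  linarith

theorem OneDepSeq.plusChain_two_le (j : ℤ) :
    plusChain (chainMoment P x fun _ m => ‖E ^ m - 1‖) j 2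
      ≤ ‖E - 1‖ ^ 2 * plusMoment P x j 2 := by
  rw [← plusChain_const_mul]
  have hy := isDamped_pow_sub_one hE
  refine plusChain_mono (chainMoment_nonneg fun _ => hy.nonneg) fun i M _ hiM =>
    chainMoment_mono (fun _ => hy.nonneg) (fun i' _ m => hy.le_mul m) ?_
  have h := hx.integrable_window hy j (q := 2) (by norm_num) (j + i) M
  rwa [block_congr _ _ (fun _ m => ‖E - 1‖ * (m : ℝ)) fun a ha => ?_] at h
  rw [window, if_pos (by omega)]

theorem OneDepSeq.chainMoment_two_le (j : ℤ) :
    chainMoment P x (fun _ m => ‖E ^ m - 1‖) j 2 ≤ ‖E - 1‖ ^ 2 * mixedMoment P x (j + 1) := by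
  have hy := isDamped_pow_sub_one hE
  rw [← chainMoment_nat_two, ← chainMoment_const_mul]
  refine chainMoment_mono (fun _ => hy.nonneg) (fun i' _ m => hy.le_mul m) ?_
  have h := hx.integrable_window hy j (q := 2) (by norm_num) j 2
  rwa [block_congr _ _ (fun _ m => ‖E - 1‖ * (m : ℝ)) fun a ha => ?_] at h
  rw [window, if_pos (by omega)]

/-- Two powers of `‖E - 1‖` suffice for the decay, but the coefficients must be small enough for the
constant 12 in `λ`. One variable is always removed: by its bound 2 in the triple moment, and
otherwise by its first absolute moment, at most `1/50`. -/
theorem OneDepSeq.plusChain_three_le (j : ℤ) :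
    plusChain (chainMoment P x fun _ m => ‖E ^ m - 1‖) j 3
      ≤ ‖E - 1‖ ^ 2 * (101 / 50 * mixedMoment P x (j + 1) + 1 / 50 * mixedMoment P x (j + 2)
        + 1 / 50 * (factMoment P x 1 j * factMoment P x 1 (j + 1))) := by
  have hy := isDamped_pow_sub_one hE
  have hf := hx.isFree hy
  have h0 := hf.split j 2 0
  rw [hf.zero, mul_one] at h0
  have h1 := hx.chainMoment_two_le hE j
  have h2 := hx.chainMoment_two_le hE (j + 1)
  rw [show j + 1 + 1 = j + 2 by ring] at h2
  have h3 := hx.plusChain_two_le hE j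
  rw [plusMoment_two, plusChain_two] at h3
  rw [plusChain_three]
  have a1 := mul_le_mul (hf.one j) h2 (hf.nonneg _ _) (by norm_num)
  have a2 := mul_le_mul h3 (hf.one (j + 2)) (hf.nonneg _ _)
    (mul_nonneg (by positivity) (add_nonneg (mixedMoment_nonneg _)
      (mul_nonneg (factMoment_nonneg _ _) (factMoment_nonneg _ _))))
  linarith

/-- The first two indices carry the power of `‖E - 1‖`, the third is used up by the split, and the
remaining `l + 1` provide the geometric decay. -/
theorem OneDepSeq.plusChain_long_le (j : ℤ) (l : ℕ) :
    plusChain (chainMoment P x fun _ m => ‖E ^ m - 1‖) j (l + 4)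
      ≤ 8 * ‖E - 1‖ ^ 2 * plusMoment P x j 2 * freeBound (l + 1) := by
  have hf := hx.isFree (isDamped_pow_sub_one hE)
  have h := hf.plusChain_split j 2 (l + 1)
  rw [show 2 + 1 + (l + 1) = l + 4 by ring] at h
  refine h.trans ?_
  have h1 := hx.plusChain_two_le hE j
  have h2 := hf.plusChain_le (j + (2 : ℕ) + 1) (l + 1)
  have := mul_le_mul h1 h2 (plusChain_nonneg hf.nonneg _ _)
    (mul_nonneg (by positivity) (plusMoment_nonneg _ _))
  linarith

/-- The decay of the characteristic function. -/
theorem OneDepSeq.norm_fst_le_exp (n : ℕ) :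
    ‖(chainMoment P x (fun _ m => (1 + jetZ E) ^ m) 1 n).fst‖
      ≤ Real.exp (-(9 / 20) * ‖E - 1‖ ^ 2 * (∑ k ∈ Finset.Icc (1 : ℤ) n, factMoment P x 1 k
        - 1.52 * ∑ k ∈ Finset.Icc (1 : ℤ) n, factMoment P x 2 k
        - 12 * ∑ k ∈ Finset.Icc (1 : ℤ) n, mixedMoment P x k)) := by
  obtain ⟨u, v, -, -, hv, -, hprod, hu⟩ := hx.exists_jet_factors hE
  set c := chainMoment P x fun _ m => ‖E ^ m - 1‖ with hc
  have hf : IsFree c := hx.isFree (isDamped_pow_sub_one hE)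
  set w2 := ‖E - 1‖ ^ 2 with hw2
  have hw : 0 ≤ w2 := by positivity
  have fst_le : ∀ j L, ‖(jetHat P x E j L).fst‖ ≤ plusChain c j L :=
    norm_fst_hatChain_le (hx.norm_chainMoment_jet_fst_le hE)
  -- the bound on a single factor
  have factor_le : ∀ k ∈ Finset.Icc (1 : ℤ) n, ‖1 + (u k).fst‖ - 1
      ≤ -(w2 / 2) * (99 / 100 * factMoment P x 1 k - factMoment P x 2 k)
        + ∑ L ∈ Finset.Ico 2 (n + 4), (10 / 9 : ℝ) ^ (L - 1) * plusChain c (k + 1 - L) L := by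
    intro k hk
    have hk := Finset.mem_Icc.1 hk
    -- Any end beyond `k` is allowed; `n + 4` leaves room to separate the lengths 2 and 3 even when
    -- `n = 0`.
    have e1 : (u k).fst = (jetHat P x E k 1).fst + ∑ L ∈ Finset.Ico 2 (n + 4),
        ((∏ i ∈ Finset.range (L - 1), v (k - 1 - i)) * jetHat P x E (k + 1 - L) L).fst := by
      rw [hu k (n + 4) (by push_cast; omega), TrivSqZeroExt.fst_sum,
        Finset.sum_eq_sum_Ico_succ_bot (by omega)]
      simp
    have h1 := hx.norm_one_add_mean_le hE k
    rw [e1, ← add_assoc]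
    have h2 : ‖∑ L ∈ Finset.Ico 2 (n + 4),
        ((∏ i ∈ Finset.range (L - 1), v (k - 1 - i)) * jetHat P x E (k + 1 - L) L).fst‖
        ≤ ∑ L ∈ Finset.Ico 2 (n + 4), (10 / 9 : ℝ) ^ (L - 1) * plusChain c (k + 1 - L) L := by
      refine (norm_sum_le _ _).trans (Finset.sum_le_sum fun L _ => ?_)
      rw [TrivSqZeroExt.fst_mul, norm_mul]
      refine mul_le_mul ?_ (fst_le _ _) (norm_nonneg _) (by positivity)
      refine (Jet.norm_fst_le _).trans ?_
      exact (norm_prod_le_pow _ _ fun i _ => hv _).trans (by simp)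
    have := norm_add_le_of_le h1 h2
    linarith
  have sum_le : ∑ k ∈ Finset.Icc (1 : ℤ) n, (‖1 + (u k).fst‖ - 1)
      ≤ -(9 / 20) * w2 * (∑ k ∈ Finset.Icc (1 : ℤ) n, factMoment P x 1 k
        - 1.52 * ∑ k ∈ Finset.Icc (1 : ℤ) n, factMoment P x 2 k
        - 12 * ∑ k ∈ Finset.Icc (1 : ℤ) n, mixedMoment P x k) := by
    refine (Finset.sum_le_sum factor_le).trans ?_
    rw [Finset.sum_add_distrib, ← Finset.mul_sum, Finset.sum_sub_distrib, ← Finset.mul_sum]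
    set S₁ := ∑ k ∈ Finset.Icc (1 : ℤ) n, factMoment P x 1 k with hS₁
    set S₂ := ∑ k ∈ Finset.Icc (1 : ℤ) n, factMoment P x 2 k
    set B := ∑ k ∈ Finset.Icc (1 : ℤ) n, mixedMoment P x k with hB
    set V := ∑ k ∈ Finset.Icc (1 : ℤ) n, factMoment P x 1 (k - 1) * factMoment P x 1 k with hV
    have hB0 : 0 ≤ B := Finset.sum_nonneg fun k _ => mixedMoment_nonneg k
    have hS0 : 0 ≤ S₁ := Finset.sum_nonneg fun k _ => factMoment_nonneg 1 k
    have hS20 : 0 ≤ S₂ := Finset.sum_nonneg fun k _ => factMoment_nonneg 2 k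
    have hVS : V ≤ 1 / 100 * S₁ := by
      rw [hV, hS₁, Finset.mul_sum]
      exact Finset.sum_le_sum fun k _ =>
        mul_le_mul_of_nonneg_right (hx.factMoment_one_le _) (factMoment_nonneg 1 k)
    have shiftB : ∀ d : ℕ, ∑ k ∈ Finset.Icc (1 : ℤ) n, mixedMoment P x (k - d) ≤ B := fun d =>
      sum_shift_le mixedMoment_nonneg (fun k hk => hx.mixedMoment_eq_zero (by omega)) n d
    have shiftV : ∀ d : ℕ, ∑ k ∈ Finset.Icc (1 : ℤ) n,
        factMoment P x 1 (k - d - 1) * factMoment P x 1 (k - d) ≤ V := fun d =>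
      sum_shift_le (f := fun k => factMoment P x 1 (k - 1) * factMoment P x 1 k)
        (fun k => mul_nonneg (factMoment_nonneg _ _) (factMoment_nonneg _ _))
        (fun k hk => by simp [hx.factMoment_eq_zero one_pos hk]) n d
    have shiftP : ∀ d : ℕ, ∑ k ∈ Finset.Icc (1 : ℤ) n, plusMoment P x (k - d - 1) 2 ≤ B + V := by
      intro d
      refine le_trans (le_of_eq ?_) (add_le_add (shiftB d) (shiftV d))
      rw [← Finset.sum_add_distrib]
      refine Finset.sum_congr rfl fun k _ => ?_
      rw [plusMoment_two, sub_add_cancel]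
    have two : ∑ k ∈ Finset.Icc (1 : ℤ) n, plusChain c (k + 1 - (2 : ℕ)) 2 ≤ w2 * (B + V) := by
      refine le_trans (Finset.sum_le_sum fun k _ => hx.plusChain_two_le hE _) ?_
      rw [← Finset.mul_sum]
      refine mul_le_mul_of_nonneg_left (le_trans (le_of_eq ?_) (shiftP 0)) hw
      refine Finset.sum_congr rfl fun k _ => ?_
      congr 1; push_cast; ring
    have three : ∑ k ∈ Finset.Icc (1 : ℤ) n, plusChain c (k + 1 - (3 : ℕ)) 3
        ≤ w2 * (102 / 50 * B + 1 / 50 * V) := by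
      refine le_trans (Finset.sum_le_sum fun k _ => hx.plusChain_three_le hE _) ?_
      rw [← Finset.mul_sum]
      refine mul_le_mul_of_nonneg_left ?_ hw
      rw [Finset.sum_add_distrib, Finset.sum_add_distrib, ← Finset.mul_sum, ← Finset.mul_sum,
        ← Finset.mul_sum]
      have h1 := shiftB 1
      have h2 := shiftB 0
      have h3' := shiftV 1
      have e1 : ∀ k : ℤ, k + 1 - ((3 : ℕ) : ℤ) + 1 = k - (1 : ℕ) := fun k => by push_cast; ring
      have e2 : ∀ k : ℤ, k + 1 - ((3 : ℕ) : ℤ) + 2 = k - (0 : ℕ) := fun k => by push_cast; ring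
      have e3 : ∀ k : ℤ, k + 1 - ((3 : ℕ) : ℤ) = k - (1 : ℕ) - 1 := fun k => by push_cast; ring
      simp only [e1, e2]
      simp only [e3]
      refine (add_le_add (add_le_add (mul_le_mul_of_nonneg_left h1 (by norm_num))
        (mul_le_mul_of_nonneg_left h2 (by norm_num)))
        (mul_le_mul_of_nonneg_left h3' (by norm_num))).trans
        (le_of_eq (by ring))
    have long : ∑ L ∈ Finset.Ico 4 (n + 4), (10 / 9 : ℝ) ^ (L - 1)
        * ∑ k ∈ Finset.Icc (1 : ℤ) n, plusChain c (k + 1 - L) L ≤ w2 * (8 / 9) * (B + V) := by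
      have each : ∀ l ∈ Finset.range n, (10 / 9 : ℝ) ^ (4 + l - 1)
          * ∑ k ∈ Finset.Icc (1 : ℤ) n, plusChain c (k + 1 - (4 + l : ℕ)) (4 + l)
          ≤ 8 * (10 / 9) ^ 3 * w2 * (B + V) * ((10 / 9 : ℝ) ^ l * freeBound (l + 1)) := by
        intro l _
        have h1 : ∑ k ∈ Finset.Icc (1 : ℤ) n, plusChain c (k + 1 - (4 + l : ℕ)) (4 + l)
            ≤ 8 * w2 * (B + V) * freeBound (l + 1) := by
          have h2 : ∀ k ∈ Finset.Icc (1 : ℤ) n, plusChain c (k + 1 - (4 + l : ℕ)) (4 + l)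
              ≤ 8 * w2 * freeBound (l + 1) * plusMoment P x (k - (l + 2 : ℕ) - 1) 2 := by
            intro k _
            have h := hx.plusChain_long_le hE (k + 1 - (4 + l : ℕ)) l
            rw [show l + 4 = 4 + l by ring] at h
            refine h.trans (le_of_eq ?_)
            rw [show k + 1 - ((4 + l : ℕ) : ℤ) = k - (l + 2 : ℕ) - 1 by push_cast; ring]
            ring
          refine (Finset.sum_le_sum h2).trans ?_
          rw [← Finset.mul_sum]
          have := mul_le_mul_of_nonneg_left (shiftP (l + 2))
            (mul_nonneg (mul_nonneg (by norm_num : (0 : ℝ) ≤ 8) hw) (freeBound_nonneg (l + 1)))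
          linarith
        rw [show 4 + l - 1 = l + 3 by omega, pow_add]
        have := mul_le_mul_of_nonneg_left h1 (by positivity : (0 : ℝ) ≤ (10 / 9) ^ l * (10 / 9) ^ 3)
        linarith
      rw [Finset.sum_Ico_eq_sum_range, Nat.add_sub_cancel]
      refine (Finset.sum_le_sum each).trans ?_
      rw [← Finset.mul_sum]
      have hBV : 0 ≤ B + V := add_nonneg hB0 (Finset.sum_nonneg fun k _ =>
        mul_nonneg (factMoment_nonneg _ _) (factMoment_nonneg _ _))
      have := mul_le_mul_of_nonneg_left (sum_freeBound_le n)
        (by positivity : 0 ≤ 8 * (10 / 9 : ℝ) ^ 3 * w2 * (B + V))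
      refine this.trans (le_of_eq ?_)
      ring
    rw [Finset.sum_comm, Finset.sum_eq_sum_Ico_succ_bot (by omega),
      Finset.sum_eq_sum_Ico_succ_bot (by omega)]
    simp only [← Finset.mul_sum]
    norm_num only at two three long ⊢
    -- The balance, in units of `w2`: the means enter with `-99/200` plus about `0.0203` from `V ≤
    -- S₁ / 100`, below `-9/20`; the second moments with `1/2 ≤ (9/20) * 1.52`; the mixed moments
    -- with `10/9 + (10/9) ^ 2 * 102/50 + 8/9 < (9/20) * 12`.
    have key : 0 ≤ w2 * (189 / 200 * S₁ - 9 / 10 * S₁) := mul_nonneg hw (by linarith)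
    have k1 : 0 ≤ w2 * S₂ := by positivity
    have k2 : 0 ≤ w2 * B := by positivity
    have k3 := mul_le_mul_of_nonneg_left hVS hw
    have k4 : 0 ≤ w2 * S₁ := by positivity
    linarith
  rw [hprod, Jet.fst_prod, norm_prod]
  have reindex : ∏ i ∈ Finset.range n, ‖(1 + u ((i : ℤ) + 1)).fst‖
      = ∏ k ∈ Finset.Icc (1 : ℤ) n, ‖1 + (u k).fst‖ := by
    refine Finset.prod_bij (fun i _ => (i : ℤ) + 1) ?_ ?_ ?_ ?_
    · intro i hi; have := Finset.mem_range.1 hi; rw [Finset.mem_Icc]; omega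
    · intro a _ b _ h; omega
    · intro k hk
      have := Finset.mem_Icc.1 hk
      exact ⟨(k - 1).toNat, Finset.mem_range.2 (by omega), by omega⟩
    · intro i _; simp
  rw [reindex]
  refine le_trans ?_ (Real.exp_le_exp.2 sum_le)
  rw [Real.exp_sum]
  refine Finset.prod_le_prod (fun _ _ => norm_nonneg _) fun k _ => ?_
  have := Real.add_one_le_exp (‖1 + (u k).fst‖ - 1)
  linarith

end Fst

end Damping

end OneDependent

/-! ### Joint moments of two and three neighbours. -/

namespace OneDependent

section Covariances

variable {Ω : Type*} [mΩ : MeasurableSpace Ω]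
variable {A : Type*} [NormedCommRing A] [NormedAlgebra ℝ A]

/-- `Ê(φ(X_{k-1}), ψ(X_k))`. -/
noncomputable def cov₂ (P : Measure Ω) (x : ℤ → Ω → ℕ) (φ ψ : ℕ → A) (k : ℤ) : A :=
  ∫ ω, φ (x (k - 1) ω) * ψ (x k ω) ∂P - (∫ ω, φ (x (k - 1) ω) ∂P) * ∫ ω, ψ (x k ω) ∂P

/-- `Ê(φ(X_{k-2}), ψ(X_{k-1}), χ(X_k))`. -/
noncomputable def cov₃ (P : Measure Ω) (x : ℤ → Ω → ℕ) (φ ψ χ : ℕ → A) (k : ℤ) : A :=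
  ∫ ω, φ (x (k - 2) ω) * ψ (x (k - 1) ω) * χ (x k ω) ∂P
    - (∫ ω, φ (x (k - 2) ω) ∂P) * ∫ ω, ψ (x (k - 1) ω) * χ (x k ω) ∂P
    - (∫ ω, φ (x (k - 2) ω) * ψ (x (k - 1) ω) ∂P
        - (∫ ω, φ (x (k - 2) ω) ∂P) * ∫ ω, ψ (x (k - 1) ω) ∂P) * ∫ ω, χ (x k ω) ∂P

/-- `Ê⁺(X_{k-1}^{(a)}, X_k^{(b)})`. -/
noncomputable def plusFact₂ (P : Measure Ω) (x : ℤ → Ω → ℕ) (a b : ℕ) (k : ℤ) : ℝ :=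
  ∫ ω, ((x (k - 1) ω).descFactorial a : ℝ) * (x k ω).descFactorial b ∂P
    + factMoment P x a (k - 1) * factMoment P x b k

/-- `Ê⁺(X_{k-2}^{(a)}, X_{k-1}^{(b)}, X_k^{(c)})`. -/
noncomputable def plusFact₃ (P : Measure Ω) (x : ℤ → Ω → ℕ) (a b c : ℕ) (k : ℤ) : ℝ :=
  ∫ ω, ((x (k - 2) ω).descFactorial a : ℝ) * (x (k - 1) ω).descFactorial b
      * (x k ω).descFactorial c ∂P
    + factMoment P x a (k - 2)
      * ∫ ω, ((x (k - 1) ω).descFactorial b : ℝ) * (x k ω).descFactorial c ∂P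
    + (∫ ω, ((x (k - 2) ω).descFactorial a : ℝ) * (x (k - 1) ω).descFactorial b ∂P
        + factMoment P x a (k - 2) * factMoment P x b (k - 1)) * factMoment P x c k

/-- A function growing at most like a polynomial of degree `d`. -/
def HasDegree (d : ℕ) (φ : ℕ → A) : Prop := ∃ C : ℝ, 0 ≤ C ∧ ∀ m : ℕ, ‖φ m‖ ≤ C * (1 + m) ^ d

omit [NormedAlgebra ℝ A] in
theorem hasDegree_of_le {d : ℕ} {φ : ℕ → A} {C : ℝ} (hC : 0 ≤ C)
    (h : ∀ m : ℕ, ‖φ m‖ ≤ C * m.descFactorial d) : HasDegree d φ :=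
  ⟨C, hC, fun m => (h m).trans (mul_le_mul_of_nonneg_left (by
    have h1 : (m.descFactorial d : ℝ) ≤ (m : ℝ) ^ d := by
      exact_mod_cast Nat.descFactorial_le_pow m d
    refine h1.trans (pow_le_pow_left₀ (Nat.cast_nonneg _) (by linarith) _)) hC)⟩

theorem hasDegree_descFactorial_smul (d : ℕ) (Z : A) :
    HasDegree d fun m => (m.descFactorial d : ℝ) • Z :=
  hasDegree_of_le (norm_nonneg Z) fun m => by
    rw [norm_smul, Real.norm_of_nonneg (Nat.cast_nonneg _), mul_comm]

theorem hasDegree_descFactorial (d : ℕ) : HasDegree d fun m => (m.descFactorial d : ℝ) := by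
  simpa using hasDegree_descFactorial_smul d (1 : ℝ)

theorem pow_mul_pow_mul_pow_le {p q r : ℝ} (hp : 1 ≤ p) (hq : 1 ≤ q) (hr : 1 ≤ r) {a b c : ℕ}
    (h : a + b + c ≤ 4) : p ^ a * q ^ b * r ^ c ≤ p ^ 4 + q ^ 4 + r ^ 4 := by
  set M := max p (max q r) with hM
  have h1 : 1 ≤ M := hp.trans (le_max_left _ _)
  have hpM : p ≤ M := le_max_left _ _
  have hqM : q ≤ M := (le_max_left _ _).trans (le_max_right _ _)
  have hrM : r ≤ M := (le_max_right _ _).trans (le_max_right _ _)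
  calc p ^ a * q ^ b * r ^ c ≤ M ^ a * M ^ b * M ^ c := by gcongr
    _ = M ^ (a + b + c) := by rw [pow_add, pow_add]
    _ ≤ M ^ 4 := pow_le_pow_right₀ h1 h
    _ ≤ _ := by
      have a1 : 0 ≤ p ^ 4 := by positivity
      have a2 : 0 ≤ q ^ 4 := by positivity
      have a3 : 0 ≤ r ^ 4 := by positivity
      rcases max_choice p (max q r) with h' | h'
      · rw [hM, h']; linarith
      · rcases max_choice q r with h'' | h''
        · rw [hM, h', h'']; linarith
        · rw [hM, h', h'']; linarith

variable {P : Measure Ω} {x : ℤ → Ω → ℕ}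

theorem cov₂_smul [CompleteSpace A] (r s : ℕ → ℝ) (Z W : A) (k : ℤ) :
    cov₂ P x (fun m => r m • Z) (fun m => s m • W) k = cov₂ P x r s k • (Z * W) := by
  simp only [cov₂, smul_mul_smul_comm, integral_smul_const, sub_smul]

theorem cov₃_smul [CompleteSpace A] (r s t : ℕ → ℝ) (Z W V : A) (k : ℤ) :
    cov₃ P x (fun m => r m • Z) (fun m => s m • W) (fun m => t m • V) k
      = cov₃ P x r s t k • (Z * W * V) := by
  simp only [cov₃, smul_mul_smul_comm, integral_smul_const, ← sub_smul, mul_assoc]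

variable [IsProbabilityMeasure P] (hx : OneDepSeq P x)
include hx

omit [NormedAlgebra ℝ A] in
-- Fourth moments allow total degree four, and no expansion below exceeds it.
theorem OneDepSeq.integrable_mul_mul {a b c : ℕ} (h : a + b + c ≤ 4) {φ ψ χ : ℕ → A}
    (hφ : HasDegree a φ) (hψ : HasDegree b ψ) (hχ : HasDegree c χ) (i j k : ℤ) :
    Integrable (fun ω => φ (x i ω) * ψ (x j ω) * χ (x k ω)) P := by
  obtain ⟨C, hC, h1⟩ := hφ
  obtain ⟨D, hD, h2⟩ := hψ
  obtain ⟨F, hF, h3⟩ := hχ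
  have meas : ∀ (θ : ℕ → A) (i : ℤ), StronglyMeasurable fun ω => θ (x i ω) := fun θ i => by
    have := hx.stronglyMeasurable_block (fun _ => θ) i 1
    rwa [show block x (fun _ => θ) i 1 = fun ω => θ (x i ω) by funext ω; simp [block]] at this
  refine Integrable.mono' ((((hx.integrable_one_add_pow i).add (hx.integrable_one_add_pow j)).add
    (hx.integrable_one_add_pow k)).const_mul (C * D * F))
    (((meas φ i).mul (meas ψ j)).mul (meas χ k)).aestronglyMeasurable
    (Filter.Eventually.of_forall fun ω => ?_)
  have hm : ∀ m : ℕ, (1 : ℝ) ≤ 1 + m := fun m => by linarith [(Nat.cast_nonneg m : (0 : ℝ) ≤ m)]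
  have h4 := pow_mul_pow_mul_pow_le (hm (x i ω)) (hm (x j ω)) (hm (x k ω)) h
  calc ‖φ (x i ω) * ψ (x j ω) * χ (x k ω)‖
      ≤ ‖φ (x i ω)‖ * ‖ψ (x j ω)‖ * ‖χ (x k ω)‖ :=
        (norm_mul_le _ _).trans (mul_le_mul_of_nonneg_right (norm_mul_le _ _) (norm_nonneg _))
    _ ≤ (C * (1 + x i ω) ^ a) * (D * (1 + x j ω) ^ b) * (F * (1 + x k ω) ^ c) := by
        gcongr
        exacts [h1 _, h2 _, h3 _]
    _ = C * D * F * ((1 + x i ω : ℝ) ^ a * (1 + x j ω : ℝ) ^ b * (1 + x k ω : ℝ) ^ c) := by ring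
    _ ≤ _ := mul_le_mul_of_nonneg_left h4 (by positivity)

omit [NormedAlgebra ℝ A] in
theorem OneDepSeq.integrable_mul {a b : ℕ} (h : a + b ≤ 4) {φ ψ : ℕ → A}
    (hφ : HasDegree a φ) (hψ : HasDegree b ψ) (i j : ℤ) :
    Integrable (fun ω => φ (x i ω) * ψ (x j ω)) P := by
  have h1 : HasDegree 0 fun _ : ℕ => (1 : A) := ⟨‖(1 : A)‖, norm_nonneg _, by simp⟩
  simpa using hx.integrable_mul_mul (c := 0) h hφ hψ h1 i j j

omit [NormedAlgebra ℝ A] in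
theorem OneDepSeq.integrable_comp {a : ℕ} (h : a ≤ 4) {φ : ℕ → A} (hφ : HasDegree a φ) (i : ℤ) :
    Integrable (fun ω => φ (x i ω)) P := by
  have h1 : HasDegree 0 fun _ : ℕ => (1 : A) := ⟨‖(1 : A)‖, norm_nonneg _, by simp⟩
  simpa using hx.integrable_mul (b := 0) h hφ h1 i i

section Linearity

variable {a a' b b' c c' : ℕ} {φ φ' ψ ψ' χ χ' : ℕ → A}

/-- Covariances are linear in each entry, so entries can be replaced one at a time by Taylor
polynomials. This lemma and its companions record the linearity together with the degrees that keep
the integrals finite. -/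
theorem OneDepSeq.cov₂_sub_left (h : a + b ≤ 4) (h' : a' + b ≤ 4) (hφ : HasDegree a φ)
    (hφ' : HasDegree a' φ') (hψ : HasDegree b ψ) (k : ℤ) :
    cov₂ P x φ ψ k - cov₂ P x φ' ψ k = cov₂ P x (fun m => φ m - φ' m) ψ k := by
  simp only [cov₂, sub_mul]
  rw [integral_sub (hx.integrable_mul h hφ hψ _ _) (hx.integrable_mul h' hφ' hψ _ _),
    integral_sub (hx.integrable_comp (by omega) hφ _) (hx.integrable_comp (by omega) hφ' _)]
  ring

theorem OneDepSeq.cov₂_sub_right (h : a + b ≤ 4) (h' : a + b' ≤ 4) (hφ : HasDegree a φ)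
    (hψ : HasDegree b ψ) (hψ' : HasDegree b' ψ') (k : ℤ) :
    cov₂ P x φ ψ k - cov₂ P x φ ψ' k = cov₂ P x φ (fun m => ψ m - ψ' m) k := by
  simp only [cov₂, mul_sub]
  rw [integral_sub (hx.integrable_mul h hφ hψ _ _) (hx.integrable_mul h' hφ hψ' _ _),
    integral_sub (hx.integrable_comp (by omega) hψ _) (hx.integrable_comp (by omega) hψ' _)]
  ring

theorem OneDepSeq.cov₃_sub_left (h : a + b + c ≤ 4) (h' : a' + b + c ≤ 4) (hφ : HasDegree a φ)
    (hφ' : HasDegree a' φ') (hψ : HasDegree b ψ) (hχ : HasDegree c χ) (k : ℤ) :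
    cov₃ P x φ ψ χ k - cov₃ P x φ' ψ χ k = cov₃ P x (fun m => φ m - φ' m) ψ χ k := by
  simp only [cov₃, sub_mul]
  rw [integral_sub (hx.integrable_mul_mul h hφ hψ hχ _ _ _)
      (hx.integrable_mul_mul h' hφ' hψ hχ _ _ _),
    integral_sub (hx.integrable_mul (by omega) hφ hψ _ _)
      (hx.integrable_mul (by omega) hφ' hψ _ _),
    integral_sub (hx.integrable_comp (by omega) hφ _) (hx.integrable_comp (by omega) hφ' _)]
  ring

theorem OneDepSeq.cov₃_sub_mid (h : a + b + c ≤ 4) (h' : a + b' + c ≤ 4) (hφ : HasDegree a φ)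
    (hψ : HasDegree b ψ) (hψ' : HasDegree b' ψ') (hχ : HasDegree c χ) (k : ℤ) :
    cov₃ P x φ ψ χ k - cov₃ P x φ ψ' χ k = cov₃ P x φ (fun m => ψ m - ψ' m) χ k := by
  simp only [cov₃, sub_mul, mul_sub]
  rw [integral_sub (hx.integrable_mul_mul h hφ hψ hχ _ _ _)
      (hx.integrable_mul_mul h' hφ hψ' hχ _ _ _),
    integral_sub (hx.integrable_mul (by omega) hφ hψ _ _)
      (hx.integrable_mul (by omega) hφ hψ' _ _),
    integral_sub (hx.integrable_mul (by omega) hψ hχ _ _)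
      (hx.integrable_mul (by omega) hψ' hχ _ _),
    integral_sub (hx.integrable_comp (by omega) hψ _) (hx.integrable_comp (by omega) hψ' _)]
  ring

theorem OneDepSeq.cov₃_sub_right (h : a + b + c ≤ 4) (h' : a + b + c' ≤ 4) (hφ : HasDegree a φ)
    (hψ : HasDegree b ψ) (hχ : HasDegree c χ) (hχ' : HasDegree c' χ') (k : ℤ) :
    cov₃ P x φ ψ χ k - cov₃ P x φ ψ χ' k = cov₃ P x φ ψ (fun m => χ m - χ' m) k := by
  simp only [cov₃, mul_sub]
  rw [integral_sub (hx.integrable_mul_mul h hφ hψ hχ _ _ _)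
      (hx.integrable_mul_mul h' hφ hψ hχ' _ _ _),
    integral_sub (hx.integrable_mul (by omega) hψ hχ _ _)
      (hx.integrable_mul (by omega) hψ hχ' _ _),
    integral_sub (hx.integrable_comp (by omega) hχ _) (hx.integrable_comp (by omega) hχ' _)]
  ring

end Linearity

section Norms

variable {a b c : ℕ} {φ ψ χ : ℕ → A} {α β γ : ℝ}

theorem OneDepSeq.norm_integral_comp_le (h : a ≤ 4)
    (hφ : ∀ m : ℕ, ‖φ m‖ ≤ α * m.descFactorial a) (i : ℤ) :
    ‖∫ ω, φ (x i ω) ∂P‖ ≤ α * factMoment P x a i := by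
  rw [factMoment, ← integral_const_mul]
  exact norm_integral_le_of_norm_le ((hx.integrable_comp h (hasDegree_descFactorial a) i).const_mul _)
    (Filter.Eventually.of_forall fun ω => hφ _)

theorem OneDepSeq.norm_integral_mul_le (h : a + b ≤ 4) (hα : 0 ≤ α)
    (hφ : ∀ m : ℕ, ‖φ m‖ ≤ α * m.descFactorial a)
    (hψ : ∀ m : ℕ, ‖ψ m‖ ≤ β * m.descFactorial b) (i j : ℤ) :
    ‖∫ ω, φ (x i ω) * ψ (x j ω) ∂P‖
      ≤ α * β * ∫ ω, ((x i ω).descFactorial a : ℝ) * (x j ω).descFactorial b ∂P := by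
  rw [← integral_const_mul]
  refine norm_integral_le_of_norm_le ((hx.integrable_mul h (hasDegree_descFactorial a)
    (hasDegree_descFactorial b) i j).const_mul _) (Filter.Eventually.of_forall fun ω => ?_)
  refine (norm_mul_le _ _).trans ((mul_le_mul (hφ _) (hψ _) (norm_nonneg _)
    (by positivity)).trans (le_of_eq (by ring)))

theorem OneDepSeq.norm_integral_mul_mul_le (h : a + b + c ≤ 4) (hα : 0 ≤ α) (hβ : 0 ≤ β)
    (hφ : ∀ m : ℕ, ‖φ m‖ ≤ α * m.descFactorial a)
    (hψ : ∀ m : ℕ, ‖ψ m‖ ≤ β * m.descFactorial b)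
    (hχ : ∀ m : ℕ, ‖χ m‖ ≤ γ * m.descFactorial c) (i j k : ℤ) :
    ‖∫ ω, φ (x i ω) * ψ (x j ω) * χ (x k ω) ∂P‖
      ≤ α * β * γ * ∫ ω, ((x i ω).descFactorial a : ℝ) * (x j ω).descFactorial b
        * (x k ω).descFactorial c ∂P := by
  rw [← integral_const_mul]
  refine norm_integral_le_of_norm_le ((hx.integrable_mul_mul h (hasDegree_descFactorial a)
    (hasDegree_descFactorial b) (hasDegree_descFactorial c) i j k).const_mul _)
    (Filter.Eventually.of_forall fun ω => ?_)
  refine (norm_mul_le _ _).trans ((mul_le_mul ((norm_mul_le _ _).trans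
    (mul_le_mul (hφ _) (hψ _) (norm_nonneg _) (by positivity))) (hχ _) (norm_nonneg _)
    (by positivity)).trans (le_of_eq (by ring)))

theorem OneDepSeq.norm_cov₂_le (h : a + b ≤ 4) (hα : 0 ≤ α)
    (hφ : ∀ m : ℕ, ‖φ m‖ ≤ α * m.descFactorial a)
    (hψ : ∀ m : ℕ, ‖ψ m‖ ≤ β * m.descFactorial b) (k : ℤ) :
    ‖cov₂ P x φ ψ k‖ ≤ α * β * plusFact₂ P x a b k := by
  have h1 := hx.norm_integral_mul_le h hα hφ hψ (k - 1) k
  have h2 := mul_le_mul (hx.norm_integral_comp_le (by omega) hφ (k - 1))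
    (hx.norm_integral_comp_le (by omega) hψ k) (norm_nonneg _)
    (mul_nonneg hα (factMoment_nonneg _ _))
  have := norm_sub_le_of_le h1 ((norm_mul_le _ _).trans h2)
  rw [cov₂, plusFact₂]
  linarith

theorem OneDepSeq.norm_cov₃_le (h : a + b + c ≤ 4) (hα : 0 ≤ α) (hβ : 0 ≤ β)
    (hφ : ∀ m : ℕ, ‖φ m‖ ≤ α * m.descFactorial a)
    (hψ : ∀ m : ℕ, ‖ψ m‖ ≤ β * m.descFactorial b)
    (hχ : ∀ m : ℕ, ‖χ m‖ ≤ γ * m.descFactorial c) (k : ℤ) :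
    ‖cov₃ P x φ ψ χ k‖ ≤ α * β * γ * plusFact₃ P x a b c k := by
  have h1 := hx.norm_integral_mul_mul_le h hα hβ hφ hψ hχ (k - 2) (k - 1) k
  have f1 := hx.norm_integral_comp_le (by omega) hφ (k - 2)
  have f2 := hx.norm_integral_comp_le (by omega) hψ (k - 1)
  have f3 := hx.norm_integral_comp_le (by omega) hχ k
  have nn : ∀ (d e : ℕ) (i j : ℤ),
      0 ≤ ∫ ω, ((x i ω).descFactorial d : ℝ) * (x j ω).descFactorial e ∂P :=
    fun d e i j => integral_nonneg fun _ => by positivity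
  have h2 := mul_le_mul f1 (hx.norm_integral_mul_le (by omega) hβ hψ hχ (k - 1) k) (norm_nonneg _)
    (mul_nonneg hα (factMoment_nonneg _ _))
  have h3 := norm_sub_le_of_le (hx.norm_integral_mul_le (by omega) hα hφ hψ (k - 2) (k - 1))
    ((norm_mul_le _ _).trans (mul_le_mul f1 f2 (norm_nonneg _)
      (mul_nonneg hα (factMoment_nonneg _ _))))
  have h4 := mul_le_mul h3 f3 (norm_nonneg _) (add_nonneg (mul_nonneg (by positivity) (nn _ _ _ _))
    (mul_nonneg (mul_nonneg hα (factMoment_nonneg _ _)) (mul_nonneg hβ (factMoment_nonneg _ _))))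
  have := norm_sub_le_of_le (norm_sub_le_of_le h1 ((norm_mul_le _ _).trans h2))
    ((norm_mul_le _ _).trans h4)
  rw [cov₃, plusFact₃]
  linarith

end Norms

end Covariances

end OneDependent

/-! ### Taylor expansion of the chains of length one, two and three. -/

namespace OneDependent

section JetTaylor

variable {E : ℂ}

/-- The terms of the binomial expansion of `(1 + Z) ^ m`. -/
noncomputable def jetTerm (E : ℂ) (i m : ℕ) : Jet :=
  (m.descFactorial i : ℝ) • ((i.factorial : ℝ)⁻¹ • jetZ E ^ i)

theorem jetTerm_eq (i m : ℕ) : jetTerm E i m = (m.choose i : ℂ) • jetZ E ^ i := by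
  have h : (m.descFactorial i : ℝ) * (i.factorial : ℝ)⁻¹ = m.choose i := by
    rw [Nat.descFactorial_eq_factorial_mul_choose]
    have : (i.factorial : ℝ) ≠ 0 := by exact_mod_cast i.factorial_ne_zero
    push_cast; field_simp
  rw [jetTerm, smul_smul, h, Nat.cast_smul_eq_nsmul, Nat.cast_smul_eq_nsmul]

theorem jetRem_one (m : ℕ) : jetRem E 1 m = jetY E m := by
  simp [jetRem, jetY]

theorem jetRem_sub_jetTerm (j m : ℕ) : jetRem E j m - jetTerm E j m = jetRem E (j + 1) m := by
  rw [jetRem, jetRem, jetTerm_eq, Finset.sum_range_succ]; ring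

variable (hE : ‖E‖ = 1)
include hE

theorem norm_jetY_le (m : ℕ) : ‖jetY E m‖ ≤ 2 * ‖E - 1‖ * m.descFactorial 1 := by
  simpa [jetRem_one] using norm_jetRem_le hE (j := 0) (by norm_num) m

theorem norm_jetTerm_one_le (m : ℕ) : ‖jetTerm E 1 m‖ ≤ 2 * ‖E - 1‖ * m.descFactorial 1 := by
  rw [jetTerm, norm_smul, Real.norm_of_nonneg (Nat.cast_nonneg _), mul_comm]
  refine mul_le_mul_of_nonneg_right ?_ (Nat.cast_nonneg _)
  simpa using norm_jetZ hE

end JetTaylor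

section Expansions

variable {Ω : Type*} [mΩ : MeasurableSpace Ω] {P : Measure Ω} {x : ℤ → Ω → ℕ} {E : ℂ}

/-- `Ê(X_{k-1}^{(a)}, X_k^{(b)})`. -/
noncomputable def hatFact₂ (P : Measure Ω) (x : ℤ → Ω → ℕ) (a b : ℕ) (k : ℤ) : ℝ :=
  cov₂ P x (fun m => (m.descFactorial a : ℝ)) (fun m => (m.descFactorial b : ℝ)) k

/-- `Ê(X_{k-2}, X_{k-1}, X_k)`. -/
noncomputable def hatFact₃ (P : Measure Ω) (x : ℤ → Ω → ℕ) (k : ℤ) : ℝ :=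
  cov₃ P x (fun m => (m.descFactorial 1 : ℝ)) (fun m => (m.descFactorial 1 : ℝ))
    (fun m => (m.descFactorial 1 : ℝ)) k

theorem jetHat_one (k : ℤ) : jetHat P x E k 1 = ∫ ω, jetY E (x k ω) ∂P := by
  simp [jetHat, hatChain_one, chainMoment, block]

theorem jetHat_two (k : ℤ) : jetHat P x E (k - 1) 2 = cov₂ P x (jetY E) (jetY E) k := by
  simp [jetHat, hatChain_two, chainMoment, block, cov₂, Finset.prod_range_succ]

theorem jetHat_three (k : ℤ) :
    jetHat P x E (k - 2) 3 = cov₃ P x (jetY E) (jetY E) (jetY E) k := by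
  have e : k - 2 + 1 = k - 1 := by ring
  have e' : k - 1 + 1 = k := by ring
  simp [jetHat, hatChain_three, chainMoment, block, cov₃, Finset.prod_range_succ, e, e']

theorem cov₂_jetTerm (a b : ℕ) (k : ℤ) : cov₂ P x (jetTerm E a) (jetTerm E b) k
    = hatFact₂ P x a b k
      • (((a.factorial : ℝ)⁻¹ • jetZ E ^ a) * ((b.factorial : ℝ)⁻¹ • jetZ E ^ b)) :=
  cov₂_smul _ _ _ _ k

theorem cov₃_jetTerm (k : ℤ) : cov₃ P x (jetTerm E 1) (jetTerm E 1) (jetTerm E 1) k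
    = hatFact₃ P x k • jetZ E ^ 3 := by
  have h := cov₃_smul (P := P) (x := x) (fun m => (m.descFactorial 1 : ℝ))
    (fun m => (m.descFactorial 1 : ℝ)) (fun m => (m.descFactorial 1 : ℝ)) (jetZ E) (jetZ E)
    (jetZ E) k
  have e : jetTerm E 1 = fun m => (m.descFactorial 1 : ℝ) • jetZ E := by
    funext m; simp [jetTerm]
  rw [show jetZ E ^ 3 = jetZ E * jetZ E * jetZ E by ring, hatFact₃, ← h, e]

theorem integral_jetTerm (i : ℕ) (k : ℤ) : ∫ ω, jetTerm E i (x k ω) ∂P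
    = factMoment P x i k • ((i.factorial : ℝ)⁻¹ • jetZ E ^ i) := by
  simp only [jetTerm]
  rw [integral_smul_const, factMoment]

theorem hasDegree_jetTerm (i : ℕ) : HasDegree i (jetTerm E i) :=
  hasDegree_descFactorial_smul _ _

variable [IsProbabilityMeasure P] (hx : OneDepSeq P x) (hE : ‖E‖ = 1)
include hE

omit [MeasurableSpace Ω] in
theorem hasDegree_jetRem {j : ℕ} (hj : j < 4) : HasDegree (j + 1) (jetRem E (j + 1)) :=
  hasDegree_of_le (by positivity) (norm_jetRem_le hE hj)

theorem hasDegree_jetY : HasDegree 1 (jetY E) := hasDegree_of_le (by positivity) (norm_jetY_le hE)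

include hx

theorem OneDepSeq.norm_integral_jetRem_le {j : ℕ} (hj : j < 4) (k : ℤ) :
    ‖∫ ω, jetRem E (j + 1) (x k ω) ∂P‖
      ≤ 2 * ‖E - 1‖ ^ (j + 1) * factMoment P x (j + 1) k :=
  hx.norm_integral_comp_le hj (norm_jetRem_le hE hj) k

theorem OneDepSeq.integral_jetRem_sub {j : ℕ} (hj : j + 1 < 4) (k : ℤ) :
    ∫ ω, jetRem E (j + 1) (x k ω) ∂P - ∫ ω, jetTerm E (j + 1) (x k ω) ∂P
      = ∫ ω, jetRem E (j + 2) (x k ω) ∂P := by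
  rw [← integral_sub (hx.integrable_comp (by omega) (hasDegree_jetRem hE (by omega)) k)
    (hx.integrable_comp (by omega) (hasDegree_jetTerm _) k)]
  simp only [jetRem_sub_jetTerm]

/-- The expansions of the mean. -/
theorem OneDepSeq.jetHat_one_expansion (k : ℤ) :
    ‖jetHat P x E k 1‖ ≤ 2 * ‖E - 1‖ * factMoment P x 1 k ∧
    ‖jetHat P x E k 1 - factMoment P x 1 k • jetZ E‖ ≤ 2 * ‖E - 1‖ ^ 2 * factMoment P x 2 k ∧
    ‖jetHat P x E k 1 - factMoment P x 1 k • jetZ E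
        - (factMoment P x 2 k / 2) • jetZ E ^ 2‖ ≤ 2 * ‖E - 1‖ ^ 3 * factMoment P x 3 k ∧
    ‖jetHat P x E k 1 - factMoment P x 1 k • jetZ E - (factMoment P x 2 k / 2) • jetZ E ^ 2
        - (factMoment P x 3 k / 6) • jetZ E ^ 3‖ ≤ 2 * ‖E - 1‖ ^ 4 * factMoment P x 4 k := by
  have h0 : jetHat P x E k 1 = ∫ ω, jetRem E 1 (x k ω) ∂P := by
    simp only [jetHat_one, jetRem_one]
  have h1 := hx.integral_jetRem_sub hE (j := 0) (by norm_num) k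
  have h2 := hx.integral_jetRem_sub hE (j := 1) (by norm_num) k
  have h3 := hx.integral_jetRem_sub hE (j := 2) (by norm_num) k
  rw [integral_jetTerm] at h1 h2 h3
  norm_num [Nat.factorial, smul_smul] at h1 h2 h3
  rw [← h0] at h1
  rw [← h1] at h2
  rw [← h2] at h3
  rw [div_eq_mul_one_div, div_eq_mul_one_div (factMoment P x 3 k), h3, h2, h1, h0]
  exact ⟨by simpa using hx.norm_integral_jetRem_le hE (j := 0) (by norm_num) k,
    hx.norm_integral_jetRem_le hE (j := 1) (by norm_num) k,
    hx.norm_integral_jetRem_le hE (j := 2) (by norm_num) k,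
    hx.norm_integral_jetRem_le hE (j := 3) (by norm_num) k⟩

/-- The entries `Y` are replaced by their linear terms `T` one after the other, `Y ⊗ Y - T ⊗ T = R₂
⊗ Y + T ⊗ R₂`, with `R₂` the second order remainder. -/
theorem OneDepSeq.norm_jetHat_two_sub_le (k : ℤ) :
    ‖jetHat P x E (k - 1) 2 - hatFact₂ P x 1 1 k • jetZ E ^ 2‖
      ≤ 4 * ‖E - 1‖ ^ 3 * (plusFact₂ P x 2 1 k + plusFact₂ P x 1 2 k) := by
  have hY := hasDegree_jetY hE
  have hT : HasDegree 1 (jetTerm E 1) := hasDegree_jetTerm 1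
  have e : ∀ m, jetY E m - jetTerm E 1 m = jetRem E 2 m := fun m => by
    rw [← jetRem_one, jetRem_sub_jetTerm]
  have h1 := hx.cov₂_sub_left (by norm_num) (by norm_num) hY hT hY k
  have h2 := hx.cov₂_sub_right (by norm_num) (by norm_num) hT hY hT k
  simp only [e] at h1 h2
  have h3 : cov₂ P x (jetTerm E 1) (jetTerm E 1) k = hatFact₂ P x 1 1 k • jetZ E ^ 2 := by
    rw [cov₂_jetTerm]; simp [sq]
  have n1 := hx.norm_cov₂_le (by norm_num) (by positivity)
    (norm_jetRem_le hE (j := 1) (by norm_num)) (norm_jetY_le hE) k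
  have n2 := hx.norm_cov₂_le (by norm_num) (by positivity) (norm_jetTerm_one_le hE)
    (norm_jetRem_le hE (j := 1) (by norm_num)) k
  rw [jetHat_two, ← h3, ← sub_add_sub_cancel _ (cov₂ P x (jetTerm E 1) (jetY E) k), h1, h2]
  refine (norm_add_le_of_le n1 n2).trans (le_of_eq ?_)
  norm_num; ring

/-- Besides the first exchange, `R₂ ⊗ Y` is split as `R₂ ⊗ R₂ + R₂ ⊗ T`, and each `R₂` facing a
linear term gives up its quadratic term. What is left is `R₂ ⊗ R₂ + R₃ ⊗ T + T ⊗ R₃`, in which every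
summand has degree four; splitting `R₂ ⊗ R₂` no further keeps it so. -/
theorem OneDepSeq.norm_jetHat_two_sub_le' (k : ℤ) :
    ‖jetHat P x E (k - 1) 2 - hatFact₂ P x 1 1 k • jetZ E ^ 2
        - ((hatFact₂ P x 2 1 k + hatFact₂ P x 1 2 k) / 2) • jetZ E ^ 3‖
      ≤ 4 * ‖E - 1‖ ^ 4 * (plusFact₂ P x 3 1 k + plusFact₂ P x 2 2 k + plusFact₂ P x 1 3 k) := by
  have hY := hasDegree_jetY hE
  have hT : HasDegree 1 (jetTerm E 1) := hasDegree_jetTerm 1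
  have hT2 : HasDegree 2 (jetTerm E 2) := hasDegree_jetTerm 2
  have hR : HasDegree 2 (jetRem E 2) := hasDegree_jetRem hE (by norm_num)
  have e : ∀ m, jetY E m - jetTerm E 1 m = jetRem E 2 m := fun m => by
    rw [← jetRem_one, jetRem_sub_jetTerm]
  have e' : ∀ m, jetRem E 2 m - jetTerm E 2 m = jetRem E 3 m := fun m => by
    rw [jetRem_sub_jetTerm]
  have h1 := hx.cov₂_sub_left (by norm_num) (by norm_num) hY hT hY k
  have h2 := hx.cov₂_sub_right (by norm_num) (by norm_num) hT hY hT k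
  have h3 := hx.cov₂_sub_right (by norm_num) (by norm_num) hR hY hT k
  have h4 := hx.cov₂_sub_left (by norm_num) (by norm_num) hR hT2 hT k
  have h5 := hx.cov₂_sub_right (by norm_num) (by norm_num) hT hR hT2 k
  simp only [e, e'] at h1 h2 h3 h4 h5
  have g : cov₂ P x (jetTerm E 1) (jetTerm E 1) k = hatFact₂ P x 1 1 k • jetZ E ^ 2 := by
    rw [cov₂_jetTerm]; simp [sq]
  have g1 : cov₂ P x (jetTerm E 2) (jetTerm E 1) k + cov₂ P x (jetTerm E 1) (jetTerm E 2) k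
      = ((hatFact₂ P x 2 1 k + hatFact₂ P x 1 2 k) / 2) • jetZ E ^ 3 := by
    rw [cov₂_jetTerm, cov₂_jetTerm]
    norm_num [Nat.factorial, smul_smul]
    rw [show jetZ E ^ 2 * jetZ E = jetZ E ^ 3 by ring, show jetZ E * jetZ E ^ 2 = jetZ E ^ 3 by ring,
      ← add_smul]
    congr 1; ring
  have n1 := hx.norm_cov₂_le (by norm_num) (by positivity)
    (norm_jetRem_le hE (j := 1) (by norm_num)) (norm_jetRem_le hE (j := 1) (by norm_num)) k
  have n2 := hx.norm_cov₂_le (by norm_num) (by positivity)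
    (norm_jetRem_le hE (j := 2) (by norm_num)) (norm_jetTerm_one_le hE) k
  have n3 := hx.norm_cov₂_le (by norm_num) (by positivity) (norm_jetTerm_one_le hE)
    (norm_jetRem_le hE (j := 2) (by norm_num)) k
  have key : jetHat P x E (k - 1) 2 - hatFact₂ P x 1 1 k • jetZ E ^ 2
      - ((hatFact₂ P x 2 1 k + hatFact₂ P x 1 2 k) / 2) • jetZ E ^ 3
      = cov₂ P x (jetRem E 2) (jetRem E 2) k + cov₂ P x (jetRem E 3) (jetTerm E 1) k
        + cov₂ P x (jetTerm E 1) (jetRem E 3) k := by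
    rw [jetHat_two, ← g, ← g1]
    linear_combination h1 + h2 + h3 + h4 + h5
  rw [key]
  refine (norm_add_le_of_le (norm_add_le_of_le n1 n2) n3).trans (le_of_eq ?_)
  norm_num; ring

theorem OneDepSeq.norm_jetHat_three_sub_le (k : ℤ) :
    ‖jetHat P x E (k - 2) 3 - hatFact₃ P x k • jetZ E ^ 3‖
      ≤ 8 * ‖E - 1‖ ^ 4
        * (plusFact₃ P x 2 1 1 k + plusFact₃ P x 1 2 1 k + plusFact₃ P x 1 1 2 k) := by
  have hY := hasDegree_jetY hE
  have hT : HasDegree 1 (jetTerm E 1) := hasDegree_jetTerm 1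
  have e : ∀ m, jetY E m - jetTerm E 1 m = jetRem E 2 m := fun m => by
    rw [← jetRem_one, jetRem_sub_jetTerm]
  have h1 := hx.cov₃_sub_left (by norm_num) (by norm_num) hY hT hY hY k
  have h2 := hx.cov₃_sub_mid (by norm_num) (by norm_num) hT hY hT hY k
  have h3 := hx.cov₃_sub_right (by norm_num) (by norm_num) hT hT hY hT k
  simp only [e] at h1 h2 h3
  have n1 := hx.norm_cov₃_le (by norm_num) (by positivity) (by positivity)
    (norm_jetRem_le hE (j := 1) (by norm_num)) (norm_jetY_le hE) (norm_jetY_le hE) k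
  have n2 := hx.norm_cov₃_le (by norm_num) (by positivity) (by positivity)
    (norm_jetTerm_one_le hE) (norm_jetRem_le hE (j := 1) (by norm_num)) (norm_jetY_le hE) k
  have n3 := hx.norm_cov₃_le (by norm_num) (by positivity) (by positivity)
    (norm_jetTerm_one_le hE) (norm_jetTerm_one_le hE) (norm_jetRem_le hE (j := 1) (by norm_num)) k
  have key : jetHat P x E (k - 2) 3 - hatFact₃ P x k • jetZ E ^ 3
      = cov₃ P x (jetRem E 2) (jetY E) (jetY E) k + cov₃ P x (jetTerm E 1) (jetRem E 2) (jetY E) k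
        + cov₃ P x (jetTerm E 1) (jetTerm E 1) (jetRem E 2) k := by
    rw [jetHat_three, ← cov₃_jetTerm]
    linear_combination h1 + h2 + h3
  rw [key]
  refine (norm_add_le_of_le (norm_add_le_of_le n1 n2) n3).trans (le_of_eq ?_)
  norm_num; ring

end Expansions

end OneDependent

/-! ### Algebra of the logarithmic expansion and bookkeeping of remainders. -/

namespace OneDependent

section Algebra

variable {A : Type*} [CommRing A] [Algebra ℝ A]

/-- With `e ≈ a Z + (b/2) Z ^ 2` and `P ≈ p Z ^ 2`, the coefficient of `Z ^ 2` on the left is the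
summand of `Γ₂`, and every summand on the right contains the remainder of one of these
approximations. -/
theorem second_order_identity (Z e P : A) (a b p : ℝ) :
    e + P - (1 / 2 : ℝ) • e ^ 2 - (a • Z + (b / 2 - a ^ 2 / 2 + p) • Z ^ 2)
      = (e - a • Z - (b / 2) • Z ^ 2) + (P - p • Z ^ 2)
        - (1 / 2 : ℝ) • ((e - a • Z) * (e + a • Z)) := by
  rw [show b / 2 - a ^ 2 / 2 + p = 1 / 2 * b - 1 / 2 * a ^ 2 + p by ring,
    show b / 2 = 1 / 2 * b by ring]
  simp only [Algebra.smul_def, map_add, map_sub, map_mul, map_pow]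
  ring

/-- The same for the third order: the coefficient of `Z ^ 3` is the summand of `Γ₃`. Its term `-(a₁
+ a) * p` collects `-P * e₁` and `-e * P`. -/
theorem third_order_identity (Z e e₁ P Q : A) (a a₁ b c p m q : ℝ) :
    e + P - P * e₁ + Q - (1 / 2 : ℝ) • e ^ 2 - e * P + (1 / 3 : ℝ) • e ^ 3
        - (a • Z + (b / 2 - a ^ 2 / 2 + p) • Z ^ 2
          + (c / 6 - a * b / 2 + a ^ 3 / 3 - (a₁ + a) * p + m / 2 + q) • Z ^ 3)
      = (e - a • Z - (b / 2) • Z ^ 2 - (c / 6) • Z ^ 3)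
        + (P - p • Z ^ 2 - (m / 2) • Z ^ 3) - (P - p • Z ^ 2) * e₁
        - p • (Z ^ 2 * (e₁ - a₁ • Z)) + (Q - q • Z ^ 3)
        - a • (Z * (e - a • Z - (b / 2) • Z ^ 2)) - (1 / 2 : ℝ) • (e - a • Z) ^ 2
        - (P - p • Z ^ 2) * e - p • (Z ^ 2 * (e - a • Z))
        + (1 / 3 : ℝ) • ((e - a • Z) * (e ^ 2 + e * (a • Z) + (a • Z) ^ 2)) := by
  have h : (algebraMap ℝ A (1 / 2)) * 2 = 1 := by
    rw [← map_ofNat (algebraMap ℝ A) 2, ← map_mul]; norm_num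
  rw [show b / 2 - a ^ 2 / 2 + p = 1 / 2 * b - 1 / 2 * a ^ 2 + p by ring,
    show c / 6 - a * b / 2 + a ^ 3 / 3 - (a₁ + a) * p + m / 2 + q
      = 1 / 2 * (1 / 3) * c - 1 / 2 * a * b + 1 / 3 * a ^ 3 - (a₁ + a) * p + 1 / 2 * m + q by ring,
    show b / 2 = 1 / 2 * b by ring, show c / 6 = 1 / 2 * (1 / 3) * c by ring,
    show m / 2 = 1 / 2 * m by ring]
  simp only [Algebra.smul_def, map_add, map_sub, map_mul, map_pow]
  generalize algebraMap ℝ A (1 / 2) = g at h ⊢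
  linear_combination -(algebraMap ℝ A a * Z * (e - algebraMap ℝ A a * Z)) * h

end Algebra

section RealBounds

variable {a a₁ a₂ a₃ a₄ b b₁ B B₁ c d p₂ p₃ t t₁ t₂ t' q r r₁ r₂ : ℝ}

/-- `a`, `a₁`, `a₂` are the means at `k`, `k - 1`, `k - 2`; `b`, `c` the higher factorial moments
and `B` the mixed moment at `k`. Products of neighbouring means are not summands of the remainder at
`k`; they are dominated by cubes at the three indices, which is why `r₁` and `r₂` appear. -/
theorem second_order_bound (ha : 0 ≤ a) (ha₁ : 0 ≤ a₁) (ha₂ : 0 ≤ a₂) (hb : 0 ≤ b) (hB : 0 ≤ B)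
    (hc : 0 ≤ c) (hp : 0 ≤ p₂) (ht : 0 ≤ t)
    (h : a ^ 3 + a * b + c + (a₂ + a₁ + a) * B + p₂ + t ≤ r) (h₁ : a₁ ^ 3 ≤ r₁)
    (h₂ : a₂ ^ 3 ≤ r₂) :
    200 * (8 * a ^ 3 + 1600 * (B + a₁ * a) * (2 * a + 2 * a₁ + 640 * (a₁ + a) + 640 * (a₂ + a₁)))
      + (2 * c + 4 * p₂ + 4 * (a * b)) ≤ 10 ^ 9 * (r + r₁ + r₂) := by
  have h3 : a₁ * a * (2 * a + 2 * a₁ + 640 * (a₁ + a) + 640 * (a₂ + a₁))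
      ≤ 2564 * (a ^ 3 + a₁ ^ 3 + a₂ ^ 3) := by
    have k1 : a₁ * a * a ≤ a ^ 3 + a₁ ^ 3 := by
      nlinarith [mul_nonneg (add_nonneg ha ha₁) (sq_nonneg (a - a₁)), pow_nonneg ha 3,
        pow_nonneg ha₁ 3]
    have k2 : a₁ * a * a₁ ≤ a ^ 3 + a₁ ^ 3 := by
      nlinarith [mul_nonneg (add_nonneg ha ha₁) (sq_nonneg (a - a₁)), pow_nonneg ha 3,
        pow_nonneg ha₁ 3]
    have k3 : a₁ * a * a₂ ≤ a ^ 3 + a₁ ^ 3 + a₂ ^ 3 := by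
      have := mul_nonneg (add_nonneg (add_nonneg ha ha₁) ha₂)
        (add_nonneg (add_nonneg (sq_nonneg (a - a₁)) (sq_nonneg (a₁ - a₂))) (sq_nonneg (a - a₂)))
      nlinarith [mul_nonneg (mul_nonneg ha ha₁) ha₂]
    have := pow_nonneg ha₂ 3
    nlinarith
  have m1 := mul_nonneg ha hB
  have m2 := mul_nonneg ha₁ hB
  have m3 := mul_nonneg ha₂ hB
  have m4 := mul_nonneg ha hb
  have m5 := pow_nonneg ha 3
  have m6 := pow_nonneg ha₁ 3
  have m7 := pow_nonneg ha₂ 3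
  linarith

theorem add_mul_sq_le (B a a₁ : ℝ) : (B + a₁ * a) ^ 2 ≤ 2 * B ^ 2 + a₁ ^ 4 + a ^ 4 := by
  nlinarith [sq_nonneg (B - a₁ * a), sq_nonneg (a₁ ^ 2 - a ^ 2)]

/-- Products of means are again dominated by pure powers. The exception is `a * t₁`, the mean at `k`
times the triple ending at `k - 1`: the remainder at `k - 1` pairs this triple only with earlier
means, and `hq` supplies the product from the chain of length four. -/
theorem third_order_bound (ha : 0 ≤ a) (ha₁ : 0 ≤ a₁) (ha₂ : 0 ≤ a₂) (ha₃ : 0 ≤ a₃)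
    (ha₄ : 0 ≤ a₄) (hc : 0 ≤ c) (hd : 0 ≤ d) (hp₂ : 0 ≤ p₂) (hp₃ : 0 ≤ p₃) (ht : 0 ≤ t)
    (ht₁ : 0 ≤ t₁) (ht₂ : 0 ≤ t₂) (ht' : 0 ≤ t') (hq : a * t₁ ≤ q)
    (h : a ^ 4 + b ^ 2 + d + (a₂ + a₁ + a) * (c + p₂) + B ^ 2 + (a + a₁ + a₂ + a₃) * t + t' + p₃ + q
      ≤ r) (h₁ : a₁ ^ 4 + b₁ ^ 2 + B₁ ^ 2 + (a₁ + a₂ + a₃) * t₁ ≤ r₁)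
    (h₂ : a₂ ^ 4 + (a₂ + a₃ + a₄) * t₂ ≤ r₂) :
    20000 * (16 * a ^ 4 + 16 * a₁ ^ 4 + 2560000 * (B + a₁ * a) ^ 2 + 2560000 * (B₁ + a₂ * a₁) ^ 2
        + 921600 * (t * (a₂ + a₁ + a)) + 921600 * (t₁ * (a₃ + a₂ + a₁))
        + 921600 * (t₂ * (a₄ + a₃ + a₂))
        + 2400 * t * (2 * a + 2 * a₁ + 2 * a₂ + 640 * (a₁ + a) + 640 * (a₂ + a₁) + 640 * (a₃ + a₂))
        + 1536000 * ((a₁ + a) * t₁))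
      + (2 * d + 4 * p₃ + 8 * (p₂ * (a₁ + a)) + 8 * ((B + a₁ * a) * (b₁ + b)) + 8 * t'
        + 4 * (a * c) + 2 * b ^ 2 + 8 * (a ^ 2 * b)) ≤ 10 ^ 12 * (r + r₁ + r₂) := by
  have k1 := add_mul_sq_le B a a₁
  have k2 := add_mul_sq_le B₁ a₁ a₂
  have k3 : (B + a₁ * a) * (b₁ + b) ≤ (B + a₁ * a) ^ 2 + b₁ ^ 2 + b ^ 2 := by
    nlinarith [sq_nonneg (B + a₁ * a - (b₁ + b)), sq_nonneg (b₁ - b), sq_nonneg (B + a₁ * a)]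
  have k4 : a ^ 2 * b ≤ a ^ 4 + b ^ 2 := by
    nlinarith [sq_nonneg (a ^ 2 - b), sq_nonneg (a ^ 2), sq_nonneg b]
  have m1 := mul_nonneg ha ht
  have m2 := mul_nonneg ha₁ ht
  have m3 := mul_nonneg ha₂ ht
  have m4 := mul_nonneg ha₃ ht
  have m5 := mul_nonneg ha₁ ht₁
  have m6 := mul_nonneg ha₂ ht₁
  have m7 := mul_nonneg ha₃ ht₁
  have m8 := mul_nonneg ha₂ ht₂
  have m9 := mul_nonneg ha₃ ht₂
  have m10 := mul_nonneg ha₄ ht₂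
  have m11 := mul_nonneg ha hc
  have m12 := mul_nonneg ha₁ hc
  have m13 := mul_nonneg ha₂ hc
  have m14 := mul_nonneg ha hp₂
  have m15 := mul_nonneg ha₁ hp₂
  have m16 := mul_nonneg ha₂ hp₂
  have m17 : 0 ≤ a ^ 4 := by positivity
  have m18 : 0 ≤ a₁ ^ 4 := by positivity
  have m19 : 0 ≤ a₂ ^ 4 := by positivity
  have m20 := sq_nonneg b
  have m21 := sq_nonneg b₁
  have m22 := sq_nonneg B
  have m23 := sq_nonneg B₁
  have m24 : 0 ≤ a * t₁ := mul_nonneg ha ht₁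
  generalize (B + a₁ * a) ^ 2 = V at *
  generalize (B₁ + a₂ * a₁) ^ 2 = V₁ at *
  generalize (B + a₁ * a) * (b₁ + b) = V₂ at *
  linarith

end RealBounds

section Factors

variable {Ω : Type*} [mΩ : MeasurableSpace Ω]

/-- The factors of the jet of the characteristic function, together with their inverses. -/
structure JetFactors (P : Measure Ω) (x : ℤ → Ω → ℕ) (E : ℂ) (u v : ℤ → Jet) : Prop where
  inverse : ∀ k, v k * (1 + u k) = 1
  norm_u : ∀ k, ‖u k‖ ≤ 1 / 10
  norm_v : ∀ k, ‖v k‖ ≤ 10 / 9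
  prod : ∀ k : ℕ, chainMoment P x (fun _ m => (1 + jetZ E) ^ m) 1 k
    = ∏ i ∈ Finset.range k, (1 + u (i + 1))
  expansion : ∀ (k : ℤ) (N : ℕ), k < N → u k = ∑ L ∈ Finset.Ico 1 N,
    (∏ i ∈ Finset.range (L - 1), v (k - 1 - i)) * jetHat P x E (k + 1 - L) L

/-- The weight of the chains of length at least `q` which end at `k`. -/
noncomputable def tailNorm (P : Measure Ω) (x : ℤ → Ω → ℕ) (E : ℂ) (q N : ℕ) (k : ℤ) : ℝ :=
  ∑ L ∈ Finset.Ico q N, (10 / 9 : ℝ) ^ (L - 1) * ‖jetHat P x E (k + 1 - L) L‖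

variable {P : Measure Ω} {x : ℤ → Ω → ℕ} {E : ℂ} {u v : ℤ → Jet}

theorem tailNorm_nonneg (q N : ℕ) (k : ℤ) : 0 ≤ tailNorm P x E q N k :=
  Finset.sum_nonneg fun _ _ => by positivity

theorem JetFactors.norm_tail_le (h : JetFactors P x E u v) (q N : ℕ) (k : ℤ) :
    ‖∑ L ∈ Finset.Ico q N, (∏ i ∈ Finset.range (L - 1), v (k - 1 - i))
      * jetHat P x E (k + 1 - L) L‖ ≤ tailNorm P x E q N k := by
  refine (norm_sum_le _ _).trans (Finset.sum_le_sum fun L _ => (norm_mul_le _ _).trans ?_)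
  refine mul_le_mul_of_nonneg_right ?_ (norm_nonneg _)
  exact (norm_prod_le_pow _ _ fun i _ => h.norm_v _).trans (by simp)

theorem JetFactors.eq_add_tail₂ (h : JetFactors P x E u v) {N : ℕ} (hN : 3 ≤ N) {k : ℤ}
    (hk : k < N) : ∃ T, u k = jetHat P x E k 1 + jetHat P x E (k - 1) 2 * v (k - 1) + T ∧
      ‖T‖ ≤ tailNorm P x E 3 N k := by
  refine ⟨_, ?_, h.norm_tail_le 3 N k⟩
  rw [h.expansion k N hk, Finset.sum_eq_sum_Ico_succ_bot (by omega),
    Finset.sum_eq_sum_Ico_succ_bot (by omega), ← add_assoc]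
  congr 2
  · simp
  · rw [show k + 1 - ((1 + 1 : ℕ) : ℤ) = k - 1 by push_cast; ring]
    simp [mul_comm]

theorem JetFactors.eq_add_tail₃ (h : JetFactors P x E u v) {N : ℕ} (hN : 4 ≤ N) {k : ℤ}
    (hk : k < N) : ∃ T, u k = jetHat P x E k 1 + jetHat P x E (k - 1) 2 * v (k - 1)
      + jetHat P x E (k - 2) 3 * v (k - 1) * v (k - 2) + T ∧
      ‖T‖ ≤ tailNorm P x E 4 N k := by
  refine ⟨_, ?_, h.norm_tail_le 4 N k⟩
  rw [h.expansion k N hk, Finset.sum_eq_sum_Ico_succ_bot (by omega),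
    Finset.sum_eq_sum_Ico_succ_bot (by omega), Finset.sum_eq_sum_Ico_succ_bot (by omega),
    ← add_assoc, ← add_assoc]
  congr 2
  · congr 1
    · simp
    · rw [show k + 1 - ((1 + 1 : ℕ) : ℤ) = k - 1 by push_cast; ring]
      simp [mul_comm]
  · rw [show k + 1 - ((1 + 1 + 1 : ℕ) : ℤ) = k - 2 by push_cast; ring]
    simp [Finset.prod_range_succ, show k - 1 - 1 = k - 2 by ring]
    ring

variable [IsProbabilityMeasure P] (hx : OneDepSeq P x) (hE : ‖E‖ = 1)
include hx

theorem OneDepSeq.exists_jetFactors (hE : ‖E‖ = 1) : ∃ u v, JetFactors P x E u v := by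
  obtain ⟨u, v, h1, h2, h3, -, h5, h6⟩ := hx.exists_jet_factors hE
  exact ⟨u, v, h1, h2, h3, h5, h6⟩

omit [IsProbabilityMeasure P] in
theorem OneDepSeq.jetHat_eq_zero {j : ℤ} (hj : j ≤ 0) {L : ℕ} (hL : 0 < L) :
    jetHat P x E j L = 0 := by
  refine hatChain_eq_zero (fun M hM => ?_) hL
  rw [chainMoment, integral_eq_zero_of_ae (Filter.Eventually.of_forall fun ω => ?_)]
  refine Finset.prod_eq_zero (Finset.mem_range.2 hM) ?_
  simp [hx.zero j hj ω, jetY]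

omit [IsProbabilityMeasure P] in
theorem OneDepSeq.tailNorm_eq_zero {q : ℕ} (hq : 1 ≤ q) (N : ℕ) {k : ℤ} (hk : k ≤ 0) :
    tailNorm P x E q N k = 0 :=
  Finset.sum_eq_zero fun L hL => by
    have := Finset.mem_Ico.1 hL
    rw [hx.jetHat_eq_zero (by omega) (by omega), norm_zero, mul_zero]

include hE

theorem OneDepSeq.tailNorm_le {q : ℕ} (hq : 1 ≤ q) (N : ℕ) (k : ℤ) :
    tailNorm P x E q N k ≤ 1 / 10 :=
  (Finset.sum_le_sum_of_subset_of_nonneg (Finset.Ico_subset_Ico_left hq)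
    fun _ _ _ => by positivity).trans (hx.sum_norm_jetHat_le hE k N)

theorem OneDepSeq.norm_jetHat_le_one (k : ℤ) {L : ℕ} (hL : 1 ≤ L) : ‖jetHat P x E k L‖ ≤ 1 := by
  have h := hx.sum_norm_jetHat_le hE (k + L - 1) (L + 1)
  have h2 := (Finset.single_le_sum (f := fun M : ℕ => (10 / 9 : ℝ) ^ (M - 1)
    * ‖jetHat P x E (k + (L : ℕ) - 1 + 1 - (M : ℕ)) M‖) (s := Finset.Ico 1 (L + 1))
    (fun _ _ => by positivity) (Finset.mem_Ico.2 ⟨hL, Nat.lt_succ_self L⟩)).trans h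
  simp only [sub_add_cancel, add_sub_cancel_right] at h2
  have h3 : (1 : ℝ) ≤ (10 / 9) ^ (L - 1) := one_le_pow₀ (by norm_num)
  nlinarith [norm_nonneg (jetHat P x E k L)]

/-- All chains of length at least `q` together cost no more, up to a constant, than those of length
exactly `q`. The constant is `500 * 800`, from `sum_tail_le` and `OneDepSeq.norm_jetHat_le_window`.
-/
theorem OneDepSeq.sum_tailNorm_le {q : ℕ} (hq1 : 1 ≤ q) (hq : q ≤ 4) (n : ℤ) (N : ℕ) :
    ∑ k ∈ Finset.Icc 1 n, tailNorm P x E q N k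
      ≤ 400000 * ‖E - 1‖ ^ q * ∑ k ∈ Finset.Icc 1 n, plusMoment P x (k + 1 - q) q := by
  have h := sum_tail_le (H := fun j L => ‖jetHat P x E j L‖) (M := fun a => plusMoment P x a q) hq1 hq
    (K := 800 * ‖E - 1‖ ^ q) (by positivity) (fun a => plusMoment_nonneg a q)
    (fun a ha => hx.plusMoment_eq_zero ha (by omega))
    (fun j L hL => hx.norm_jetHat_le_window hE j hq1 hq hL) n N
  refine h.trans (le_of_eq ?_)
  ring

end Factors

end OneDependent

/-! ### Expansion of the sum of the logarithms. -/

namespace OneDependent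

section LogExpansion

variable {Ω : Type*} [mΩ : MeasurableSpace Ω]

/-- The summands of the first remainder. -/
noncomputable def remainder₁ (P : Measure Ω) (x : ℤ → Ω → ℕ) (k : ℤ) : ℝ :=
  factMoment P x 1 k ^ 3 + factMoment P x 1 k * factMoment P x 2 k + factMoment P x 3 k
    + (factMoment P x 1 (k - 2) + factMoment P x 1 (k - 1) + factMoment P x 1 k)
      * mixedMoment P x k
    + (plusFact₂ P x 2 1 k + plusFact₂ P x 1 2 k) + plusMoment P x (k - 2) 3

/-- The summands of the second remainder. -/
noncomputable def remainder₂ (P : Measure Ω) (x : ℤ → Ω → ℕ) (k : ℤ) : ℝ :=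
  factMoment P x 1 k ^ 4 + factMoment P x 2 k ^ 2 + factMoment P x 4 k
    + (factMoment P x 1 (k - 2) + factMoment P x 1 (k - 1) + factMoment P x 1 k)
      * (factMoment P x 3 k + (plusFact₂ P x 2 1 k + plusFact₂ P x 1 2 k))
    + mixedMoment P x k ^ 2
    + (factMoment P x 1 k + factMoment P x 1 (k - 1) + factMoment P x 1 (k - 2)
      + factMoment P x 1 (k - 3)) * plusMoment P x (k - 2) 3
    + (plusFact₃ P x 2 1 1 k + plusFact₃ P x 1 2 1 k + plusFact₃ P x 1 1 2 k)
    + (plusFact₂ P x 3 1 k + plusFact₂ P x 2 2 k + plusFact₂ P x 1 3 k)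
    + plusMoment P x (k - 3) 4

/-- The summands of `Γ₂`. -/
noncomputable def coeff₂ (P : Measure Ω) (x : ℤ → Ω → ℕ) (k : ℤ) : ℝ :=
  factMoment P x 2 k / 2 - factMoment P x 1 k ^ 2 / 2 + hatFact₂ P x 1 1 k

/-- The summands of `Γ₃`. -/
noncomputable def coeff₃ (P : Measure Ω) (x : ℤ → Ω → ℕ) (k : ℤ) : ℝ :=
  factMoment P x 3 k / 6 - factMoment P x 1 k * factMoment P x 2 k / 2 + factMoment P x 1 k ^ 3 / 3
    - (factMoment P x 1 (k - 1) + factMoment P x 1 k) * hatFact₂ P x 1 1 k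
    + (hatFact₂ P x 2 1 k + hatFact₂ P x 1 2 k) / 2 + hatFact₃ P x k

variable {P : Measure Ω} {x : ℤ → Ω → ℕ} {E : ℂ} {u v : ℤ → Jet}

theorem plusFact₂_nonneg (a b : ℕ) (k : ℤ) : 0 ≤ plusFact₂ P x a b k :=
  add_nonneg (integral_nonneg fun _ => by positivity)
    (mul_nonneg (factMoment_nonneg _ _) (factMoment_nonneg _ _))

theorem plusFact₃_nonneg (a b c : ℕ) (k : ℤ) : 0 ≤ plusFact₃ P x a b c k := by
  have nn : ∀ (d e : ℕ) (i j : ℤ),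
      0 ≤ ∫ ω, ((x i ω).descFactorial d : ℝ) * (x j ω).descFactorial e ∂P :=
    fun d e i j => integral_nonneg fun _ => by positivity
  have h1 := factMoment_nonneg (P := P) (x := x) a (k - 2)
  have h2 := factMoment_nonneg (P := P) (x := x) b (k - 1)
  have h3 := factMoment_nonneg (P := P) (x := x) c k
  exact add_nonneg (add_nonneg (integral_nonneg fun _ => by positivity) (mul_nonneg h1 (nn _ _ _ _)))
    (mul_nonneg (add_nonneg (nn _ _ _ _) (mul_nonneg h1 h2)) h3)

theorem plusFact₂_one_one (k : ℤ) : plusFact₂ P x 1 1 k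
    = mixedMoment P x k + factMoment P x 1 (k - 1) * factMoment P x 1 k := by
  simp [plusFact₂, mixedMoment]

theorem plusMoment_two' (k : ℤ) : plusMoment P x (k - 1) 2
    = mixedMoment P x k + factMoment P x 1 (k - 1) * factMoment P x 1 k := by
  rw [plusMoment_two, sub_add_cancel]

theorem remainder₁_nonneg (k : ℤ) : 0 ≤ remainder₁ P x k := by
  have h : ∀ j k, 0 ≤ factMoment P x j k := factMoment_nonneg
  have h1 := mixedMoment_nonneg (P := P) (x := x) k
  have h2 := plusFact₂_nonneg (P := P) (x := x) 2 1 k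
  have h3 := plusFact₂_nonneg (P := P) (x := x) 1 2 k
  have h4 := plusMoment_nonneg (P := P) (x := x) (k - 2) 3
  have a1 := h 1 k
  have a2 := h 2 k
  have a3 := h 3 k
  have a4 := h 1 (k - 1)
  have a5 := h 1 (k - 2)
  unfold remainder₁
  positivity

theorem remainder₂_nonneg (k : ℤ) : 0 ≤ remainder₂ P x k := by
  have h : ∀ j k, 0 ≤ factMoment P x j k := factMoment_nonneg
  have h' : ∀ a b, 0 ≤ plusFact₂ P x a b k := fun a b => plusFact₂_nonneg a b k
  have h'' : ∀ a b c, 0 ≤ plusFact₃ P x a b c k := fun a b c => plusFact₃_nonneg a b c k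
  have h1 := mixedMoment_nonneg (P := P) (x := x) k
  have h4 := plusMoment_nonneg (P := P) (x := x) (k - 2) 3
  have h5 := plusMoment_nonneg (P := P) (x := x) (k - 3) 4
  have a1 := h 1 k
  have a2 := h 2 k
  have a3 := h 3 k
  have a4 := h 1 (k - 1)
  have a5 := h 1 (k - 2)
  have a6 := h 1 (k - 3)
  have a7 := h 4 k
  have b1 := h' 2 1
  have b2 := h' 1 2
  have b3 := h' 2 2
  have b4 := h' 3 1
  have b5 := h' 1 3
  have c1 := h'' 2 1 1
  have c2 := h'' 1 2 1
  have c3 := h'' 1 1 2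
  unfold remainder₂
  positivity

/-- The left side is one summand of the recursion for the chain of length four, all of whose
summands are nonnegative. It provides the hypothesis `hq` of `third_order_bound`. -/
theorem plusMoment_three_mul_le (k : ℤ) :
    factMoment P x 1 k * plusMoment P x (k - 3) 3 ≤ plusMoment P x (k - 3) 4 := by
  have hc : ∀ i L, 0 ≤ chainMoment P x (fun _ m => (m : ℝ)) i L :=
    chainMoment_nonneg fun _ _ => Nat.cast_nonneg _
  rw [← plusMoment_one k, plusMoment, plusMoment, plusMoment, plusChain_one, plusChain_four,
    plusChain_three, show k - 3 + 3 = k by ring]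
  set c := chainMoment P x fun _ m => (m : ℝ)
  have h1 := hc (k - 3) 4
  have h2 := mul_nonneg (hc (k - 3) 1) (hc (k - 3 + 1) 3)
  have h3 := mul_nonneg (add_nonneg (hc (k - 3) 2) (mul_nonneg (hc (k - 3) 1) (hc (k - 3 + 1) 1)))
    (hc (k - 3 + 2) 2)
  linarith

theorem half_smul_eq (y : Jet) : (1 / 2 : ℂ) • y = (1 / 2 : ℝ) • y := by
  ext <;> simp

theorem third_smul_eq (y : Jet) : (1 / 3 : ℂ) • y = (1 / 3 : ℝ) • y := by
  ext <;> simp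

variable [IsProbabilityMeasure P] (hx : OneDepSeq P x)
include hx

theorem OneDepSeq.abs_hatFact₂_le (k : ℤ) : |hatFact₂ P x 1 1 k|
    ≤ mixedMoment P x k + factMoment P x 1 (k - 1) * factMoment P x 1 k := by
  have h := hx.norm_cov₂_le (a := 1) (b := 1) (by norm_num) zero_le_one
    (φ := fun m => (m.descFactorial 1 : ℝ)) (ψ := fun m => (m.descFactorial 1 : ℝ)) (β := 1)
    (fun m => by simp) (fun m => by simp) k
  rwa [one_mul, one_mul, plusFact₂_one_one] at h

omit [IsProbabilityMeasure P] in
theorem OneDepSeq.remainder₁_eq_zero {k : ℤ} (hk : k ≤ 0) : remainder₁ P x k = 0 := by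
  have h : ∀ j, 0 < j → factMoment P x j k = 0 := fun j hj => hx.factMoment_eq_zero hj hk
  have h1 : ∀ a b, 0 < b → plusFact₂ P x a b k = 0 := fun a b hb => by
    obtain ⟨i, rfl⟩ : ∃ i, b = i + 1 := ⟨b - 1, by omega⟩
    simp [plusFact₂, h, hx.zero k hk]
  simp [remainder₁, h, h1, hx.mixedMoment_eq_zero (show k ≤ 1 by omega),
    hx.plusMoment_eq_zero (show k - 2 ≤ 0 by omega)]

omit [IsProbabilityMeasure P] in
theorem OneDepSeq.remainder₂_eq_zero {k : ℤ} (hk : k ≤ 0) : remainder₂ P x k = 0 := by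
  have h : ∀ j, 0 < j → factMoment P x j k = 0 := fun j hj => hx.factMoment_eq_zero hj hk
  have h1 : ∀ a b, 0 < b → plusFact₂ P x a b k = 0 := fun a b hb => by
    obtain ⟨i, rfl⟩ : ∃ i, b = i + 1 := ⟨b - 1, by omega⟩
    simp [plusFact₂, h, hx.zero k hk]
  have h2 : ∀ a b c, 0 < c → plusFact₃ P x a b c k = 0 := fun a b c hc => by
    obtain ⟨i, rfl⟩ : ∃ i, c = i + 1 := ⟨c - 1, by omega⟩
    simp [plusFact₃, h, hx.zero k hk]
  simp [remainder₂, h, h1, h2, hx.mixedMoment_eq_zero (show k ≤ 1 by omega),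
    hx.plusMoment_eq_zero (show k - 2 ≤ 0 by omega),
    hx.plusMoment_eq_zero (show k - 3 ≤ 0 by omega)]

variable (hE : ‖E‖ = 1)
include hE

/-- Two sizes of the same quantity, from windows of length two and of length one. The second, with a
single power of `‖E - 1‖`, is used where the pair multiplies another small quantity. -/
theorem OneDepSeq.norm_pair_le (k : ℤ) :
    ‖jetHat P x E (k - 1) 2‖ ≤ 1600 * ‖E - 1‖ ^ 2
      * (mixedMoment P x k + factMoment P x 1 (k - 1) * factMoment P x 1 k) ∧
    ‖jetHat P x E (k - 1) 2‖
      ≤ 640 * ‖E - 1‖ * (factMoment P x 1 (k - 1) + factMoment P x 1 k) := by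
  have h1 := hx.norm_jetHat_le_window hE (k - 1) (L := 2) (q := 2) (by norm_num) (by norm_num) le_rfl
  have h2 := hx.norm_jetHat_le_window hE (k - 1) (L := 2) (q := 1) (by norm_num) (by norm_num)
    (by norm_num)
  norm_num [Finset.sum_range_succ, plusMoment_one] at h1 h2
  rw [plusMoment_two'] at h1
  exact ⟨h1.trans (le_of_eq (by ring)), h2.trans (le_of_eq (by ring))⟩

theorem OneDepSeq.norm_triple_le (k : ℤ) :
    ‖jetHat P x E (k - 2) 3‖ ≤ 2400 * ‖E - 1‖ ^ 3 * plusMoment P x (k - 2) 3 ∧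
    ‖jetHat P x E (k - 2) 3‖ ≤ 384 * ‖E - 1‖
      * (factMoment P x 1 (k - 2) + factMoment P x 1 (k - 1) + factMoment P x 1 k) := by
  have h1 := hx.norm_jetHat_le_window hE (k - 2) (L := 3) (q := 3) (by norm_num) (by norm_num) le_rfl
  have h2 := hx.norm_jetHat_le_window hE (k - 2) (L := 3) (q := 1) (by norm_num) (by norm_num)
    (by norm_num)
  norm_num [Finset.sum_range_succ, plusMoment_one] at h1 h2
  rw [show k - 2 + 1 = k - 1 by ring] at h2
  exact ⟨h1.trans (le_of_eq (by ring)), h2.trans (le_of_eq (by ring))⟩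

/-- The index `k - 1` enters through the inverse factor after the pair, and `k - 2` through the pair
that ends at `k - 1`. The powers of `‖E - 1‖` are collected first; the rest is `second_order_bound`.
-/
theorem OneDepSeq.norm_logJet_sub_le₂ (h : JetFactors P x E u v) {N : ℕ} (hN : 3 ≤ N) {k : ℤ}
    (hk : k < N) :
    ‖logJet (u k) - (factMoment P x 1 k • jetZ E + coeff₂ P x k • jetZ E ^ 2)‖
      ≤ 10 ^ 9 * ‖E - 1‖ ^ 3 * (remainder₁ P x k + remainder₁ P x (k - 1) + remainder₁ P x (k - 2))
        + 200 * (tailNorm P x E 3 N k + tailNorm P x E 3 N (k - 1)) := by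
  obtain ⟨T, hT, hTn⟩ := h.eq_add_tail₂ hN hk
  obtain ⟨T₁, hT₁, hTn₁⟩ := h.eq_add_tail₂ hN (show k - 1 < N by omega)
  have hlog := logJet_second_order (h.norm_v (k - 1)) (h.norm_v (k - 1 - 1)) (h.inverse (k - 1)) hT
    hT₁ (h.norm_u k) (hx.norm_jetHat_le_one hE k le_rfl)
    (hx.norm_jetHat_le_one hE (k - 1) one_le_two)
    (hTn.trans ((hx.tailNorm_le hE (by norm_num) N k).trans (by norm_num)))
  have hid := second_order_identity (jetZ E) (jetHat P x E k 1) (jetHat P x E (k - 1) 2)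
    (factMoment P x 1 k) (factMoment P x 2 k) (hatFact₂ P x 1 1 k)
  rw [half_smul_eq] at hlog
  have hp := hx.norm_pair_le hE k
  have hp₁ := (hx.norm_pair_le hE (k - 1)).2
  have he := hx.jetHat_one_expansion hE k
  have he₁ := (hx.jetHat_one_expansion hE (k - 1)).1
  have hpp := hx.norm_jetHat_two_sub_le hE k
  rw [show k - 1 - 1 = k - 2 by ring] at hp₁ hlog
  have hz := norm_jetZ hE
  rw [coeff₂, ← sub_add_sub_cancel _ (jetHat P x E k 1 + jetHat P x E (k - 1) 2
    - (1 / 2 : ℝ) • jetHat P x E k 1 ^ 2), hid]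
  have rem : ∀ j, factMoment P x 1 j ^ 3 ≤ remainder₁ P x j := fun j => by
    have h0 : ∀ i k, 0 ≤ factMoment P x i k := factMoment_nonneg
    have h1 := mul_nonneg (h0 1 j) (h0 2 j)
    have h2 := mul_nonneg (add_nonneg (add_nonneg (h0 1 (j - 2)) (h0 1 (j - 1))) (h0 1 j))
      (mixedMoment_nonneg (P := P) (x := x) j)
    have h3 := plusFact₂_nonneg (P := P) (x := x) 2 1 j
    have h4 := plusFact₂_nonneg (P := P) (x := x) 1 2 j
    have h5 := plusMoment_nonneg (P := P) (x := x) (j - 2) 3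
    have h6 := h0 3 j
    rw [remainder₁]; linarith
  have hr := second_order_bound (factMoment_nonneg 1 k) (factMoment_nonneg 1 (k - 1))
    (factMoment_nonneg 1 (k - 2)) (factMoment_nonneg 2 k) (mixedMoment_nonneg k)
    (factMoment_nonneg 3 k) (add_nonneg (plusFact₂_nonneg 2 1 k) (plusFact₂_nonneg 1 2 k))
    (plusMoment_nonneg (k - 2) 3) (le_refl (remainder₁ P x k)) (rem (k - 1)) (rem (k - 2))
  have na := factMoment_nonneg (P := P) (x := x) 1 k
  have nb := factMoment_nonneg (P := P) (x := x) 2 k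
  have nB := mixedMoment_nonneg (P := P) (x := x) k
  have na₁ := factMoment_nonneg (P := P) (x := x) 1 (k - 1)
  set a := factMoment P x 1 k
  set a₁ := factMoment P x 1 (k - 1)
  set a₂ := factMoment P x 1 (k - 2)
  set w := ‖E - 1‖ with hw
  have nw : 0 ≤ w := norm_nonneg _
  have b1 : ‖jetHat P x E k 1‖ ^ 3 ≤ 8 * w ^ 3 * a ^ 3 :=
    (pow_le_pow_left₀ (norm_nonneg _) he.1 3).trans (le_of_eq (by ring))
  have b2 : ‖jetHat P x E (k - 1) 2‖ * (‖jetHat P x E k 1‖ + ‖jetHat P x E (k - 1) 1‖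
      + ‖jetHat P x E (k - 1) 2‖ + ‖jetHat P x E (k - 2) 2‖)
      ≤ w ^ 3 * (1600 * (mixedMoment P x k + a₁ * a)
        * (2 * a + 2 * a₁ + 640 * (a₁ + a) + 640 * (a₂ + a₁))) := by
    have := mul_le_mul hp.1 (add_le_add (add_le_add (add_le_add he.1 he₁) hp.2) hp₁)
      (by positivity) (by positivity)
    refine this.trans (le_of_eq (by ring))
  have b3 : ‖(1 / 2 : ℝ) • ((jetHat P x E k 1 - a • jetZ E) * (jetHat P x E k 1 + a • jetZ E))‖
      ≤ w ^ 3 * (4 * (a * factMoment P x 2 k)) := by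
    have h1 : ‖a • jetZ E‖ ≤ a * (2 * w) := by
      rw [norm_smul, Real.norm_of_nonneg na]; exact mul_le_mul_of_nonneg_left hz na
    rw [norm_smul]
    have h2 := (norm_mul_le (jetHat P x E k 1 - a • jetZ E) (jetHat P x E k 1 + a • jetZ E)).trans
      (mul_le_mul he.2.1 (norm_add_le_of_le he.1 h1) (norm_nonneg _) (by positivity))
    norm_num
    linarith
  have b4 := norm_add_le_of_le hlog (norm_sub_le_of_le (norm_add_le_of_le he.2.2.1 hpp) b3)
  have hr' := mul_le_mul_of_nonneg_left hr (pow_nonneg nw 3)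
  linarith

theorem OneDepSeq.norm_logJet_sub_le₃ (h : JetFactors P x E u v) {N : ℕ} (hN : 4 ≤ N) {k : ℤ}
    (hk : k < N) :
    ‖logJet (u k) - (factMoment P x 1 k • jetZ E + coeff₂ P x k • jetZ E ^ 2
        + coeff₃ P x k • jetZ E ^ 3)‖
      ≤ 10 ^ 12 * ‖E - 1‖ ^ 4 * (remainder₂ P x k + remainder₂ P x (k - 1) + remainder₂ P x (k - 2))
        + 20000 * (tailNorm P x E 4 N k + tailNorm P x E 4 N (k - 1)
          + tailNorm P x E 4 N (k - 2)) := by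
  have i1 : k - 1 - 1 = k - 2 := by ring
  have i2 : k - 1 - 2 = k - 3 := by ring
  have i3 : k - 2 - 1 = k - 3 := by ring
  have i4 : k - 2 - 2 = k - 4 := by ring
  have i5 : k - 1 - 3 = k - 4 := by ring
  obtain ⟨T, hT, hTn⟩ := h.eq_add_tail₃ hN hk
  obtain ⟨T₁, hT₁, hTn₁⟩ := h.eq_add_tail₃ hN (show k - 1 < N by omega)
  obtain ⟨T₂, hT₂, hTn₂⟩ := h.eq_add_tail₃ hN (show k - 2 < N by omega)
  rw [i1, i2] at hT₁
  rw [i3, i4] at hT₂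
  have hlog := logJet_third_order (h.norm_v (k - 1)) (h.norm_v (k - 2)) (h.norm_v (k - 3))
    (h.norm_v (k - 4)) (h.inverse (k - 1)) (h.inverse (k - 2)) hT hT₁ hT₂ (h.norm_u k)
    (hx.norm_jetHat_le_one hE k le_rfl) (hx.norm_jetHat_le_one hE (k - 1) le_rfl)
    (hx.norm_jetHat_le_one hE (k - 1) one_le_two) (hx.norm_jetHat_le_one hE (k - 2) one_le_two)
    (hx.norm_jetHat_le_one hE (k - 2) (by norm_num))
    (hx.norm_jetHat_le_one hE (k - 3) (by norm_num))
    (hTn.trans ((hx.tailNorm_le hE (by norm_num) N k).trans (by norm_num)))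
    (hTn₁.trans ((hx.tailNorm_le hE (by norm_num) N (k - 1)).trans (by norm_num)))
  have hid := third_order_identity (jetZ E) (jetHat P x E k 1) (jetHat P x E (k - 1) 1)
    (jetHat P x E (k - 1) 2) (jetHat P x E (k - 2) 3) (factMoment P x 1 k)
    (factMoment P x 1 (k - 1)) (factMoment P x 2 k) (factMoment P x 3 k) (hatFact₂ P x 1 1 k)
    (hatFact₂ P x 2 1 k + hatFact₂ P x 1 2 k) (hatFact₃ P x k)
  rw [half_smul_eq, third_smul_eq] at hlog
  have hp := hx.norm_pair_le hE k
  have hp₁ := hx.norm_pair_le hE (k - 1)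
  have hp₂ := hx.norm_pair_le hE (k - 2)
  have hq := hx.norm_triple_le hE k
  have hq₁ := hx.norm_triple_le hE (k - 1)
  have hq₂ := hx.norm_triple_le hE (k - 2)
  have he := hx.jetHat_one_expansion hE k
  have he₁ := hx.jetHat_one_expansion hE (k - 1)
  have he₂ := hx.jetHat_one_expansion hE (k - 2)
  have hpp := hx.norm_jetHat_two_sub_le hE k
  have hpp' := hx.norm_jetHat_two_sub_le' hE k
  have hqq := hx.norm_jetHat_three_sub_le hE k
  have hh := hx.abs_hatFact₂_le k
  rw [i1, i2] at hq₁
  rw [i3, i4] at hq₂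
  rw [i1] at hp₁
  rw [i3] at hp₂
  have hz := norm_jetZ hE
  rw [coeff₂, coeff₃, ← sub_add_sub_cancel _ (jetHat P x E k 1 + jetHat P x E (k - 1) 2
    - jetHat P x E (k - 1) 2 * jetHat P x E (k - 1) 1 + jetHat P x E (k - 2) 3
    - (1 / 2 : ℝ) • jetHat P x E k 1 ^ 2 - jetHat P x E k 1 * jetHat P x E (k - 1) 2
    + (1 / 3 : ℝ) • jetHat P x E k 1 ^ 3), hid]
  have na : ∀ i k, 0 ≤ factMoment P x i k := factMoment_nonneg
  have nB := mixedMoment_nonneg (P := P) (x := x)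
  have nt : ∀ k, 0 ≤ plusMoment P x k 3 := fun k => plusMoment_nonneg k 3
  have np := plusFact₂_nonneg (P := P) (x := x)
  have np3 := plusFact₃_nonneg (P := P) (x := x)
  have rem : ∀ j, factMoment P x 1 j ^ 4 + factMoment P x 2 j ^ 2 + mixedMoment P x j ^ 2
      + (factMoment P x 1 j + factMoment P x 1 (j - 1) + factMoment P x 1 (j - 2))
        * plusMoment P x (j - 2) 3 ≤ remainder₂ P x j := fun j => by
    have h2 := mul_nonneg (add_nonneg (add_nonneg (na 1 (j - 2)) (na 1 (j - 1))) (na 1 j))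
      (add_nonneg (na 3 j) (add_nonneg (np 2 1 j) (np 1 2 j)))
    have h3 := add_nonneg (add_nonneg (np3 2 1 1 j) (np3 1 2 1 j)) (np3 1 1 2 j)
    have h4 := add_nonneg (add_nonneg (np 3 1 j) (np 2 2 j)) (np 1 3 j)
    have h5 := plusMoment_nonneg (P := P) (x := x) (j - 3) 4
    have h6 := na 4 j
    have h7 := mul_nonneg (na 1 (j - 3)) (nt (j - 2))
    rw [remainder₂]; linarith
  have rem₁ := rem (k - 1)
  have rem₂ := rem (k - 2)
  rw [i1, i2] at rem₁
  rw [i3, i4] at rem₂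
  have hr := third_order_bound (b := factMoment P x 2 k) (b₁ := factMoment P x 2 (k - 1))
    (B := mixedMoment P x k) (B₁ := mixedMoment P x (k - 1)) (na 1 k) (na 1 (k - 1)) (na 1 (k - 2))
    (na 1 (k - 3)) (na 1 (k - 4)) (na 3 k) (na 4 k) (add_nonneg (np 2 1 k) (np 1 2 k))
    (add_nonneg (add_nonneg (np 3 1 k) (np 2 2 k)) (np 1 3 k)) (nt (k - 2)) (nt (k - 3)) (nt (k - 4))
    (add_nonneg (add_nonneg (np3 2 1 1 k) (np3 1 2 1 k)) (np3 1 1 2 k)) (plusMoment_three_mul_le k)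
    (r := remainder₂ P x k) (by rw [remainder₂]) rem₁
    ((by
      have := sq_nonneg (factMoment P x 2 (k - 2))
      have := sq_nonneg (mixedMoment P x (k - 2))
      linarith : _ ≤ _).trans rem₂)
  generalize hpl₂ : plusFact₂ P x 2 1 k + plusFact₂ P x 1 2 k = p₂ at *
  generalize hpl₃ : plusFact₂ P x 3 1 k + plusFact₂ P x 2 2 k + plusFact₂ P x 1 3 k = p₃ at *
  generalize hpl₄ : plusFact₃ P x 2 1 1 k + plusFact₃ P x 1 2 1 k + plusFact₃ P x 1 1 2 k = t' at *
  have np₂ : 0 ≤ p₂ := by rw [← hpl₂]; exact add_nonneg (np _ _ _) (np _ _ _)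
  clear rem rem₁ rem₂ hid hT hT₁ hT₂
  have na0 := na 1 k
  have na1 := na 1 (k - 1)
  have na2 := na 1 (k - 2)
  have na3 := na 1 (k - 3)
  have nb0 := na 2 k
  have nb1 := na 2 (k - 1)
  have nc0 := na 3 k
  have nB0 := nB k
  have nB1 := nB (k - 1)
  have nt0 := nt (k - 2)
  have nt1 := nt (k - 3)
  have nt2 := nt (k - 4)
  have nw : 0 ≤ ‖E - 1‖ := norm_nonneg _
  generalize ‖E - 1‖ = w at *
  generalize factMoment P x 1 k = a at *
  generalize factMoment P x 1 (k - 1) = a₁ at *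
  generalize factMoment P x 1 (k - 2) = a₂ at *
  generalize factMoment P x 1 (k - 3) = a₃ at *
  generalize factMoment P x 1 (k - 4) = a₄ at *
  generalize factMoment P x 2 k = b at *
  generalize factMoment P x 2 (k - 1) = b₁ at *
  generalize factMoment P x 3 k = c at *
  generalize factMoment P x 4 k = d at *
  generalize mixedMoment P x k = B at *
  generalize mixedMoment P x (k - 1) = B₁ at *
  generalize plusMoment P x (k - 2) 3 = t at *
  generalize plusMoment P x (k - 3) 3 = t₁ at *
  generalize plusMoment P x (k - 4) 3 = t₂ at *
  generalize hatFact₂ P x 1 1 k = p at *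
  generalize hatFact₃ P x k = q at *
  generalize hatFact₂ P x 2 1 k + hatFact₂ P x 1 2 k = m at *
  generalize jetHat P x E k 1 = e at *
  generalize jetHat P x E (k - 1) 1 = e₁ at *
  generalize jetHat P x E (k - 2) 1 = e₂ at *
  generalize jetHat P x E (k - 1) 2 = y at *
  generalize jetHat P x E (k - 2) 2 = y₁ at *
  generalize jetHat P x E (k - 3) 2 = y₂ at *
  generalize jetHat P x E (k - 2) 3 = z at *
  generalize jetHat P x E (k - 3) 3 = z₁ at *
  generalize jetHat P x E (k - 4) 3 = z₂ at *
  have sq_le : ∀ {s α β : ℝ}, 0 ≤ s → s ≤ α → s ≤ β → s ^ 2 ≤ α * β := fun h0 h1 h2 => by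
    rw [sq]; exact mul_le_mul h1 h2 h0 (h0.trans h1)
  have mul_le : ∀ {f g : Jet} {α β : ℝ}, ‖f‖ ≤ α → ‖g‖ ≤ β → ‖f * g‖ ≤ α * β := fun h1 h2 =>
    (norm_mul_le _ _).trans (mul_le_mul h1 h2 (norm_nonneg _) ((norm_nonneg _).trans h1))
  have smul_le : ∀ {r : ℝ} {f : Jet} {α β : ℝ}, |r| ≤ α → ‖f‖ ≤ β → ‖r • f‖ ≤ α * β :=
    fun h1 h2 => by
      rw [norm_smul]
      exact mul_le_mul h1 h2 (norm_nonneg _) ((abs_nonneg _).trans h1)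
  have haZ : ‖a • jetZ E‖ ≤ a * (2 * w) := smul_le (abs_of_nonneg na0).le hz
  have hZ2 : ‖jetZ E ^ 2‖ ≤ 2 * w * (2 * w) := by rw [sq]; exact mul_le hz hz
  have hlog' : thirdError ‖e‖ ‖e₁‖ ‖e₂‖ ‖y‖ ‖y₁‖ ‖y₂‖ ‖z‖ ‖z₁‖ ‖z₂‖ ‖T‖ ‖T₁‖ ‖T₂‖
      ≤ w ^ 4 * (16 * a ^ 4 + 16 * a₁ ^ 4 + 2560000 * (B + a₁ * a) ^ 2
        + 2560000 * (B₁ + a₂ * a₁) ^ 2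
        + 921600 * (t * (a₂ + a₁ + a)) + 921600 * (t₁ * (a₃ + a₂ + a₁))
        + 921600 * (t₂ * (a₄ + a₃ + a₂))
        + 2400 * t * (2 * a + 2 * a₁ + 2 * a₂ + 640 * (a₁ + a) + 640 * (a₂ + a₁) + 640 * (a₃ + a₂))
        + 1536000 * ((a₁ + a) * t₁))
        + (tailNorm P x E 4 N k + tailNorm P x E 4 N (k - 1) + tailNorm P x E 4 N (k - 2)) := by
    have c1 := pow_le_pow_left₀ (norm_nonneg _) he.1 4
    have c2 := pow_le_pow_left₀ (norm_nonneg _) he₁.1 4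
    have c3 := pow_le_pow_left₀ (norm_nonneg _) hp.1 2
    have c4 := pow_le_pow_left₀ (norm_nonneg _) hp₁.1 2
    -- In the square of a triple one factor is bounded with the third power of `w` and the other
    -- with the first, which produces the required fourth power.
    have c5 := sq_le (norm_nonneg _) hq.1 hq.2
    have c6 := sq_le (norm_nonneg _) hq₁.1 hq₁.2
    have c7 := sq_le (norm_nonneg _) hq₂.1 hq₂.2
    have c8 := mul_le_mul hq.1 (add_le_add (add_le_add (add_le_add (add_le_add (add_le_add he.1
      he₁.1) he₂.1) hp.2) hp₁.2) hp₂.2) (by positivity) (by positivity)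
    have c9 := mul_le_mul hp.2 hq₁.1 (norm_nonneg _) (by positivity)
    rw [thirdError]
    linarith
  have d1 := mul_le hpp he₁.1
  have d2 := smul_le hh (mul_le hZ2 he₁.2.1)
  have d3 := smul_le (abs_of_nonneg na0).le (mul_le hz he.2.2.1)
  have d4 : ‖(1 / 2 : ℝ) • (e - a • jetZ E) ^ 2‖ ≤ 1 / 2 * ((2 * w ^ 2 * b) * (2 * w ^ 2 * b)) :=
    smul_le (by norm_num) (by rw [sq]; exact mul_le he.2.1 he.2.1)
  have d5 := mul_le hpp he.1
  have d6 := smul_le hh (mul_le hZ2 he.2.1)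
  have d7 : ‖(1 / 3 : ℝ) • ((e - a • jetZ E) * (e ^ 2 + e * (a • jetZ E) + (a • jetZ E) ^ 2))‖
      ≤ 1 / 3 * (2 * w ^ 2 * b * ((2 * w * a) * (2 * w * a) + 2 * w * a * (a * (2 * w))
        + a * (2 * w) * (a * (2 * w)))) := by
    refine smul_le (by norm_num) (mul_le he.2.1 (norm_add_le_of_le (norm_add_le_of_le ?_
      (mul_le he.1 haZ)) ?_))
    · rw [sq]; exact mul_le he.1 he.1
    · rw [sq]; exact mul_le haZ haZ
  have d8 := norm_add_le_of_le (norm_sub_le_of_le (norm_sub_le_of_le (norm_sub_le_of_le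
    (norm_sub_le_of_le (norm_add_le_of_le (norm_sub_le_of_le (norm_sub_le_of_le
    (norm_add_le_of_le he.2.2.2 hpp') d1) d2) hqq) d3) d4) d5) d6) d7
  have d9 := norm_add_le_of_le hlog d8
  have hr' := mul_le_mul_of_nonneg_left hr (pow_nonneg nw 4)
  linarith

/-- The first order expansion of the logarithm of the characteristic function. -/
theorem OneDepSeq.sum_norm_logJet_sub_le₂ (h : JetFactors P x E u v) (n : ℕ) :
    ∑ k ∈ Finset.Icc (1 : ℤ) n,
        ‖logJet (u k) - (factMoment P x 1 k • jetZ E + coeff₂ P x k • jetZ E ^ 2)‖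
      ≤ 10 ^ 10 * ‖E - 1‖ ^ 3 * ∑ k ∈ Finset.Icc (1 : ℤ) n, remainder₁ P x k := by
  have h1 : ∀ k ∈ Finset.Icc (1 : ℤ) n, _ := fun k hk =>
    hx.norm_logJet_sub_le₂ hE h (N := n + 3) (by omega) (k := k)
      (by have := Finset.mem_Icc.1 hk; push_cast; omega)
  refine (Finset.sum_le_sum h1).trans ?_
  rw [Finset.sum_add_distrib, ← Finset.mul_sum, ← Finset.mul_sum, Finset.sum_add_distrib,
    Finset.sum_add_distrib, Finset.sum_add_distrib]
  -- Sums over `k - 1` and `k - 2` reduce to the sum over `k`, since all terms vanish at nonpositive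
  -- indices. The tails reduce to windows of length three, which are themselves summands of
  -- `remainder₁`.
  have s1 := sum_shift_le remainder₁_nonneg (fun k hk => hx.remainder₁_eq_zero hk) n 1
  have s2 := sum_shift_le remainder₁_nonneg (fun k hk => hx.remainder₁_eq_zero hk) n 2
  have s3 := sum_shift_le (fun k => tailNorm_nonneg (P := P) (x := x) (E := E) 3 (n + 3) k)
    (fun k hk => hx.tailNorm_eq_zero (by norm_num) _ hk) n 1
  have s4 := hx.sum_tailNorm_le hE (q := 3) (by norm_num) (by norm_num) n (n + 3)
  have s5 : ∑ k ∈ Finset.Icc (1 : ℤ) n, plusMoment P x (k + 1 - (3 : ℕ)) 3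
      ≤ ∑ k ∈ Finset.Icc (1 : ℤ) n, remainder₁ P x k := by
    refine Finset.sum_le_sum fun k _ => ?_
    rw [show k + 1 - ((3 : ℕ) : ℤ) = k - 2 by push_cast; ring]
    have na : ∀ i k, 0 ≤ factMoment P x i k := factMoment_nonneg
    have m1 := pow_nonneg (na 1 k) 3
    have m2 := mul_nonneg (na 1 k) (na 2 k)
    have m3 := na 3 k
    have m4 := mul_nonneg (add_nonneg (add_nonneg (na 1 (k - 2)) (na 1 (k - 1))) (na 1 k))
      (mixedMoment_nonneg (P := P) (x := x) k)
    have m5 := plusFact₂_nonneg (P := P) (x := x) 2 1 k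
    have m6 := plusFact₂_nonneg (P := P) (x := x) 1 2 k
    rw [remainder₁]; linarith
  have hw : 0 ≤ ‖E - 1‖ ^ 3 := by positivity
  have t1 := mul_le_mul_of_nonneg_left s1 hw
  have t2 := mul_le_mul_of_nonneg_left s2 hw
  have t3 := mul_le_mul_of_nonneg_left s5 hw
  have t4 := mul_nonneg hw (Finset.sum_nonneg fun k (_ : k ∈ Finset.Icc (1 : ℤ) n) =>
    remainder₁_nonneg (P := P) (x := x) k)
  simp only [Nat.cast_one, Nat.cast_ofNat] at *
  linarith

/-- The second order expansion of the logarithm of the characteristic function. -/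
theorem OneDepSeq.sum_norm_logJet_sub_le₃ (h : JetFactors P x E u v) (n : ℕ) :
    ∑ k ∈ Finset.Icc (1 : ℤ) n, ‖logJet (u k) - (factMoment P x 1 k • jetZ E
        + coeff₂ P x k • jetZ E ^ 2 + coeff₃ P x k • jetZ E ^ 3)‖
      ≤ 10 ^ 13 * ‖E - 1‖ ^ 4 * ∑ k ∈ Finset.Icc (1 : ℤ) n, remainder₂ P x k := by
  have h1 : ∀ k ∈ Finset.Icc (1 : ℤ) n, _ := fun k hk =>
    hx.norm_logJet_sub_le₃ hE h (N := n + 4) (by omega) (k := k)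
      (by have := Finset.mem_Icc.1 hk; push_cast; omega)
  refine (Finset.sum_le_sum h1).trans ?_
  rw [Finset.sum_add_distrib, ← Finset.mul_sum, ← Finset.mul_sum, Finset.sum_add_distrib,
    Finset.sum_add_distrib, Finset.sum_add_distrib, Finset.sum_add_distrib]
  have s1 := sum_shift_le remainder₂_nonneg (fun k hk => hx.remainder₂_eq_zero hk) n 1
  have s2 := sum_shift_le remainder₂_nonneg (fun k hk => hx.remainder₂_eq_zero hk) n 2
  have s3 := sum_shift_le (fun k => tailNorm_nonneg (P := P) (x := x) (E := E) 4 (n + 4) k)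
    (fun k hk => hx.tailNorm_eq_zero (by norm_num) _ hk) n 1
  have s3' := sum_shift_le (fun k => tailNorm_nonneg (P := P) (x := x) (E := E) 4 (n + 4) k)
    (fun k hk => hx.tailNorm_eq_zero (by norm_num) _ hk) n 2
  have s4 := hx.sum_tailNorm_le hE (q := 4) (by norm_num) (by norm_num) n (n + 4)
  have s5 : ∑ k ∈ Finset.Icc (1 : ℤ) n, plusMoment P x (k + 1 - (4 : ℕ)) 4
      ≤ ∑ k ∈ Finset.Icc (1 : ℤ) n, remainder₂ P x k := by
    refine Finset.sum_le_sum fun k _ => ?_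
    rw [show k + 1 - ((4 : ℕ) : ℤ) = k - 3 by push_cast; ring]
    have na : ∀ i k, 0 ≤ factMoment P x i k := factMoment_nonneg
    have np := plusFact₂_nonneg (P := P) (x := x)
    have np3 := plusFact₃_nonneg (P := P) (x := x)
    have m1 := pow_nonneg (na 1 k) 4
    have m2 := sq_nonneg (factMoment P x 2 k)
    have m3 := na 4 k
    have m4 := mul_nonneg (add_nonneg (add_nonneg (na 1 (k - 2)) (na 1 (k - 1))) (na 1 k))
      (add_nonneg (na 3 k) (add_nonneg (np 2 1 k) (np 1 2 k)))
    have m5 := sq_nonneg (mixedMoment P x k)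
    have m6 := mul_nonneg (add_nonneg (add_nonneg (add_nonneg (na 1 k) (na 1 (k - 1)))
      (na 1 (k - 2))) (na 1 (k - 3))) (plusMoment_nonneg (P := P) (x := x) (k - 2) 3)
    have m7 := add_nonneg (add_nonneg (np 3 1 k) (np 2 2 k)) (np 1 3 k)
    have m8 := add_nonneg (add_nonneg (np3 2 1 1 k) (np3 1 2 1 k)) (np3 1 1 2 k)
    rw [remainder₂]; linarith
  have hw : 0 ≤ ‖E - 1‖ ^ 4 := by positivity
  have t1 := mul_le_mul_of_nonneg_left s1 hw
  have t2 := mul_le_mul_of_nonneg_left s2 hw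
  have t3 := mul_le_mul_of_nonneg_left s5 hw
  have t4 := mul_nonneg hw (Finset.sum_nonneg fun k (_ : k ∈ Finset.Icc (1 : ℤ) n) =>
    remainder₂_nonneg (P := P) (x := x) k)
  simp only [Nat.cast_one, Nat.cast_ofNat] at *
  linarith

end LogExpansion

end OneDependent

/-! ### The characteristic function and its logarithmic derivative. -/

namespace OneDependent

section CharacteristicFunction

theorem Jet.snd_prod {ι : Type*} (s : Finset ι) (f : ι → Jet) (h : ∀ i ∈ s, (f i).fst ≠ 0) :
    (∏ i ∈ s, f i).snd = (∏ i ∈ s, (f i).fst) * ∑ i ∈ s, (f i).snd / (f i).fst := by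
  classical
  induction s using Finset.induction_on with
  | empty => simp
  | insert a s ha ih =>
    have h0 := h a (Finset.mem_insert_self a s)
    rw [Finset.prod_insert ha, Finset.prod_insert ha, Finset.sum_insert ha, TrivSqZeroExt.snd_mul,
      ih fun i hi => h i (Finset.mem_insert_of_mem hi), Jet.fst_prod]
    simp only [smul_eq_mul, MulOpposite.smul_eq_mul_unop, MulOpposite.unop_op]
    field_simp
    ring

theorem prod_range_eq_prod_Icc {M : Type*} [CommMonoid M] (n : ℕ) (f : ℤ → M) :
    ∏ i ∈ Finset.range n, f (i + 1) = ∏ k ∈ Finset.Icc (1 : ℤ) n, f k := by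
  refine Finset.prod_bij (fun i _ => (i : ℤ) + 1) ?_ ?_ ?_ ?_
  · intro i hi; have := Finset.mem_range.1 hi; rw [Finset.mem_Icc]; omega
  · intro a _ b _ h; omega
  · intro k hk
    have := Finset.mem_Icc.1 hk
    exact ⟨(k - 1).toNat, Finset.mem_range.2 (by omega), by omega⟩
  · intro i _; rfl

variable {Ω : Type*} [mΩ : MeasurableSpace Ω] {P : Measure Ω} {x : ℤ → Ω → ℕ} {E : ℂ}

/-- The partial sums. -/
noncomputable def partialSum (x : ℤ → Ω → ℕ) (n : ℕ) (ω : Ω) : ℕ := ∑ k ∈ Finset.Icc (1 : ℤ) n, x k ω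

omit mΩ in
theorem block_pow_eq {A : Type*} [CommMonoid A] (c : A) (n : ℕ) (ω : Ω) :
    block x (fun _ m => c ^ m) 1 n ω = c ^ partialSum x n ω := by
  rw [partialSum, ← Finset.prod_pow_eq_pow_sum, ← prod_range_eq_prod_Icc n fun k => c ^ x k ω, block]
  simp only [add_comm]

variable [IsProbabilityMeasure P] (hx : OneDepSeq P x) (hE : ‖E‖ = 1)
include hx hE

theorem OneDepSeq.integrable_jet_pow (n : ℕ) :
    Integrable (fun ω => (1 + jetZ E) ^ partialSum x n ω) P := by
  have h := hx.integrable_block_jet (φ := fun _ m => (1 + jetZ E) ^ m) le_rfl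
    (fun _ m => by rw [one_add_jetZ_pow_fst, norm_pow, hE, one_pow])
    (fun _ m => by
      rw [one_add_jetZ_pow_snd, norm_mul, norm_mul, norm_mul, norm_pow, hE, one_pow, Complex.norm_I,
        Complex.norm_real, Real.norm_of_nonneg (jetScale_nonneg E), Complex.norm_natCast, jetScale]
      have : (0 : ℝ) ≤ m := Nat.cast_nonneg _
      nlinarith [norm_sub_one_le_two hE]) 1 n
  simpa only [block_pow_eq] using h.congr (Filter.Eventually.of_forall fun ω => block_pow_eq _ n ω)

theorem OneDepSeq.chainMoment_pow_fst (n : ℕ) :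
    (chainMoment P x (fun _ m => (1 + jetZ E) ^ m) 1 n).fst = ∫ ω, E ^ partialSum x n ω ∂P := by
  simp only [chainMoment, block_pow_eq]
  rw [fst_integral (hx.integrable_jet_pow hE n)]
  simp only [one_add_jetZ_pow_fst]

theorem OneDepSeq.chainMoment_pow_snd (n : ℕ) :
    (chainMoment P x (fun _ m => (1 + jetZ E) ^ m) 1 n).snd
      = jetScale E * Complex.I * ∫ ω, partialSum x n ω * E ^ partialSum x n ω ∂P := by
  simp only [chainMoment, block_pow_eq]
  rw [snd_integral (hx.integrable_jet_pow hE n), ← integral_const_mul]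
  simp only [one_add_jetZ_pow_snd]

/-- The logarithm of the characteristic function and its derivative. -/
theorem OneDepSeq.exists_log_expansion (hE1 : E ≠ 1) (n : ℕ) : ∃ y y' : ℂ,
    ∫ ω, E ^ partialSum x n ω ∂P
      = Complex.exp ((∑ k ∈ Finset.Icc (1 : ℤ) n, factMoment P x 1 k : ℝ) * (E - 1)
        + (∑ k ∈ Finset.Icc (1 : ℤ) n, coeff₂ P x k : ℝ) * (E - 1) ^ 2 + y) ∧
    ∫ ω, partialSum x n ω * E ^ partialSum x n ω ∂P = (∫ ω, E ^ partialSum x n ω ∂P)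
      * (E * ((∑ k ∈ Finset.Icc (1 : ℤ) n, factMoment P x 1 k : ℝ)
        + 2 * (∑ k ∈ Finset.Icc (1 : ℤ) n, coeff₂ P x k : ℝ) * (E - 1)) + y') ∧
    ‖y‖ ≤ 10 ^ 17 * (∑ k ∈ Finset.Icc (1 : ℤ) n, remainder₁ P x k) * ‖E - 1‖ ^ 3 ∧
    ‖y'‖ ≤ 10 ^ 17 * (∑ k ∈ Finset.Icc (1 : ℤ) n, remainder₁ P x k) * ‖E - 1‖ ^ 2 ∧
    ‖y - (∑ k ∈ Finset.Icc (1 : ℤ) n, coeff₃ P x k : ℝ) * (E - 1) ^ 3‖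
      ≤ 10 ^ 17 * (∑ k ∈ Finset.Icc (1 : ℤ) n, remainder₂ P x k) * ‖E - 1‖ ^ 4 ∧
    ‖y' - 3 * (∑ k ∈ Finset.Icc (1 : ℤ) n, coeff₃ P x k : ℝ) * (E - 1) ^ 2 * E‖
      ≤ 10 ^ 17 * (∑ k ∈ Finset.Icc (1 : ℤ) n, remainder₂ P x k) * ‖E - 1‖ ^ 3 := by
  obtain ⟨u, v, h⟩ := hx.exists_jetFactors hE
  set Γ₁ := ∑ k ∈ Finset.Icc (1 : ℤ) n, factMoment P x 1 k with hΓ₁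
  set Γ₂ := ∑ k ∈ Finset.Icc (1 : ℤ) n, coeff₂ P x k with hΓ₂
  set Γ₃ := ∑ k ∈ Finset.Icc (1 : ℤ) n, coeff₃ P x k with hΓ₃
  set R₁ := ∑ k ∈ Finset.Icc (1 : ℤ) n, remainder₁ P x k
  set R₂ := ∑ k ∈ Finset.Icc (1 : ℤ) n, remainder₂ P x k
  have hR₁ : 0 ≤ R₁ := Finset.sum_nonneg fun k _ => remainder₁_nonneg k
  have hR₂ : 0 ≤ R₂ := Finset.sum_nonneg fun k _ => remainder₂_nonneg k
  -- Summing the principal logarithms of the factors, all close to 1, avoids any choice of branch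
  -- for the product; the exponential restores the product, and the second component is its
  -- logarithmic derivative.
  set Λ : Jet := ∑ k ∈ Finset.Icc (1 : ℤ) n, logJet (u k) with hΛ
  have hne : ∀ k, 1 + (u k).fst ≠ 0 := fun k =>
    (norm_one_add_inv_le ((Jet.norm_fst_le _).trans (h.norm_u k))).1
  have hprod := h.prod n
  rw [prod_range_eq_prod_Icc n fun k => 1 + u k] at hprod
  have hf : ∫ ω, E ^ partialSum x n ω ∂P = Complex.exp Λ.fst := by
    rw [← hx.chainMoment_pow_fst hE, hprod, Jet.fst_prod, hΛ, TrivSqZeroExt.fst_sum,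
      Complex.exp_sum]
    refine Finset.prod_congr rfl fun k _ => ?_
    simp [logJet, Complex.exp_log (hne k)]
  have hw : 0 < ‖E - 1‖ := norm_pos_iff.2 (sub_ne_zero.2 hE1)
  have hs : (jetScale E : ℂ) ≠ 0 := by
    rw [jetScale]; exact_mod_cast (by positivity : (1 / 10000 * ‖E - 1‖ : ℝ) ≠ 0)
  have hsI := mul_ne_zero hs Complex.I_ne_zero
  have hf' : jetScale E * Complex.I * ∫ ω, partialSum x n ω * E ^ partialSum x n ω ∂P
      = Complex.exp Λ.fst * Λ.snd := by
    rw [← hf, ← hx.chainMoment_pow_fst hE, ← hx.chainMoment_pow_snd hE, hprod,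
      Jet.snd_prod _ _ fun k _ => by simpa using hne k, Jet.fst_prod, hΛ, TrivSqZeroExt.snd_sum]
    simp [logJet]
  have b₁ : ‖Λ - (Γ₁ • jetZ E + Γ₂ • jetZ E ^ 2)‖ ≤ 10 ^ 10 * ‖E - 1‖ ^ 3 * R₁ := by
    refine le_trans ?_ (hx.sum_norm_logJet_sub_le₂ hE h n)
    refine le_trans (le_of_eq ?_) (norm_sum_le _ _)
    rw [Finset.sum_sub_distrib, Finset.sum_add_distrib, ← Finset.sum_smul, ← Finset.sum_smul]
  have b₂ : ‖Λ - (Γ₁ • jetZ E + Γ₂ • jetZ E ^ 2 + Γ₃ • jetZ E ^ 3)‖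
      ≤ 10 ^ 13 * ‖E - 1‖ ^ 4 * R₂ := by
    refine le_trans ?_ (hx.sum_norm_logJet_sub_le₃ hE h n)
    refine le_trans (le_of_eq ?_) (norm_sum_le _ _)
    rw [Finset.sum_sub_distrib, Finset.sum_add_distrib, Finset.sum_add_distrib, ← Finset.sum_smul,
      ← Finset.sum_smul, ← Finset.sum_smul]
  have f1 := (Jet.norm_fst_le _).trans b₁
  have f2 := (Jet.norm_fst_le _).trans b₂
  have s1 := (Jet.norm_snd_le _).trans b₁
  have s2 := (Jet.norm_snd_le _).trans b₂
  -- Undoing the scaling of derivatives costs the constant 10000 and one power of `‖E - 1‖`, which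
  -- must not vanish. Thus `10 ^ 13` becomes the common constant `10 ^ 17`.
  have scale : ∀ {c : ℂ} {M : ℝ} {j : ℕ}, ‖jetScale E * Complex.I * c‖ ≤ M * ‖E - 1‖ ^ (j + 1) →
      ‖c‖ ≤ 10000 * M * ‖E - 1‖ ^ j := by
    intro c M j hc
    rw [norm_mul, norm_mul, Complex.norm_I, Complex.norm_real,
      Real.norm_of_nonneg (jetScale_nonneg E), jetScale, pow_succ] at hc
    refine le_of_mul_le_mul_right ?_ hw
    linarith
  have e2 : (jetZ E ^ 2).snd = jetScale E * Complex.I * (2 * (E - 1) * E) := by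
    rw [sq, TrivSqZeroExt.snd_mul, jetZ_fst, jetZ_snd]; simp; ring
  have e3 : (jetZ E ^ 3).snd = jetScale E * Complex.I * (3 * (E - 1) ^ 2 * E) := by
    rw [pow_succ, TrivSqZeroExt.snd_mul, e2, TrivSqZeroExt.fst_pow, jetZ_fst, jetZ_snd]; simp; ring
  refine ⟨Λ.fst - (Γ₁ * (E - 1) + Γ₂ * (E - 1) ^ 2),
    Λ.snd / (jetScale E * Complex.I) - E * (Γ₁ + 2 * Γ₂ * (E - 1)), ?_, ?_, ?_, ?_, ?_, ?_⟩
  · rw [hf]; congr 1; ring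
  · rw [hf]
    refine mul_left_cancel₀ hsI ?_
    rw [hf']; field_simp; ring
  · refine le_trans (le_of_eq ?_) (f1.trans ?_)
    · simp [jetZ_fst]
    · have : 0 ≤ ‖E - 1‖ ^ 3 * R₁ := by positivity
      linarith
  · refine (scale (M := 10 ^ 10 * R₁) (j := 2) (le_trans (le_of_eq ?_) (s1.trans
      (le_of_eq (by ring))))).trans ?_
    · congr 1
      simp only [TrivSqZeroExt.snd_sub, TrivSqZeroExt.snd_add, TrivSqZeroExt.snd_smul, e2, jetZ_snd,
        Complex.real_smul]
      field_simp
    · have : 0 ≤ R₁ * ‖E - 1‖ ^ 2 := by positivity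
      linarith
  · refine le_trans (le_of_eq ?_) (f2.trans ?_)
    · congr 1
      simp [jetZ_fst]; ring
    · have : 0 ≤ ‖E - 1‖ ^ 4 * R₂ := by positivity
      linarith
  · refine (scale (M := 10 ^ 13 * R₂) (j := 3) (le_trans (le_of_eq ?_) (s2.trans
      (le_of_eq (by ring))))).trans ?_
    · congr 1
      simp only [TrivSqZeroExt.snd_sub, TrivSqZeroExt.snd_add, TrivSqZeroExt.snd_smul, e2, e3,
        jetZ_snd, Complex.real_smul]
      field_simp; ring
    · have : 0 ≤ R₂ * ‖E - 1‖ ^ 3 := by positivity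
      linarith

omit hE in
-- Means are at most `1/100`, so half the square of the mean and the product of neighbouring means
-- contribute `1/200 + 1/100` times the mean.
theorem OneDepSeq.abs_coeff₂_sum_le (n : ℕ) : |∑ k ∈ Finset.Icc (1 : ℤ) n, coeff₂ P x k|
    ≤ 3 / 200 * ∑ k ∈ Finset.Icc (1 : ℤ) n, factMoment P x 1 k
      + 1 / 2 * ∑ k ∈ Finset.Icc (1 : ℤ) n, factMoment P x 2 k
      + ∑ k ∈ Finset.Icc (1 : ℤ) n, mixedMoment P x k := by
  refine (Finset.abs_sum_le_sum_abs _ _).trans ?_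
  rw [Finset.mul_sum, Finset.mul_sum, ← Finset.sum_add_distrib, ← Finset.sum_add_distrib]
  refine Finset.sum_le_sum fun k _ => ?_
  have h1 := abs_le.1 (hx.abs_hatFact₂_le k)
  have h2 := hx.factMoment_one_le k
  have h3 := hx.factMoment_one_le (k - 1)
  have h4 := factMoment_nonneg (P := P) (x := x) 1 k
  have h5 := factMoment_nonneg (P := P) (x := x) 2 k
  have h6 := mul_le_mul_of_nonneg_right h3 h4
  have h7 := mul_le_mul_of_nonneg_right h2 h4
  have h8 := sq_nonneg (factMoment P x 1 k)
  rw [coeff₂, abs_le]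
  constructor <;> nlinarith

/-- The decay of the characteristic function of the limit. -/
theorem OneDepSeq.norm_exp_le (n : ℕ) :
    ‖Complex.exp ((∑ k ∈ Finset.Icc (1 : ℤ) n, factMoment P x 1 k : ℝ) * (E - 1)
        + (∑ k ∈ Finset.Icc (1 : ℤ) n, coeff₂ P x k : ℝ) * (E - 1) ^ 2)‖
      ≤ Real.exp (-(9 / 20) * ‖E - 1‖ ^ 2 * (∑ k ∈ Finset.Icc (1 : ℤ) n, factMoment P x 1 k
        - 1.52 * ∑ k ∈ Finset.Icc (1 : ℤ) n, factMoment P x 2 k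
        - 12 * ∑ k ∈ Finset.Icc (1 : ℤ) n, mixedMoment P x k)) := by
  have h := hx.abs_coeff₂_sum_le n
  have h1 : 0 ≤ ∑ k ∈ Finset.Icc (1 : ℤ) n, factMoment P x 1 k :=
    Finset.sum_nonneg fun k _ => factMoment_nonneg 1 k
  have h2 : 0 ≤ ∑ k ∈ Finset.Icc (1 : ℤ) n, factMoment P x 2 k :=
    Finset.sum_nonneg fun k _ => factMoment_nonneg 2 k
  have h3 : 0 ≤ ∑ k ∈ Finset.Icc (1 : ℤ) n, mixedMoment P x k :=
    Finset.sum_nonneg fun k _ => mixedMoment_nonneg k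
  rw [Complex.norm_exp, Real.exp_le_exp, Complex.add_re, Complex.re_ofReal_mul,
    Complex.re_ofReal_mul]
  have e1 : E.re ^ 2 + E.im ^ 2 = 1 := by
    have := Complex.sq_norm E
    rw [hE, Complex.normSq_apply] at this; linarith
  have e2 : (E - 1).re = -(‖E - 1‖ ^ 2 / 2) := by
    rw [Complex.sq_norm, Complex.normSq_apply]; simp; linarith
  have e3 : |((E - 1) ^ 2).re| ≤ ‖E - 1‖ ^ 2 := by
    rw [← norm_pow]; exact Complex.abs_re_le_norm _
  generalize ∑ k ∈ Finset.Icc (1 : ℤ) n, coeff₂ P x k = c at *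
  generalize ∑ k ∈ Finset.Icc (1 : ℤ) n, factMoment P x 1 k = S₁ at *
  generalize ∑ k ∈ Finset.Icc (1 : ℤ) n, factMoment P x 2 k = S₂ at *
  generalize ∑ k ∈ Finset.Icc (1 : ℤ) n, mixedMoment P x k = B at *
  have h4 : c * ((E - 1) ^ 2).re ≤ |c| * ‖E - 1‖ ^ 2 :=
    (le_abs_self _).trans (by rw [abs_mul]; exact mul_le_mul_of_nonneg_left e3 (abs_nonneg _))
  have hw := sq_nonneg ‖E - 1‖
  have h5 := mul_le_mul_of_nonneg_right h hw
  have m1 := mul_nonneg h1 hw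
  have m2 := mul_nonneg h2 hw
  have m3 := mul_nonneg h3 hw
  -- The linear term gives `-1/2` per mean, and losing `3/200` still leaves less than `-9/20`. The
  -- other two coefficients, `1/2` and 1, are below `(9/20) * 1.52` and `(9/20) * 12`.
  rw [e2]
  norm_num only at *
  linarith

end CharacteristicFunction

end OneDependent

/-! ### Gaussian weights and Fourier inversion. -/

namespace OneDependent

section Gaussian

theorem norm_exp_sub_one_le (t : ℝ) : ‖Complex.exp (Complex.I * t) - 1‖ ≤ |t| := by
  simpa using Real.norm_exp_I_mul_ofReal_sub_one_le (x := t)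

theorem le_norm_exp_sub_one {t : ℝ} (ht : |t| ≤ Real.pi) :
    2 / Real.pi * |t| ≤ ‖Complex.exp (Complex.I * t) - 1‖ := by
  rw [Complex.norm_exp_I_mul_ofReal_sub_one, Real.norm_eq_abs, abs_mul, abs_two]
  have h := Real.mul_le_sin (x := |t| / 2) (by positivity) (by linarith)
  have h2 : |Real.sin (t / 2)| = |Real.sin (|t| / 2)| := by
    rcases abs_choice t with h | h <;> rw [h]
    rw [neg_div, Real.sin_neg, abs_neg]
  rw [h2]
  have := le_abs_self (Real.sin (|t| / 2))
  linarith

/-- The absolute moments of a Gaussian weight. -/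
noncomputable def gaussMoment (κ : ℝ) (p : ℕ) : ℝ := ∫ s : ℝ, |s| ^ p * Real.exp (-κ * s ^ 2)

variable {κ : ℝ}

theorem integrable_gaussMoment (hκ : 0 < κ) (p : ℕ) :
    Integrable fun s : ℝ => |s| ^ p * Real.exp (-κ * s ^ 2) := by
  have h := (integrable_rpow_mul_exp_neg_mul_sq hκ (s := p)
    (lt_of_lt_of_le (by norm_num) (Nat.cast_nonneg p))).norm
  refine h.congr (Filter.Eventually.of_forall fun s => ?_)
  simp [Real.norm_eq_abs]

theorem gaussMoment_nonneg (κ : ℝ) (p : ℕ) : 0 ≤ gaussMoment κ p :=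
  integral_nonneg fun _ => by positivity

/-- On `[-π, π]` one has `(2/π) |t| ≤ ‖exp (it) - 1‖ ≤ |t|`. The substitution `s = b t` and
integration over the whole line then give a moment independent of `b`. -/
theorem integral_gaussian_weight_le (hκ : 0 < κ) (p : ℕ) {b : ℝ} (hb : 0 < b) :
    ∫ t in -Real.pi..Real.pi, ‖Complex.exp (Complex.I * t) - 1‖ ^ p
        * Real.exp (-κ * b ^ 2 * ‖Complex.exp (Complex.I * t) - 1‖ ^ 2)
      ≤ gaussMoment (κ * (2 / Real.pi) ^ 2) p * (b ^ (p + 1))⁻¹ := by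
  have hpi := Real.pi_pos
  have hκ' : 0 < κ * (2 / Real.pi) ^ 2 := by positivity
  set c := κ * (2 / Real.pi) ^ 2 with hc
  have hint : Integrable fun t : ℝ => |b * t| ^ p * Real.exp (-c * (b * t) ^ 2) :=
    (integrable_gaussMoment hκ' p).comp_mul_left' hb.ne'
  have hbp : (b ^ p)⁻¹ * b ^ p = 1 := inv_mul_cancel₀ (by positivity)
  have h1 : ∫ t : ℝ, |b * t| ^ p * Real.exp (-c * (b * t) ^ 2) = b⁻¹ * gaussMoment c p := by
    rw [Measure.integral_comp_mul_left (fun s : ℝ => |s| ^ p * Real.exp (-c * s ^ 2)), gaussMoment,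
      smul_eq_mul, abs_of_pos (inv_pos.2 hb)]
  have h2 : ∀ t ∈ Set.Icc (-Real.pi) Real.pi, ‖Complex.exp (Complex.I * t) - 1‖ ^ p
      * Real.exp (-κ * b ^ 2 * ‖Complex.exp (Complex.I * t) - 1‖ ^ 2)
      ≤ (b ^ p)⁻¹ * (|b * t| ^ p * Real.exp (-c * (b * t) ^ 2)) := by
    intro t ht
    have ht' : |t| ≤ Real.pi := abs_le.2 ht
    rw [abs_mul, abs_of_pos hb, mul_pow, ← mul_assoc, ← mul_assoc, hbp, one_mul]
    have h3 := norm_exp_sub_one_le t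
    have h4 := pow_le_pow_left₀ (by positivity) (le_norm_exp_sub_one ht') 2
    rw [mul_pow, sq_abs] at h4
    refine mul_le_mul (pow_le_pow_left₀ (norm_nonneg _) h3 p) (Real.exp_le_exp.2 ?_)
      (Real.exp_pos _).le (by positivity)
    have := mul_le_mul_of_nonneg_left h4 (by positivity : 0 ≤ κ * b ^ 2)
    rw [hc]; linarith
  have hle : -Real.pi ≤ Real.pi := by linarith
  calc _ ≤ ∫ t in -Real.pi..Real.pi, (b ^ p)⁻¹ * (|b * t| ^ p * Real.exp (-c * (b * t) ^ 2)) := by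
        refine intervalIntegral.integral_mono_on hle (Continuous.intervalIntegrable (by fun_prop) _ _)
          (Continuous.intervalIntegrable (by fun_prop) _ _) h2
    _ ≤ (b ^ p)⁻¹ * (b⁻¹ * gaussMoment c p) := by
        rw [intervalIntegral.integral_const_mul, ← h1]
        refine mul_le_mul_of_nonneg_left ?_ (by positivity)
        rw [intervalIntegral.integral_of_le hle]
        exact setIntegral_le_integral hint (Filter.Eventually.of_forall fun _ => by positivity)
    _ = _ := by rw [pow_succ, mul_inv]; ring

end Gaussian

section Transforms

/-- The function `h` has the Fourier coefficients `M`. -/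
def IsTransform (M : ℤ → ℝ) (h : ℝ → ℂ) : Prop :=
  Continuous h ∧ ∀ k : ℤ, (M k : ℂ)
    = (2 * Real.pi)⁻¹ * ∫ t in -Real.pi..Real.pi, Complex.exp (-(k * t) * Complex.I) * h t

theorem IsTransform.eq_fourierCoeffOn {M : ℤ → ℝ} {h : ℝ → ℂ} (H : IsTransform M h) (k : ℤ) :
    (M k : ℂ) = fourierCoeffOn (neg_lt_self Real.pi_pos) h k := by
  rw [H.2 k, fourierCoeffOn_eq_integral]
  have e : Real.pi - -Real.pi = 2 * Real.pi := by ring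
  rw [one_div, e, Complex.real_smul]
  push_cast
  congr 1
  refine intervalIntegral.integral_congr fun t _ => ?_
  simp only [smul_eq_mul]
  rw [fourier_coe_apply]
  congr 2
  have := Real.pi_ne_zero
  push_cast
  field_simp

/-- Parseval's identity. -/
theorem IsTransform.hasSum_sq {M : ℤ → ℝ} {h : ℝ → ℂ} (H : IsTransform M h) :
    HasSum (fun k => M k ^ 2) ((2 * Real.pi)⁻¹ * ∫ t in -Real.pi..Real.pi, ‖h t‖ ^ 2) := by
  have hm : MemLp h 2 (volume.restrict (Set.Ioc (-Real.pi) Real.pi)) :=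
    (memLp_two_iff_integrable_sq_norm H.1.aestronglyMeasurable).2
      ((H.1.norm.pow 2).integrableOn_Icc.mono_set Set.Ioc_subset_Icc_self)
  have h1 := hasSum_sq_fourierCoeffOn (neg_lt_self Real.pi_pos) hm
  simp only [← H.eq_fourierCoeffOn, Complex.norm_real, Real.norm_eq_abs, sq_abs] at h1
  rwa [show Real.pi - -Real.pi = 2 * Real.pi by ring, smul_eq_mul] at h1

theorem IsTransform.abs_le {M : ℤ → ℝ} {h : ℝ → ℂ} (H : IsTransform M h) (k : ℤ) :
    |M k| ≤ ∫ t in -Real.pi..Real.pi, ‖h t‖ := by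
  have hpi := Real.pi_gt_three
  rw [← Real.norm_eq_abs, ← Complex.norm_real, H.2 k, norm_mul]
  have h1 : ‖∫ t in -Real.pi..Real.pi, Complex.exp (-(k * t) * Complex.I) * h t‖
      ≤ ∫ t in -Real.pi..Real.pi, ‖h t‖ := by
    refine (intervalIntegral.norm_integral_le_integral_norm (by linarith)).trans (le_of_eq ?_)
    refine intervalIntegral.integral_congr fun t _ => ?_
    simp only [norm_mul]
    rw [show -((k : ℂ) * t) * Complex.I = ((-(k * t) : ℝ) : ℂ) * Complex.I by push_cast; ring,
      Complex.norm_exp_ofReal_mul_I, one_mul]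
  have h2 : ‖(((2 * Real.pi)⁻¹ : ℝ) : ℂ)‖ ≤ 1 := by
    rw [Complex.norm_real, Real.norm_of_nonneg (by positivity)]
    exact inv_le_one_of_one_le₀ (by linarith)
  calc _ ≤ 1 * ∫ t in -Real.pi..Real.pi, ‖h t‖ := mul_le_mul h2 h1 (norm_nonneg _) zero_le_one
    _ = _ := one_mul _

/-- By the mean value theorem the increment is `δ / (1 + c ^ 2)` with `c` within distance 1 of `u`,
and then `1 + c ^ 2 ≤ 3 (1 + u ^ 2)`. -/
theorem inv_one_add_sq_le_arctan (u : ℝ) {δ : ℝ} (h0 : 0 < δ) (h1 : δ ≤ 1) :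
    (1 + u ^ 2)⁻¹ ≤ 3 * δ⁻¹ * (Real.arctan (u + δ) - Real.arctan u) := by
  obtain ⟨c, ⟨hc1, hc2⟩, hc⟩ := exists_hasDerivAt_eq_slope Real.arctan (fun x => 1 / (1 + x ^ 2))
    (show u < u + δ by linarith) Real.continuous_arctan.continuousOn
    fun x _ => Real.hasDerivAt_arctan x
  have e : Real.arctan (u + δ) - Real.arctan u = δ * (1 / (1 + c ^ 2)) := by
    rw [hc, add_sub_cancel_left]; field_simp
  have e2 : 3 * δ⁻¹ * (δ * (1 / (1 + c ^ 2))) = 3 / (1 + c ^ 2) := by field_simp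
  rw [e, e2, inv_eq_one_div, div_le_div_iff₀ (by positivity) (by positivity)]
  nlinarith [sq_nonneg (u + 1), sq_nonneg (u - 1), mul_nonneg (sub_nonneg.2 hc1.le)
    (sub_nonneg.2 hc2.le), sq_nonneg (c - u)]

/-- With steps `1/b ≤ 1` the sum is dominated by a telescoping sum of arctangents, whose total
variation is `π`. The bound is uniform in the centre `a`. -/
theorem sum_inv_one_add_sq_le {a b : ℝ} (hb : 1 ≤ b) (s : Finset ℤ) :
    ∑ k ∈ s, (1 + ((k - a) / b) ^ 2)⁻¹ ≤ 3 * b * Real.pi := by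
  have hb0 : 0 < b := by linarith
  obtain ⟨N, hN⟩ : ∃ N : ℕ, s ⊆ (Finset.range (2 * N)).image fun i : ℕ => (i : ℤ) - N := by
    refine ⟨s.sup Int.natAbs + 1, fun k hk => ?_⟩
    have h : k.natAbs ≤ s.sup Int.natAbs := Finset.le_sup (f := Int.natAbs) hk
    rw [Finset.mem_image]
    exact ⟨(k + (s.sup Int.natAbs + 1 : ℕ)).toNat, Finset.mem_range.2 (by omega), by omega⟩
  refine (Finset.sum_le_sum_of_subset_of_nonneg hN fun _ _ _ => by positivity).trans ?_
  rw [Finset.sum_image fun i _ j _ h => by simpa using h]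
  have each : ∀ i ∈ Finset.range (2 * N), (1 + ((((i : ℤ) - N : ℤ) - a) / b) ^ 2)⁻¹
      ≤ 3 * b * Real.arctan (((i + 1 : ℕ) - N - a) / b)
        - 3 * b * Real.arctan (((i : ℕ) - N - a) / b) := by
    intro i _
    have := inv_one_add_sq_le_arctan (((i : ℝ) - N - a) / b) (inv_pos.2 hb0)
      (inv_le_one_of_one_le₀ hb)
    rw [inv_inv] at this
    push_cast
    rw [show ((i : ℝ) + 1 - N - a) / b = (i - N - a) / b + b⁻¹ by field_simp; ring]
    linarith
  refine (Finset.sum_le_sum each).trans ?_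
  rw [Finset.sum_range_sub fun i : ℕ => 3 * b * Real.arctan (((i : ℝ) - N - a) / b)]
  have h1 := Real.arctan_lt_pi_div_two (((2 * N : ℕ) - N - a) / b)
  have h2 := Real.neg_pi_div_two_lt_arctan (((0 : ℕ) - N - a) / b)
  nlinarith

/-- Cauchy–Schwarz with the weight `1 + ((k - a) / b) ^ 2`, followed by Parseval's identity for `M`
and for `(k - a) M`. -/
theorem IsTransform.sum_abs_sq_le {M : ℤ → ℝ} {h h₁ : ℝ → ℂ} {a b : ℝ} (hb : 1 ≤ b)
    (H : IsTransform M h) (H₁ : IsTransform (fun k => (k - a) * M k) h₁) (s : Finset ℤ) :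
    (∑ k ∈ s, |M k|) ^ 2 ≤ 3 * b * Real.pi * ((∫ t in -Real.pi..Real.pi, ‖h t‖ ^ 2)
      + (b ^ 2)⁻¹ * ∫ t in -Real.pi..Real.pi, ‖h₁ t‖ ^ 2) := by
  have hpi := Real.pi_gt_three
  have hb0 : 0 < b := by linarith
  have cs := Finset.sum_sq_le_sum_mul_sum_of_sq_le_mul s (r := fun k => |M k|)
    (f := fun k : ℤ => (1 + ((k - a) / b) ^ 2)⁻¹)
    (g := fun k : ℤ => (1 + ((k - a) / b) ^ 2) * M k ^ 2) (fun _ _ => by positivity)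
    (fun _ _ => by positivity) (fun k _ => by
      rw [sq_abs, inv_mul_cancel_left₀ (by positivity)])
  have h1 := sum_le_hasSum s (fun _ _ => sq_nonneg _) H.hasSum_sq
  have h2 := sum_le_hasSum s (fun _ _ => sq_nonneg _) H₁.hasSum_sq
  have shrink : ∀ {J : ℝ}, 0 ≤ J → (2 * Real.pi)⁻¹ * J ≤ J := fun hJ =>
    mul_le_of_le_one_left hJ (inv_le_one_of_one_le₀ (by linarith))
  have i1 : 0 ≤ ∫ t in -Real.pi..Real.pi, ‖h t‖ ^ 2 :=
    intervalIntegral.integral_nonneg (by linarith) fun _ _ => by positivity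
  have i2 : 0 ≤ ∫ t in -Real.pi..Real.pi, ‖h₁ t‖ ^ 2 :=
    intervalIntegral.integral_nonneg (by linarith) fun _ _ => by positivity
  refine cs.trans (mul_le_mul (sum_inv_one_add_sq_le hb s) ?_
    (Finset.sum_nonneg fun _ _ => by positivity) (by positivity))
  have e : ∑ k ∈ s, (1 + (((k : ℝ) - a) / b) ^ 2) * M k ^ 2
      = ∑ k ∈ s, M k ^ 2 + (b ^ 2)⁻¹ * ∑ k ∈ s, ((k - a) * M k) ^ 2 := by
    rw [Finset.mul_sum, ← Finset.sum_add_distrib]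
    refine Finset.sum_congr rfl fun k _ => ?_
    field_simp
  rw [e]
  exact add_le_add (h1.trans (shrink i1))
    (mul_le_mul_of_nonneg_left (h2.trans (shrink i2)) (by positivity))

/-- A bound for a transform: a polynomial in `|e^{it} - 1|` times a Gaussian weight. -/
def HasGaussianBound (κ b : ℝ) (A : ℕ → ℝ) (h : ℝ → ℂ) : Prop :=
  ∀ t : ℝ, ‖h t‖ ≤ (∑ j ∈ Finset.range 8, A j * ‖Complex.exp (Complex.I * t) - 1‖ ^ j)
    * Real.exp (-κ * b ^ 2 * ‖Complex.exp (Complex.I * t) - 1‖ ^ 2)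

/-- The sum of the Gaussian moments that are used. -/
noncomputable def gaussConst (κ : ℝ) : ℝ :=
  ∑ p ∈ Finset.range 16, gaussMoment (κ * (2 / Real.pi) ^ 2) p

theorem gaussConst_nonneg (κ : ℝ) : 0 ≤ gaussConst κ :=
  Finset.sum_nonneg fun p _ => gaussMoment_nonneg _ p

theorem gaussMoment_le_gaussConst (κ : ℝ) {p : ℕ} (hp : p < 16) :
    gaussMoment (κ * (2 / Real.pi) ^ 2) p ≤ gaussConst κ :=
  Finset.single_le_sum (f := fun p => gaussMoment (κ * (2 / Real.pi) ^ 2) p)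
    (fun p _ => gaussMoment_nonneg _ p) (Finset.mem_range.2 hp)

variable {κ b : ℝ} {A : ℕ → ℝ} {h : ℝ → ℂ}

theorem HasGaussianBound.integral_norm_le (hκ : 0 < κ) (hb : 0 < b) (hA : ∀ j, 0 ≤ A j)
    (hh : Continuous h) (H : HasGaussianBound κ b A h) :
    ∫ t in -Real.pi..Real.pi, ‖h t‖
      ≤ gaussConst κ * ∑ j ∈ Finset.range 8, A j * (b ^ (j + 1))⁻¹ := by
  have hpi := Real.pi_pos
  have h1 : ∫ t in -Real.pi..Real.pi, ‖h t‖ ≤ ∫ t in -Real.pi..Real.pi, ∑ j ∈ Finset.range 8,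
      A j * (‖Complex.exp (Complex.I * t) - 1‖ ^ j
        * Real.exp (-κ * b ^ 2 * ‖Complex.exp (Complex.I * t) - 1‖ ^ 2)) := by
    refine intervalIntegral.integral_mono_on (by linarith) (hh.norm.intervalIntegrable _ _)
      (Continuous.intervalIntegrable (by fun_prop) _ _) fun t _ => (H t).trans (le_of_eq ?_)
    rw [Finset.sum_mul]
    exact Finset.sum_congr rfl fun j _ => by ring
  refine h1.trans ?_
  rw [intervalIntegral.integral_finsetSum fun j _ =>
    Continuous.intervalIntegrable (by fun_prop) _ _, Finset.mul_sum]
  refine Finset.sum_le_sum fun j hj => ?_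
  rw [intervalIntegral.integral_const_mul]
  have h2 := integral_gaussian_weight_le hκ j hb
  have h3 := mul_le_mul_of_nonneg_right (gaussMoment_le_gaussConst κ (p := j)
    (by have := Finset.mem_range.1 hj; omega)) (by positivity : 0 ≤ (b ^ (j + 1))⁻¹)
  have := mul_le_mul_of_nonneg_left (h2.trans h3) (hA j)
  linarith

theorem HasGaussianBound.integral_norm_sq_le (hκ : 0 < κ) (hb : 0 < b) (hA : ∀ j, 0 ≤ A j)
    (hh : Continuous h) (H : HasGaussianBound κ b A h) :
    ∫ t in -Real.pi..Real.pi, ‖h t‖ ^ 2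
      ≤ 8 * gaussConst κ * b⁻¹ * (∑ j ∈ Finset.range 8, A j * (b ^ j)⁻¹) ^ 2 := by
  have hpi := Real.pi_pos
  have h1 : ∫ t in -Real.pi..Real.pi, ‖h t‖ ^ 2 ≤ ∫ t in -Real.pi..Real.pi,
      ∑ j ∈ Finset.range 8, 8 * A j ^ 2 * (‖Complex.exp (Complex.I * t) - 1‖ ^ (2 * j)
        * Real.exp (-κ * b ^ 2 * ‖Complex.exp (Complex.I * t) - 1‖ ^ 2)) := by
    refine intervalIntegral.integral_mono_on (by linarith)
      (Continuous.intervalIntegrable (by fun_prop) _ _)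
      (Continuous.intervalIntegrable (by fun_prop) _ _) fun t _ => ?_
    have h2 := pow_le_pow_left₀ (norm_nonneg _) (H t) 2
    refine h2.trans ?_
    rw [mul_pow]
    set w := ‖Complex.exp (Complex.I * t) - 1‖
    have h3 : Real.exp (-κ * b ^ 2 * w ^ 2) ≤ 1 := by
      rw [Real.exp_le_one_iff]
      have : 0 ≤ κ * b ^ 2 * w ^ 2 := by positivity
      linarith
    have h4 : Real.exp (-κ * b ^ 2 * w ^ 2) ^ 2 ≤ Real.exp (-κ * b ^ 2 * w ^ 2) := by
      nlinarith [Real.exp_pos (-κ * b ^ 2 * w ^ 2)]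
    -- Cauchy–Schwarz over the eight terms gives the factor 8 and doubles the exponents, up to 14;
    -- hence the sixteen moments in `gaussConst`.
    have h5 := sq_sum_le_card_mul_sum_sq (s := Finset.range 8) (f := fun j => A j * w ^ j)
    refine (mul_le_mul h5 h4 (sq_nonneg _) (by positivity)).trans (le_of_eq ?_)
    rw [Finset.card_range, Finset.mul_sum, Finset.sum_mul]
    refine Finset.sum_congr rfl fun j _ => ?_
    push_cast
    ring
  refine h1.trans ?_
  rw [intervalIntegral.integral_finsetSum fun j _ =>
    Continuous.intervalIntegrable (by fun_prop) _ _]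
  have h6 : ∑ j ∈ Finset.range 8, (A j * (b ^ j)⁻¹) ^ 2
      ≤ (∑ j ∈ Finset.range 8, A j * (b ^ j)⁻¹) ^ 2 :=
    Finset.sum_sq_le_sq_sum_of_nonneg fun j _ => mul_nonneg (hA j) (by positivity)
  refine le_trans ?_ (mul_le_mul_of_nonneg_left h6
    (mul_nonneg (mul_nonneg (by norm_num) (gaussConst_nonneg κ)) (by positivity)))
  rw [Finset.mul_sum]
  refine Finset.sum_le_sum fun j hj => ?_
  rw [intervalIntegral.integral_const_mul]
  have h2 := integral_gaussian_weight_le hκ (2 * j) hb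
  have h3 := mul_le_mul_of_nonneg_right (gaussMoment_le_gaussConst κ (p := 2 * j)
    (by have := Finset.mem_range.1 hj; omega)) (by positivity : 0 ≤ (b ^ (2 * j + 1))⁻¹)
  have h7 := mul_le_mul_of_nonneg_left (h2.trans h3) (by positivity : 0 ≤ 8 * A j ^ 2)
  refine h7.trans (le_of_eq ?_)
  rw [pow_succ b, mul_comm 2 j, pow_mul, mul_inv, mul_pow, inv_pow]
  ring

/-- Bounds for the norms of a measure in terms of its transform and the derivative of the latter. -/
theorem exists_norm_bounds (hκ : 0 < κ) : ∃ C : ℝ, 0 < C ∧ ∀ (a b : ℝ) (M : ℤ → ℝ) (h h₁ : ℝ → ℂ)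
    (A B : ℕ → ℝ), 1 ≤ b → (∀ j, 0 ≤ A j) → (∀ j, 0 ≤ B j) → IsTransform M h →
    IsTransform (fun k => (k - a) * M k) h₁ → HasGaussianBound κ b A h → HasGaussianBound κ b B h₁ →
    tvNorm M ≤ ENNReal.ofReal (C * (∑ j ∈ Finset.range 8, A j * (b ^ j)⁻¹
      + ∑ j ∈ Finset.range 8, B j * (b ^ (j + 1))⁻¹)) ∧
    localNorm M ≤ ENNReal.ofReal (C * ∑ j ∈ Finset.range 8, A j * (b ^ (j + 1))⁻¹) := by
  have hK := gaussConst_nonneg κ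
  have hpi := Real.pi_gt_three
  -- The squared norm is at most `c (X + Y) ^ 2` with `c = 3 * 8 * π * gaussConst κ`; adding 1
  -- replaces the square root of `c` by `c + 1`.
  refine ⟨24 * Real.pi * gaussConst κ + 1, by positivity, fun a b M h h₁ A B hb hA hB H H₁ hh hh₁ =>
    ⟨?_, ?_⟩⟩
  · have hb0 : 0 < b := by linarith
    set X := ∑ j ∈ Finset.range 8, A j * (b ^ j)⁻¹ with hX
    set Y := ∑ j ∈ Finset.range 8, B j * (b ^ (j + 1))⁻¹ with hY
    have hX0 : 0 ≤ X := Finset.sum_nonneg fun j _ => mul_nonneg (hA j) (by positivity)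
    have hY0 : 0 ≤ Y := Finset.sum_nonneg fun j _ => mul_nonneg (hB j) (by positivity)
    have eY : Y = b⁻¹ * ∑ j ∈ Finset.range 8, B j * (b ^ j)⁻¹ := by
      rw [hY, Finset.mul_sum]
      exact Finset.sum_congr rfl fun j _ => by rw [pow_succ, mul_inv]; ring
    have fin : ∀ s : Finset ℤ, ∑ k ∈ s, |M k| ≤ (24 * Real.pi * gaussConst κ + 1) * (X + Y) := by
      intro s
      have h1 := IsTransform.sum_abs_sq_le hb H H₁ s
      have h2 := hh.integral_norm_sq_le hκ hb0 hA H.1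
      have h3 := hh₁.integral_norm_sq_le hκ hb0 hB H₁.1
      have h4 : (b ^ 2)⁻¹ * (8 * gaussConst κ * b⁻¹ * (∑ j ∈ Finset.range 8, B j * (b ^ j)⁻¹) ^ 2)
          = 8 * gaussConst κ * b⁻¹ * Y ^ 2 := by
        rw [eY, mul_pow, inv_pow]; ring
      have h5 := add_le_add h2 (mul_le_mul_of_nonneg_left h3 (by positivity : 0 ≤ (b ^ 2)⁻¹))
      rw [h4] at h5
      have h6 := h1.trans (mul_le_mul_of_nonneg_left h5 (by positivity : 0 ≤ 3 * b * Real.pi))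
      have h7 : 3 * b * Real.pi * (8 * gaussConst κ * b⁻¹ * X ^ 2 + 8 * gaussConst κ * b⁻¹ * Y ^ 2)
          = 24 * Real.pi * gaussConst κ * (X ^ 2 + Y ^ 2) := by
        field_simp; ring
      rw [h7] at h6
      refine le_of_sq_le_sq (h6.trans ?_) (by positivity)
      set c := 24 * Real.pi * gaussConst κ
      have hc : 0 ≤ c := by positivity
      have h8 : c * (X ^ 2 + Y ^ 2) ≤ c * (X + Y) ^ 2 :=
        mul_le_mul_of_nonneg_left (by nlinarith [mul_nonneg hX0 hY0]) hc
      have h9 : c * (X + Y) ^ 2 ≤ (c + 1) ^ 2 * (X + Y) ^ 2 :=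
        mul_le_mul_of_nonneg_right (by nlinarith) (sq_nonneg _)
      rw [mul_pow]; linarith
    rw [tvNorm, ENNReal.tsum_eq_iSup_sum]
    refine iSup_le fun s => ?_
    rw [← ENNReal.ofReal_sum_of_nonneg fun _ _ => abs_nonneg _]
    exact ENNReal.ofReal_le_ofReal (fin s)
  · refine iSup_le fun k => ENNReal.ofReal_le_ofReal ?_
    have hb0 : 0 < b := by linarith
    have h1 := (H.abs_le k).trans (hh.integral_norm_le hκ hb0 hA H.1)
    refine h1.trans (mul_le_mul_of_nonneg_right ?_
      (Finset.sum_nonneg fun j _ => mul_nonneg (hA j) (by positivity)))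
    nlinarith

end Transforms

end OneDependent

/-! ### Transforms of convolutions, exponential measures and laws. -/

namespace OneDependent

section Transforms

theorem integral_exp_int (k : ℤ) :
    ∫ t in -Real.pi..Real.pi, Complex.exp (k * t * Complex.I)
      = if k = 0 then ((2 * Real.pi : ℝ) : ℂ) else 0 := by
  split_ifs with hk
  · subst hk; simp; ring
  · have hc : (k : ℂ) * Complex.I ≠ 0 := mul_ne_zero (Int.cast_ne_zero.2 hk) Complex.I_ne_zero
    have h := integral_exp_mul_complex (a := -Real.pi) (b := Real.pi) hc
    rw [intervalIntegral.integral_congr (g := fun t : ℝ => Complex.exp (k * Complex.I * t))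
      fun t _ => by simp only; congr 1; ring, h, div_eq_zero_iff]
    left
    rw [sub_eq_zero, Complex.exp_eq_exp_iff_exists_int]
    exact ⟨k, by push_cast; ring⟩

variable {M N : ℤ → ℝ} {h h₁ q : ℝ → ℂ}

theorem IsTransform.sub (H : IsTransform M h) (H₁ : IsTransform N h₁) :
    IsTransform (fun k => M k - N k) fun t => h t - h₁ t := by
  refine ⟨H.1.sub H₁.1, fun k => ?_⟩
  have c1 := H.1
  have c2 := H₁.1
  push_cast
  rw [H.2, H₁.2, ← mul_sub, ← intervalIntegral.integral_sub
    (Continuous.intervalIntegrable (by fun_prop) _ _)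
    (Continuous.intervalIntegrable (by fun_prop) _ _)]
  push_cast
  simp only [mul_sub]

theorem IsTransform.const_mul (H : IsTransform M h) (a : ℝ) :
    IsTransform (fun k => a * M k) fun t => a * h t := by
  refine ⟨continuous_const.mul H.1, fun k => ?_⟩
  push_cast
  rw [H.2, ← mul_assoc, mul_comm (a : ℂ), mul_assoc, ← intervalIntegral.integral_const_mul]
  push_cast
  congr 1
  refine intervalIntegral.integral_congr fun t _ => ?_
  ring

theorem isTransform_dirac_zero : IsTransform (dirac 0) fun _ => 1 := by
  refine ⟨continuous_const, fun k => ?_⟩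
  have h := integral_exp_int (-k)
  have e : ∀ t : ℝ, -((k : ℂ) * t) * Complex.I = ((-k : ℤ) : ℂ) * t * Complex.I := fun t => by
    push_cast; ring
  simp only [e, mul_one, h, dirac, Pi.single_apply]
  have hpi : (Real.pi : ℂ) ≠ 0 := Complex.ofReal_ne_zero.2 Real.pi_ne_zero
  rcases eq_or_ne k 0 with rfl | hk
  · simp; field_simp
  · simp [hk]

/-- Integration by parts over a period, where the boundary terms cancel. -/
theorem IsTransform.derivative (H : IsTransform M h) {h' : ℝ → ℂ}
    (hd : ∀ t, HasDerivAt h (h' t) t) (hc : Continuous h') (hper : h (-Real.pi) = h Real.pi) :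
    IsTransform (fun k => k * M k) fun t => -Complex.I * h' t := by
  refine ⟨continuous_const.mul hc, fun k => ?_⟩
  have hcont := H.1
  have d1 : ∀ t : ℝ, HasDerivAt (fun t : ℝ => Complex.exp (-(k * t) * Complex.I) * h t)
      (Complex.exp (-(k * t) * Complex.I) * (-k * Complex.I) * h t
        + Complex.exp (-(k * t) * Complex.I) * h' t) t := by
    intro t
    have h1 : HasDerivAt (fun t : ℝ => -((k : ℂ) * t) * Complex.I) (-k * Complex.I) t := by
      have h2 := (((hasDerivAt_id t).ofReal_comp.const_mul (k : ℂ)).neg).mul_const Complex.I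
      simpa using h2
    exact h1.cexp.mul (hd t)
  have h3 := intervalIntegral.integral_eq_sub_of_hasDerivAt (a := -Real.pi) (b := Real.pi)
    (fun t _ => d1 t) (Continuous.intervalIntegrable (by fun_prop) _ _)
  have h4 : Complex.exp (-(k * (Real.pi : ℝ)) * Complex.I)
      = Complex.exp (-(k * ((-Real.pi : ℝ) : ℂ)) * Complex.I) := by
    rw [Complex.exp_eq_exp_iff_exists_int]
    exact ⟨-k, by push_cast; ring⟩
  rw [h4, hper, sub_self, intervalIntegral.integral_add
    (Continuous.intervalIntegrable (by fun_prop) _ _)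
    (Continuous.intervalIntegrable (by fun_prop) _ _)] at h3
  have h5 : ∫ t in -Real.pi..Real.pi, Complex.exp (-(k * t) * Complex.I) * (-k * Complex.I) * h t
      = (-k * Complex.I) * ∫ t in -Real.pi..Real.pi, Complex.exp (-(k * t) * Complex.I) * h t := by
    rw [← intervalIntegral.integral_const_mul]
    exact intervalIntegral.integral_congr fun t _ => by ring
  have h6 : ∫ t in -Real.pi..Real.pi, Complex.exp (-(k * t) * Complex.I) * (-Complex.I * h' t)
      = -Complex.I * ∫ t in -Real.pi..Real.pi, Complex.exp (-(k * t) * Complex.I) * h' t := by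
    rw [← intervalIntegral.integral_const_mul]
    exact intervalIntegral.integral_congr fun t _ => by ring
  rw [h5] at h3
  push_cast
  rw [H.2, h6]
  push_cast
  linear_combination ((2 * (Real.pi : ℂ))⁻¹ * Complex.I) * h3
    + ((2 * (Real.pi : ℂ))⁻¹ * k
      * ∫ t in -Real.pi..Real.pi, Complex.exp (-(k * t) * Complex.I) * h t) * Complex.I_sq

/-- The finitely supported measure `N` has the characteristic function `q`. -/
def HasSymbol (N : ℤ → ℝ) (q : ℝ → ℂ) : Prop :=
  (∃ s : Finset ℤ, ∀ i ∉ s, N i = 0) ∧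
    ∀ t : ℝ, HasSum (fun i : ℤ => (N i : ℂ) * Complex.exp (i * t * Complex.I)) (q t)

theorem hasSum_of_eq {f g : ℤ → ℂ} {c : ℂ} (h : HasSum g c) (e : ∀ i, f i = g i) :
    HasSum f c := by
  rwa [funext e]

theorem HasSymbol.add {N' : ℤ → ℝ} {q' : ℝ → ℂ} (H : HasSymbol N q) (H' : HasSymbol N' q') :
    HasSymbol (N + N') fun t => q t + q' t := by
  classical
  obtain ⟨⟨s, hs⟩, H⟩ := H
  obtain ⟨⟨s', hs'⟩, H'⟩ := H'
  refine ⟨⟨s ∪ s', fun i hi => ?_⟩, fun t => ?_⟩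
  · rw [Finset.mem_union, not_or] at hi
    rw [Pi.add_apply, hs i hi.1, hs' i hi.2, add_zero]
  · refine hasSum_of_eq ((H t).add (H' t)) fun i => ?_
    rw [Pi.add_apply]; push_cast; ring

theorem HasSymbol.smul (H : HasSymbol N q) (a : ℝ) : HasSymbol (a • N) fun t => a * q t := by
  obtain ⟨⟨s, hs⟩, H⟩ := H
  refine ⟨⟨s, fun i hi => by simp [hs i hi]⟩, fun t => ?_⟩
  refine hasSum_of_eq ((H t).mul_left (a : ℂ)) fun i => ?_
  rw [Pi.smul_apply, smul_eq_mul]; push_cast; ring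

theorem HasSymbol.shift (H : HasSymbol N q) :
    HasSymbol (fun k => N (k - 1)) fun t => Complex.exp (Complex.I * t) * q t := by
  obtain ⟨⟨s, hs⟩, H⟩ := H
  refine ⟨⟨s.image (· + 1), fun i hi => hs _ fun h => hi (Finset.mem_image.2 ⟨_, h, by ring⟩)⟩,
    fun t => ?_⟩
  have h1 := ((Equiv.subRight (1 : ℤ)).hasSum_iff.2 (H t)).mul_left (Complex.exp (Complex.I * t))
  refine hasSum_of_eq h1 fun i => ?_
  simp only [Function.comp_apply, Equiv.subRight_apply]
  rw [mul_left_comm, ← Complex.exp_add]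
  congr 2
  push_cast; ring

theorem hasSymbol_dirac_zero : HasSymbol (dirac 0) fun _ => 1 := by
  refine ⟨⟨{0}, fun i hi => ?_⟩, fun t => ?_⟩
  · simp only [Finset.mem_singleton] at hi
    simp [dirac, hi]
  · convert hasSum_ite_eq (0 : ℤ) (1 : ℂ) using 1
    funext i
    rcases eq_or_ne i 0 with rfl | hi
    · simp [dirac]
    · simp [dirac, hi]

theorem conv_U (M : ℤ → ℝ) (k : ℤ) : conv M U k = M (k - 1) - M k := by
  rw [conv_apply, tsum_eq_sum (s := {k - 1, k}), Finset.sum_pair (by omega)]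
  · simp [U, dirac, sub_eq_add_neg]
  · intro j hj
    simp only [Finset.mem_insert, Finset.mem_singleton, not_or] at hj
    have h1 : k - j ≠ 1 := by omega
    have h2 : k - j ≠ 0 := by omega
    simp [U, dirac, h1, h2]

theorem hasSymbol_convPow_U (m : ℕ) :
    HasSymbol (convPow U m) fun t => (Complex.exp (Complex.I * t) - 1) ^ m := by
  induction m with
  | zero => simpa [convPow] using hasSymbol_dirac_zero
  | succ m ih =>
    have e : convPow U (m + 1) = (fun k => convPow U m (k - 1)) + (-1 : ℝ) • convPow U m := by
      funext k
      rw [convPow, conv_U]; simp; ring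
    rw [e]
    convert ih.shift.add (ih.smul (-1)) using 2
    push_cast; ring

theorem hasSymbol_U : HasSymbol U fun t => Complex.exp (Complex.I * t) - 1 := by
  have e : U = convPow U 1 := by
    funext k
    rw [convPow, conv_U, convPow, U]
    simp [dirac, Pi.single_apply, sub_eq_iff_eq_add]
  rw [e]
  simpa using hasSymbol_convPow_U 1

theorem HasSymbol.continuous (H : HasSymbol N q) : Continuous q := by
  obtain ⟨⟨s, hs⟩, H⟩ := H
  have e : q = fun t : ℝ => ∑ i ∈ s, (N i : ℂ) * Complex.exp (i * t * Complex.I) := by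
    funext t
    exact (H t).unique (hasSum_sum_of_ne_finset_zero fun i hi => by simp [hs i hi])
  rw [e]; fun_prop

/-- Since `N` has finite support, the convolution is a finite combination of translates of `M` and
no convergence is at stake. -/
theorem IsTransform.conv (H : IsTransform M h) (Q : HasSymbol N q) :
    IsTransform (conv M N) fun t => h t * q t := by
  refine ⟨H.1.mul Q.continuous, fun k => ?_⟩
  obtain ⟨⟨s, hs⟩, Q⟩ := Q
  have hcont := H.1
  have e : ∀ t, q t = ∑ i ∈ s, (N i : ℂ) * Complex.exp (i * t * Complex.I) := fun t =>
    (Q t).unique (hasSum_sum_of_ne_finset_zero fun i hi => by simp [hs i hi])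
  have e1 : OneDependent.conv M N k = ∑ i ∈ s, M (k - i) * N i := by
    rw [conv_apply, ← (Equiv.subLeft k).tsum_eq]
    simp only [Equiv.subLeft_apply, sub_sub_cancel]
    exact tsum_eq_sum fun i hi => by rw [hs i hi, mul_zero]
  rw [e1]
  push_cast
  have e2 : ∀ t : ℝ, Complex.exp (-(k * t) * Complex.I) * (h t * q t)
      = ∑ i ∈ s, (N i : ℂ) * (Complex.exp (-((k - i : ℤ) * t) * Complex.I) * h t) := by
    intro t
    rw [e t, Finset.mul_sum, Finset.mul_sum]
    refine Finset.sum_congr rfl fun i _ => ?_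
    rw [show -(((k - i : ℤ) : ℂ) * t) * Complex.I = -(k * t) * Complex.I + i * t * Complex.I by
      push_cast; ring, Complex.exp_add]
    ring
  simp only [e2]
  rw [intervalIntegral.integral_finsetSum fun i _ =>
    Continuous.intervalIntegrable (by fun_prop) _ _, Finset.mul_sum]
  refine Finset.sum_congr rfl fun i _ => ?_
  rw [intervalIntegral.integral_const_mul, H.2]
  push_cast; ring

theorem HasSymbol.isTransform_convPow (Q : HasSymbol N q) (m : ℕ) :
    IsTransform (convPow N m) fun t => q t ^ m := by
  induction m with
  | zero => simpa [convPow] using isTransform_dirac_zero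
  | succ m ih =>
    have := ih.conv Q
    simpa only [convPow, pow_succ] using this

/-- The exponential series of the bounded function `q` is integrated term by term by dominated
convergence; its terms are the transforms of the convolution powers. -/
theorem HasSymbol.isTransform_expMeasure (Q : HasSymbol N q) :
    IsTransform (expMeasure N) fun t => Complex.exp (q t) := by
  have hq := Q.continuous
  refine ⟨Complex.continuous_exp.comp hq, fun k => ?_⟩
  obtain ⟨B, hB⟩ := isCompact_uIcc.exists_bound_of_continuousOn (s := Set.uIcc (-Real.pi) Real.pi)
    hq.continuousOn
  have hsum := intervalIntegral.hasSum_integral_of_dominated_convergence (a := -Real.pi)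
    (b := Real.pi) (μ := volume)
    (F := fun (m : ℕ) (t : ℝ) => Complex.exp (-(k * t) * Complex.I)
      * ((m.factorial : ℂ)⁻¹ * q t ^ m))
    (f := fun t => Complex.exp (-(k * t) * Complex.I) * Complex.exp (q t))
    (fun m _ => (m.factorial : ℝ)⁻¹ * B ^ m)
    (fun m => Continuous.aestronglyMeasurable (by fun_prop))
    (fun m => Filter.Eventually.of_forall fun t ht => by
      rw [norm_mul, show -((k : ℂ) * t) * Complex.I = ((-(k * t) : ℝ) : ℂ) * Complex.I by
        push_cast; ring, Complex.norm_exp_ofReal_mul_I, one_mul, norm_mul, norm_inv,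
        Complex.norm_natCast, norm_pow]
      exact mul_le_mul_of_nonneg_left (pow_le_pow_left₀ (norm_nonneg _)
        (hB t (Set.uIoc_subset_uIcc ht)) m) (by positivity))
    (Filter.Eventually.of_forall fun t _ => by
      simpa [div_eq_inv_mul] using Real.summable_pow_div_factorial B)
    intervalIntegrable_const
    (Filter.Eventually.of_forall fun t _ => by
      refine HasSum.mul_left _ ?_
      have := NormedSpace.expSeries_div_hasSum_exp (𝔸 := ℂ) (q t)
      rw [← Complex.exp_eq_exp_ℂ] at this
      simpa [div_eq_inv_mul] using this)
  have hterm : ∀ m : ℕ, (((m.factorial : ℝ)⁻¹ * convPow N m k : ℝ) : ℂ)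
      = (2 * Real.pi)⁻¹ * ∫ t in -Real.pi..Real.pi, Complex.exp (-(k * t) * Complex.I)
        * ((m.factorial : ℂ)⁻¹ * q t ^ m) := by
    intro m
    have e : ∫ t in -Real.pi..Real.pi, Complex.exp (-(k * t) * Complex.I)
        * ((m.factorial : ℂ)⁻¹ * q t ^ m) = (m.factorial : ℂ)⁻¹
        * ∫ t in -Real.pi..Real.pi, Complex.exp (-(k * t) * Complex.I) * q t ^ m := by
      rw [← intervalIntegral.integral_const_mul]
      exact intervalIntegral.integral_congr fun t _ => by ring
    rw [e]
    push_cast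
    rw [(Q.isTransform_convPow m).2 k]
    push_cast; ring
  rw [expMeasure, Complex.ofReal_tsum]
  simp only [hterm]
  rw [(hsum.mul_left _).tsum_eq]

end Transforms

section Laws

variable {Ω : Type*} [MeasurableSpace Ω] {P : Measure Ω} [IsProbabilityMeasure P]

/-- Fubini's theorem and the orthogonality of the exponentials. The weights 1 and `m` give the law
and its first moment measure; at negative `k` the event is empty, so the value of `k.toNat` is
irrelevant. -/
theorem isTransform_weighted_law {S : Ω → ℕ} (hS : Measurable S) {g : ℕ → ℝ}
    (hg : Integrable (fun ω => g (S ω)) P) :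
    IsTransform (fun k => g k.toNat * P.real {ω | (S ω : ℤ) = k})
      fun t => ∫ ω, (g (S ω) : ℂ) * Complex.exp (Complex.I * t) ^ S ω ∂P := by
  have norm_one : ∀ t : ℝ, ‖Complex.exp (Complex.I * t)‖ = 1 := fun t => by
    rw [mul_comm]; exact Complex.norm_exp_ofReal_mul_I t
  have meas : ∀ (F : ℕ → ℂ), Measurable fun ω => F (S ω) := fun F =>
    (measurable_from_top (f := F)).comp hS
  refine ⟨continuous_of_dominated (fun t => (meas fun m => (g m : ℂ)
      * Complex.exp (Complex.I * t) ^ m).aestronglyMeasurable)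
    (fun t => Filter.Eventually.of_forall fun ω => ?_) hg.norm
    (Filter.Eventually.of_forall fun ω => by fun_prop), fun k => ?_⟩
  · rw [norm_mul, norm_pow, norm_one, one_pow, mul_one, Complex.norm_real]
  have e1 : ∀ t : ℝ, Complex.exp (-(k * t) * Complex.I)
      * ∫ ω, (g (S ω) : ℂ) * Complex.exp (Complex.I * t) ^ S ω ∂P
      = ∫ ω, (g (S ω) : ℂ) * Complex.exp (((S ω : ℤ) - k : ℤ) * t * Complex.I) ∂P := by
    intro t
    rw [← integral_const_mul]
    refine integral_congr_ae (Filter.Eventually.of_forall fun ω => ?_)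
    simp only
    rw [← Complex.exp_nat_mul, mul_left_comm, ← Complex.exp_add]
    congr 2
    push_cast; ring
  simp only [e1]
  rw [intervalIntegral_integral_swap]
  · have e2 : ∀ ω, ∫ t in -Real.pi..Real.pi, (g (S ω) : ℂ)
        * Complex.exp (((S ω : ℤ) - k : ℤ) * t * Complex.I)
        = Set.indicator {ω | (S ω : ℤ) = k}
          (fun _ => (g k.toNat : ℂ) * ((2 * Real.pi : ℝ) : ℂ)) ω := by
      intro ω
      rw [intervalIntegral.integral_const_mul, integral_exp_int]
      by_cases h : (S ω : ℤ) = k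
      · rw [Set.indicator_of_mem (by exact h), if_pos (by omega)]
        congr 3; omega
      · rw [Set.indicator_of_notMem (by exact h), if_neg (by omega), mul_zero]
    simp only [e2]
    have hm : MeasurableSet {ω | (S ω : ℤ) = k} :=
      hS (MeasurableSet.of_discrete (s := {m : ℕ | (m : ℤ) = k}))
    rw [integral_indicator hm,
      setIntegral_const]
    have hpi : (Real.pi : ℂ) ≠ 0 := Complex.ofReal_ne_zero.2 Real.pi_ne_zero
    rw [Complex.real_smul]
    push_cast
    field_simp
  · have : IsFiniteMeasure (volume.restrict (Set.uIoc (-Real.pi) Real.pi)) := by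
      rw [Set.uIoc]; infer_instance
    have hbound : Integrable (fun p : ℝ × Ω => g (S p.2))
        ((volume.restrict (Set.uIoc (-Real.pi) Real.pi)).prod P) := by
      have := (integrable_const (1 : ℝ)
        (μ := volume.restrict (Set.uIoc (-Real.pi) Real.pi))).mul_prod hg
      simpa using this
    refine hbound.norm.mono' ?_ (Filter.Eventually.of_forall fun p => ?_)
    · refine Measurable.aestronglyMeasurable ?_
      have m1 : Measurable fun p : ℝ × Ω => (g (S p.2) : ℂ) := (meas fun m => (g m : ℂ)).comp
        measurable_snd
      have m2 : Measurable fun p : ℝ × Ω => (((S p.2 : ℤ) - k : ℤ) : ℂ) :=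
        (meas fun m => (((m : ℤ) - k : ℤ) : ℂ)).comp measurable_snd
      have m3 : Measurable fun p : ℝ × Ω => (p.1 : ℂ) :=
        Complex.measurable_ofReal.comp measurable_fst
      exact m1.mul (Complex.measurable_exp.comp ((m2.mul m3).mul_const _))
    · simp only [Function.uncurry]
      rw [norm_mul, show (((S p.2 : ℤ) - k : ℤ) : ℂ) * p.1 * Complex.I
        = (((((S p.2 : ℤ) - k : ℤ) : ℝ) * p.1 : ℝ) : ℂ) * Complex.I by push_cast; ring,
        Complex.norm_exp_ofReal_mul_I, mul_one, Complex.norm_real]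

end Laws

end OneDependent

/-! ### Comparison of exponentials and the approximating transforms. -/

namespace OneDependent

section Exponentials

variable {g y : ℂ} {ε : ℝ}

/-- The modulus is the exponential of a function affine in `s`, so its maximum on the segment is
attained at an end. Thus bounds for both characteristic functions suffice, with no loss of a factor
`exp ‖y‖`. -/
theorem norm_exp_add_smul_le (h0 : ‖Complex.exp g‖ ≤ ε) (h1 : ‖Complex.exp (g + y)‖ ≤ ε) {s : ℝ}
    (hs : s ∈ Set.Icc (0 : ℝ) 1) : ‖Complex.exp (g + s * y)‖ ≤ ε := by
  rw [Complex.norm_exp] at *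
  rw [Complex.add_re] at h1
  rw [Complex.add_re, Complex.re_ofReal_mul]
  rcases le_total 0 y.re with h | h
  · refine le_trans (Real.exp_le_exp.2 ?_) h1
    nlinarith [hs.2]
  · refine le_trans (Real.exp_le_exp.2 ?_) h0
    nlinarith [hs.1]

theorem hasDerivAt_exp_add_mul (g y : ℂ) (s : ℝ) :
    HasDerivAt (fun s : ℝ => Complex.exp (g + s * y)) (Complex.exp (g + s * y) * y) s := by
  have h1 : HasDerivAt (fun s : ℝ => g + (s : ℂ) * y) y s := by
    simpa using ((hasDerivAt_id s).ofReal_comp.mul_const y).const_add g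
  exact h1.cexp

theorem norm_exp_add_sub_le (h0 : ‖Complex.exp g‖ ≤ ε) (h1 : ‖Complex.exp (g + y)‖ ≤ ε) :
    ‖Complex.exp (g + y) - Complex.exp g‖ ≤ ‖y‖ * ε := by
  have h := norm_image_sub_le_of_norm_deriv_le_segment_01' (C := ‖y‖ * ε)
    (fun s _ => (hasDerivAt_exp_add_mul g y s).hasDerivWithinAt) fun s hs => by
      rw [norm_mul, mul_comm]
      exact mul_le_mul_of_nonneg_left (norm_exp_add_smul_le h0 h1 (Set.Ico_subset_Icc_self hs))
        (norm_nonneg _)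
  simpa using h

/-- The mean value inequality, whose derivative bound comes from `norm_exp_add_sub_le` on the part
of the segment up to `s`. -/
theorem norm_exp_add_sub_sub_le (h0 : ‖Complex.exp g‖ ≤ ε) (h1 : ‖Complex.exp (g + y)‖ ≤ ε) :
    ‖Complex.exp (g + y) - Complex.exp g - Complex.exp g * y‖ ≤ ‖y‖ ^ 2 * ε := by
  have hd : ∀ s : ℝ, HasDerivAt (fun s : ℝ => Complex.exp (g + s * y) - s * (Complex.exp g * y))
      (Complex.exp (g + s * y) * y - Complex.exp g * y) s := fun s => by
    have h2 := (hasDerivAt_id s).ofReal_comp.mul_const (Complex.exp g * y)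
    have h3 : HasDerivAt (fun s : ℝ => Complex.exp (g + s * y) - s * (Complex.exp g * y)) _ s :=
      (hasDerivAt_exp_add_mul g y s).sub h2
    exact h3.congr_deriv (by simp)
  have h := norm_image_sub_le_of_norm_deriv_le_segment_01' (C := ‖y‖ ^ 2 * ε)
    (fun s _ => (hd s).hasDerivWithinAt) fun s hs => by
      have hs' := Set.Ico_subset_Icc_self hs
      rw [← sub_mul, norm_mul]
      have h3 := norm_exp_add_sub_le h0 (norm_exp_add_smul_le h0 h1 hs')
      have h4 : ‖(s : ℂ) * y‖ ≤ ‖y‖ := by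
        rw [norm_mul, Complex.norm_real, Real.norm_of_nonneg hs'.1]
        exact mul_le_of_le_one_left (norm_nonneg _) hs'.2
      have h5 : 0 ≤ ε := (norm_nonneg _).trans h0
      have h6 := mul_le_mul_of_nonneg_right (h3.trans (mul_le_mul_of_nonneg_right h4 h5))
        (norm_nonneg y)
      refine h6.trans (le_of_eq (by ring))
  refine le_trans (le_of_eq ?_) h
  congr 1
  push_cast
  rw [zero_mul, zero_mul, one_mul, one_mul, add_zero]
  ring

end Exponentials

section Approximation

variable {Ω : Type*} [mΩ : MeasurableSpace Ω]

/-- The sum of the means. -/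
noncomputable def sumMean (P : Measure Ω) (x : ℤ → Ω → ℕ) (n : ℕ) : ℝ :=
  ∑ k ∈ Finset.Icc (1 : ℤ) n, factMoment P x 1 k

noncomputable def sumCoeff₂ (P : Measure Ω) (x : ℤ → Ω → ℕ) (n : ℕ) : ℝ :=
  ∑ k ∈ Finset.Icc (1 : ℤ) n, coeff₂ P x k

noncomputable def sumCoeff₃ (P : Measure Ω) (x : ℤ → Ω → ℕ) (n : ℕ) : ℝ :=
  ∑ k ∈ Finset.Icc (1 : ℤ) n, coeff₃ P x k

noncomputable def sumRemainder₁ (P : Measure Ω) (x : ℤ → Ω → ℕ) (n : ℕ) : ℝ :=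
  ∑ k ∈ Finset.Icc (1 : ℤ) n, remainder₁ P x k

noncomputable def sumRemainder₂ (P : Measure Ω) (x : ℤ → Ω → ℕ) (n : ℕ) : ℝ :=
  ∑ k ∈ Finset.Icc (1 : ℤ) n, remainder₂ P x k

/-- The parameter which governs the decay of the characteristic function. -/
noncomputable def decay (P : Measure Ω) (x : ℤ → Ω → ℕ) (n : ℕ) : ℝ :=
  ∑ k ∈ Finset.Icc (1 : ℤ) n, factMoment P x 1 k
    - 1.52 * ∑ k ∈ Finset.Icc (1 : ℤ) n, factMoment P x 2 k
    - 12 * ∑ k ∈ Finset.Icc (1 : ℤ) n, mixedMoment P x k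

/-- The distribution of a partial sum. -/
noncomputable def partialSumLaw (P : Measure Ω) (x : ℤ → Ω → ℕ) (n : ℕ) : ℤ → ℝ :=
  fun k => P.real {ω | (partialSum x n ω : ℤ) = k}

noncomputable def limitMeasure (P : Measure Ω) (x : ℤ → Ω → ℕ) (n : ℕ) : ℤ → ℝ :=
  expMeasure (sumMean P x n • U + sumCoeff₂ P x n • convPow U 2)

noncomputable def limitExpansion (P : Measure Ω) (x : ℤ → Ω → ℕ) (n : ℕ) : ℤ → ℝ :=
  conv (limitMeasure P x n) (dirac 0 + sumCoeff₃ P x n • convPow U 3)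

variable {P : Measure Ω} {x : ℤ → Ω → ℕ} [IsProbabilityMeasure P] (hx : OneDepSeq P x)

section Limit

variable (P x)

/-- The characteristic function of the limit. -/
noncomputable def limitChar (n : ℕ) (t : ℝ) : ℂ :=
  Complex.exp (sumMean P x n * (Complex.exp (Complex.I * t) - 1)
    + sumCoeff₂ P x n * (Complex.exp (Complex.I * t) - 1) ^ 2)

omit [IsProbabilityMeasure P] in
theorem isTransform_limitMeasure (n : ℕ) : IsTransform (limitMeasure P x n) (limitChar P x n) :=
  ((hasSymbol_U.smul _).add ((hasSymbol_convPow_U 2).smul _)).isTransform_expMeasure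

omit [IsProbabilityMeasure P] in
theorem isTransform_limitExpansion (n : ℕ) : IsTransform (limitExpansion P x n) fun t =>
    limitChar P x n t * (1 + sumCoeff₃ P x n * (Complex.exp (Complex.I * t) - 1) ^ 3) :=
  (isTransform_limitMeasure P x n).conv
    (hasSymbol_dirac_zero.add ((hasSymbol_convPow_U 3).smul _))

theorem hasDerivAt_exp_I (t : ℝ) : HasDerivAt (fun t : ℝ => Complex.exp (Complex.I * t) - 1)
    (Complex.exp (Complex.I * t) * Complex.I) t := by
  have h1 : HasDerivAt (fun t : ℝ => Complex.I * (t : ℂ)) Complex.I t := by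
    simpa using (hasDerivAt_id t).ofReal_comp.const_mul Complex.I
  exact h1.cexp.sub_const 1

theorem exp_I_neg_pi : Complex.exp (Complex.I * ((-Real.pi : ℝ) : ℂ))
    = Complex.exp (Complex.I * (Real.pi : ℝ)) := by
  rw [Complex.exp_eq_exp_iff_exists_int]
  exact ⟨-1, by push_cast; ring⟩

omit [IsProbabilityMeasure P] in
theorem hasDerivAt_limitChar (n : ℕ) (t : ℝ) : HasDerivAt (limitChar P x n)
    (limitChar P x n t * (Complex.I * Complex.exp (Complex.I * t)
      * (sumMean P x n + 2 * sumCoeff₂ P x n * (Complex.exp (Complex.I * t) - 1)))) t := by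
  have hz := hasDerivAt_exp_I t
  have h : HasDerivAt (limitChar P x n) _ t :=
    ((hz.const_mul (sumMean P x n : ℂ)).add ((hz.pow 2).const_mul (sumCoeff₂ P x n : ℂ))).cexp
  refine h.congr_deriv ?_
  simp only [limitChar, Pi.add_apply, Pi.pow_apply]
  push_cast
  ring

omit [IsProbabilityMeasure P] in
theorem isTransform_mul_limitMeasure (n : ℕ) : IsTransform (fun k => k * limitMeasure P x n k)
    fun t => limitChar P x n t * (Complex.exp (Complex.I * t)
      * (sumMean P x n + 2 * sumCoeff₂ P x n * (Complex.exp (Complex.I * t) - 1))) := by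
  have hc := (isTransform_limitMeasure P x n).1
  have h := (isTransform_limitMeasure P x n).derivative (hasDerivAt_limitChar P x n) (by fun_prop)
    (by simp only [limitChar, exp_I_neg_pi])
  convert h using 2 with t
  linear_combination ((limitChar P x n t * Complex.exp (Complex.I * t)
      * (sumMean P x n + 2 * sumCoeff₂ P x n * (Complex.exp (Complex.I * t) - 1))))
    * Complex.I_sq

omit [IsProbabilityMeasure P] in
theorem isTransform_mul_limitExpansion (n : ℕ) :
    IsTransform (fun k => k * limitExpansion P x n k)
      fun t => limitChar P x n t * Complex.exp (Complex.I * t)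
        * ((sumMean P x n + 2 * sumCoeff₂ P x n * (Complex.exp (Complex.I * t) - 1))
            * (1 + sumCoeff₃ P x n * (Complex.exp (Complex.I * t) - 1) ^ 3)
          + 3 * sumCoeff₃ P x n * (Complex.exp (Complex.I * t) - 1) ^ 2) := by
  have hc := (isTransform_limitMeasure P x n).1
  have hd : ∀ t : ℝ, HasDerivAt (fun t : ℝ => limitChar P x n t
      * (1 + sumCoeff₃ P x n * (Complex.exp (Complex.I * t) - 1) ^ 3))
      (limitChar P x n t * Complex.exp (Complex.I * t) * Complex.I
        * ((sumMean P x n + 2 * sumCoeff₂ P x n * (Complex.exp (Complex.I * t) - 1))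
            * (1 + sumCoeff₃ P x n * (Complex.exp (Complex.I * t) - 1) ^ 3)
          + 3 * sumCoeff₃ P x n * (Complex.exp (Complex.I * t) - 1) ^ 2)) t := by
    intro t
    have h : HasDerivAt (fun t : ℝ => limitChar P x n t
        * (1 + sumCoeff₃ P x n * (Complex.exp (Complex.I * t) - 1) ^ 3)) _ t :=
      (hasDerivAt_limitChar P x n t).mul
        ((((hasDerivAt_exp_I t).pow 3).const_mul (sumCoeff₃ P x n : ℂ)).const_add 1)
    refine h.congr_deriv ?_
    push_cast
    ring
  have h := (isTransform_limitExpansion P x n).derivative hd (by fun_prop)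
    (by simp only [limitChar, exp_I_neg_pi])
  convert h using 2 with t
  linear_combination ((limitChar P x n t * Complex.exp (Complex.I * t)
      * ((sumMean P x n + 2 * sumCoeff₂ P x n * (Complex.exp (Complex.I * t) - 1))
          * (1 + sumCoeff₃ P x n * (Complex.exp (Complex.I * t) - 1) ^ 3)
        + 3 * sumCoeff₃ P x n * (Complex.exp (Complex.I * t) - 1) ^ 2))) * Complex.I_sq

end Limit

include hx

omit [IsProbabilityMeasure P] in
theorem OneDepSeq.measurable_partialSum (n : ℕ) : Measurable (partialSum x n) :=
  Finset.measurable_sum _ fun k _ => hx.meas k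

theorem OneDepSeq.integrable_partialSum (n : ℕ) :
    Integrable (fun ω => (partialSum x n ω : ℝ)) P := by
  simp only [partialSum, Nat.cast_sum]
  exact integrable_finsetSum _ fun k _ => hx.integrable_id k

theorem OneDepSeq.integral_partialSum (n : ℕ) :
    ∫ ω, (partialSum x n ω : ℝ) ∂P = sumMean P x n := by
  simp only [partialSum, Nat.cast_sum, sumMean, factMoment_one]
  exact integral_finsetSum _ fun k _ => hx.integrable_id k

theorem OneDepSeq.isTransform_partialSumLaw (n : ℕ) : IsTransform (partialSumLaw P x n)
    fun t => ∫ ω, Complex.exp (Complex.I * t) ^ partialSum x n ω ∂P := by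
  have h := isTransform_weighted_law (P := P) (hx.measurable_partialSum n) (g := fun _ => 1)
    (integrable_const 1)
  simp only [one_mul, Complex.ofReal_one] at h
  exact h

theorem OneDepSeq.isTransform_mul_partialSumLaw (n : ℕ) :
    IsTransform (fun k => k * partialSumLaw P x n k) fun t =>
      ∫ ω, partialSum x n ω * Complex.exp (Complex.I * t) ^ partialSum x n ω ∂P := by
  have h := isTransform_weighted_law (P := P) (hx.measurable_partialSum n) (g := fun m => (m : ℝ))
    (hx.integrable_partialSum n)
  simp only [Complex.ofReal_natCast] at h
  convert h using 2 with k
  rcases le_or_gt 0 k with hk | hk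
  · obtain ⟨m, rfl⟩ := Int.eq_ofNat_of_zero_le hk
    simp [partialSumLaw]
  · have e : {ω | (partialSum x n ω : ℤ) = k} = ∅ := by
      ext ω; simp; omega
    simp [partialSumLaw, e]

/-- The expansion of the characteristic function at all points of the unit circle. -/
theorem OneDepSeq.exists_char_expansion (n : ℕ) (t : ℝ) : ∃ y y' : ℂ,
    ∫ ω, Complex.exp (Complex.I * t) ^ partialSum x n ω ∂P
      = Complex.exp (sumMean P x n * (Complex.exp (Complex.I * t) - 1)
        + sumCoeff₂ P x n * (Complex.exp (Complex.I * t) - 1) ^ 2 + y) ∧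
    ∫ ω, partialSum x n ω * Complex.exp (Complex.I * t) ^ partialSum x n ω ∂P
      = (∫ ω, Complex.exp (Complex.I * t) ^ partialSum x n ω ∂P)
      * (Complex.exp (Complex.I * t) * (sumMean P x n
        + 2 * sumCoeff₂ P x n * (Complex.exp (Complex.I * t) - 1)) + y') ∧
    ‖y‖ ≤ 10 ^ 17 * sumRemainder₁ P x n * ‖Complex.exp (Complex.I * t) - 1‖ ^ 3 ∧
    ‖y'‖ ≤ 10 ^ 17 * sumRemainder₁ P x n * ‖Complex.exp (Complex.I * t) - 1‖ ^ 2 ∧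
    ‖y - sumCoeff₃ P x n * (Complex.exp (Complex.I * t) - 1) ^ 3‖
      ≤ 10 ^ 17 * sumRemainder₂ P x n * ‖Complex.exp (Complex.I * t) - 1‖ ^ 4 ∧
    ‖y' - 3 * sumCoeff₃ P x n * (Complex.exp (Complex.I * t) - 1) ^ 2
        * Complex.exp (Complex.I * t)‖
      ≤ 10 ^ 17 * sumRemainder₂ P x n * ‖Complex.exp (Complex.I * t) - 1‖ ^ 3 := by
  have hE : ‖Complex.exp (Complex.I * t)‖ = 1 := by
    rw [mul_comm]; exact Complex.norm_exp_ofReal_mul_I t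
  -- At the excluded point `E = 1` both corrections vanish: the characteristic function is 1 and the
  -- expectation in the derivative formula is the mean `Γ₁`.
  rcases eq_or_ne (Complex.exp (Complex.I * t)) 1 with h | h
  · refine ⟨0, 0, ?_, ?_, ?_, ?_, ?_, ?_⟩ <;> rw [h]
    · simp
    · simp only [one_pow, mul_one, sub_self, mul_zero, add_zero, one_mul, integral_const,
        probReal_univ, one_smul]
      rw [← hx.integral_partialSum n, ← integral_complex_ofReal]
      simp
    all_goals simp
  · exact hx.exists_log_expansion hE h n

end Approximation

end OneDependent

/-! ### Pointwise bounds for the differences of transforms. -/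

namespace OneDependent

section Pointwise

variable {E g y y' : ℂ} {a b c r s ε : ℝ}

/-- Centring at `a` cancels the value of the drift at `E = 1`; the factor `a` that remains is
accompanied by a power of `‖E - 1‖`, which is worth `1 / √λ` after integration. -/
theorem norm_drift_le (hE : ‖E‖ = 1) (hb : |b| ≤ a) :
    ‖E * (a + 2 * b * (E - 1)) - a‖ ≤ 3 * a * ‖E - 1‖ := by
  have h : E * (a + 2 * b * (E - 1)) - a = a * (E - 1) + 2 * E * b * (E - 1) := by ring
  have ha : 0 ≤ a := (abs_nonneg b).trans hb
  rw [h]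
  refine (norm_add_le _ _).trans ?_
  simp only [norm_mul, hE, Complex.norm_real, Real.norm_eq_abs, abs_of_nonneg ha,
    Complex.norm_ofNat]
  nlinarith [norm_nonneg (E - 1)]

variable (h0 : ‖Complex.exp g‖ ≤ ε) (h1 : ‖Complex.exp (g + y)‖ ≤ ε)
  (hy : ‖y‖ ≤ r * ‖E - 1‖ ^ 3)

include h0 h1 hy

theorem norm_char_sub_le :
    ‖Complex.exp (g + y) - Complex.exp g‖ ≤ r * ‖E - 1‖ ^ 3 * ε :=
  (norm_exp_add_sub_le h0 h1).trans
    (mul_le_mul_of_nonneg_right hy ((norm_nonneg _).trans h0))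

/-- The centred derivative splits into the drift times the difference of the transforms and the
correction `y'` times the characteristic function. -/
theorem norm_centered_char_sub_le (hE : ‖E‖ = 1) (hb : |b| ≤ a) (hy' : ‖y'‖ ≤ r * ‖E - 1‖ ^ 2) :
    ‖Complex.exp (g + y) * (E * (a + 2 * b * (E - 1)) + y')
        - Complex.exp g * (E * (a + 2 * b * (E - 1)))
        - a * (Complex.exp (g + y) - Complex.exp g)‖
      ≤ (3 * a * r * ‖E - 1‖ ^ 4 + r * ‖E - 1‖ ^ 2) * ε := by
  have e : Complex.exp (g + y) * (E * (a + 2 * b * (E - 1)) + y')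
        - Complex.exp g * (E * (a + 2 * b * (E - 1)))
        - a * (Complex.exp (g + y) - Complex.exp g)
      = (E * (a + 2 * b * (E - 1)) - a) * (Complex.exp (g + y) - Complex.exp g)
        + y' * Complex.exp (g + y) := by ring
  have ha : 0 ≤ a := (abs_nonneg b).trans hb
  rw [e]
  refine (norm_add_le _ _).trans ?_
  rw [norm_mul, norm_mul]
  have h2 := mul_le_mul (norm_drift_le hE hb) (norm_char_sub_le h0 h1 hy) (norm_nonneg _)
    (by positivity)
  have h3 := mul_le_mul hy' h1 (norm_nonneg _) ((norm_nonneg _).trans hy')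
  refine (add_le_add h2 h3).trans (le_of_eq (by ring))

/-- The quadratic remainder of the exponential gives the term with `r ^ 2`; replacing `y` by its
leading term in the linear part gives the term with `s`. -/
theorem norm_char_sub_expansion_le (hz : ‖y - c * (E - 1) ^ 3‖ ≤ s * ‖E - 1‖ ^ 4) :
    ‖Complex.exp (g + y) - Complex.exp g * (1 + c * (E - 1) ^ 3)‖
      ≤ (r ^ 2 * ‖E - 1‖ ^ 6 + s * ‖E - 1‖ ^ 4) * ε := by
  have e : Complex.exp (g + y) - Complex.exp g * (1 + c * (E - 1) ^ 3)
      = (Complex.exp (g + y) - Complex.exp g - Complex.exp g * y)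
        + (y - c * (E - 1) ^ 3) * Complex.exp g := by ring
  have hε : 0 ≤ ε := (norm_nonneg _).trans h0
  rw [e]
  refine (norm_add_le _ _).trans ?_
  rw [norm_mul]
  have h2 := (norm_exp_add_sub_sub_le h0 h1).trans
    (mul_le_mul_of_nonneg_right (pow_le_pow_left₀ (norm_nonneg _) hy 2) hε)
  have h3 := mul_le_mul hz h0 (norm_nonneg _) ((norm_nonneg _).trans hz)
  refine (add_le_add h2 h3).trans (le_of_eq (by ring))

theorem norm_centered_char_sub_expansion_le (hE : ‖E‖ = 1) (hb : |b| ≤ a)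
    (hy' : ‖y'‖ ≤ r * ‖E - 1‖ ^ 2) (hz : ‖y - c * (E - 1) ^ 3‖ ≤ s * ‖E - 1‖ ^ 4)
    (hz' : ‖y' - 3 * c * (E - 1) ^ 2 * E‖ ≤ s * ‖E - 1‖ ^ 3) :
    ‖Complex.exp (g + y) * (E * (a + 2 * b * (E - 1)) + y')
        - Complex.exp g * E * ((a + 2 * b * (E - 1)) * (1 + c * (E - 1) ^ 3)
          + 3 * c * (E - 1) ^ 2)
        - a * (Complex.exp (g + y) - Complex.exp g * (1 + c * (E - 1) ^ 3))‖
      ≤ (3 * a * r ^ 2 * ‖E - 1‖ ^ 7 + (3 * a * s + r ^ 2) * ‖E - 1‖ ^ 5 + s * ‖E - 1‖ ^ 3)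
        * ε := by
  have e : Complex.exp (g + y) * (E * (a + 2 * b * (E - 1)) + y')
        - Complex.exp g * E * ((a + 2 * b * (E - 1)) * (1 + c * (E - 1) ^ 3)
          + 3 * c * (E - 1) ^ 2)
        - a * (Complex.exp (g + y) - Complex.exp g * (1 + c * (E - 1) ^ 3))
      = (E * (a + 2 * b * (E - 1)) - a)
          * (Complex.exp (g + y) - Complex.exp g * (1 + c * (E - 1) ^ 3))
        + (Complex.exp (g + y) - Complex.exp g) * y'
        + (y' - 3 * c * (E - 1) ^ 2 * E) * Complex.exp g := by ring
  have ha : 0 ≤ a := (abs_nonneg b).trans hb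
  have hd := norm_char_sub_le h0 h1 hy
  rw [e]
  refine (norm_add₃_le ).trans ?_
  rw [norm_mul, norm_mul, norm_mul]
  have h2 := mul_le_mul (norm_drift_le hE hb) (norm_char_sub_expansion_le h0 h1 hy hz)
    (norm_nonneg _) (by positivity)
  have h3 := mul_le_mul hd hy' (norm_nonneg _) ((norm_nonneg _).trans hd)
  have h4 := mul_le_mul hz' h0 (norm_nonneg _) ((norm_nonneg _).trans hz')
  refine (add_le_add (add_le_add h2 h3) h4).trans (le_of_eq (by ring))

end Pointwise

section Scale

variable {l w : ℝ}

/-- The scale `max 1 √l`. -/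
noncomputable def scale (l : ℝ) : ℝ := max 1 √l

theorem one_le_scale (l : ℝ) : 1 ≤ scale l := le_max_left _ _

theorem inv_scale_pow_le (hl : 0 < l) (j : ℕ) {p : ℝ} (hp : p = -(j / 2 : ℝ)) :
    (scale l ^ j)⁻¹ ≤ min 1 (l ^ p) := by
  have h1 := one_le_scale l
  have hs : 0 < √l := Real.sqrt_pos.2 hl
  have h2 : √l ≤ scale l := le_max_right _ _
  have e : l ^ p = (√l ^ j)⁻¹ := by
    rw [hp, Real.sqrt_eq_rpow, ← Real.rpow_natCast, ← Real.rpow_mul hl.le, ← Real.rpow_neg hl.le]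
    congr 1
    ring
  rw [e]
  exact le_min (inv_le_one_of_one_le₀ (one_le_pow₀ h1))
    (inv_anti₀ (by positivity) (pow_le_pow_left₀ hs.le h2 j))

/-- Since `scale l ^ 2 ≤ 1 + l` and `w ^ 2 ≤ 4`, passing from `l` to the squared scale costs at most
`exp (4 * 9/20)`. -/
theorem exp_decay_le (hl : 0 < l) (hw : 0 ≤ w) (hw' : w ≤ 2) :
    Real.exp (-(9 / 20) * w ^ 2 * l)
      ≤ Real.exp (9 / 5) * Real.exp (-(9 / 20) * scale l ^ 2 * w ^ 2) := by
  rw [← Real.exp_add, Real.exp_le_exp]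
  have h : scale l ^ 2 ≤ 1 + l := by
    rcases max_choice 1 √l with h | h <;> rw [scale, h]
    · nlinarith
    · rw [Real.sq_sqrt hl.le]; linarith
  have h1 : w ^ 2 ≤ 4 := by nlinarith
  nlinarith [mul_le_mul_of_nonneg_right h (sq_nonneg w)]

end Scale

section Bounds

variable {Ω : Type*} [mΩ : MeasurableSpace Ω] {P : Measure Ω} {x : ℤ → Ω → ℕ}
  [IsProbabilityMeasure P] (hx : OneDepSeq P x) {n : ℕ}

theorem norm_exp_I (t : ℝ) : ‖Complex.exp (Complex.I * t)‖ = 1 := by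
  rw [mul_comm]; exact Complex.norm_exp_ofReal_mul_I t

theorem norm_exp_I_sub_one_le_two (t : ℝ) : ‖Complex.exp (Complex.I * t) - 1‖ ≤ 2 := by
  refine (norm_sub_le _ _).trans ?_
  rw [norm_exp_I, norm_one]; norm_num

omit [IsProbabilityMeasure P] in
theorem sumMean_nonneg : 0 ≤ sumMean P x n := Finset.sum_nonneg fun _ _ => factMoment_nonneg 1 _

omit [IsProbabilityMeasure P] in
theorem sumRemainder₁_nonneg : 0 ≤ sumRemainder₁ P x n :=
  Finset.sum_nonneg fun k _ => remainder₁_nonneg k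

omit [IsProbabilityMeasure P] in
theorem sumRemainder₂_nonneg : 0 ≤ sumRemainder₂ P x n :=
  Finset.sum_nonneg fun k _ => remainder₂_nonneg k

include hx

/-- Positivity of `decay` bounds the mixed moments by a twelfth of the means, so the coefficients
`3/200`, `1/2` and `1/12` add up to less than 1. -/
theorem OneDepSeq.abs_sumCoeff₂_le
    (hν : ∑ k ∈ Finset.Icc (1 : ℤ) n, factMoment P x 2 k ≤ sumMean P x n)
    (hd : 0 < decay P x n) : |sumCoeff₂ P x n| ≤ sumMean P x n := by
  have h := hx.abs_coeff₂_sum_le n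
  have h2 : 0 ≤ ∑ k ∈ Finset.Icc (1 : ℤ) n, factMoment P x 2 k :=
    Finset.sum_nonneg fun k _ => factMoment_nonneg 2 k
  simp only [decay] at hd
  simp only [sumMean, sumCoeff₂] at *
  linarith

/-- The differences of the characteristic functions and of their derivatives. -/
theorem OneDepSeq.exists_char_bounds (n : ℕ) (hd : 0 < decay P x n) (t : ℝ) : ∃ g y y' : ℂ,
    limitChar P x n t = Complex.exp g ∧
    ∫ ω, Complex.exp (Complex.I * t) ^ partialSum x n ω ∂P = Complex.exp (g + y) ∧
    ∫ ω, partialSum x n ω * Complex.exp (Complex.I * t) ^ partialSum x n ω ∂P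
      = Complex.exp (g + y) * (Complex.exp (Complex.I * t) * (sumMean P x n
        + 2 * sumCoeff₂ P x n * (Complex.exp (Complex.I * t) - 1)) + y') ∧
    ‖Complex.exp g‖ ≤ Real.exp (9 / 5) * Real.exp (-(9 / 20) * scale (decay P x n) ^ 2
        * ‖Complex.exp (Complex.I * t) - 1‖ ^ 2) ∧
    ‖Complex.exp (g + y)‖ ≤ Real.exp (9 / 5) * Real.exp (-(9 / 20) * scale (decay P x n) ^ 2
        * ‖Complex.exp (Complex.I * t) - 1‖ ^ 2) ∧
    ‖y‖ ≤ 10 ^ 17 * sumRemainder₁ P x n * ‖Complex.exp (Complex.I * t) - 1‖ ^ 3 ∧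
    ‖y'‖ ≤ 10 ^ 17 * sumRemainder₁ P x n * ‖Complex.exp (Complex.I * t) - 1‖ ^ 2 ∧
    ‖y - sumCoeff₃ P x n * (Complex.exp (Complex.I * t) - 1) ^ 3‖
      ≤ 10 ^ 17 * sumRemainder₂ P x n * ‖Complex.exp (Complex.I * t) - 1‖ ^ 4 ∧
    ‖y' - 3 * sumCoeff₃ P x n * (Complex.exp (Complex.I * t) - 1) ^ 2
        * Complex.exp (Complex.I * t)‖
      ≤ 10 ^ 17 * sumRemainder₂ P x n * ‖Complex.exp (Complex.I * t) - 1‖ ^ 3 := by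
  obtain ⟨y, y', hf, hf', h1, h2, h3, h4⟩ := hx.exists_char_expansion n t
  have hε := exp_decay_le hd (norm_nonneg _) (norm_exp_I_sub_one_le_two t)
  refine ⟨_, y, y', rfl, hf, ?_, (hx.norm_exp_le (norm_exp_I t) n).trans hε, ?_, h1, h2, h3, h4⟩
  · rw [hf', hf]
  · rw [← hf, ← hx.chainMoment_pow_fst (norm_exp_I t)]
    exact (hx.norm_fst_le_exp (norm_exp_I t) n).trans hε

end Bounds

end OneDependent

/-! ### Norm estimates with absolute constants. -/

namespace OneDependent

/-- The bounds for the approximation by the exponential measure and by its expansion. -/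
theorem exists_approximation_bounds : ∃ C : ℝ, 0 < C ∧
    ∀ (Ω : Type*) [MeasurableSpace Ω] (P : Measure Ω) [IsProbabilityMeasure P]
      (x : ℤ → Ω → ℕ) (n : ℕ), OneDepSeq P x →
      ∑ k ∈ Finset.Icc (1 : ℤ) n, factMoment P x 2 k ≤ sumMean P x n →
      0 < decay P x n → ∀ b : ℝ, b = scale (decay P x n) →
      tvNorm (partialSumLaw P x n - limitMeasure P x n) ≤
          ENNReal.ofReal (C * (sumRemainder₁ P x n * ((b ^ 3)⁻¹
            + (3 * sumMean P x n * (b ^ 5)⁻¹ + (b ^ 3)⁻¹)))) ∧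
        localNorm (partialSumLaw P x n - limitMeasure P x n) ≤
          ENNReal.ofReal (C * (sumRemainder₁ P x n * (b ^ 4)⁻¹)) ∧
        tvNorm (partialSumLaw P x n - limitExpansion P x n) ≤
          ENNReal.ofReal (C * (sumRemainder₁ P x n ^ 2 * ((b ^ 6)⁻¹
              + (3 * sumMean P x n * (b ^ 8)⁻¹ + (b ^ 6)⁻¹))
            + sumRemainder₂ P x n * ((b ^ 4)⁻¹
              + (3 * sumMean P x n * (b ^ 6)⁻¹ + (b ^ 4)⁻¹)))) ∧
        localNorm (partialSumLaw P x n - limitExpansion P x n) ≤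
          ENNReal.ofReal (C * (sumRemainder₁ P x n ^ 2 * (b ^ 7)⁻¹
            + sumRemainder₂ P x n * (b ^ 5)⁻¹)) := by
  obtain ⟨C, hC, hbound⟩ := exists_norm_bounds (κ := 9 / 20) (by norm_num)
  refine ⟨C * (Real.exp (9 / 5) * 10 ^ 34), by positivity, ?_⟩
  intro Ω _ P _ x n hx hν hd b hb
  have hG := hx.abs_sumCoeff₂_le hν hd
  have ha : 0 ≤ sumMean P x n := sumMean_nonneg
  have hR₁ : 0 ≤ sumRemainder₁ P x n := sumRemainder₁_nonneg
  have hR₂ : 0 ≤ sumRemainder₂ P x n := sumRemainder₂_nonneg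
  have hchar := hx.exists_char_bounds n hd
  have hb1 : 1 ≤ b := hb ▸ one_le_scale _
  rw [← hb] at hchar
  have hD := Real.exp_pos (9 / 5)
  set D := Real.exp (9 / 5)
  set a := sumMean P x n with ha'
  set r := sumRemainder₁ P x n
  set s := sumRemainder₂ P x n
  have hb0 : 0 < b := by linarith
  -- The two families list the coefficients of the powers of `‖E - 1‖` in the bounds for the
  -- transform and for its version centred at the mean `a`.
  have h1 := hbound a b (partialSumLaw P x n - limitMeasure P x n) _ _
    (fun j => if j = 3 then D * (10 ^ 17 * r) else 0)
    (fun j => if j = 4 then D * (3 * a * (10 ^ 17 * r)) else if j = 2 then D * (10 ^ 17 * r) else 0)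
    hb1 (fun j => by split_ifs <;> positivity) (fun j => by split_ifs <;> positivity)
    ((hx.isTransform_partialSumLaw n).sub (isTransform_limitMeasure P x n))
    (by
      convert ((hx.isTransform_mul_partialSumLaw n).sub (isTransform_mul_limitMeasure P x n)).sub
        (((hx.isTransform_partialSumLaw n).sub (isTransform_limitMeasure P x n)).const_mul a)
        using 2 with k
      simp only [Pi.sub_apply]
      ring)
    (fun t => by
      obtain ⟨g, y, y', e1, e2, e3, h0, h1, hy, hy', hz, hz'⟩ := hchar t
      rw [e1, e2]
      refine (norm_char_sub_le h0 h1 hy).trans (le_of_eq ?_)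
      simp
      ring)
    (fun t => by
      obtain ⟨g, y, y', e1, e2, e3, h0, h1, hy, hy', hz, hz'⟩ := hchar t
      rw [e1, e2, e3]
      refine (norm_centered_char_sub_le h0 h1 hy (norm_exp_I t) hG hy').trans (le_of_eq ?_)
      simp [Finset.sum_range_succ]
      ring)
  have h2 := hbound a b (partialSumLaw P x n - limitExpansion P x n) _ _
    (fun j => if j = 6 then D * (10 ^ 17 * r) ^ 2 else if j = 4 then D * (10 ^ 17 * s) else 0)
    (fun j => if j = 7 then D * (3 * a * (10 ^ 17 * r) ^ 2)
      else if j = 5 then D * (3 * a * (10 ^ 17 * s) + (10 ^ 17 * r) ^ 2)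
      else if j = 3 then D * (10 ^ 17 * s) else 0)
    hb1 (fun j => by split_ifs <;> positivity) (fun j => by split_ifs <;> positivity)
    ((hx.isTransform_partialSumLaw n).sub (isTransform_limitExpansion P x n))
    (by
      convert ((hx.isTransform_mul_partialSumLaw n).sub (isTransform_mul_limitExpansion P x n)).sub
        (((hx.isTransform_partialSumLaw n).sub (isTransform_limitExpansion P x n)).const_mul a)
        using 2 with k
      simp only [Pi.sub_apply]
      ring)
    (fun t => by
      obtain ⟨g, y, y', e1, e2, e3, h0, h1, hy, hy', hz, hz'⟩ := hchar t
      rw [e1, e2]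
      refine (norm_char_sub_expansion_le h0 h1 hy hz).trans (le_of_eq ?_)
      simp [Finset.sum_range_succ]
      ring)
    (fun t => by
      obtain ⟨g, y, y', e1, e2, e3, h0, h1, hy, hy', hz, hz'⟩ := hchar t
      rw [e1, e2, e3]
      refine (norm_centered_char_sub_expansion_le h0 h1 hy (norm_exp_I t) hG hy' hz hz').trans
        (le_of_eq ?_)
      simp [Finset.sum_range_succ]
      ring)
  simp only [Finset.sum_range_succ, Finset.sum_range_zero] at h1 h2
  norm_num only [if_true, if_false, zero_mul, zero_add, add_zero] at h1 h2
  have hb' : ∀ j, 0 < (b ^ j)⁻¹ := fun j => by positivity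
  -- The squared remainder needs the constant `(10 ^ 17) ^ 2`, the linear terms only `10 ^ 17`. The
  -- number here is the difference `10 ^ 34 - 10 ^ 17`, the slack in the linear terms.
  have q : ∀ u : ℝ, 0 ≤ u → 0 ≤ C * D * (99999999999999999 * 10 ^ 17) * u := fun u hu => by
    positivity
  refine ⟨h1.1.trans (ENNReal.ofReal_le_ofReal ?_), h1.2.trans (ENNReal.ofReal_le_ofReal ?_),
    h2.1.trans (ENNReal.ofReal_le_ofReal ?_), h2.2.trans (ENNReal.ofReal_le_ofReal ?_)⟩
  · linarith [q (r * ((b ^ 3)⁻¹ + (3 * a * (b ^ 5)⁻¹ + (b ^ 3)⁻¹))) (by positivity)]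
  · linarith [q (r * (b ^ 4)⁻¹) (by positivity)]
  · linarith [q (s * ((b ^ 4)⁻¹ + (3 * a * (b ^ 6)⁻¹ + (b ^ 4)⁻¹))) (by positivity)]
  · linarith [q (s * (b ^ 5)⁻¹) (by positivity)]

/-- The bounds for the approximation by the exponential measure and by its expansion, in terms of
the decay parameter. -/
theorem exists_decay_bounds : ∃ C : ℝ, 0 < C ∧
    ∀ (Ω : Type*) [MeasurableSpace Ω] (P : Measure Ω) [IsProbabilityMeasure P]
      (x : ℤ → Ω → ℕ) (n : ℕ) (l : ℝ), OneDepSeq P x →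
      ∑ k ∈ Finset.Icc (1 : ℤ) n, factMoment P x 2 k ≤ sumMean P x n →
      l = decay P x n → 0 < l →
      tvNorm (partialSumLaw P x n - limitMeasure P x n) ≤
          ENNReal.ofReal (C * sumRemainder₁ P x n * (1 + sumMean P x n * min 1 l⁻¹) *
            min 1 (l ^ (-(3 / 2) : ℝ))) ∧
        tvNorm (partialSumLaw P x n - limitExpansion P x n) ≤
          ENNReal.ofReal (C * (1 + sumMean P x n * min 1 l⁻¹) *
            (sumRemainder₁ P x n ^ 2 * min 1 (l ^ (-3 : ℝ)) +
              sumRemainder₂ P x n * min 1 (l ^ (-2 : ℝ)))) ∧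
        localNorm (partialSumLaw P x n - limitMeasure P x n) ≤
          ENNReal.ofReal (C * sumRemainder₁ P x n * min 1 (l ^ (-2 : ℝ))) ∧
        localNorm (partialSumLaw P x n - limitExpansion P x n) ≤
          ENNReal.ofReal (C *
            (sumRemainder₁ P x n ^ 2 * min 1 (l ^ (-(7 / 2) : ℝ)) +
              sumRemainder₂ P x n * min 1 (l ^ (-(5 / 2) : ℝ)))) := by
  obtain ⟨C, hC, hbound⟩ := exists_approximation_bounds
  refine ⟨3 * C, by positivity, ?_⟩
  intro Ω _ P _ x n l hx hν hl hl0
  obtain ⟨h1, h2, h3, h4⟩ := hbound Ω P x n hx hν (hl ▸ hl0) _ rfl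
  rw [← hl] at h1 h2 h3 h4
  have i2 := inv_scale_pow_le hl0 2 (p := -1) (by norm_num)
  have i3 := inv_scale_pow_le hl0 3 (p := -(3 / 2)) (by norm_num)
  have i4 := inv_scale_pow_le hl0 4 (p := -2) (by norm_num)
  have i5 := inv_scale_pow_le hl0 5 (p := -(5 / 2)) (by norm_num)
  have i6 := inv_scale_pow_le hl0 6 (p := -3) (by norm_num)
  have i7 := inv_scale_pow_le hl0 7 (p := -(7 / 2)) (by norm_num)
  rw [Real.rpow_neg_one] at i2
  have hb := zero_lt_one.trans_le (one_le_scale l)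
  set b := scale l
  have ha : 0 ≤ sumMean P x n := sumMean_nonneg
  have hR₁ : 0 ≤ sumRemainder₁ P x n := sumRemainder₁_nonneg
  have hR₂ : 0 ≤ sumRemainder₂ P x n := sumRemainder₂_nonneg
  -- The drift term has two more powers of `1 / b`, and `(b ^ 2)⁻¹ ≤ min 1 l⁻¹`; this produces the
  -- factor `1 + Γ₁ min (1, 1/λ)`.
  have key : ∀ j : ℕ, ∀ m : ℝ, (b ^ j)⁻¹ ≤ m → (b ^ j)⁻¹
      + (3 * sumMean P x n * (b ^ (j + 2))⁻¹ + (b ^ j)⁻¹)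
        ≤ 3 * ((1 + sumMean P x n * min 1 l⁻¹) * m) := fun j m hm => by
    have e : (b ^ (j + 2))⁻¹ = (b ^ j)⁻¹ * (b ^ 2)⁻¹ := by rw [pow_add, mul_inv]
    have hj : 0 < (b ^ j)⁻¹ := by positivity
    have h5 : (b ^ j)⁻¹ * (b ^ 2)⁻¹ ≤ m * min 1 l⁻¹ :=
      mul_le_mul hm i2 (by positivity) (hj.le.trans hm)
    rw [e]
    nlinarith [mul_le_mul_of_nonneg_left h5 ha]
  refine ⟨h1.trans (ENNReal.ofReal_le_ofReal ?_), h3.trans (ENNReal.ofReal_le_ofReal ?_),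
    h2.trans (ENNReal.ofReal_le_ofReal ?_), h4.trans (ENNReal.ofReal_le_ofReal ?_)⟩
  · refine (mul_le_mul_of_nonneg_left (mul_le_mul_of_nonneg_left (key 3 _ i3) hR₁) hC.le).trans
      (le_of_eq (by ring))
  · refine (mul_le_mul_of_nonneg_left (add_le_add
      (mul_le_mul_of_nonneg_left (key 6 _ i6) (sq_nonneg _))
      (mul_le_mul_of_nonneg_left (key 4 _ i4) hR₂)) hC.le).trans (le_of_eq (by ring))
  · have h := mul_le_mul_of_nonneg_left i4 (mul_nonneg hC.le hR₁)
    have h0 : 0 ≤ C * sumRemainder₁ P x n * (b ^ 4)⁻¹ := by positivity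
    linarith
  · have h := mul_le_mul_of_nonneg_left (add_le_add
      (mul_le_mul_of_nonneg_left i7 (sq_nonneg (sumRemainder₁ P x n)))
      (mul_le_mul_of_nonneg_left i5 hR₂)) hC.le
    have h0 : 0 ≤ C * (sumRemainder₁ P x n ^ 2 * (b ^ 7)⁻¹ + sumRemainder₂ P x n * (b ^ 5)⁻¹) := by
      positivity
    linarith

end OneDependent

/-! ### Truncation at `n` and identification with the quantities of the statement. -/

namespace OneDependent

section HatMoments

variable {Ω : Type*} [mΩ : MeasurableSpace Ω] {P : Measure Ω}

theorem hatE_eq (Y : List (Ω → ℝ)) : hatE P Y = (∫ ω, Y.prod ω ∂P)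
    - ∑ j ∈ Finset.Ico 1 Y.length, hatE P (Y.take j) * ∫ ω, (Y.drop j).prod ω ∂P := by
  rw [hatE, Finset.sum_coe_sort (Finset.Ico 1 Y.length)
    fun j => hatE P (Y.take j) * ∫ ω, (Y.drop j).prod ω ∂P]

theorem hatEplus_eq (Y : List (Ω → ℝ)) : hatEplus P Y = (∫ ω, Y.prod ω ∂P)
    + ∑ j ∈ Finset.Ico 1 Y.length, hatEplus P (Y.take j) * ∫ ω, (Y.drop j).prod ω ∂P := by
  rw [hatEplus, Finset.sum_coe_sort (Finset.Ico 1 Y.length)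
    fun j => hatEplus P (Y.take j) * ∫ ω, (Y.drop j).prod ω ∂P]

variable (A B C D : Ω → ℝ)

theorem hatE_one : hatE P [A] = ∫ ω, A ω ∂P := by
  rw [hatE_eq]; simp

theorem hatE_two : hatE P [A, B] = ∫ ω, A ω * B ω ∂P - (∫ ω, A ω ∂P) * ∫ ω, B ω ∂P := by
  rw [hatE_eq]; simp [hatE_one]

theorem hatE_three : hatE P [A, B, C] = ∫ ω, A ω * B ω * C ω ∂P
    - (∫ ω, A ω ∂P) * ∫ ω, B ω * C ω ∂P - hatE P [A, B] * ∫ ω, C ω ∂P := by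
  rw [hatE_eq]
  simp [Finset.sum_Ico_succ_top, hatE_one, mul_assoc]
  ring

theorem hatEplus_one : hatEplus P [A] = ∫ ω, A ω ∂P := by
  rw [hatEplus_eq]; simp

theorem hatEplus_two : hatEplus P [A, B]
    = ∫ ω, A ω * B ω ∂P + (∫ ω, A ω ∂P) * ∫ ω, B ω ∂P := by
  rw [hatEplus_eq]; simp [hatEplus_one]

theorem hatEplus_three : hatEplus P [A, B, C] = ∫ ω, A ω * B ω * C ω ∂P
    + (∫ ω, A ω ∂P) * ∫ ω, B ω * C ω ∂P + hatEplus P [A, B] * ∫ ω, C ω ∂P := by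
  rw [hatEplus_eq]
  simp [Finset.sum_Ico_succ_top, hatEplus_one, mul_assoc]
  ring

theorem hatEplus_four : hatEplus P [A, B, C, D] = ∫ ω, A ω * B ω * C ω * D ω ∂P
    + (∫ ω, A ω ∂P) * ∫ ω, B ω * C ω * D ω ∂P + hatEplus P [A, B] * ∫ ω, C ω * D ω ∂P
    + hatEplus P [A, B, C] * ∫ ω, D ω ∂P := by
  rw [hatEplus_eq]
  simp [Finset.sum_Ico_succ_top, hatEplus_one, mul_assoc]
  ring

end HatMoments

section Chains

variable {Ω : Type*} [mΩ : MeasurableSpace Ω] {P : Measure Ω} {x : ℤ → Ω → ℕ} (k : ℤ)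

theorem plusMoment_three_sub : plusMoment P x (k - 2) 3
    = hatEplus P [fun ω => (x (k - 2) ω : ℝ), fun ω => (x (k - 1) ω : ℝ), fun ω => (x k ω : ℝ)] := by
  have e1 : k - 2 + 1 = k - 1 := by ring
  simp [plusMoment, plusChain_three, chainMoment, block, Finset.prod_range_succ, hatEplus_three,
    hatEplus_two, e1]

theorem plusMoment_four_sub : plusMoment P x (k - 3) 4
    = hatEplus P [fun ω => (x (k - 3) ω : ℝ), fun ω => (x (k - 2) ω : ℝ),
      fun ω => (x (k - 1) ω : ℝ), fun ω => (x k ω : ℝ)] := by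
  have e1 : k - 3 + 1 = k - 2 := by ring
  have e2 : k - 3 + 2 = k - 1 := by ring
  have e3 : k - 2 + 1 = k - 1 := by ring
  simp [plusMoment, plusChain_four, chainMoment, block, Finset.prod_range_succ,
    hatEplus_four, hatEplus_three, hatEplus_two, e1, e2, e3]

end Chains

section Truncation

variable {Ω : Type*} {X : ℕ → Ω → ℕ} {n : ℕ}

/-- The sequence cut off at the index `n`. -/
def trunc (X : ℕ → Ω → ℕ) (n : ℕ) (k : ℤ) : Ω → ℕ := if k ≤ n then ext X k else fun _ => 0

theorem trunc_of_le {k : ℤ} (hk : k ≤ n) : trunc X n k = ext X k := if_pos hk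

theorem trunc_cases (k : ℤ) : (trunc X n k = fun _ => 0) ∨
    (1 ≤ k ∧ k ≤ n ∧ trunc X n k = X k.toNat) := by
  unfold trunc ext
  split_ifs with h1 h2
  · exact Or.inr ⟨h2, h1, rfl⟩
  · exact Or.inl rfl
  · exact Or.inl rfl

theorem rv_eq_fall (k : ℤ) : rv X k = fall X 1 k := by
  funext ω; simp [rv, fall]

/-- For `m ≤ 6` the constant `6 ^ 4 = 1296` suffices; beyond, `m ≤ 2 (m - 3)`. Hence a finite fourth
factorial moment yields a finite fourth moment. -/
theorem pow_four_le_descFactorial (m : ℕ) : m ^ 4 ≤ 1296 + 16 * m.descFactorial 4 := by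
  have h := Nat.pow_sub_le_descFactorial m 4
  rcases le_or_gt m 6 with hm | hm
  · have := Nat.pow_le_pow_left hm 4
    omega
  · have h1 : m ≤ 2 * (m + 1 - 4) := by omega
    have h2 := Nat.pow_le_pow_left h1 4
    rw [mul_pow] at h2
    omega

theorem comap_zero_le {m : MeasurableSpace Ω} {f : Ω → ℕ} (hf : f = fun _ => 0) :
    MeasurableSpace.comap f ⊤ ≤ m := by
  rw [hf, MeasurableSpace.comap_const]
  exact bot_le

variable [mΩ : MeasurableSpace Ω] {P : Measure Ω} [IsProbabilityMeasure P]

/-- The moment conditions concern only the indices up to `n`; setting the other variables to zero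
makes them valid everywhere. Constant variables generate the trivial σ-algebra, so 1-dependence is
preserved; for `s ≤ 0`, which the hypothesis on `X` does not cover, the whole left σ-algebra is
trivial. -/
theorem oneDepSeq_trunc (hm : ∀ k, 1 ≤ k → Measurable (X k)) (hX : MDependent 1 X P)
    (h1 : ∀ k : ℕ, 1 ≤ k → k ≤ n → nu P X 1 k ≤ 1 / 100)
    (h4 : ∀ k : ℕ, 1 ≤ k → k ≤ n → Integrable (fall X 4 k) P) : OneDepSeq P (trunc X n) where
  meas i := by
    rcases trunc_cases (X := X) (n := n) i with h | ⟨ha, hb, h⟩ <;> rw [h]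
    · exact measurable_const
    · exact hm _ (by omega)
  indep s t hst := by
    rcases le_or_gt s 0 with hs | hs
    · refine indep_of_indep_of_le_left (indep_bot_left _) (iSup₂_le fun i hi => ?_)
      rcases trunc_cases (X := X) (n := n) i with h | ⟨ha, hb, h⟩
      · exact comap_zero_le h
      · have := Set.mem_Iic.1 hi; omega
    · refine indep_of_indep_of_le_left (indep_of_indep_of_le_right
        (hX s.toNat t.toNat (by omega) (by omega)) (iSup₂_le fun i hi => ?_))
        (iSup₂_le fun i hi => ?_)
      · rcases trunc_cases (X := X) (n := n) i with h | ⟨ha, hb, h⟩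
        · exact comap_zero_le h
        · rw [h]
          have := Set.mem_Ici.1 hi
          exact le_iSup₂_of_le i.toNat (Set.mem_Ici.2 (by omega)) le_rfl
      · rcases trunc_cases (X := X) (n := n) i with h | ⟨ha, hb, h⟩
        · exact comap_zero_le h
        · rw [h]
          have := Set.mem_Iic.1 hi
          exact le_iSup₂_of_le i.toNat (Set.mem_Icc.2 (by omega)) le_rfl
  zero i hi ω := by
    rcases trunc_cases (X := X) (n := n) i with h | ⟨ha, hb, h⟩
    · rw [h]
    · omega
  fourth i := by
    rcases trunc_cases (X := X) (n := n) i with h | ⟨ha, hb, h⟩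
    · simp [h]
    · lift i to ℕ using by omega
      have e : ext X i = X i := by simp only [ext, if_pos ha, Int.toNat_natCast]
      have h5 := h4 i (by omega) (by omega)
      have hmeas := hm i (by omega)
      rw [h, Int.toNat_natCast]
      refine Integrable.mono' ((integrable_const (1296 : ℝ)).add (h5.const_mul 16))
        (by fun_prop) (ae_of_all _ fun ω => ?_)
      rw [Real.norm_of_nonneg (by positivity)]
      simp only [Pi.add_apply, fall, e]
      exact_mod_cast pow_four_le_descFactorial (X i ω)
  mean i := by
    rcases trunc_cases (X := X) (n := n) i with h | ⟨ha, hb, h⟩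
    · simp [h]
    · lift i to ℕ using by omega
      have h5 := h1 i (by omega) (by omega)
      rw [trunc_of_le hb]
      simpa [nu, fall] using h5

end Truncation

end OneDependent

namespace OneDependent

section Identification

variable {Ω : Type*} [mΩ : MeasurableSpace Ω] {P : Measure Ω} {X : ℕ → Ω → ℕ} {n : ℕ}

theorem nu_eq_factMoment (j : ℕ) {k : ℤ} (hk : k ≤ n) :
    nu P X j k = factMoment P (trunc X n) j k := by
  simp only [nu, factMoment, fall, trunc_of_le hk]

theorem pairMoment_eq_mixedMoment {k : ℤ} (hk : k ≤ n) :
    pairMoment P X k = mixedMoment P (trunc X n) k := by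
  simp only [pairMoment, mixedMoment, rv, trunc_of_le hk, trunc_of_le (show k - 1 ≤ n by omega)]

theorem hatE_fall_eq_hatFact₂ (a b : ℕ) {k : ℤ} (hk : k ≤ n) :
    hatE P [fall X a (k - 1), fall X b k] = hatFact₂ P (trunc X n) a b k := by
  simp only [hatE_two, hatFact₂, cov₂, fall, trunc_of_le hk,
    trunc_of_le (show k - 1 ≤ n by omega)]

theorem hatE_fall_eq_hatFact₃ {k : ℤ} (hk : k ≤ n) :
    hatE P [fall X 1 (k - 2), fall X 1 (k - 1), fall X 1 k] = hatFact₃ P (trunc X n) k := by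
  simp only [hatE_three, hatE_two, hatFact₃, cov₃, fall, trunc_of_le hk,
    trunc_of_le (show k - 1 ≤ n by omega), trunc_of_le (show k - 2 ≤ n by omega)]

theorem hatEplus_fall_eq_plusFact₂ (a b : ℕ) {k : ℤ} (hk : k ≤ n) :
    hatEplus P [fall X a (k - 1), fall X b k] = plusFact₂ P (trunc X n) a b k := by
  simp only [hatEplus_two, plusFact₂, factMoment, fall, trunc_of_le hk,
    trunc_of_le (show k - 1 ≤ n by omega)]

theorem hatEplus_fall_eq_plusFact₃ (a b c : ℕ) {k : ℤ} (hk : k ≤ n) :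
    hatEplus P [fall X a (k - 2), fall X b (k - 1), fall X c k]
      = plusFact₃ P (trunc X n) a b c k := by
  simp only [hatEplus_three, hatEplus_two, plusFact₃, factMoment, fall, trunc_of_le hk,
    trunc_of_le (show k - 1 ≤ n by omega), trunc_of_le (show k - 2 ≤ n by omega)]

theorem triplePlus_eq_plusMoment {k : ℤ} (hk : k ≤ n) :
    triplePlus P X k = plusMoment P (trunc X n) (k - 2) 3 := by
  rw [plusMoment_three_sub, trunc_of_le hk, trunc_of_le (show k - 1 ≤ n by omega),
    trunc_of_le (show k - 2 ≤ n by omega)]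
  rfl

theorem quadPlus_eq_plusMoment {k : ℤ} (hk : k ≤ n) :
    quadPlus P X k = plusMoment P (trunc X n) (k - 3) 4 := by
  rw [plusMoment_four_sub, trunc_of_le hk, trunc_of_le (show k - 1 ≤ n by omega),
    trunc_of_le (show k - 2 ≤ n by omega), trunc_of_le (show k - 3 ≤ n by omega)]
  rfl

theorem hatFact₂_eq_zero {x : ℤ → Ω → ℕ} (hx : OneDepSeq P x) {a b : ℕ} (ha : 0 < a) {k : ℤ}
    (hk : k < 2) : hatFact₂ P x a b k = 0 := by
  have h := hx.zero (k - 1) (by omega)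
  simp [hatFact₂, cov₂, h, Nat.descFactorial_of_lt ha]

theorem hatFact₃_eq_zero {x : ℤ → Ω → ℕ} (hx : OneDepSeq P x) {k : ℤ} (hk : k < 3) :
    hatFact₃ P x k = 0 := by
  have h := hx.zero (k - 2) (by omega)
  simp [hatFact₃, cov₃, h]

/-- Sums over pairs and triples start at 2 and 3. Because the variables vanish at nonpositive
indices, they may start at 1 and be merged with the sums over single indices. -/
theorem sum_Icc_eq_sum_Icc_one {f : ℤ → ℝ} {a : ℤ} (ha : 1 ≤ a) (hf : ∀ k < a, f k = 0) (n : ℕ) :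
    ∑ k ∈ Finset.Icc a n, f k = ∑ k ∈ Finset.Icc (1 : ℤ) n, f k := by
  refine Finset.sum_subset (Finset.Icc_subset_Icc_left ha) fun k hk hk' => hf k ?_
  simp only [Finset.mem_Icc] at hk hk'
  omega

theorem Γ₁_eq : Γ₁ P X n = sumMean P (trunc X n) n :=
  Finset.sum_congr rfl fun _ hk => nu_eq_factMoment 1 (Finset.mem_Icc.1 hk).2

theorem R₁_eq : R₁ P X n = sumRemainder₁ P (trunc X n) n := by
  refine Finset.sum_congr rfl fun k hk => ?_
  have hk := (Finset.mem_Icc.1 hk).2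
  simp only [remainder₁, pairPlus₂, rv_eq_fall, nu_eq_factMoment _ hk,
    nu_eq_factMoment _ (show k - 1 ≤ n by omega), nu_eq_factMoment _ (show k - 2 ≤ n by omega),
    pairMoment_eq_mixedMoment hk, hatEplus_fall_eq_plusFact₂ _ _ hk, triplePlus_eq_plusMoment hk]

theorem R₂_eq : R₂ P X n = sumRemainder₂ P (trunc X n) n := by
  refine Finset.sum_congr rfl fun k hk => ?_
  have hk := (Finset.mem_Icc.1 hk).2
  simp only [remainder₂, pairPlus₂, pairPlus₃, triplePlus₂, rv_eq_fall, Finset.sum_range_succ,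
    Finset.sum_range_zero, Nat.cast_zero, Nat.cast_one, Nat.cast_ofNat, sub_zero, zero_add,
    nu_eq_factMoment _ hk, nu_eq_factMoment _ (show k - 1 ≤ n by omega),
    nu_eq_factMoment _ (show k - 2 ≤ n by omega), nu_eq_factMoment _ (show k - 3 ≤ n by omega),
    pairMoment_eq_mixedMoment hk, hatEplus_fall_eq_plusFact₂ _ _ hk,
    hatEplus_fall_eq_plusFact₃ _ _ _ hk, triplePlus_eq_plusMoment hk, quadPlus_eq_plusMoment hk]

variable (hx : OneDepSeq P (trunc X n))

include hx

theorem lam_eq : lam P X n = decay P (trunc X n) n := by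
  have h1 : ∀ j, ∑ k ∈ Finset.Icc (1 : ℤ) n, nu P X j k
      = ∑ k ∈ Finset.Icc (1 : ℤ) n, factMoment P (trunc X n) j k := fun j =>
    Finset.sum_congr rfl fun _ hk => nu_eq_factMoment j (Finset.mem_Icc.1 hk).2
  have h2 : ∑ k ∈ Finset.Icc (2 : ℤ) n, pairMoment P X k
      = ∑ k ∈ Finset.Icc (1 : ℤ) n, mixedMoment P (trunc X n) k := by
    rw [← sum_Icc_eq_sum_Icc_one (a := 2) (by norm_num)
      fun k hk => hx.mixedMoment_eq_zero (show k ≤ 1 by omega)]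
    exact Finset.sum_congr rfl fun _ hk => pairMoment_eq_mixedMoment (Finset.mem_Icc.1 hk).2
  rw [lam, decay, h1, h1, h2]

theorem Γ₂_eq : Γ₂ P X n = sumCoeff₂ P (trunc X n) n := by
  have h2 : ∑ k ∈ Finset.Icc (2 : ℤ) n, hatE P [rv X (k - 1), rv X k]
      = ∑ k ∈ Finset.Icc (1 : ℤ) n, hatFact₂ P (trunc X n) 1 1 k := by
    rw [← sum_Icc_eq_sum_Icc_one (a := 2) (by norm_num) fun k hk => hatFact₂_eq_zero hx one_pos hk]
    refine Finset.sum_congr rfl fun k hk => ?_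
    rw [rv_eq_fall, rv_eq_fall, hatE_fall_eq_hatFact₂ _ _ (Finset.mem_Icc.1 hk).2]
  rw [Γ₂, h2, Finset.mul_sum, ← Finset.sum_add_distrib]
  refine Finset.sum_congr rfl fun k hk => ?_
  have hk := (Finset.mem_Icc.1 hk).2
  rw [nu_eq_factMoment _ hk, nu_eq_factMoment _ hk, coeff₂]
  ring

theorem Γ₃_eq : Γ₃ P X n = sumCoeff₃ P (trunc X n) n := by
  have h2 : ∑ k ∈ Finset.Icc (2 : ℤ) n,
        (nu P X 1 (k - 1) + nu P X 1 k) * hatE P [rv X (k - 1), rv X k]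
      = ∑ k ∈ Finset.Icc (1 : ℤ) n, (factMoment P (trunc X n) 1 (k - 1)
          + factMoment P (trunc X n) 1 k) * hatFact₂ P (trunc X n) 1 1 k := by
    rw [← sum_Icc_eq_sum_Icc_one (a := 2) (by norm_num) fun k hk => by
      rw [hatFact₂_eq_zero hx one_pos hk, mul_zero]]
    refine Finset.sum_congr rfl fun k hk => ?_
    have hk := (Finset.mem_Icc.1 hk).2
    rw [rv_eq_fall, rv_eq_fall, hatE_fall_eq_hatFact₂ _ _ hk, nu_eq_factMoment _ hk,
      nu_eq_factMoment _ (show k - 1 ≤ n by omega)]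
  have h3 : ∑ k ∈ Finset.Icc (2 : ℤ) n,
        (hatE P [fall X 2 (k - 1), rv X k] + hatE P [rv X (k - 1), fall X 2 k])
      = ∑ k ∈ Finset.Icc (1 : ℤ) n,
        (hatFact₂ P (trunc X n) 2 1 k + hatFact₂ P (trunc X n) 1 2 k) := by
    rw [← sum_Icc_eq_sum_Icc_one (a := 2) (by norm_num) fun k hk => by
      rw [hatFact₂_eq_zero hx one_pos hk, hatFact₂_eq_zero hx two_pos hk, add_zero]]
    refine Finset.sum_congr rfl fun k hk => ?_
    have hk := (Finset.mem_Icc.1 hk).2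
    rw [rv_eq_fall, rv_eq_fall, hatE_fall_eq_hatFact₂ _ _ hk, hatE_fall_eq_hatFact₂ _ _ hk]
  have h4 : ∑ k ∈ Finset.Icc (3 : ℤ) n, hatE P [rv X (k - 2), rv X (k - 1), rv X k]
      = ∑ k ∈ Finset.Icc (1 : ℤ) n, hatFact₃ P (trunc X n) k := by
    rw [← sum_Icc_eq_sum_Icc_one (a := 3) (by norm_num) fun k hk => hatFact₃_eq_zero hx hk]
    refine Finset.sum_congr rfl fun k hk => ?_
    rw [rv_eq_fall, rv_eq_fall, rv_eq_fall, hatE_fall_eq_hatFact₃ (Finset.mem_Icc.1 hk).2]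
  rw [Γ₃, h2, h3, h4, Finset.mul_sum, Finset.mul_sum, ← Finset.sum_sub_distrib,
    ← Finset.sum_add_distrib, ← Finset.sum_add_distrib]
  refine Finset.sum_congr rfl fun k hk => ?_
  have hk := (Finset.mem_Icc.1 hk).2
  simp only [nu_eq_factMoment _ hk, coeff₃]
  ring

theorem G_eq : G P X n = limitMeasure P (trunc X n) n := by
  rw [G, limitMeasure, Γ₁_eq, Γ₂_eq hx]

theorem Gexp_eq : Gexp P X n = limitExpansion P (trunc X n) n := by
  rw [Gexp, limitExpansion, G_eq hx, Γ₃_eq hx]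

omit hx mΩ in
theorem partialSum_trunc (ω : Ω) : partialSum (trunc X n) n ω = ∑ i ∈ Finset.Icc 1 n, X i ω := by
  symm
  refine Finset.sum_bij' (fun i _ => (i : ℤ)) (fun k _ => k.toNat) ?_ ?_ ?_ ?_ ?_
  · intro i hi
    simp only [Finset.mem_Icc] at hi ⊢
    omega
  · intro k hk
    simp only [Finset.mem_Icc] at hk ⊢
    omega
  · intro i _
    exact Int.toNat_natCast i
  · intro k hk
    simp only [Finset.mem_Icc] at hk
    omega
  · intro i hi
    simp only [Finset.mem_Icc] at hi
    rw [trunc_of_le (by omega), ext, if_pos (by omega), Int.toNat_natCast]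

omit hx in
theorem sumLaw_eq : sumLaw P X n = partialSumLaw P (trunc X n) n := by
  funext k
  simp only [sumLaw, partialSumLaw, partialSum_trunc]

end Identification

end OneDependent

theorem mainTheorem1 :
    ∃ C₅ C₆ C₇ C₈ : ℝ, 0 < C₅ ∧ 0 < C₆ ∧ 0 < C₇ ∧ 0 < C₈ ∧
      ∀ (Ω : Type*) [MeasurableSpace Ω] (P : Measure Ω) [IsProbabilityMeasure P]
        (X : ℕ → Ω → ℕ) (n : ℕ),
        (∀ k, 1 ≤ k → Measurable (X k)) →
        OneDependent.MDependent 1 X P →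
        (∀ k : ℕ, 1 ≤ k → k ≤ n →
          OneDependent.nu P X 1 k ≤ 1 / 100 ∧
          OneDependent.nu P X 2 k ≤ OneDependent.nu P X 1 k ∧
          Integrable (OneDependent.fall X 4 k) P) →
        0 < OneDependent.lam P X n →
        OneDependent.tvNorm (OneDependent.sumLaw P X n - OneDependent.G P X n) ≤
            ENNReal.ofReal (C₅ * OneDependent.R₁ P X n *
              (1 + OneDependent.Γ₁ P X n * min 1 (OneDependent.lam P X n)⁻¹) *
              min 1 (OneDependent.lam P X n ^ (-(3 / 2) : ℝ))) ∧
          OneDependent.tvNorm (OneDependent.sumLaw P X n - OneDependent.Gexp P X n) ≤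
            ENNReal.ofReal (C₆ * (1 + OneDependent.Γ₁ P X n * min 1 (OneDependent.lam P X n)⁻¹) *
              (OneDependent.R₁ P X n ^ 2 * min 1 (OneDependent.lam P X n ^ (-3 : ℝ)) +
                OneDependent.R₂ P X n * min 1 (OneDependent.lam P X n ^ (-2 : ℝ)))) ∧
          OneDependent.localNorm (OneDependent.sumLaw P X n - OneDependent.G P X n) ≤
            ENNReal.ofReal (C₇ * OneDependent.R₁ P X n * min 1 (OneDependent.lam P X n ^ (-2 : ℝ))) ∧
          OneDependent.localNorm (OneDependent.sumLaw P X n - OneDependent.Gexp P X n) ≤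
            ENNReal.ofReal (C₈ *
              (OneDependent.R₁ P X n ^ 2 * min 1 (OneDependent.lam P X n ^ (-(7 / 2) : ℝ)) +
                OneDependent.R₂ P X n * min 1 (OneDependent.lam P X n ^ (-(5 / 2) : ℝ)))) := by
  obtain ⟨C, hC, hbound⟩ := OneDependent.exists_decay_bounds
  refine ⟨C, C, C, C, hC, hC, hC, hC, ?_⟩
  intro Ω _ P _ X n hm hX hν hl
  -- All quantities in the estimates involve only indices up to `n`, so they do not change when the
  -- sequence is cut off there.
  have hx : OneDependent.OneDepSeq P (OneDependent.trunc X n) :=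
    OneDependent.oneDepSeq_trunc hm hX (fun k h1 h2 => (hν k h1 h2).1)
      fun k h1 h2 => (hν k h1 h2).2.2
  have hsum : ∑ k ∈ Finset.Icc (1 : ℤ) n, OneDependent.factMoment P (OneDependent.trunc X n) 2 k
      ≤ OneDependent.sumMean P (OneDependent.trunc X n) n := by
    refine Finset.sum_le_sum fun k hk => ?_
    have hk := Finset.mem_Icc.1 hk
    rw [← OneDependent.nu_eq_factMoment _ hk.2, ← OneDependent.nu_eq_factMoment _ hk.2]
    lift k to ℕ using by omega
    exact (hν k (by omega) (by omega)).2.1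
  rw [OneDependent.sumLaw_eq, OneDependent.G_eq hx, OneDependent.Gexp_eq hx, OneDependent.R₁_eq,
    OneDependent.R₂_eq, OneDependent.Γ₁_eq]
  exact hbound Ω P _ n _ hx hsum (OneDependent.lam_eq hx) hl
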